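/- Curves are smooth maps $\phi\colon S^1\to\mathbb R^2$, where $S^1=\mathbb R/\mathbb Z$ and the plane has its standard orientation; they are called quasidoodles. An I-doodle is an immersion $S^1\to\mathbb R^2$ without triple points (no three different points of $S^1$ have the same image); it is regular if its double points are transverse. Two I-doodles are equivalent if they are connected by a path of I-doodles that is continuous in the $C^\infty$-topology; an invariant is a (real-valued) function on I-doodles that is constant on equivalence classes. *Moments.* For $t\notin\phi(S^1)$ let $\mathrm{ind}_\phi(t)$ be the counterclockwise rotation number of the vector from $t$ to the point running once along the curve. The index $i(x)$ of a double or multiple point $x$ is the arithmetical mean of the values of $\mathrm{ind}_\phi$ in the sectors adjacent to $x$. Fix a point $*$ of the curve that is not a double point, and let $i(*)$ be the greater of the values of $\mathrm{ind}_\phi$ on the two sides of the curve at $*$. For a transverse double point $x$ let $\sigma(x)=+1$ if the frame (velocity at the first visit of $x$ after leaving $*$, velocity at the second visit) is clockwise, and $\sigma(x)=-1$ if it is counterclockwise. Put $\binom i\beta=i(i-1)\cdots(i-\beta+1)/\beta!$. For a natural number $\beta\ge1$ and a regular I-doodle put $$M(\beta)=\sum_x\sigma(x)\binom{i(x)}{\beta}+2\binom{i(*)}{\beta+1},$$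 the sum being over all double points. *Regular quasidoodles.* A quasidoodle is regular if it is an immersion and each point of the plane with at least three preimages (there are finitely many of these) has finitely many preimages, with pairwise nontangent branches. Its groups are the sets $\phi^{-1}(x)$ with at least three elements, and its complexity is the sum of $|G|-1$ over all groups $G$. *Degeneration processes.* A degeneration process of a regular quasidoodle $\phi$ is a sequence of steps leading from the empty collection of groups to the collection of groups of $\phi$. At each step either a new group of three points of $S^1$, disjoint from the existing groups, appears, or one point outside all existing groups joins an existing group. Let $J$ be the collection of groups before the last step. A one-step resolution of $\phi$ is the endpoint $\phi_1$ of a $C^\infty$-continuous path $(\phi_t)_{0\le t\le1}$ with $\phi_0=\phi$ such that, for $0<t\le1$, $\phi_t$ is a regular quasidoodle whose groups are exactly $J$. There are two kinds of resolutions, positive and negative, distinguished for small $t>0$ as follows. If the last step created a triple point, the positive side is the one with the greater value of $\sum\sigma(x)\,i(x)$ over the three double points into which the triple point splits. If at the last step a point joined a group $G$, the positive side is the one on which the multiple point $\phi_t(G)$ has the greater index. *Characteristic numbers and order.* The characteristic number that an invariant $V$ assigns to an I-doodle with the empty process is its value. The number that $V$ assigns to a regular quasidoodle with a process having at least one step is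 the characteristic number of a positive one-step resolution minus that of a negative one, both taken with the process without its last step. The invariant $V$ is of order $j$ if all characteristic numbers of all regular quasidoodles of complexity greater than $j$, for all their degeneration processes (and all choices of the resolutions), are equal to $0$. **Proposition.** For any natural number $\beta\ge1$, $M(\beta)$ is an invariant of I-doodles: there is an invariant of I-doodles whose value at any regular I-doodle is $M(\beta)$, computed with any choice of the point $*$. Any such invariant is of order $\beta+1$. -/

import Mathlib

open Set Filter Topology
open scoped ContDiff

noncomputable section

/-- A quasidoodle: a smooth map `S¹ → ℝ²`, written as a smooth `1`-periodic map `ℝ → ℂ`.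
The plane is `ℂ` with its standard (counterclockwise) orientation, and `S¹ = ℝ / ℤ`. -/
structure Quasidoodle where
  toFun : ℝ → ℂ
  smooth : ContDiff ℝ ∞ toFun
  periodic : Function.Periodic toFun 1

/-- The oriented area of the parallelogram spanned by `u` and `v`. -/
def planeDet (u v : ℂ) : ℝ := u.re * v.im - u.im * v.re

namespace Quasidoodle

theorem deriv_periodic (φ : Quasidoodle) : Function.Periodic (deriv φ.toFun) 1 := by
  intro s
  have h : (fun y => φ.toFun (y + 1)) = φ.toFun := funext φ.periodic
  rw [← deriv_comp_add_const, h]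

/-- The value of `φ` at a point of the circle. -/
def pt (φ : Quasidoodle) : UnitAddCircle → ℂ := φ.periodic.lift

/-- The velocity `φ'` at a point of the circle. -/
def vel (φ : Quasidoodle) : UnitAddCircle → ℂ := φ.deriv_periodic.lift

def fiber (φ : Quasidoodle) (x : ℂ) : Set UnitAddCircle := {z | φ.pt z = x}

def IsImmersion (φ : Quasidoodle) : Prop := ∀ z, φ.vel z ≠ 0

/-- An immersion without triple points. -/
def IsIDoodle (φ : Quasidoodle) : Prop :=
  φ.IsImmersion ∧
    ∀ x y z : UnitAddCircle, x ≠ y → y ≠ z → x ≠ z → ¬ (φ.pt x = φ.pt y ∧ φ.pt y = φ.pt z)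

/-- An I-doodle all of whose double points are transverse. -/
def IsRegularIDoodle (φ : Quasidoodle) : Prop :=
  φ.IsIDoodle ∧ ∀ z w, z ≠ w → φ.pt z = φ.pt w → planeDet (φ.vel z) (φ.vel w) ≠ 0

/-- `γ t`, `0 ≤ t ≤ 1`, is a continuous path in `C^∞(S¹, ℝ²)`: all derivatives along the curve
depend continuously on the pair (parameter of the path, parameter of the curve). -/
def IsContinuousFamily (γ : ℝ → Quasidoodle) : Prop :=
  ∀ k : ℕ, ContinuousOn (fun p : ℝ × ℝ => iteratedDeriv k (γ p.1).toFun p.2) (Icc 0 1 ×ˢ univ)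

/-! ### Indices -/

/-- The rotation number (in the counterclockwise sense) of the vector from `p` to the point
running once along the curve, for `p` outside the curve. -/
def ind (φ : Quasidoodle) (p : ℂ) : ℝ :=
  (2 * Real.pi)⁻¹ * ∫ s in (0 : ℝ)..1, (deriv φ.toFun s / (φ.toFun s - p)).im

/-- The value of `ind` in the component of the complement entered when one leaves the point `x` of
the curve in the direction `v` (not tangent to any branch at `x`). -/
def indToward (φ : Quasidoodle) (x v : ℂ) : ℝ :=
  limUnder (𝓝[>] (0 : ℝ)) (fun ε : ℝ => φ.ind (x + (ε : ℂ) * v))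

/-- `v` lies in the sector at `x` on the side `s z` of the branch at `z`, for each branch
through `x` (`1`: left, `-1`: right). -/
def PointsInto (φ : Quasidoodle) (x : ℂ) (s : φ.fiber x → SignType) (v : ℂ) : Prop :=
  ∀ z : φ.fiber x, SignType.sign (planeDet (φ.vel z) v) = s z

/-- The sectors into which the branches through `x` divide a small neighbourhood of `x`, i.e. the
neighbouring components of the complement of the curve at `x`; a sector is coded by the sides of
the branches on which it lies. If `a` pairwise nontangent branches meet, there are `2 * a`. -/
def sectors (φ : Quasidoodle) (x : ℂ) : Set (φ.fiber x → SignType) :=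
  {s | (∀ z, s z ≠ 0) ∧ ∃ v, φ.PointsInto x s v}

open Classical in
/-- The value of `ind` in the sector `s` at `x`. -/
def sectorInd (φ : Quasidoodle) (x : ℂ) (s : φ.fiber x → SignType) : ℝ :=
  if h : ∃ v, φ.PointsInto x s v then φ.indToward x h.choose else 0

/-- The index of a (double or multiple) point `x` of the curve: the arithmetical mean of the
values of `ind` in the neighbouring components of the complement. -/
def pointIndex (φ : Quasidoodle) (x : ℂ) : ℝ :=
  (∑ᶠ s ∈ φ.sectors x, φ.sectorInd x s) / ((φ.sectors x).ncard : ℝ)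

/-- The index of a distinguished nonsingular point: the greater of the values of `ind` in the two
neighbouring components (to the left and to the right of the curve). -/
def baseIndex (φ : Quasidoodle) (b : UnitAddCircle) : ℝ :=
  max (φ.indToward (φ.pt b) (Complex.I * φ.vel b)) (φ.indToward (φ.pt b) (-Complex.I * φ.vel b))

end Quasidoodle

/-! ### The moments -/

/-- `i (i - 1) ⋯ (i - β + 1) / β!`. -/
def binom (i : ℝ) (β : ℕ) : ℝ := (∏ k ∈ Finset.range β, (i - k)) / (β.factorial : ℝ)

/-- The time in `[0, 1)` at which one visits `z` after leaving the point `b` of the circle. -/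
def visitTime (b z : UnitAddCircle) : ℝ := (AddCircle.equivIco 1 0 (z - b) : ℝ)

namespace Quasidoodle

/-- The crossings with both preimages in `U`, as pairs of preimages in order of the visits after
leaving `b`. -/
def crossings (φ : Quasidoodle) (b : UnitAddCircle) (U : Set UnitAddCircle) :
    Set (UnitAddCircle × UnitAddCircle) :=
  {p | p.1 ∈ U ∧ p.2 ∈ U ∧ visitTime b p.1 < visitTime b p.2 ∧ φ.pt p.1 = φ.pt p.2}

/-- The sign of a crossing: `+1` if the frame (velocity at the first visit, velocity at the second
visit) is clockwise, and `-1` if it is counterclockwise. -/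
def crossingSign (φ : Quasidoodle) (p : UnitAddCircle × UnitAddCircle) : ℝ :=
  -((SignType.sign (planeDet (φ.vel p.1) (φ.vel p.2)) : SignType) : ℝ)

/-- The sum of `σ(x) binom(i(x), β)` over the crossings `x` with both preimages in `U`. -/
def crossingSum (φ : Quasidoodle) (b : UnitAddCircle) (β : ℕ) (U : Set UnitAddCircle) : ℝ :=
  ∑ᶠ p ∈ φ.crossings b U, φ.crossingSign p * binom (φ.pointIndex (φ.pt p.1)) β

/-- The `β`-th moment of a regular I-doodle, computed with the distinguished point `b`. -/
def moment (φ : Quasidoodle) (b : UnitAddCircle) (β : ℕ) : ℝ :=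
  φ.crossingSum b β univ + 2 * binom (φ.baseIndex b) (β + 1)

end Quasidoodle

/-! ### Invariants of I-doodles -/

abbrev IDoodle : Type := {φ : Quasidoodle // φ.IsIDoodle}

/-- There is a continuous family of I-doodles connecting `φ` and `ψ`. -/
def IDoodle.Equivalent (φ ψ : IDoodle) : Prop :=
  ∃ γ : ℝ → Quasidoodle, Quasidoodle.IsContinuousFamily γ ∧ γ 0 = φ.1 ∧ γ 1 = ψ.1 ∧
    ∀ t ∈ Icc (0 : ℝ) 1, (γ t).IsIDoodle

/-- `V` is an invariant of I-doodles. -/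
def IsIDoodleInvariant (V : IDoodle → ℝ) : Prop :=
  ∀ φ ψ : IDoodle, φ.Equivalent ψ → V φ = V ψ

/-- `V` is the invariant `M(β)` of I-doodles: it is an invariant, and on any regular I-doodle it is
given by the `β`-th moment, computed with any distinguished point that is not a double point. -/
def IsMomentInvariant (β : ℕ) (V : IDoodle → ℝ) : Prop :=
  IsIDoodleInvariant V ∧
    ∀ φ : IDoodle, φ.1.IsRegularIDoodle → ∀ b : UnitAddCircle, φ.1.fiber (φ.1.pt b) = {b} →
      V φ = φ.1.moment b β

/-! ### Regular quasidoodles and degeneration processes -/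

namespace Quasidoodle

/-- The groups of at least three points of the circle glued together by `φ`. To say that `φ`
strictly respects a configuration `J` is to say that `φ.groups = J`. -/
def groups (φ : Quasidoodle) : Set (Set UnitAddCircle) :=
  {G | ∃ x : ℂ, G = φ.fiber x ∧ 3 ≤ G.encard}

/-- An immersion all of whose points of multiplicity at least `3` are standard singular points:
finitely many branches meet there, and they are pairwise nontangent. -/
def IsRegular (φ : Quasidoodle) : Prop :=
  φ.IsImmersion ∧ φ.groups.Finite ∧
    ∀ G ∈ φ.groups, G.Finite ∧
      ∀ z ∈ G, ∀ w ∈ G, z ≠ w → planeDet (φ.vel z) (φ.vel w) ≠ 0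

/-- The sum of the degrees of the singularities, a point of multiplicity `j + 1` having
degree `j`. -/
def complexity (φ : Quasidoodle) : ℕ := ∑ᶠ G ∈ φ.groups, (G.ncard - 1)

end Quasidoodle

/-- A step of a degeneration process: either three points `T` of the circle are glued together to
a new triple point, or the point `z` is glued to the already existing group `G`. -/
inductive DegenerationStep where
  | triple (T : Set UnitAddCircle)
  | join (G : Set UnitAddCircle) (z : UnitAddCircle)

namespace DegenerationStep

/-- The step can be performed on quasidoodles with groups `J`. -/
def Admissible (J : Set (Set UnitAddCircle)) : DegenerationStep → Prop
  | triple T => T.encard = 3 ∧ ∀ G ∈ J, Disjoint G T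
  | join G z => G ∈ J ∧ ∀ H ∈ J, z ∉ H

/-- The groups after the step. -/
def result (J : Set (Set UnitAddCircle)) : DegenerationStep → Set (Set UnitAddCircle)
  | triple T => insert T J
  | join G z => insert (insert z G) (J \ {G})

/-- The family `γp` lies on the positive side of the step and `γm` on the negative one, where
`γp t`, `γm t` are resolutions, for `t > 0`, of the quasidoodle `γp 0 = γm 0`.

If a triple point is resolved, the positive side is the one with the greater sum
`∑ σ(x) i(x)` over the three crossings born from the triple point (the crossings all of whose
preimages are near `T`; any point `b` off `T` may serve as the distinguished point).

If one branch is moved off the multiple point of a group `G`, the positive side is the one on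
which this multiple point has the greater index. -/
def Separates (γp γm : ℝ → Quasidoodle) : DegenerationStep → Prop
  | triple T => ∀ b ∉ T, ∀ᶠ δ in 𝓝[>] (0 : ℝ), ∀ᶠ t in 𝓝[>] (0 : ℝ),
      (γm t).crossingSum b 1 (Metric.thickening δ T) <
        (γp t).crossingSum b 1 (Metric.thickening δ T)
  | join G _ => ∀ g ∈ G, ∀ᶠ t in 𝓝[>] (0 : ℝ),
      (γm t).pointIndex ((γm t).pt g) < (γp t).pointIndex ((γp t).pt g)

end DegenerationStep

/-- The groups produced by a degeneration process (a list of steps, the last step first). -/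
def processGroups : List DegenerationStep → Set (Set UnitAddCircle)
  | [] => ∅
  | s :: P => s.result (processGroups P)

/-- Each step of the process is admissible. -/
def IsProcess : List DegenerationStep → Prop
  | [] => True
  | s :: P => s.Admissible (processGroups P) ∧ IsProcess P

/-- `γ` is a path resolving `φ = γ 0` to `ψ = γ 1`: for `0 < t ≤ 1` it runs inside the set of
regular quasidoodles strictly respecting the configuration `J`. -/
def IsResolutionPath (J : Set (Set UnitAddCircle)) (φ ψ : Quasidoodle) (γ : ℝ → Quasidoodle) :
    Prop :=
  Quasidoodle.IsContinuousFamily γ ∧ γ 0 = φ ∧ γ 1 = ψ ∧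
    ∀ t ∈ Ioc (0 : ℝ) 1, (γ t).IsRegular ∧ (γ t).groups = J

/-- `φp` and `φm` are the positive and the negative one-step resolutions of `φ` with respect to the
step `s` leading from the configuration `J` to that of `φ`. -/
def AreResolutions (s : DegenerationStep) (J : Set (Set UnitAddCircle))
    (φ φp φm : Quasidoodle) : Prop :=
  ∃ γp γm : ℝ → Quasidoodle,
    IsResolutionPath J φ φp γp ∧ IsResolutionPath J φ φm γm ∧ s.Separates γp γm

/-- `n` is the characteristic number which `V` defines at the pair (`φ`, process `P`). -/
def IsCharacteristicNumber (V : IDoodle → ℝ) :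
    List DegenerationStep → Quasidoodle → ℝ → Prop
  | [], φ, n => ∃ h : φ.IsIDoodle, n = V ⟨φ, h⟩
  | s :: P, φ, n => ∃ (φp φm : Quasidoodle) (a b : ℝ),
      AreResolutions s (processGroups P) φ φp φm ∧
      IsCharacteristicNumber V P φp a ∧ IsCharacteristicNumber V P φm b ∧ n = a - b

/-- `V` is of order `j`: all characteristic numbers at all regular quasidoodles of complexity
greater than `j` and all their degeneration processes are zero. -/
def IsOfOrder (V : IDoodle → ℝ) (j : ℕ) : Prop :=
  ∀ φ : Quasidoodle, φ.IsRegular → j < φ.complexity →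
    ∀ P : List DegenerationStep, IsProcess P → processGroups P = φ.groups →
      ∀ n : ℝ, IsCharacteristicNumber V P φ n → n = 0

end

/-!
Throughout, the index of a point *on* a curve is the principal value of its rotation number; at a
multiple point this is the mean over the adjacent sectors (`pointIndex_eq`), and at a simple point
the greater adjacent value is `1 / 2` more (`baseIndex_eq`). Near a multiple point the index varies,
also under `C¹`-small changes of the curve, by half the sum of the signs that tell on which side of
the branches a point lies (`ind_sub_ind`).

*Invariance.* The sum in the moment is a weighted count of the zeros of the chord map
`(s, t) ↦ φ t - φ s` on pairs of times `s < t` after the initial time `b`. As long as the weight is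
locally constant along double points, this count is a degree, and it is computed by integrating the
pullback of a rotationally symmetric area form with support in the unit disc, after a strong
dilation of the curve (`eventually_chordArea_scale`). Stokes' theorem along the segment between two
nearby curves shows that the count changes only by chords with an end at the time `b`, and that the
change is `-2 K` times the change of the index of the point at time `b`, where `K` is the weight of
the crossings there (`chordArea_sub_chordArea`, `integral_fanDensity`, `exists_signedSum_sub`). For
the weight `binom · β`, Pascal's rule says that the last term of the moment compensates for this
(`IsCore.exists_partialMoment_eq`); applied to shifts of time, the same argument shows that the
moment does not depend on the distinguished point (`IsRegularIDoodle.partialMoment_eq`). Hence all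
regular I-doodles near a given I-doodle have the same moment (`IsIDoodle.exists_moment_eq`). There
are such regular I-doodles, since the perturbations with a tangency form the image of a space of
smaller dimension (`IsIDoodle.frequently_isRegularIDoodle`). The common moment is the invariant
`momentInvariant`; any other invariant with the same values on regular I-doodles agrees with it.

*Order.* Near a curve with a transverse triple point of index `c`, each of the three crossings of a
resolution has index `c + 1 / 2` or `c - 1 / 2`, according to its sign, its place in the cyclic
order and the side of the resolution (`IsNearTriple.exists_side`). The other crossings contribute
equally on both sides, so the jump of the moment is the central difference
`binom (c + 1 / 2) β - binom (c - 1 / 2) β` (`IsMomentInvariant.sub_eq`). When a branch is moved off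
a multiple point, the index of the latter changes by `± 1 / 2` (`AreResolutions.ind_eq`). So after
`L` steps a single group has as characteristic number the `L`-th central difference of a polynomial
of degree `β`; a second group does not change the index of the first, hence with several groups the
number is zero (`IsMomentInvariant.characteristicNumber_eq`). The complexity of a single group is
`L + 1`, and the difference vanishes for `L > β`.
-/

namespace Quasidoodle

variable (φ : Quasidoodle)

/-! ### Quasidoodles on the line and on the circle -/

theorem hasDerivAt (s : ℝ) : HasDerivAt φ.toFun (deriv φ.toFun s) s :=
  ((φ.smooth.differentiable (by simp)) s).hasDerivAt

theorem contDiff_deriv : ContDiff ℝ ∞ (deriv φ.toFun) :=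
  ((contDiff_infty_iff_deriv (𝕜 := ℝ)).1 φ.smooth).2

theorem continuous_toFun : Continuous φ.toFun := φ.smooth.continuous

theorem continuous_deriv : Continuous (deriv φ.toFun) := φ.contDiff_deriv.continuous

theorem pt_coe (s : ℝ) : φ.pt (s : UnitAddCircle) = φ.toFun s := rfl

theorem vel_coe (s : ℝ) : φ.vel (s : UnitAddCircle) = deriv φ.toFun s := rfl

theorem toFun_add_int (s : ℝ) (m : ℤ) : φ.toFun (s + m) = φ.toFun s := by
  simpa using (φ.periodic.int_mul m) s

theorem deriv_add_int (s : ℝ) (m : ℤ) : deriv φ.toFun (s + m) = deriv φ.toFun s := by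
  simpa using (φ.deriv_periodic.int_mul m) s

theorem continuous_pt : Continuous φ.pt :=
  (QuotientAddGroup.isQuotientMap_mk _).continuous_iff.2 φ.continuous_toFun

theorem mem_fiber {x : ℂ} {z : UnitAddCircle} : z ∈ φ.fiber x ↔ φ.pt z = x := Iff.rfl

theorem IsImmersion.deriv_ne_zero {φ : Quasidoodle} (h : φ.IsImmersion) (s : ℝ) :
    deriv φ.toFun s ≠ 0 := h s

end Quasidoodle

theorem circle_coe_eq_iff {s t : ℝ} : (s : UnitAddCircle) = t ↔ ∃ m : ℤ, s = t + m := by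
  rw [← sub_eq_zero, ← AddCircle.coe_sub, AddCircle.coe_eq_zero_iff]
  constructor
  · rintro ⟨m, hm⟩
    exact ⟨m, by rw [zsmul_eq_mul, mul_one] at hm; linarith⟩
  · rintro ⟨m, rfl⟩
    exact ⟨m, by simp⟩

theorem circle_coe_ne_of_lt {s t : ℝ} (h : s < t) (h' : t < s + 1) : (s : UnitAddCircle) ≠ t := by
  intro he
  obtain ⟨m, hm⟩ := circle_coe_eq_iff.1 he
  have h1 : (m : ℝ) < 0 := by linarith
  have h2 : (-1 : ℝ) < m := by linarith
  have h3 : m < 0 := by exact_mod_cast h1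
  have h4 : -1 < m := by exact_mod_cast h2
  omega

theorem circle_coe_add_int (s : ℝ) (m : ℤ) : ((s + m : ℝ) : UnitAddCircle) = s :=
  circle_coe_eq_iff.2 ⟨m, rfl⟩

theorem exists_coe_mem_Ico (a : ℝ) (z : UnitAddCircle) : ∃ s ∈ Ico a (a + 1), (s : UnitAddCircle) = z :=
  ⟨AddCircle.equivIco 1 a z, (AddCircle.equivIco 1 a z).2, AddCircle.coe_equivIco⟩

theorem circle_coe_inj_Ico {a s t : ℝ} (hs : s ∈ Ico a (a + 1)) (ht : t ∈ Ico a (a + 1))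
    (h : (s : UnitAddCircle) = t) : s = t :=
  (AddCircle.coe_eq_coe_iff_of_mem_Ico hs ht).1 h

theorem circle_nhds_coe (s : ℝ) : 𝓝 (s : UnitAddCircle) = map ((↑) : ℝ → UnitAddCircle) (𝓝 s) :=
  (QuotientAddGroup.nhds_eq _ s)

theorem planeDet_swap (u v : ℂ) : planeDet u v = -planeDet v u := by
  simp [planeDet]; ring

theorem planeDet_smul_left (r : ℝ) (u v : ℂ) : planeDet (r * u) v = r * planeDet u v := by
  simp [planeDet]; ring

theorem planeDet_smul_right (r : ℝ) (u v : ℂ) : planeDet u (r * v) = r * planeDet u v := by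
  simp [planeDet]; ring

theorem continuous_planeDet : Continuous fun p : ℂ × ℂ => planeDet p.1 p.2 := by
  unfold planeDet; fun_prop

namespace Quasidoodle

/-! ### The `C¹`-topology -/

/-- `ψ` is closer than `δ` to `φ` in the `C¹`-norm (pointwise estimate). -/
def Close (δ : ℝ) (φ ψ : Quasidoodle) : Prop :=
  ∀ s, ‖ψ.toFun s - φ.toFun s‖ < δ ∧ ‖deriv ψ.toFun s - deriv φ.toFun s‖ < δ

theorem Close.mono {δ δ' : ℝ} {φ ψ : Quasidoodle} (h : Close δ φ ψ) (hδ : δ ≤ δ') :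
    Close δ' φ ψ := fun s => ⟨(h s).1.trans_le hδ, (h s).2.trans_le hδ⟩

theorem Close.refl {δ : ℝ} (hδ : 0 < δ) (φ : Quasidoodle) : Close δ φ φ := by
  intro s; simpa using hδ

theorem Close.trans {δ δ' : ℝ} {φ ψ χ : Quasidoodle} (h : Close δ φ ψ) (h' : Close δ' ψ χ) :
    Close (δ + δ') φ χ := by
  intro s
  have e1 : χ.toFun s - φ.toFun s = (ψ.toFun s - φ.toFun s) + (χ.toFun s - ψ.toFun s) := by ring
  have e2 : deriv χ.toFun s - deriv φ.toFun s =
    (deriv ψ.toFun s - deriv φ.toFun s) + (deriv χ.toFun s - deriv ψ.toFun s) := by ring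
  rw [e1, e2]
  exact ⟨(norm_add_le _ _).trans_lt (add_lt_add (h s).1 (h' s).1),
    (norm_add_le _ _).trans_lt (add_lt_add (h s).2 (h' s).2)⟩

/-- The filter of `C¹`-neighbourhoods of `φ`. -/
def nhdsC1 (φ : Quasidoodle) : Filter Quasidoodle := ⨅ δ ∈ Ioi (0 : ℝ), 𝓟 {ψ | Close δ φ ψ}

theorem hasBasis_nhdsC1 (φ : Quasidoodle) :
    φ.nhdsC1.HasBasis (fun δ : ℝ => 0 < δ) fun δ => {ψ | Close δ φ ψ} := by
  refine hasBasis_biInf_principal (s := fun δ : ℝ => {ψ | Close δ φ ψ}) (S := Ioi (0 : ℝ)) ?_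
    ⟨1, mem_Ioi.2 one_pos⟩
  intro a ha b hb
  exact ⟨min a b, mem_Ioi.2 (lt_min (mem_Ioi.1 ha) (mem_Ioi.1 hb)), fun ψ h => Close.mono h (min_le_left _ _),
    fun ψ h => Close.mono h (min_le_right _ _)⟩

theorem eventually_nhdsC1_iff {φ : Quasidoodle} {p : Quasidoodle → Prop} :
    (∀ᶠ ψ in φ.nhdsC1, p ψ) ↔ ∃ δ > 0, ∀ ψ, Close δ φ ψ → p ψ :=
  φ.hasBasis_nhdsC1.eventually_iff

theorem eventually_close (φ : Quasidoodle) {δ : ℝ} (hδ : 0 < δ) : ∀ᶠ ψ in φ.nhdsC1, Close δ φ ψ :=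
  eventually_nhdsC1_iff.2 ⟨δ, hδ, fun _ h => h⟩

theorem pure_le_nhdsC1 (φ : Quasidoodle) : pure φ ≤ φ.nhdsC1 := by
  intro s hs
  obtain ⟨δ, hδ, h⟩ := φ.hasBasis_nhdsC1.mem_iff.1 hs
  exact h (Close.refl hδ φ)

theorem eventually_self {φ : Quasidoodle} {p : Quasidoodle → Prop} (h : ∀ᶠ ψ in φ.nhdsC1, p ψ) :
    p φ := φ.pure_le_nhdsC1 h

/-- A property that holds near `φ` holds near all `ψ` near `φ`. -/
theorem eventually_eventually_nhdsC1 {φ : Quasidoodle} {p : Quasidoodle → Prop}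
    (h : ∀ᶠ ψ in φ.nhdsC1, p ψ) : ∀ᶠ ψ in φ.nhdsC1, ∀ᶠ χ in ψ.nhdsC1, p χ := by
  obtain ⟨δ, hδ, h⟩ := eventually_nhdsC1_iff.1 h
  refine eventually_nhdsC1_iff.2 ⟨δ / 2, half_pos hδ, fun ψ hψ => ?_⟩
  refine eventually_nhdsC1_iff.2 ⟨δ / 2, half_pos hδ, fun χ hχ => h χ ?_⟩
  simpa using hψ.trans hχ

theorem tendsto_toFun (φ : Quasidoodle) (s : ℝ) :
    Tendsto (fun q : Quasidoodle × ℝ => q.1.toFun q.2) (φ.nhdsC1 ×ˢ 𝓝 s) (𝓝 (φ.toFun s)) := by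
  rw [Metric.tendsto_nhds]
  intro ε hε
  have h1 := φ.eventually_close (half_pos hε)
  have h2 : ∀ᶠ t in 𝓝 s, dist (φ.toFun t) (φ.toFun s) < ε / 2 :=
    Metric.tendsto_nhds.1 φ.continuous_toFun.continuousAt _ (half_pos hε)
  filter_upwards [h1.prod_mk h2] with q hq
  have := (hq.1 q.2).1
  rw [← dist_eq_norm] at this
  linarith [dist_triangle (q.1.toFun q.2) (φ.toFun q.2) (φ.toFun s), hq.2]

theorem tendsto_deriv (φ : Quasidoodle) (s : ℝ) :
    Tendsto (fun q : Quasidoodle × ℝ => deriv q.1.toFun q.2) (φ.nhdsC1 ×ˢ 𝓝 s)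
      (𝓝 (deriv φ.toFun s)) := by
  rw [Metric.tendsto_nhds]
  intro ε hε
  have h1 := φ.eventually_close (half_pos hε)
  have h2 : ∀ᶠ t in 𝓝 s, dist (deriv φ.toFun t) (deriv φ.toFun s) < ε / 2 :=
    Metric.tendsto_nhds.1 φ.continuous_deriv.continuousAt _ (half_pos hε)
  filter_upwards [h1.prod_mk h2] with q hq
  have := (hq.1 q.2).2
  rw [← dist_eq_norm] at this
  linarith [dist_triangle (deriv q.1.toFun q.2) (deriv φ.toFun q.2) (deriv φ.toFun s), hq.2]

theorem tendsto_pt (φ : Quasidoodle) (z : UnitAddCircle) :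
    Tendsto (fun q : Quasidoodle × UnitAddCircle => q.1.pt q.2) (φ.nhdsC1 ×ˢ 𝓝 z) (𝓝 (φ.pt z)) := by
  obtain ⟨s, -, rfl⟩ := exists_coe_mem_Ico 0 z
  have : φ.nhdsC1 ×ˢ 𝓝 (s : UnitAddCircle) =
      map (fun q : Quasidoodle × ℝ => (q.1, (q.2 : UnitAddCircle))) (φ.nhdsC1 ×ˢ 𝓝 s) := by
    rw [circle_nhds_coe]
    conv_lhs => rw [← map_id (f := φ.nhdsC1)]
    rw [prod_map_map_eq]
    rfl
  rw [this, tendsto_map'_iff]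
  exact φ.tendsto_toFun s

/-- The quasidoodle at time `τ` on the segment from `φ` to `ψ`. -/
def lin (τ : ℝ) (φ ψ : Quasidoodle) : Quasidoodle where
  toFun s := (1 - τ : ℝ) * φ.toFun s + (τ : ℝ) * ψ.toFun s
  smooth := (contDiff_const.mul φ.smooth).add (contDiff_const.mul ψ.smooth)
  periodic s := by simp only [φ.periodic s, ψ.periodic s]

theorem lin_toFun (τ : ℝ) (φ ψ : Quasidoodle) (s : ℝ) :
    (lin τ φ ψ).toFun s = (1 - τ : ℝ) * φ.toFun s + (τ : ℝ) * ψ.toFun s := rfl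

theorem deriv_lin (τ : ℝ) (φ ψ : Quasidoodle) (s : ℝ) :
    deriv (lin τ φ ψ).toFun s = (1 - τ : ℝ) * deriv φ.toFun s + (τ : ℝ) * deriv ψ.toFun s :=
  (((φ.hasDerivAt s).const_mul _).add ((ψ.hasDerivAt s).const_mul _)).deriv

theorem ext_toFun {φ ψ : Quasidoodle} (h : ∀ s, φ.toFun s = ψ.toFun s) : φ = ψ := by
  cases φ; cases ψ; congr; exact funext h

theorem lin_zero (φ ψ : Quasidoodle) : lin 0 φ ψ = φ := ext_toFun fun s => by simp [lin_toFun]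

theorem lin_one (φ ψ : Quasidoodle) : lin 1 φ ψ = ψ := ext_toFun fun s => by simp [lin_toFun]

theorem norm_convex_comb_lt {τ δ : ℝ} (hτ : τ ∈ Icc (0 : ℝ) 1) {a b c : ℂ} (ha : ‖a - c‖ < δ)
    (hb : ‖b - c‖ < δ) : ‖(1 - τ : ℝ) * a + (τ : ℝ) * b - c‖ < δ := by
  have := convex_ball c δ (mem_ball_iff_norm.2 ha) (mem_ball_iff_norm.2 hb)
    (sub_nonneg.2 hτ.2) hτ.1 (by ring)
  simpa [dist_eq_norm, Complex.real_smul] using this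

theorem Close.lin {δ τ : ℝ} (hτ : τ ∈ Icc (0 : ℝ) 1) {φ ψ χ : Quasidoodle} (hψ : Close δ φ ψ)
    (hχ : Close δ φ χ) : Close δ φ (lin τ ψ χ) := by
  intro s
  rw [lin_toFun, deriv_lin]
  exact ⟨norm_convex_comb_lt hτ (hψ s).1 (hχ s).1, norm_convex_comb_lt hτ (hψ s).2 (hχ s).2⟩

theorem isContinuousFamily_lin (φ ψ : Quasidoodle) : IsContinuousFamily fun τ => lin τ φ ψ := by
  intro k
  have : (fun p : ℝ × ℝ => iteratedDeriv k (Quasidoodle.lin p.1 φ ψ).toFun p.2) = fun p : ℝ × ℝ =>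
      (1 - p.1 : ℝ) * iteratedDeriv k φ.toFun p.2 + (p.1 : ℝ) * iteratedDeriv k ψ.toFun p.2 := by
    funext p
    have hk : ((k : ℕ) : WithTop ℕ∞) ≤ ∞ := by exact_mod_cast le_top
    have h1 : ContDiff ℝ k φ.toFun := φ.smooth.of_le hk
    have h2 : ContDiff ℝ k ψ.toFun := ψ.smooth.of_le hk
    have : (Quasidoodle.lin p.1 φ ψ).toFun =
        (fun s => ((1 - p.1 : ℝ) : ℂ) * φ.toFun s) + fun s => ((p.1 : ℝ) : ℂ) * ψ.toFun s := rfl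
    rw [this, iteratedDeriv_add (contDiff_const.mul h1).contDiffAt (contDiff_const.mul h2).contDiffAt]
    simp [iteratedDeriv_const_mul_field]
  rw [this]
  have c1 : Continuous (iteratedDeriv k φ.toFun) := φ.smooth.continuous_iteratedDeriv k
    (by exact_mod_cast le_top)
  have c2 : Continuous (iteratedDeriv k ψ.toFun) := ψ.smooth.continuous_iteratedDeriv k
    (by exact_mod_cast le_top)
  exact Continuous.continuousOn (by fun_prop)

theorem exists_forall_lt_of_continuousOn {g : ℝ × ℝ → ℂ} (hg : ContinuousOn g (Icc 0 1 ×ˢ univ))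
    {t₀ : ℝ} (ht₀ : t₀ ∈ Icc (0 : ℝ) 1) {δ : ℝ} (hδ : 0 < δ) :
    ∀ᶠ t in 𝓝[Icc 0 1] t₀, ∀ s ∈ Icc (0 : ℝ) 1, ‖g (t, s) - g (t₀, s)‖ < δ := by
  have hc : IsCompact (Icc (0 : ℝ) 1) := isCompact_Icc
  have hu : UniformContinuousOn g (Icc 0 1 ×ˢ Icc 0 1) :=
    (hc.prod hc).uniformContinuousOn_of_continuous (hg.mono (prod_mono_right (subset_univ _)))
  obtain ⟨η, hη, h⟩ := Metric.uniformContinuousOn_iff.1 hu δ hδ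
  filter_upwards [self_mem_nhdsWithin, nhdsWithin_le_nhds (Metric.ball_mem_nhds t₀ hη)] with t ht ht' s hs
  rw [← dist_eq_norm]
  refine h _ ⟨ht, hs⟩ _ ⟨ht₀, hs⟩ ?_
  simpa [Prod.dist_eq, hη] using ht'

theorem IsContinuousFamily.tendsto {γ : ℝ → Quasidoodle} (h : IsContinuousFamily γ) {t₀ : ℝ}
    (ht₀ : t₀ ∈ Icc (0 : ℝ) 1) : Tendsto γ (𝓝[Icc 0 1] t₀) (γ t₀).nhdsC1 := by
  rw [(γ t₀).hasBasis_nhdsC1.tendsto_right_iff]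
  intro δ hδ
  have h0 := exists_forall_lt_of_continuousOn (by simpa using h 0) ht₀ hδ
  have h1 := exists_forall_lt_of_continuousOn (by simpa using h 1) ht₀ hδ
  filter_upwards [h0, h1] with t h0 h1 s
  obtain ⟨r, hr, hrs⟩ := exists_coe_mem_Ico 0 (s : UnitAddCircle)
  have hr' : r ∈ Icc (0 : ℝ) 1 := by rw [zero_add] at hr; exact Ico_subset_Icc_self hr
  have e (ψ : Quasidoodle) : ψ.toFun s = ψ.toFun r ∧ deriv ψ.toFun s = deriv ψ.toFun r := by
    rw [← pt_coe, ← vel_coe, ← hrs]; exact ⟨rfl, rfl⟩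
  rw [(e _).1, (e _).1, (e _).2, (e _).2]
  exact ⟨h0 r hr', h1 r hr'⟩

end Quasidoodle

/-! ### The angle swept by a monotone arc -/

theorem arg_I_mul_of_re_pos {z : ℂ} (hz : 0 < z.re) :
    Complex.arg (Complex.I * z) = Complex.arg z + Real.pi / 2 := by
  have h := abs_lt.1 (Complex.abs_arg_lt_pi_div_two_iff.2 (Or.inl hz))
  have hz0 : z ≠ 0 := fun h => by simp [h] at hz
  rw [Complex.arg_mul Complex.I_ne_zero hz0, Complex.arg_I, add_comm]
  rw [Complex.arg_I]
  constructor <;> linarith [h.1, h.2, Real.pi_pos]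

theorem arg_neg_I_mul_of_re_pos {z : ℂ} (hz : 0 < z.re) :
    Complex.arg (-Complex.I * z) = Complex.arg z - Real.pi / 2 := by
  have h := abs_lt.1 (Complex.abs_arg_lt_pi_div_two_iff.2 (Or.inl hz))
  have hz0 : z ≠ 0 := fun h => by simp [h] at hz
  rw [Complex.arg_mul (neg_ne_zero.2 Complex.I_ne_zero) hz0, Complex.arg_neg_I]
  · ring
  rw [Complex.arg_neg_I]
  constructor <;> linarith [h.1, h.2, Real.pi_pos]

/-- A curve that, after multiplication by a constant, avoids the negative half-axis sweeps the
difference of the arguments of its endpoints. -/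
theorem integral_im_div_of_mem_slitPlane {f f' : ℝ → ℂ} (hf : ∀ s, HasDerivAt f (f' s) s)
    (hf' : Continuous f') {a c : ℝ} {u : ℂ} (h : ∀ r ∈ uIcc a c, u * f r ∈ Complex.slitPlane) :
    IntervalIntegrable (fun r => (f' r / f r).im) MeasureTheory.volume a c ∧
      ∫ r in a..c, (f' r / f r).im = Complex.arg (u * f c) - Complex.arg (u * f a) := by
  have hne : ∀ r ∈ uIcc a c, u ≠ 0 ∧ f r ≠ 0 := fun r hr => by
    have := Complex.slitPlane_ne_zero (h r hr)
    exact mul_ne_zero_iff.1 this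
  have hcf : Continuous f := continuous_iff_continuousAt.2 fun s => (hf s).continuousAt
  have hint : IntervalIntegrable (fun r => (f' r / f r).im) MeasureTheory.volume a c := by
    refine ContinuousOn.intervalIntegrable ?_
    exact Complex.continuous_im.comp_continuousOn
      (hf'.continuousOn.div hcf.continuousOn fun r hr => (hne r hr).2)
  refine ⟨hint, ?_⟩
  have key : ∀ r ∈ uIcc a c, HasDerivAt (fun r => Complex.arg (u * f r)) ((f' r / f r).im) r := by
    intro r hr
    have h1 := ((hf r).const_mul u).clog_real (h r hr)
    have h2 := (Complex.imCLM.hasFDerivAt.comp_hasDerivAt r h1)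
    rw [mul_div_mul_left _ _ (hne r hr).1] at h2
    refine h2.congr_of_eventuallyEq (Eventually.of_forall fun s => ?_)
    simp [Complex.log_im]
  rw [intervalIntegral.integral_eq_sub_of_hasDerivAt key hint]

theorem re_sub_ge_of_deriv {f f' : ℝ → ℂ} (hf : ∀ s, HasDerivAt f (f' s) s) {a c m : ℝ}
    (hm : ∀ r ∈ Icc a c, m ≤ (f' r).re) {x y : ℝ} (hx : x ∈ Icc a c) (hy : y ∈ Icc a c)
    (hxy : x ≤ y) : m * (y - x) ≤ (f y).re - (f x).re := by
  have hd : ∀ s, HasDerivAt (fun s => (f s).re) ((f' s).re) s := fun s =>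
    Complex.reCLM.hasFDerivAt.comp_hasDerivAt s (hf s)
  refine (convex_Icc a c).mul_sub_le_image_sub_of_le_deriv
    (fun s _ => (hd s).continuousAt.continuousWithinAt)
    (fun s _ => (hd s).differentiableAt.differentiableWithinAt) (fun s hs => ?_) x hx y hy hxy
  rw [(hd s).deriv]
  exact hm s (interior_subset hs)

theorem exists_pos_le_re {f' : ℝ → ℂ} (hf' : Continuous f') {a c : ℝ}
    (hpos : ∀ r ∈ Icc a c, 0 < (f' r).re) : ∃ m > 0, ∀ r ∈ Icc a c, m ≤ (f' r).re := by
  rcases (Icc a c).eq_empty_or_nonempty with h | h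
  · exact ⟨1, one_pos, by simp [h]⟩
  · obtain ⟨r, hr, hmin⟩ := isCompact_Icc.exists_isMinOn h
      (Complex.continuous_re.comp hf').continuousOn
    exact ⟨_, hpos r hr, fun s hs => hmin hs⟩

/-- The angular velocity of a `C²` arc about one of its points is bounded: only the real part of
`f' / f` has a pole there. -/
theorem exists_bound_im_div {f f' f'' : ℝ → ℂ} (hf : ∀ s, HasDerivAt f (f' s) s)
    (hf' : ∀ s, HasDerivAt f' (f'' s) s) (hf'' : Continuous f'') {a c r₀ : ℝ}
    (hr₀ : r₀ ∈ Icc a c) (hpos : ∀ r ∈ Icc a c, 0 < (f' r).re) (h0 : f r₀ = 0) :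
    ∃ C, ∀ r ∈ Icc a c, |(f' r / f r).im| ≤ C := by
  have hcf' : Continuous f' := continuous_iff_continuousAt.2 fun s => (hf' s).continuousAt
  obtain ⟨m, hm, hml⟩ := exists_pos_le_re hcf' hpos
  obtain ⟨K, hK⟩ := isCompact_Icc.exists_bound_of_continuousOn (s := Icc a c) hf''.continuousOn
  obtain ⟨N, hN⟩ := isCompact_Icc.exists_bound_of_continuousOn (s := Icc a c) hcf'.continuousOn
  have hK0 : 0 ≤ K := (norm_nonneg _).trans (hK r₀ hr₀)
  have hN0 : 0 ≤ N := (norm_nonneg _).trans (hN r₀ hr₀)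
  refine ⟨N * K / m ^ 2, fun r hr => ?_⟩
  -- the curve moves to the right with horizontal speed at least `m`
  have hlow : m * |r - r₀| ≤ ‖f r‖ := by
    refine le_trans ?_ (Complex.abs_re_le_norm _)
    rcases le_total r₀ r with h | h
    · have := re_sub_ge_of_deriv hf hml hr₀ hr h
      rw [h0] at this
      rw [abs_of_nonneg (sub_nonneg.2 h)]
      simp only [Complex.zero_re, sub_zero] at this
      exact this.trans (le_abs_self _)
    · have := re_sub_ge_of_deriv hf hml hr hr₀ h
      rw [h0] at this
      rw [abs_of_nonpos (sub_nonpos.2 h)]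
      simp only [Complex.zero_re, zero_sub] at this
      rw [neg_sub]
      exact this.trans (neg_le_abs _)
  have hsub : uIcc r₀ r ⊆ Icc a c := by
    rw [uIcc_eq_union]; exact union_subset (Icc_subset_Icc hr₀.1 hr.2) (Icc_subset_Icc hr.1 hr₀.2)
  -- Taylor's formula at `r`: the error vanishes to second order at `r₀`
  have hrem : ‖f r - (r - r₀ : ℝ) * f' r‖ ≤ K * |r - r₀| * |r - r₀| := by
    have hd : ∀ s ∈ uIcc r₀ r, HasDerivWithinAt (fun s : ℝ => f s - ((s - r₀ : ℝ) : ℂ) * f' s)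
        (-(((s - r₀ : ℝ) : ℂ) * f'' s)) (uIcc r₀ r) s := by
      intro s _
      have h1 : HasDerivAt (fun s : ℝ => ((s - r₀ : ℝ) : ℂ)) 1 s := by
        simpa using ((hasDerivAt_id s).sub_const r₀).ofReal_comp
      have := ((hf s).sub (h1.mul (hf' s)))
      refine (this.congr_deriv ?_).hasDerivWithinAt
      ring
    have hb : ∀ s ∈ uIcc r₀ r, ‖-(((s - r₀ : ℝ) : ℂ) * f'' s)‖ ≤ K * |r - r₀| := by
      intro s hs
      rw [norm_neg, norm_mul, Complex.norm_real, Real.norm_eq_abs, mul_comm K]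
      have h1 : |s - r₀| ≤ |r - r₀| := by
        have := abs_sub_left_of_mem_uIcc hs
        simpa using this
      exact mul_le_mul h1 (hK s (hsub hs)) (norm_nonneg _) (abs_nonneg _)
    have := (convex_uIcc r₀ r).norm_image_sub_le_of_norm_hasDerivWithin_le hd hb left_mem_uIcc
      right_mem_uIcc
    simpa [h0] using this
  rcases eq_or_ne r r₀ with rfl | hne
  · rw [h0]; simp only [div_zero, Complex.zero_im, abs_zero]; positivity
  have hpos' : 0 < |r - r₀| := abs_pos.2 (sub_ne_zero.2 hne)
  have hfpos : 0 < ‖f r‖ := lt_of_lt_of_le (by positivity) hlow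
  have hnum : |(f' r * (starRingEnd ℂ) (f r)).im| ≤ N * (K * |r - r₀| * |r - r₀|) := by
    -- a real multiple of `f' r` does not contribute to the imaginary part
    have e : (f' r * (starRingEnd ℂ) (f r)).im =
        (f' r * (starRingEnd ℂ) (f r - (r - r₀ : ℝ) * f' r)).im := by
      simp; ring
    rw [e]
    refine (Complex.abs_im_le_norm _).trans ?_
    rw [norm_mul, Complex.norm_conj]
    exact mul_le_mul (hN r hr) hrem (norm_nonneg _) hN0
  have e : (f' r / f r).im = (f' r * (starRingEnd ℂ) (f r)).im / ‖f r‖ ^ 2 := by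
    rw [Complex.div_im, ← Complex.normSq_eq_norm_sq]
    simp; ring
  rw [e, abs_div, abs_of_pos (pow_pos hfpos 2), div_le_div_iff₀ (pow_pos hfpos 2) (by positivity)]
  have h2 : (m * |r - r₀|) ^ 2 ≤ ‖f r‖ ^ 2 := pow_le_pow_left₀ (by positivity) hlow 2
  calc _ ≤ N * (K * |r - r₀| * |r - r₀|) * m ^ 2 := by gcongr
    _ = N * K * (m * |r - r₀|) ^ 2 := by ring
    _ ≤ N * K * ‖f r‖ ^ 2 := by gcongr

theorem intervalIntegrable_of_bound {g : ℝ → ℝ} (hg : Measurable g) {a c C : ℝ} (hac : a ≤ c)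
    (h : ∀ r ∈ Icc a c, |g r| ≤ C) : IntervalIntegrable g MeasureTheory.volume a c := by
  rw [intervalIntegrable_iff_integrableOn_Icc_of_le hac]
  refine MeasureTheory.Measure.integrableOn_of_bounded (M := C) (by simp) hg.aestronglyMeasurable ?_
  exact (MeasureTheory.ae_restrict_iff' measurableSet_Icc).2 (Eventually.of_forall h)

/-- The angle swept by an arc moving to the right, seen from a point of the vertical line through
one of its points: it is determined by the endpoints up to `π` times the side on which the curve
passes. On the curve itself, the principal value is meant. -/
theorem integral_im_div_of_re_deriv_pos {f f' f'' : ℝ → ℂ} (hf : ∀ s, HasDerivAt f (f' s) s)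
    (hf' : ∀ s, HasDerivAt f' (f'' s) s) (hf'' : Continuous f'') {a c r₀ μ : ℝ}
    (hr₀ : r₀ ∈ Ioo a c) (hpos : ∀ r ∈ Icc a c, 0 < (f' r).re) (h0 : f r₀ = -(μ * Complex.I)) :
    IntervalIntegrable (fun r => (f' r / f r).im) MeasureTheory.volume a c ∧
      ∫ r in a..c, (f' r / f r).im = Complex.arg (f c) - Complex.arg (-f a) +
        Real.pi * ((SignType.sign μ : SignType) : ℝ) := by
  have hcf' : Continuous f' := continuous_iff_continuousAt.2 fun s => (hf' s).continuousAt
  have hcf : Continuous f := continuous_iff_continuousAt.2 fun s => (hf s).continuousAt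
  obtain ⟨m, hm, hml⟩ := exists_pos_le_re hcf' hpos
  have hac : a ≤ c := (hr₀.1.trans hr₀.2).le
  have hr₀' : r₀ ∈ Icc a c := Ioo_subset_Icc_self hr₀
  have hre0 : (f r₀).re = 0 := by simp [h0]
  have hright : ∀ r ∈ Icc a c, r₀ < r → 0 < (f r).re := fun r hr h => by
    have := re_sub_ge_of_deriv hf hml hr₀' hr h.le
    have h' : 0 < m * (r - r₀) := mul_pos hm (sub_pos.2 h)
    linarith
  have hleft : ∀ r ∈ Icc a c, r < r₀ → (f r).re < 0 := fun r hr h => by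
    have := re_sub_ge_of_deriv hf hml hr hr₀' h.le
    have h' : 0 < m * (r₀ - r) := mul_pos hm (sub_pos.2 h)
    linarith
  have hc := hright c (right_mem_Icc.2 hac) hr₀.2
  have ha := hleft a (left_mem_Icc.2 hac) hr₀.1
  have ha' : 0 < (-f a).re := by simpa using ha
  rcases lt_trichotomy μ 0 with hμ | rfl | hμ
  -- the curve crosses the vertical axis above the origin, so `-I * f` avoids the negative
  -- half-axis
  · obtain ⟨hi, h⟩ := integral_im_div_of_mem_slitPlane (a := a) (c := c) (u := -Complex.I) hf hcf' (by
      intro r hr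
      rw [uIcc_of_le hac] at hr
      rcases lt_trichotomy r r₀ with h | rfl | h
      · right; simpa using (hleft r hr h).ne
      · left; simp [h0, hμ]
      · right; simpa using (hright r hr h).ne')
    refine ⟨hi, h.trans ?_⟩
    rw [arg_neg_I_mul_of_re_pos hc, show -Complex.I * f a = Complex.I * -f a by ring,
      arg_I_mul_of_re_pos ha', sign_neg hμ]
    simp; ring
  -- the curve passes through the origin: both halves are integrated separately, and the
  -- arguments of `f` from the right and of `-f` from the left tend to the argument of `f' r₀`
  · have h0' : f r₀ = 0 := by simpa using h0
    obtain ⟨C, hC⟩ := exists_bound_im_div hf hf' hf'' hr₀' hpos h0'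
    have hmeas : Measurable fun r => (f' r / f r).im :=
      Complex.measurable_im.comp (hcf'.measurable.div hcf.measurable)
    have hi1 := intervalIntegrable_of_bound hmeas hr₀.1.le
      (fun r hr => hC r (Icc_subset_Icc_right hr₀.2.le hr))
    have hi2 := intervalIntegrable_of_bound hmeas hr₀.2.le
      (fun r hr => hC r (Icc_subset_Icc_left hr₀.1.le hr))
    refine ⟨hi1.trans hi2, ?_⟩
    have hslope : Tendsto (fun r : ℝ => ((r - r₀ : ℝ)⁻¹ : ℂ) * f r) (𝓝[≠] r₀) (𝓝 (f' r₀)) := by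
      have := (hasDerivAt_iff_tendsto_slope.1 (hf r₀))
      refine this.congr fun r => ?_
      rw [slope_def_module, h0', sub_zero, Complex.real_smul, Complex.ofReal_inv]
    have hcont : ContinuousAt Complex.arg (f' r₀) :=
      Complex.continuousAt_arg (Or.inl (hpos r₀ hr₀'))
    have hlim := hcont.tendsto.comp hslope
    have hR : Tendsto (fun r => Complex.arg (f r)) (𝓝[>] r₀) (𝓝 (Complex.arg (f' r₀))) := by
      refine (hlim.mono_left (nhdsWithin_mono _ fun x (hx : r₀ < x) => hx.ne')).congr' ?_
      filter_upwards [self_mem_nhdsWithin] with r (hr : r₀ < r)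
      have : (0 : ℝ) < (r - r₀)⁻¹ := inv_pos.2 (sub_pos.2 hr)
      rw [Function.comp_apply, ← Complex.ofReal_inv, Complex.arg_real_mul _ this]
    have hL : Tendsto (fun r => Complex.arg (-f r)) (𝓝[<] r₀) (𝓝 (Complex.arg (f' r₀))) := by
      refine (hlim.mono_left (nhdsWithin_mono _ fun x (hx : x < r₀) => hx.ne)).congr' ?_
      filter_upwards [self_mem_nhdsWithin] with r (hr : r < r₀)
      have : (0 : ℝ) < -(r - r₀)⁻¹ := by
        rw [← inv_neg, inv_pos]; linarith
      rw [Function.comp_apply, ← Complex.ofReal_inv, ← Complex.arg_real_mul (-f r) this]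
      simp
    have hder : ∀ r, 0 < (f r).re → HasDerivAt (fun r => Complex.arg (f r)) ((f' r / f r).im) r := by
      intro r hr
      have h1 := (hf r).clog_real (Or.inl hr)
      exact (Complex.imCLM.hasFDerivAt.comp_hasDerivAt r h1).congr_of_eventuallyEq
        (Eventually.of_forall fun s => by simp [Complex.log_im])
    have hder' : ∀ r, (f r).re < 0 → HasDerivAt (fun r => Complex.arg (-f r)) ((f' r / f r).im) r := by
      intro r hr
      have h1 := (hf r).neg.clog_real (Or.inl (by simpa using hr))
      rw [Pi.neg_apply, neg_div_neg_eq] at h1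
      exact (Complex.imCLM.hasFDerivAt.comp_hasDerivAt r h1).congr_of_eventuallyEq
        (Eventually.of_forall fun s => by simp [Complex.log_im])
    have e1 := intervalIntegral.integral_eq_sub_of_hasDerivAt_of_tendsto hr₀.1
      (fun r hr => hder' r (hleft r ⟨hr.1.le, hr.2.le.trans hr₀.2.le⟩ hr.2)) hi1
      (fa := Complex.arg (-f a)) (((hder' a ha).continuousAt.tendsto).mono_left nhdsWithin_le_nhds) hL
    have e2 := intervalIntegral.integral_eq_sub_of_hasDerivAt_of_tendsto hr₀.2
      (fun r hr => hder r (hright r ⟨hr₀.1.le.trans hr.1.le, hr.2.le⟩ hr.1)) hi2 hR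
      (fb := Complex.arg (f c)) (((hder c hc).continuousAt.tendsto).mono_left nhdsWithin_le_nhds)
    rw [← intervalIntegral.integral_add_adjacent_intervals hi1 hi2, e1, e2]
    simp
  -- the curve passes below the origin, so `I * f` avoids the negative half-axis
  · obtain ⟨hi, h⟩ := integral_im_div_of_mem_slitPlane (a := a) (c := c) (u := Complex.I) hf hcf' (by
      intro r hr
      rw [uIcc_of_le hac] at hr
      rcases lt_trichotomy r r₀ with h | rfl | h
      · right; simpa using (hleft r hr h).ne
      · left; simp [h0, hμ]
      · right; simpa using (hright r hr h).ne')
    refine ⟨hi, h.trans ?_⟩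
    rw [arg_I_mul_of_re_pos hc, show Complex.I * f a = -Complex.I * -f a by ring,
      arg_neg_I_mul_of_re_pos ha', sign_pos hμ]
    simp; ring

/-! ### The rotation number -/

/-- The rotation number of a closed curve about a point outside it is an integer. -/
theorem exists_int_integral_im_div {f f' : ℝ → ℂ} (hf : ∀ s, HasDerivAt f (f' s) s)
    (hf' : Continuous f') (hp : f 1 = f 0) (h0 : ∀ s, f s ≠ 0) :
    ∃ n : ℤ, (2 * Real.pi)⁻¹ * ∫ s in (0 : ℝ)..1, (f' s / f s).im = n := by
  have hcf : Continuous f := continuous_iff_continuousAt.2 fun s => (hf s).continuousAt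
  have hc : Continuous fun s => f' s / f s := hf'.div hcf h0
  set G : ℝ → ℂ := fun s => ∫ r in (0 : ℝ)..s, f' r / f r with hG
  have hGd : ∀ s, HasDerivAt G (f' s / f s) s := fun s =>
    intervalIntegral.integral_hasDerivAt_right (hc.intervalIntegrable _ _)
      (hc.stronglyMeasurableAtFilter _ _) hc.continuousAt
  -- `f * exp (-∫ f' / f)` is constant, so the exponential of the integral over a period is `1`
  have hd : ∀ s, HasDerivAt (fun s => f s * Complex.exp (-G s)) 0 s := by
    intro s
    have := (hf s).mul ((hGd s).neg.cexp)
    refine this.congr_deriv ?_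
    field_simp [h0 s]
    ring
  have hconst := is_const_of_deriv_eq_zero (fun s => (hd s).differentiableAt)
    (fun s => (hd s).deriv) 1 0
  have hG0 : G 0 = 0 := by simp [hG]
  simp only [hp, hG0, neg_zero] at hconst
  have h1 := mul_left_cancel₀ (h0 0) hconst
  obtain ⟨n, hn⟩ := Complex.exp_eq_exp_iff_exists_int.1 h1
  have him : ∫ s in (0 : ℝ)..1, (f' s / f s).im = (G 1).im := by
    have := Complex.imCLM.intervalIntegral_comp_comm (hc.intervalIntegrable (μ := MeasureTheory.volume) 0 1)
    simpa [hG] using this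
  refine ⟨-n, ?_⟩
  rw [him]
  have := congrArg Complex.im hn
  simp at this
  have hpi := Real.pi_pos
  push_cast
  field_simp
  linarith

theorem IsCompact.eventually_forall_mem {α X : Type*} [TopologicalSpace X] {F : Filter α} {K : Set X}
    (hK : IsCompact K) {P : α → X → Prop} (h : ∀ x ∈ K, ∀ᶠ q in F ×ˢ 𝓝 x, P q.1 q.2) :
    ∀ᶠ a in F, ∀ x ∈ K, P a x := by
  have h1 : ∀ᶠ q in F ×ˢ 𝓝ˢ K, P q.1 q.2 := by
    rw [hK.prod_nhdsSet_eq_biSup]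
    simpa only [eventually_iSup] using h
  obtain ⟨pa, hpa, pb, hpb, hp⟩ := eventually_prod_iff.1 h1
  filter_upwards [hpa] with a ha x hx
  exact hp ha (hpb.self_of_nhdsSet x hx)

namespace Quasidoodle

/-! ### The local structure of the index -/

/-- The angular velocity of the curve about `p`. -/
noncomputable def angVel (ψ : Quasidoodle) (p : ℂ) (s : ℝ) : ℝ :=
  (deriv ψ.toFun s / (ψ.toFun s - p)).im

theorem angVel_periodic (ψ : Quasidoodle) (p : ℂ) : Function.Periodic (ψ.angVel p) 1 := by
  intro s; simp only [angVel, ψ.periodic s, ψ.deriv_periodic s]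

theorem ind_eq_integral (ψ : Quasidoodle) (p : ℂ) (a : ℝ) :
    ψ.ind p = (2 * Real.pi)⁻¹ * ∫ s in a..(a + 1), ψ.angVel p s := by
  rw [(ψ.angVel_periodic p).intervalIntegral_add_eq a 0]
  simp [ind, angVel]

/-- The point `p` lies to the left (`e = 1`), to the right (`e = -1`) or on (`e = 0`) the branch of
`ψ` on `(z - r, z + r)`, as seen along the direction `v` of the branch. -/
def IsSide (ψ : Quasidoodle) (z r : ℝ) (v p : ℂ) (e : ℝ) : Prop :=
  ∃ r₀ ∈ Ioo (z - r) (z + r), ∃ μ : ℝ, p = ψ.toFun r₀ + μ * Complex.I * v ∧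
    e = ((SignType.sign μ : SignType) : ℝ)

theorem IsSide.add_int {ψ : Quasidoodle} {z r : ℝ} {v p : ℂ} {e : ℝ} (h : IsSide ψ z r v p e)
    (m : ℤ) : IsSide ψ (z + m) r v p e := by
  obtain ⟨r₀, hr, μ, h1, h2⟩ := h
  refine ⟨r₀ + m, ⟨by linarith [hr.1], by linarith [hr.2]⟩, μ, ?_, h2⟩
  rw [toFun_add_int]; exact h1

/-- The angle swept by a branch running in the direction `v`. -/
theorem integral_angVel_of_isSide {ψ : Quasidoodle} {z r : ℝ} {v p : ℂ} {e : ℝ}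
    (h : IsSide ψ z r v p e)
    (hv : ∀ s ∈ Icc (z - r) (z + r), 0 < (deriv ψ.toFun s / v).re) :
    IntervalIntegrable (ψ.angVel p) MeasureTheory.volume (z - r) (z + r) ∧
      ∫ s in (z - r)..(z + r), ψ.angVel p s = Complex.arg ((ψ.toFun (z + r) - p) / v) -
        Complex.arg (-((ψ.toFun (z - r) - p) / v)) + Real.pi * e := by
  obtain ⟨r₀, hr, μ, h1, rfl⟩ := h
  have hv0 : v ≠ 0 := by
    rintro rfl
    simpa using hv r₀ (Ioo_subset_Icc_self hr)
  have hf : ∀ s, HasDerivAt (fun s => (ψ.toFun s - p) / v) (deriv ψ.toFun s / v) s := fun s =>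
    ((ψ.hasDerivAt s).sub_const p).div_const v
  have hd2 : ∀ s, HasDerivAt (deriv ψ.toFun) (deriv (deriv ψ.toFun) s) s := fun s =>
    (ψ.contDiff_deriv.differentiable (by simp) s).hasDerivAt
  have hcd2 : Continuous (deriv (deriv ψ.toFun)) :=
    ((contDiff_infty_iff_deriv (𝕜 := ℝ)).1 ψ.contDiff_deriv).2.continuous
  have key := integral_im_div_of_re_deriv_pos hf (fun s => (hd2 s).div_const v)
    (hcd2.div_const v) hr hv (μ := μ) (by rw [h1]; field_simp; ring)
  have e1 : (fun s => (deriv ψ.toFun s / v / ((ψ.toFun s - p) / v)).im) = ψ.angVel p := by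
    funext s
    rw [div_div_div_cancel_right₀ hv0, angVel]
  rwa [e1] at key

theorem tendsto_toFun_sub (φ : Quasidoodle) (x : ℂ) (s : ℝ) :
    Tendsto (fun q : Quasidoodle × ℂ => q.1.toFun s - q.2) (φ.nhdsC1 ×ˢ 𝓝 x)
      (𝓝 (φ.toFun s - x)) := by
  have h1 : Tendsto (fun q : Quasidoodle × ℂ => q.1.toFun s) (φ.nhdsC1 ×ˢ 𝓝 x)
      (𝓝 (φ.toFun s)) :=
    (φ.tendsto_toFun s).comp (tendsto_fst.prodMk (tendsto_const_nhds))
  exact h1.sub tendsto_snd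

theorem re_endpoints_pos {φ : Quasidoodle} {z r : ℝ} {v : ℂ} (hr : 0 < r)
    (hv : ∀ s ∈ Icc (z - r) (z + r), 0 < (deriv φ.toFun s / v).re) :
    0 < ((φ.toFun (z + r) - φ.toFun z) / v).re ∧
      0 < (-((φ.toFun (z - r) - φ.toFun z) / v)).re := by
  obtain ⟨m, hm, hml⟩ := exists_pos_le_re (f' := fun s => deriv φ.toFun s / v)
    (φ.continuous_deriv.div_const v) hv
  have hf : ∀ s, HasDerivAt (fun s => (φ.toFun s - φ.toFun z) / v) (deriv φ.toFun s / v) s :=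
    fun s => ((φ.hasDerivAt s).sub_const _).div_const v
  have hp1 := re_sub_ge_of_deriv hf hml (x := z) (y := z + r) ⟨by linarith, by linarith⟩
    ⟨by linarith, by linarith⟩ (by linarith)
  have hp2 := re_sub_ge_of_deriv hf hml (x := z - r) (y := z) ⟨by linarith, by linarith⟩
    ⟨by linarith, by linarith⟩ (by linarith)
  have hmr : 0 < m * r := mul_pos hm hr
  simp only [sub_self, zero_div, Complex.zero_re] at hp1 hp2
  refine ⟨by linarith, ?_⟩
  rw [Complex.neg_re]; linarith

/-- A point near `φ z` has a side with respect to the branch at `z` of every curve near `φ`: by the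
intermediate value theorem the branch meets the normal direction through the point. -/
theorem exists_isSide {φ : Quasidoodle} {z r : ℝ} (hr : 0 < r)
    (hv : ∀ s ∈ Icc (z - r) (z + r), 0 < (deriv φ.toFun s / deriv φ.toFun z).re) :
    ∀ᶠ q in φ.nhdsC1 ×ˢ 𝓝 (φ.toFun z), ∃ e, IsSide q.1 z r (deriv φ.toFun z) q.2 e := by
  set v := deriv φ.toFun z with hvdef
  have hv0 : v ≠ 0 := by
    intro h0
    have := hv z ⟨by linarith, by linarith⟩
    simp [h0] at this
  obtain ⟨hp1, hp2⟩ := re_endpoints_pos hr hv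
  have hlim (s : ℝ) : Tendsto (fun q : Quasidoodle × ℂ => ((q.1.toFun s - q.2) / v).re)
      (φ.nhdsC1 ×ˢ 𝓝 (φ.toFun z)) (𝓝 (((φ.toFun s - φ.toFun z) / v).re)) :=
    (Complex.continuous_re.tendsto _).comp ((φ.tendsto_toFun_sub _ s).div_const v)
  have e1 := (hlim (z + r)).eventually_const_lt hp1
  have e2 := (hlim (z - r)).eventually_lt_const (u := 0) (by simpa using hp2)
  filter_upwards [e1, e2] with q h1 h2
  have hcont : Continuous fun s => ((q.1.toFun s - q.2) / v).re :=
    Complex.continuous_re.comp ((q.1.continuous_toFun.sub continuous_const).div_const v)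
  obtain ⟨r₀, hr₀, h0⟩ := intermediate_value_Ioo (by linarith : z - r ≤ z + r) hcont.continuousOn
    ⟨h2, h1⟩
  refine ⟨_, r₀, hr₀, -((q.1.toFun r₀ - q.2) / v).im, ?_, rfl⟩
  have : (q.1.toFun r₀ - q.2) / v = ((q.1.toFun r₀ - q.2) / v).im * Complex.I := by
    apply Complex.ext <;> simp [h0]
  have h3 : q.1.toFun r₀ - q.2 = ((q.1.toFun r₀ - q.2) / v).im * Complex.I * v := by
    rw [← this, div_mul_cancel₀ _ hv0]
  push_cast
  linear_combination -h3

/-- The part of the period `[a, a + 1]` at distance at least `r` from the points `z i`. -/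
def farPart {ι : Type*} (S : Finset ι) (z : ι → ℝ) (a r : ℝ) : Set ℝ :=
  Icc a (a + 1) \ ⋃ i ∈ S, Ioo (z i - r) (z i + r)

theorem isCompact_farPart {ι : Type*} (S : Finset ι) (z : ι → ℝ) (a r : ℝ) :
    IsCompact (farPart S z a r) :=
  isCompact_Icc.diff (isOpen_biUnion fun _ _ => isOpen_Ioo)

/-- The angle swept in one period about a point `p` near a multiple point: a sum of terms that depend
continuously on the curve and on `p`, and of `± π` or `0` for each branch, according to the side on
which `p` lies. -/
theorem integral_angVel_eq_sum {ι : Type*} {ψ : Quasidoodle} {p : ℂ} {a r : ℝ} (hr : 0 < r)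
    {S : Finset ι} {z : ι → ℝ} {v : ι → ℂ} {e : ι → ℝ}
    (hz : ∀ i ∈ S, Icc (z i - r) (z i + r) ⊆ Ioo a (a + 1))
    (hdisj : ∀ i ∈ S, ∀ j ∈ S, i ≠ j → 2 * r < |z i - z j|)
    (hcone : ∀ i ∈ S, ∀ s ∈ Icc (z i - r) (z i + r), 0 < (deriv ψ.toFun s / v i).re)
    (hside : ∀ i ∈ S, IsSide ψ (z i) r (v i) p (e i))
    (hfar : ∀ s ∈ farPart S z a r, ψ.toFun s ≠ p) :
    ∫ s in a..(a + 1), ψ.angVel p s =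
      (∑ i ∈ S, (Complex.arg ((ψ.toFun (z i + r) - p) / v i) -
        Complex.arg (-((ψ.toFun (z i - r) - p) / v i)))) +
      (∫ s in farPart S z a r, ψ.angVel p s) + Real.pi * ∑ i ∈ S, e i := by
  have harc := fun i hi => integral_angVel_of_isSide (hside i hi) (hcone i hi)
  have hle (i : ι) : z i - r ≤ z i + r := by linarith
  have hint : MeasureTheory.IntegrableOn (ψ.angVel p) (farPart S z a r) := by
    refine ContinuousOn.integrableOn_compact (isCompact_farPart S z a r) ?_
    refine Complex.continuous_im.comp_continuousOn ?_
    exact ψ.continuous_deriv.continuousOn.div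
      (ψ.continuous_toFun.sub continuous_const).continuousOn
      fun s hs => sub_ne_zero.2 (hfar s hs)
  have hintA : ∀ i ∈ S, MeasureTheory.IntegrableOn (ψ.angVel p) (Ioo (z i - r) (z i + r)) :=
    fun i hi => (intervalIntegrable_iff_integrableOn_Ioo_of_le (hle i)).1 (harc i hi).1
  have hU : Icc a (a + 1) = (⋃ i ∈ S, Ioo (z i - r) (z i + r)) ∪ farPart S z a r := by
    rw [farPart, union_sdiff_cancel]
    exact iUnion₂_subset fun i hi => Ioo_subset_Icc_self.trans ((hz i hi).trans Ioo_subset_Icc_self)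
  have hdj : Disjoint (⋃ i ∈ S, Ioo (z i - r) (z i + r)) (farPart S z a r) := disjoint_sdiff_right
  rw [intervalIntegral.integral_of_le (by linarith), ← MeasureTheory.integral_Icc_eq_integral_Ioc, hU,
    MeasureTheory.setIntegral_union hdj
      (isCompact_farPart S z a r).isClosed.measurableSet
      ((MeasureTheory.integrableOn_finset_iUnion).2 hintA) hint,
    MeasureTheory.integral_biUnion_finset S (fun i _ => measurableSet_Ioo) ?_ hintA]
  · have : ∀ i ∈ S, ∫ s in Ioo (z i - r) (z i + r), ψ.angVel p s =
        Complex.arg ((ψ.toFun (z i + r) - p) / v i) -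
        Complex.arg (-((ψ.toFun (z i - r) - p) / v i)) + Real.pi * e i := fun i hi => by
      rw [← (harc i hi).2, intervalIntegral.integral_of_le (hle i),
        MeasureTheory.integral_Ioc_eq_integral_Ioo]
    rw [Finset.sum_congr rfl this, Finset.sum_add_distrib, Finset.mul_sum]
    ring
  · intro i hi j hj hij
    refine Set.disjoint_left.2 fun s hs hs' => ?_
    have := hdisj i hi j hj hij
    rcases lt_abs.1 this with h | h <;> linarith [hs.1, hs.2, hs'.1, hs'.2]

/-- Away from the preimages of `x`, the angle swept about a point is continuous in the curve and in
the point. -/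
theorem tendsto_integral_farPart {φ : Quasidoodle} {x : ℂ} {K : Set ℝ} (hK : IsCompact K)
    (hx : ∀ s ∈ K, φ.toFun s ≠ x) :
    Tendsto (fun q : Quasidoodle × ℂ => ∫ s in K, q.1.angVel q.2 s) (φ.nhdsC1 ×ˢ 𝓝 x)
      (𝓝 (∫ s in K, φ.angVel x s)) ∧ ∀ᶠ q in φ.nhdsC1 ×ˢ 𝓝 x, ∀ s ∈ K, q.1.toFun s ≠ q.2 := by
  have h1 (s : ℝ) : Tendsto (fun w : (Quasidoodle × ℂ) × ℝ => w.1.1.toFun w.2 - w.1.2)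
      ((φ.nhdsC1 ×ˢ 𝓝 x) ×ˢ 𝓝 s) (𝓝 (φ.toFun s - x)) := by
    have a1 : Tendsto (fun w : (Quasidoodle × ℂ) × ℝ => w.1.1.toFun w.2)
        ((φ.nhdsC1 ×ˢ 𝓝 x) ×ˢ 𝓝 s) (𝓝 (φ.toFun s)) :=
      (φ.tendsto_toFun s).comp ((tendsto_fst.comp tendsto_fst).prodMk tendsto_snd)
    exact a1.sub (tendsto_snd.comp tendsto_fst)
  have h2 (s : ℝ) : Tendsto (fun w : (Quasidoodle × ℂ) × ℝ => deriv w.1.1.toFun w.2)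
        ((φ.nhdsC1 ×ˢ 𝓝 x) ×ˢ 𝓝 s) (𝓝 (deriv φ.toFun s)) :=
      (φ.tendsto_deriv s).comp ((tendsto_fst.comp tendsto_fst).prodMk tendsto_snd)
  have h3 (s : ℝ) (hs : s ∈ K) : Tendsto (fun w : (Quasidoodle × ℂ) × ℝ => w.1.1.angVel w.1.2 w.2)
        ((φ.nhdsC1 ×ˢ 𝓝 x) ×ˢ 𝓝 s) (𝓝 (φ.angVel x s)) :=
    (Complex.continuous_im.tendsto _).comp ((h2 s).div (h1 s) (sub_ne_zero.2 (hx s hs)))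
  have hne : ∀ᶠ q in φ.nhdsC1 ×ˢ 𝓝 x, ∀ s ∈ K, q.1.toFun s ≠ q.2 := by
    refine hK.eventually_forall_mem (P := fun (q : Quasidoodle × ℂ) s => q.1.toFun s ≠ q.2) fun s hs => ?_
    filter_upwards [(h1 s).eventually_ne (sub_ne_zero.2 (hx s hs))] with w hw
    exact sub_ne_zero.1 hw
  refine ⟨?_, hne⟩
  have hcont (ψ : Quasidoodle) (p : ℂ) (h : ∀ s ∈ K, ψ.toFun s ≠ p) : ContinuousOn (ψ.angVel p) K :=
    Complex.continuous_im.comp_continuousOn (ψ.continuous_deriv.continuousOn.div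
      (ψ.continuous_toFun.sub continuous_const).continuousOn fun s hs => sub_ne_zero.2 (h s hs))
  rw [Metric.tendsto_nhds]
  intro ε hε
  set η := ε / (MeasureTheory.volume.real K + 1) with hη
  have hV : 0 ≤ MeasureTheory.volume.real K := MeasureTheory.measureReal_nonneg
  have hηpos : 0 < η := by positivity
  have hunif : ∀ᶠ q in φ.nhdsC1 ×ˢ 𝓝 x, ∀ s ∈ K, dist (q.1.angVel q.2 s) (φ.angVel x s) < η := by
    refine hK.eventually_forall_mem
      (P := fun (q : Quasidoodle × ℂ) s => s ∈ K → dist (q.1.angVel q.2 s) (φ.angVel x s) < η) (fun s hs => ?_) |>.mono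
      fun q hq s hs => hq s hs hs
    have b1 := Metric.tendsto_nhds.1 (h3 s hs) (η / 2) (half_pos hηpos)
    have b2 : ∀ᶠ t in 𝓝[K] s, dist (φ.angVel x t) (φ.angVel x s) < η / 2 :=
      Metric.tendsto_nhds.1 (hcont φ x hx s hs) _ (half_pos hηpos)
    have b3 : ∀ᶠ w in (φ.nhdsC1 ×ˢ 𝓝 x) ×ˢ 𝓝 s, w.2 ∈ K →
        dist (φ.angVel x w.2) (φ.angVel x s) < η / 2 :=
      tendsto_snd.eventually (eventually_nhdsWithin_iff.1 b2)
    filter_upwards [b1, b3] with w hw hw' hwK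
    have := hw' hwK
    linarith [dist_triangle_right (w.1.1.angVel w.1.2 w.2) (φ.angVel x w.2) (φ.angVel x s)]
  filter_upwards [hunif, hne] with q hq hqne
  rw [dist_eq_norm, ← MeasureTheory.integral_sub ((hcont _ _ hqne).integrableOn_compact hK)
    ((hcont _ _ hx).integrableOn_compact hK)]
  have hfin : MeasureTheory.volume K < ⊤ := hK.measure_lt_top
  refine (MeasureTheory.norm_setIntegral_le_of_norm_le_const hfin fun s hs => (hq s hs).le).trans_lt ?_
  rw [hη, div_mul_eq_mul_div, div_lt_iff₀ (by positivity)]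
  nlinarith

/-- The version of `ind_sub_ind` for preimages given by their times in one period. -/
theorem ind_sub_ind_aux {ι : Type*} {φ : Quasidoodle} (hφ : φ.IsImmersion) {x : ℂ} {a : ℝ}
    {S : Finset ι} {z : ι → ℝ} (hinj : ∀ i ∈ S, ∀ j ∈ S, z i = z j → i = j)
    (hza : ∀ i ∈ S, z i ∈ Ioo a (a + 1))
    (hS : ∀ s ∈ Icc a (a + 1), φ.toFun s = x ↔ ∃ i ∈ S, s = z i) {r₁ : ℝ} (hr₁ : 0 < r₁) :
    ∃ r ∈ Ioo 0 r₁, (∀ᶠ q in φ.nhdsC1 ×ˢ 𝓝 x,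
      ∀ i ∈ S, ∃ e, IsSide q.1 (z i) r (deriv φ.toFun (z i)) q.2 e) ∧
      ∀ ε > 0, ∀ᶠ q in φ.nhdsC1 ×ˢ 𝓝 x, ∀ e : ι → ℝ,
        (∀ i ∈ S, IsSide q.1 (z i) r (deriv φ.toFun (z i)) q.2 (e i)) →
          |q.1.ind q.2 - φ.ind x - 2⁻¹ * ∑ i ∈ S, e i| < ε := by
  -- `r` is so small that the arcs of radius `r` around the preimages lie in the period, are
  -- disjoint, and run within a right angle of the direction of the branch
  have hzr : ∀ i ∈ S, ∀ᶠ r in 𝓝[>] (0 : ℝ), Icc (z i - r) (z i + r) ⊆ Ioo a (a + 1) := by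
    intro i hi
    have h1 : ∀ᶠ r in 𝓝 (0 : ℝ), r < z i - a := gt_mem_nhds (by linarith [(hza i hi).1])
    have h2 : ∀ᶠ r in 𝓝 (0 : ℝ), r < a + 1 - z i := gt_mem_nhds (by linarith [(hza i hi).2])
    filter_upwards [nhdsWithin_le_nhds h1, nhdsWithin_le_nhds h2] with r h1 h2 s hs
    exact ⟨by linarith [hs.1], by linarith [hs.2]⟩
  have hdr : ∀ i ∈ S, ∀ j ∈ S, ∀ᶠ r in 𝓝[>] (0 : ℝ), i ≠ j → 2 * r < |z i - z j| := by
    intro i hi j hj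
    by_cases hij : i = j
    · simp [hij]
    · have h0 : 0 < |z i - z j| / 2 :=
        half_pos (abs_pos.2 (sub_ne_zero.2 fun h => hij (hinj i hi j hj h)))
      filter_upwards [nhdsWithin_le_nhds (gt_mem_nhds h0)] with r hr _
      linarith
  have hcr : ∀ i ∈ S, ∀ᶠ r in 𝓝[>] (0 : ℝ), ∀ s ∈ Icc (z i - r) (z i + r),
      0 < (deriv φ.toFun s / deriv φ.toFun (z i)).re := by
    intro i _
    have hc : ∀ᶠ s in 𝓝 (z i), 0 < (deriv φ.toFun s / deriv φ.toFun (z i)).re := by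
      have : ContinuousAt (fun s => (deriv φ.toFun s / deriv φ.toFun (z i)).re) (z i) :=
        (Complex.continuous_re.comp (φ.continuous_deriv.div_const _)).continuousAt
      refine this.eventually (lt_mem_nhds ?_)
      simp [div_self (hφ.deriv_ne_zero (z i))]
    obtain ⟨η, hη, h⟩ := Metric.eventually_nhds_iff.1 hc
    filter_upwards [nhdsWithin_le_nhds (gt_mem_nhds hη)] with r hr s hs
    refine h ?_
    rw [Real.dist_eq, abs_lt]
    exact ⟨by linarith [hs.1], by linarith [hs.2]⟩
  have hall := ((S.eventually_all.2 hzr).and ((S.eventually_all.2 fun i hi =>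
    S.eventually_all.2 (hdr i hi)).and (S.eventually_all.2 hcr))).and (Ioo_mem_nhdsGT hr₁)
  obtain ⟨r, ⟨hz, hdisj, hcone⟩, hr⟩ := hall.exists
  have hr0 : 0 < r := hr.1
  refine ⟨r, hr, ?_, ?_⟩
  · refine S.eventually_all.2 fun i hi => ?_
    have := exists_isSide hr0 (hcone i hi)
    rwa [(hS _ (Ioo_subset_Icc_self (hza i hi))).2 ⟨i, hi, rfl⟩] at this
  · intro ε hε
    have hfar0 : ∀ s ∈ farPart S z a r, φ.toFun s ≠ x := by
      intro s hs h
      obtain ⟨i, hi, rfl⟩ := (hS s hs.1).1 h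
      exact hs.2 (mem_biUnion hi ⟨by linarith, by linarith⟩)
    obtain ⟨hlimR, hfar⟩ := tendsto_integral_farPart (isCompact_farPart S z a r) hfar0
    have hconeψ : ∀ᶠ ψ in φ.nhdsC1, ∀ i ∈ S, ∀ s ∈ Icc (z i - r) (z i + r),
        0 < (deriv ψ.toFun s / deriv φ.toFun (z i)).re := by
      refine S.eventually_all.2 fun i hi => isCompact_Icc.eventually_forall_mem
        (P := fun (ψ : Quasidoodle) s => 0 < (deriv ψ.toFun s / deriv φ.toFun (z i)).re) fun s hs => ?_
      have := (Complex.continuous_re.tendsto _).comp ((φ.tendsto_deriv s).div_const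
        (deriv φ.toFun (z i)))
      exact this.eventually (lt_mem_nhds (hcone i hi s hs))
    have hmono : ∀ i ∈ S, 0 < ((φ.toFun (z i + r) - x) / deriv φ.toFun (z i)).re ∧
        0 < (-((φ.toFun (z i - r) - x) / deriv φ.toFun (z i))).re := by
      intro i hi
      have h0 : φ.toFun (z i) = x := (hS _ (Ioo_subset_Icc_self (hza i hi))).2 ⟨i, hi, rfl⟩
      have := re_endpoints_pos hr0 (hcone i hi)
      rwa [h0] at this
    -- everything but the contribution `π * ∑ e i` of the sides depends continuously on the curve
    -- and the point
    have hlimA : Tendsto (fun q : Quasidoodle × ℂ =>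
        (∑ i ∈ S, (Complex.arg ((q.1.toFun (z i + r) - q.2) / deriv φ.toFun (z i)) -
        Complex.arg (-((q.1.toFun (z i - r) - q.2) / deriv φ.toFun (z i))))) +
        ∫ s in farPart S z a r, q.1.angVel q.2 s) (φ.nhdsC1 ×ˢ 𝓝 x)
        (𝓝 ((∑ i ∈ S, (Complex.arg ((φ.toFun (z i + r) - x) / deriv φ.toFun (z i)) -
        Complex.arg (-((φ.toFun (z i - r) - x) / deriv φ.toFun (z i))))) +
        ∫ s in farPart S z a r, φ.angVel x s)) := by
      refine Tendsto.add (tendsto_finsetSum S fun i hi => Tendsto.sub ?_ ?_) hlimR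
      · exact (Complex.continuousAt_arg (Or.inl (hmono i hi).1)).tendsto.comp ((φ.tendsto_toFun_sub x _).div_const _)
      · exact (Complex.continuousAt_arg (Or.inl (hmono i hi).2)).tendsto.comp
          ((φ.tendsto_toFun_sub x _).div_const _).neg
    have hpi : 0 < 2 * Real.pi := by positivity
    have hclose := Metric.tendsto_nhds.1 hlimA (2 * Real.pi * ε) (by positivity)
    filter_upwards [hclose, hfar, tendsto_fst.eventually hconeψ] with q h1 h2 h3 e he
    have E1 := integral_angVel_eq_sum hr0 hz hdisj h3 he h2
    have E2 := integral_angVel_eq_sum (ψ := φ) (p := x) (e := fun _ => 0) hr0 hz hdisj hcone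
      (fun i hi => ⟨z i, ⟨by linarith, by linarith⟩, 0, by
        rw [(hS _ (Ioo_subset_Icc_self (hza i hi))).2 ⟨i, hi, rfl⟩]; simp, by simp⟩) hfar0
    rw [ind_eq_integral _ _ a, ind_eq_integral _ _ a, E1, E2]
    rw [Real.dist_eq] at h1
    simp only [Finset.sum_const_zero, mul_zero, add_zero]
    rw [abs_lt] at h1 ⊢
    have key : ∀ A B s : ℝ, (2 * Real.pi)⁻¹ * (A + Real.pi * s) - (2 * Real.pi)⁻¹ * B - 2⁻¹ * s =
        (2 * Real.pi)⁻¹ * (A - B) := by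
      intro A B s
      field_simp
      ring
    rw [key]
    constructor
    · rw [lt_inv_mul_iff₀ hpi]; linarith [h1.1]
    · rw [inv_mul_lt_iff₀ hpi]; linarith [h1.2]

/-- The index of a point `p` near a point `x` of multiplicity at least one, with respect to a curve
`ψ` near `φ`: it differs from the index of `x` by half the sum of the signs that tell on which sides
of the branches `p` lies. -/
theorem ind_sub_ind {ι : Type*} {φ : Quasidoodle} (hφ : φ.IsImmersion) {x : ℂ}
    {S : Finset ι} {z : ι → ℝ}
    (hinj : ∀ i ∈ S, ∀ j ∈ S, (z i : UnitAddCircle) = z j → i = j)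
    (hS : ∀ s : ℝ, φ.toFun s = x ↔ ∃ i ∈ S, (s : UnitAddCircle) = z i) {r₁ : ℝ} (hr₁ : 0 < r₁) :
    ∃ r ∈ Ioo 0 r₁, (∀ᶠ q in φ.nhdsC1 ×ˢ 𝓝 x,
      ∀ i ∈ S, ∃ e, IsSide q.1 (z i) r (deriv φ.toFun (z i)) q.2 e) ∧
      ∀ ε > 0, ∀ᶠ q in φ.nhdsC1 ×ˢ 𝓝 x, ∀ e : ι → ℝ,
        (∀ i ∈ S, IsSide q.1 (z i) r (deriv φ.toFun (z i)) q.2 (e i)) →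
          |q.1.ind q.2 - φ.ind x - 2⁻¹ * ∑ i ∈ S, e i| < ε := by
  obtain ⟨a, ha⟩ : ∃ a : ℝ, φ.toFun a ≠ x := by
    by_contra hcon
    push Not at hcon
    have : deriv φ.toFun 0 = 0 := by
      rw [show φ.toFun = fun _ => x from funext hcon]; simp
    exact hφ.deriv_ne_zero 0 this
  have hrep : ∀ i, ∃ m : ℤ, z i + m ∈ Ico a (a + 1) := by
    intro i
    obtain ⟨s, hs, h⟩ := exists_coe_mem_Ico a (z i : UnitAddCircle)
    obtain ⟨m, rfl⟩ := circle_coe_eq_iff.1 h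
    exact ⟨m, hs⟩
  choose m hm using hrep
  have hcoe (i : ι) : ((z i + m i : ℝ) : UnitAddCircle) = z i := circle_coe_add_int _ _
  have hxz : ∀ i ∈ S, φ.toFun (z i + m i) = x := fun i hi => (hS _).2 ⟨i, hi, hcoe i⟩
  have hne : ∀ i ∈ S, z i + m i ∈ Ioo a (a + 1) := fun i hi =>
    ⟨lt_of_le_of_ne (hm i).1 fun h => ha (h ▸ hxz i hi), (hm i).2⟩
  obtain ⟨r, hr, h1, h2⟩ := ind_sub_ind_aux hφ (x := x) (a := a) (S := S) (z := fun i => z i + m i)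
    (fun i hi j hj h => hinj i hi j hj (by rw [← hcoe i, ← hcoe j, h])) hne
    (fun s hs => by
      rw [hS]
      refine ⟨fun ⟨i, hi, h⟩ => ⟨i, hi, ?_⟩, fun ⟨i, hi, h⟩ => ⟨i, hi, by rw [h, hcoe]⟩⟩
      refine circle_coe_inj_Ico ⟨hs.1, lt_of_le_of_ne hs.2 ?_⟩ (hm i) (h.trans (hcoe i).symm)
      rintro rfl
      exact ha (by rw [← φ.periodic a]; exact (hS _).2 ⟨i, hi, h⟩)) hr₁
  simp only [deriv_add_int] at h1 h2
  refine ⟨r, hr, ?_, fun ε hε => ?_⟩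
  · filter_upwards [h1] with q hq i hi
    obtain ⟨e, he⟩ := hq i hi
    refine ⟨e, ?_⟩
    simpa using he.add_int (-m i)
  · filter_upwards [h2 ε hε] with q hq e he
    exact hq e fun i hi => (he i hi).add_int (m i)

end Quasidoodle

theorem planeDet_add_right (u v w : ℂ) : planeDet u (v + w) = planeDet u v + planeDet u w := by
  simp [planeDet]; ring

theorem planeDet_self (u : ℂ) : planeDet u u = 0 := by
  simp [planeDet]; ring

theorem planeDet_I_mul_pos_iff {u v : ℂ} (hv : v ≠ 0) :
    0 < planeDet u (Complex.I * v) ↔ 0 < (u / v).re := by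
  have h : planeDet u (Complex.I * v) = (u / v).re * Complex.normSq v := by
    rw [Complex.div_re]
    have := Complex.normSq_pos.2 hv
    simp [planeDet]
    field_simp
  rw [h]
  exact mul_pos_iff_of_pos_right (Complex.normSq_pos.2 hv)

theorem exists_planeDet_ne_zero (A : Set ℂ) (hA : A.Finite) (h0 : (0 : ℂ) ∉ A) :
    ∃ v : ℂ, ∀ a ∈ A, planeDet a v ≠ 0 := by
  have hfin : ((fun a : ℂ => a.im / a.re) '' A).Finite := hA.image _
  obtain ⟨t, ht⟩ := hfin.exists_notMem
  refine ⟨⟨1, t⟩, fun a ha h => ?_⟩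
  simp only [planeDet, mul_one] at h
  by_cases hre : a.re = 0
  · rw [hre] at h
    exact h0 (by convert ha using 1; apply Complex.ext <;> simp [hre]; linarith)
  · exact ht ⟨a, ha, by field_simp; linarith⟩

namespace Quasidoodle

theorem exists_int_ind_eq {φ : Quasidoodle} {p : ℂ} (hp : ∀ s, φ.toFun s ≠ p) :
    ∃ n : ℤ, φ.ind p = n := by
  refine exists_int_integral_im_div (f := fun s => φ.toFun s - p)
    (fun s => (φ.hasDerivAt s).sub_const p) φ.continuous_deriv ?_ fun s => sub_ne_zero.2 (hp s)
  have := φ.periodic 0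
  rw [zero_add] at this
  simp only [this]

/-- Mean value theorem for the oriented area with a fixed second vector. -/
theorem exists_planeDet_secant (ψ : Quasidoodle) (u : ℂ) {a b : ℝ} (hab : a ≠ b) :
    ∃ s ∈ Ioo (min a b) (max a b),
      planeDet (ψ.toFun b - ψ.toFun a) u = (b - a) * planeDet (deriv ψ.toFun s) u := by
  have hd : ∀ s, HasDerivAt (fun s => planeDet (ψ.toFun s) u) (planeDet (deriv ψ.toFun s) u) s := by
    intro s
    have h1 := (Complex.reCLM.hasFDerivAt.comp_hasDerivAt s (ψ.hasDerivAt s)).mul_const u.im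
    have h2 := (Complex.imCLM.hasFDerivAt.comp_hasDerivAt s (ψ.hasDerivAt s)).mul_const u.re
    exact h1.sub h2
  have hsub (x y : ℂ) : planeDet (x - y) u = planeDet x u - planeDet y u := by
    simp [planeDet]; ring
  rcases lt_or_gt_of_ne hab with h | h
  · obtain ⟨s, hs, hs'⟩ := exists_hasDerivAt_eq_slope _ _ h
      (fun s _ => (hd s).continuousAt.continuousWithinAt) fun s _ => hd s
    refine ⟨s, by rwa [min_eq_left h.le, max_eq_right h.le], ?_⟩
    rw [hs', hsub]; field_simp [sub_ne_zero.2 h.ne']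
  · obtain ⟨s, hs, hs'⟩ := exists_hasDerivAt_eq_slope _ _ h
      (fun s _ => (hd s).continuousAt.continuousWithinAt) fun s _ => hd s
    refine ⟨s, by rwa [min_eq_right h.le, max_eq_left h.le], ?_⟩
    rw [hs', hsub]; field_simp [sub_ne_zero.2 h.ne']; ring

/-- The side on which a point `p` lies is the side to which the vector to `p` from some point of
the branch points. -/
theorem IsSide.eq_sign {ψ : Quasidoodle} {z r : ℝ} {v p : ℂ} {e : ℝ} (h : IsSide ψ z r v p e)
    (hv : ∀ s ∈ Icc (z - r) (z + r), 0 < (deriv ψ.toFun s / v).re) {r₁ : ℝ}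
    (hr₁ : r₁ ∈ Icc (z - r) (z + r)) {u : ℂ} (hp : p = ψ.toFun r₁ + u) {σ : SignType}
    (hσ : ∀ s ∈ Icc (z - r) (z + r), SignType.sign (planeDet (deriv ψ.toFun s) u) = σ) :
    e = (σ : ℝ) := by
  obtain ⟨r₀, hr₀, μ, h1, rfl⟩ := h
  have hr₀' := Ioo_subset_Icc_self hr₀
  have hv0 : v ≠ 0 := by
    rintro rfl
    simpa using hv r₀ hr₀'
  have hposI : ∀ s ∈ Icc (z - r) (z + r), 0 < planeDet (deriv ψ.toFun s) (Complex.I * v) :=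
    fun s hs => (planeDet_I_mul_pos_iff hv0).2 (hv s hs)
  have hu : u = (ψ.toFun r₀ - ψ.toFun r₁) + (μ : ℝ) * (Complex.I * v) := by
    linear_combination h1 - hp
  congr 1
  by_cases hne : r₁ = r₀
  · subst hne
    rw [sub_self, zero_add] at hu
    rw [← hσ r₁ hr₁, hu, planeDet_smul_right, sign_mul, sign_pos (hposI r₁ hr₁), mul_one]
  -- the mean value theorem replaces the secant from `r₁` to `r₀` by velocities of the branch,
  -- whose position with respect to `u` and to `I * v` is known
  · obtain ⟨s, hs, h2⟩ := ψ.exists_planeDet_secant u hne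
    obtain ⟨t, ht, h3⟩ := ψ.exists_planeDet_secant (Complex.I * v) hne
    have hsub : Ioo (min r₁ r₀) (max r₁ r₀) ⊆ Icc (z - r) (z + r) := by
      refine Ioo_subset_Icc_self.trans (Icc_subset_Icc (le_min hr₁.1 hr₀'.1) (max_le hr₁.2 hr₀'.2))
    have h4 : planeDet (ψ.toFun r₀ - ψ.toFun r₁) u =
        μ * planeDet (ψ.toFun r₀ - ψ.toFun r₁) (Complex.I * v) := by
      conv_lhs => rw [hu]
      rw [planeDet_add_right, planeDet_self, zero_add, planeDet_smul_right]
    rw [h2, h3, mul_left_comm] at h4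
    have h5 := mul_left_cancel₀ (sub_ne_zero.2 (Ne.symm hne)) h4
    rw [← hσ s (hsub hs), h5, sign_mul, sign_pos (hposI t (hsub ht)), mul_one]

theorem isSide_of_mem {ψ : Quasidoodle} {z r s : ℝ} {v : ℂ} (hs : s ∈ Ioo (z - r) (z + r)) :
    IsSide ψ z r v (ψ.toFun s) 0 := ⟨s, hs, 0, by simp, by simp⟩

theorem IsSide.cases {ψ : Quasidoodle} {z r : ℝ} {v p : ℂ} {e : ℝ} (h : IsSide ψ z r v p e)
    (hp : ∀ s ∈ Ioo (z - r) (z + r), ψ.toFun s ≠ p) : e = 1 ∨ e = -1 := by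
  obtain ⟨r₀, hr₀, μ, h1, rfl⟩ := h
  rcases lt_trichotomy μ 0 with h | rfl | h
  · right; simp [sign_neg h]
  · exact absurd (by simpa using h1.symm) (hp r₀ hr₀)
  · left; simp [sign_pos h]

/-- The velocities of curves near `φ` at times near `z` are near the velocity of `φ` at `z`. -/
theorem exists_forall_deriv_mem (φ : Quasidoodle) (z : ℝ) {U : Set ℂ} (hU : U ∈ 𝓝 (deriv φ.toFun z)) :
    ∃ r > 0, ∀ᶠ ψ in φ.nhdsC1, ∀ s ∈ Icc (z - r) (z + r), deriv ψ.toFun s ∈ U := by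
  obtain ⟨pa, hpa, pb, hpb, h⟩ := eventually_prod_iff.1 ((φ.tendsto_deriv z).eventually hU)
  obtain ⟨η, hη, hb⟩ := Metric.eventually_nhds_iff.1 hpb
  refine ⟨η / 2, half_pos hη, hpa.mono fun ψ hψ s hs => h hψ (hb ?_)⟩
  rw [Real.dist_eq, abs_lt]
  exact ⟨by linarith [hs.1], by linarith [hs.2]⟩

theorem dense_compl_range (φ : Quasidoodle) : Dense (range φ.toFun)ᶜ := by
  refine ContDiff.dense_compl_range_of_finrank_lt_finrank
    (φ.smooth.of_le (by exact_mod_cast le_top)) ?_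
  rw [Complex.finrank_real_complex]; simp

/-- The index of a point of multiplicity `m` is an integer plus `m / 2`. -/
theorem exists_int_ind_eq_add {ι : Type*} {φ : Quasidoodle} (hφ : φ.IsImmersion) {x : ℂ}
    {S : Finset ι} {z : ι → ℝ}
    (hinj : ∀ i ∈ S, ∀ j ∈ S, (z i : UnitAddCircle) = z j → i = j)
    (hS : ∀ s : ℝ, φ.toFun s = x ↔ ∃ i ∈ S, (s : UnitAddCircle) = z i) :
    ∃ n : ℤ, φ.ind x = n + (S.card : ℝ) / 2 := by
  obtain ⟨r, -, h1, h2⟩ := ind_sub_ind hφ hinj hS one_pos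
  -- at points near `x` off the curve the index is an integer, and all sides are `1` or `-1`
  have hcl : φ.ind x - (S.card : ℝ) / 2 ∈ closure (range ((↑) : ℤ → ℝ)) := by
    rw [Metric.mem_closure_iff]
    intro ε hε
    have hp : ∀ᶠ p in 𝓝 x, _ := ((h1.and (h2 ε hε)).filter_mono
      (prod_mono φ.pure_le_nhdsC1 le_rfl)).filter_mono
        (show map (fun p => (φ, p)) (𝓝 x) ≤ pure φ ×ˢ 𝓝 x by rw [pure_prod])
    obtain ⟨p, ⟨hp1, hp2⟩, hpr⟩ := (hp.and_frequently (mem_closure_iff_frequently.1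
      (φ.dense_compl_range x))).exists
    have hoff : ∀ s, φ.toFun s ≠ p := fun s hs => hpr ⟨s, hs⟩
    choose! e he using hp1
    have h3 := hp2 e he
    obtain ⟨n, hn⟩ := exists_int_ind_eq hoff
    have he' : ∀ i ∈ S, ∃ k : ℤ, e i = 2 * k - 1 := fun i hi => by
      rcases (he i hi).cases (fun s _ => hoff s) with h | h
      · exact ⟨1, by rw [h]; norm_num⟩
      · exact ⟨0, by rw [h]; norm_num⟩
    choose! k hk using he'
    have hsum : ∑ i ∈ S, e i = 2 * (∑ i ∈ S, k i : ℤ) - S.card := by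
      rw [Finset.sum_congr rfl hk, Finset.sum_sub_distrib, ← Finset.mul_sum]
      push_cast; simp
    refine ⟨_, ⟨n - ∑ i ∈ S, k i, rfl⟩, ?_⟩
    rw [dist_comm, Real.dist_eq]
    convert h3 using 2
    rw [hsum, hn]
    push_cast; ring
  rw [Int.isClosedEmbedding_coe_real.isClosed_range.closure_eq] at hcl
  obtain ⟨n, hn⟩ := hcl
  exact ⟨n, by linarith⟩

/-! ### Computation of the indices of the statement -/

/-- Representative in `[0, 1)` of a point of the circle. -/
noncomputable def rep (z : UnitAddCircle) : ℝ := (AddCircle.equivIco 1 0 z : ℝ)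

theorem coe_rep (z : UnitAddCircle) : (rep z : UnitAddCircle) = z := AddCircle.coe_equivIco

theorem toFun_rep (φ : Quasidoodle) (z : UnitAddCircle) : φ.toFun (rep z) = φ.pt z := by
  rw [← pt_coe, coe_rep]

theorem deriv_rep (φ : Quasidoodle) (z : UnitAddCircle) : deriv φ.toFun (rep z) = φ.vel z := by
  rw [← vel_coe, coe_rep]

theorem rep_inj (S : Finset UnitAddCircle) :
    ∀ i ∈ S, ∀ j ∈ S, (rep i : UnitAddCircle) = rep j → i = j := by
  intro i _ j _ h
  rwa [coe_rep, coe_rep] at h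

theorem toFun_eq_iff_exists_rep {φ : Quasidoodle} {x : ℂ} {S : Finset UnitAddCircle}
    (hS : φ.fiber x = S) (s : ℝ) : φ.toFun s = x ↔ ∃ i ∈ S, (s : UnitAddCircle) = rep i := by
  rw [← pt_coe, ← mem_fiber, hS]
  refine ⟨fun h => ⟨_, h, (coe_rep _).symm⟩, fun ⟨i, hi, h⟩ => ?_⟩
  rw [h, coe_rep]; exact hi

/-- The rotation number in the sector of a direction `v` at a multiple point. -/
theorem indToward_eq {φ : Quasidoodle} (hφ : φ.IsImmersion) {x : ℂ} {S : Finset UnitAddCircle}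
    (hS : φ.fiber x = S) {v : ℂ} (hv : ∀ z ∈ S, planeDet (φ.vel z) v ≠ 0) :
    φ.indToward x v = φ.ind x +
      2⁻¹ * ∑ z ∈ S, ((SignType.sign (planeDet (φ.vel z) v) : SignType) : ℝ) := by
  have hloc : ∀ z ∈ S, ∃ r > 0, ∀ s ∈ Icc (rep z - r) (rep z + r),
      0 < (deriv φ.toFun s / φ.vel z).re ∧
      SignType.sign (planeDet (deriv φ.toFun s) v) = SignType.sign (planeDet (φ.vel z) v) := by
    intro z hz
    have hU : {w : ℂ | 0 < (w / φ.vel z).re ∧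
        SignType.sign (planeDet w v) = SignType.sign (planeDet (φ.vel z) v)} ∈
        𝓝 (deriv φ.toFun (rep z)) := by
      rw [deriv_rep]
      have h1 : ContinuousAt (fun w : ℂ => (w / φ.vel z).re) (φ.vel z) := by fun_prop
      have h2 : ContinuousAt (fun w : ℂ => planeDet w v) (φ.vel z) := by
        unfold planeDet; fun_prop
      have h3 := (continuousAt_sign_of_ne_zero (hv z hz)).comp
        (f := fun w : ℂ => planeDet w v) h2
      have h4 := h3.tendsto.eventually (show {SignType.sign (planeDet (φ.vel z) v)} ∈ 𝓝 _ from
        (isOpen_discrete _).mem_nhds rfl)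
      exact (h1.eventually (lt_mem_nhds (by simp [div_self (hφ z)]))).and h4
    obtain ⟨r, hr, h⟩ := φ.exists_forall_deriv_mem (rep z) hU
    exact ⟨r, hr, eventually_self h⟩
  choose! ρ hρ hloc using hloc
  obtain ⟨r₁, hr₁, hr₁'⟩ : ∃ r₁ > 0, ∀ z ∈ S, r₁ ≤ ρ z := by
    have : ∀ᶠ r in 𝓝[>] (0 : ℝ), ∀ z ∈ S, r ≤ ρ z := S.eventually_all.2 fun z hz =>
      nhdsWithin_le_nhds (ge_mem_nhds (hρ z hz))
    obtain ⟨r, h, h0⟩ := (this.and self_mem_nhdsWithin).exists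
    exact ⟨r, h0, h⟩
  obtain ⟨r, hr, h1, h2⟩ := ind_sub_ind hφ (rep_inj S) (toFun_eq_iff_exists_rep hS) hr₁
  refine Tendsto.limUnder_eq ?_
  rw [Metric.tendsto_nhds]
  intro η hη
  have hlim : Tendsto (fun ε : ℝ => (φ, x + (ε : ℂ) * v)) (𝓝[>] 0) (φ.nhdsC1 ×ˢ 𝓝 x) := by
    refine Tendsto.prodMk (tendsto_const_pure.mono_right φ.pure_le_nhdsC1) ?_
    have : ContinuousAt (fun ε : ℝ => x + (ε : ℂ) * v) 0 := by fun_prop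
    simpa using this.tendsto.mono_left (nhdsWithin_le_nhds (s := Ioi (0 : ℝ)))
  filter_upwards [hlim.eventually h1, hlim.eventually (h2 η hη), self_mem_nhdsWithin] with ε e1 e2 e3
  choose! e he using e1
  have hes : ∀ z ∈ S, e z = ((SignType.sign (planeDet (φ.vel z) v) : SignType) : ℝ) := by
    intro z hz
    have hsub : Icc (rep z - r) (rep z + r) ⊆ Icc (rep z - ρ z) (rep z + ρ z) :=
      Icc_subset_Icc (by linarith [hr₁' z hz, hr.2]) (by linarith [hr₁' z hz, hr.2])
    refine (he z hz).eq_sign (r₁ := rep z) (u := (ε : ℂ) * v) ?_ ?_ ?_ ?_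
    · intro s hs; rw [deriv_rep]; exact (hloc z hz s (hsub hs)).1
    · exact ⟨by linarith [hr.1], by linarith [hr.1]⟩
    · rw [toFun_rep]
      have : z ∈ φ.fiber x := by rw [hS]; exact hz
      rw [(mem_fiber φ).1 this]
    · intro s hs
      rw [planeDet_smul_right, sign_mul, sign_pos e3, one_mul]
      exact (hloc z hz s (hsub hs)).2
  have := e2 e he
  rw [Finset.sum_congr rfl hes] at this
  rw [Real.dist_eq]
  convert this using 2
  ring

theorem pointsInto_ne_zero {φ : Quasidoodle} {x v : ℂ} {s : φ.fiber x → SignType}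
    (hs : ∀ z, s z ≠ 0) (h : φ.PointsInto x s v) (z : UnitAddCircle) (hz : z ∈ φ.fiber x) :
    planeDet (φ.vel z) v ≠ 0 := by
  intro h0
  have := h ⟨z, hz⟩
  rw [h0, sign_zero] at this
  exact hs _ this.symm

/-- The index of a point of finite multiplicity is the principal value of the rotation number. -/
theorem pointIndex_eq {φ : Quasidoodle} (hφ : φ.IsImmersion) {x : ℂ} (hfin : (φ.fiber x).Finite) :
    φ.pointIndex x = φ.ind x := by
  classical
  have : Finite (φ.fiber x) := hfin
  have : Fintype (φ.fiber x) := Fintype.ofFinite _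
  have hsec : ∀ s ∈ φ.sectors x, φ.sectorInd x s = φ.ind x + 2⁻¹ * ∑ z, (s z : ℝ) := by
    rintro s ⟨hs0, hs⟩
    have hch := hs.choose_spec
    rw [sectorInd, dif_pos hs, indToward_eq hφ (S := hfin.toFinset) (by simp)
      (fun z hz => pointsInto_ne_zero hs0 hch z (by simpa using hz))]
    congr 2
    have hz : ∀ z : φ.fiber x, (s z : ℝ) = ((SignType.sign (planeDet (φ.vel z) hs.choose) :
      SignType) : ℝ) := fun z => by rw [hch z]
    rw [Finset.sum_congr rfl fun z _ => hz z]
    exact Finset.sum_subtype hfin.toFinset (fun z => by simp)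
      (fun z => ((SignType.sign (planeDet (φ.vel z) hs.choose) : SignType) : ℝ))
  have hsfin : (φ.sectors x).Finite := Set.toFinite _
  have hne : (φ.sectors x).Nonempty := by
    obtain ⟨v, hv⟩ := exists_planeDet_ne_zero (φ.vel '' φ.fiber x) (hfin.image _)
      (by rintro ⟨z, -, h⟩; exact hφ z h)
    refine ⟨fun z => SignType.sign (planeDet (φ.vel z) v), fun z h => ?_, v, fun z => rfl⟩
    exact hv _ ⟨z, z.2, rfl⟩ (sign_eq_zero_iff.1 h)
  -- opposite sectors have opposite sides, so the contributions of the sides cancel in the mean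
  have hneg : ∀ s ∈ φ.sectors x, (fun z => -s z) ∈ φ.sectors x := by
    rintro s ⟨hs0, v, hv⟩
    refine ⟨fun z => by simpa using hs0 z, -v, fun z => ?_⟩
    show _ = -s z
    rw [← hv z, ← Left.sign_neg]
    congr 1
    simp [planeDet]; ring
  have hsum0 : ∑ s ∈ hsfin.toFinset, ∑ z, (s z : ℝ) = 0 := by
    have h1 : ∑ s ∈ hsfin.toFinset, ∑ z, (s z : ℝ) =
        ∑ s ∈ hsfin.toFinset, -∑ z, (s z : ℝ) := by
      refine Finset.sum_nbij' (fun s z => -s z) (fun s z => -s z) ?_ ?_ ?_ ?_ ?_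
      · intro s hs; simpa using hneg s (by simpa using hs)
      · intro s hs; simpa using hneg s (by simpa using hs)
      · intro s _; simp
      · intro s _; simp
      · intro s _
        rw [← Finset.sum_neg_distrib]
        refine Finset.sum_congr rfl fun z _ => ?_
        simp
    rw [Finset.sum_neg_distrib] at h1
    linarith
  have hcard : ((φ.sectors x).ncard : ℝ) ≠ 0 := by
    exact_mod_cast (Set.ncard_pos hsfin).2 hne |>.ne'
  rw [pointIndex, div_eq_iff hcard, ← Set.Finite.coe_toFinset hsfin, finsum_mem_coe_finset,
    Finset.sum_congr rfl fun s hs => hsec s (by simpa using hs), Finset.sum_add_distrib,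
    ← Finset.mul_sum, hsum0, Finset.sum_const, Set.ncard_coe_finset]
  simp [mul_comm]

/-- At a simple point the greater of the two adjacent values is the principal value plus `1 / 2`. -/
theorem baseIndex_eq {φ : Quasidoodle} (hφ : φ.IsImmersion) {b : UnitAddCircle}
    (hb : φ.fiber (φ.pt b) = {b}) : φ.baseIndex b = φ.ind (φ.pt b) + 2⁻¹ := by
  have hS : φ.fiber (φ.pt b) = (({b} : Finset UnitAddCircle) : Set UnitAddCircle) := by
    rw [hb]; simp
  have h1 : 0 < planeDet (φ.vel b) (Complex.I * φ.vel b) :=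
    (planeDet_I_mul_pos_iff (hφ b)).2 (by simp [div_self (hφ b)])
  have h2 : planeDet (φ.vel b) (-Complex.I * φ.vel b) < 0 := by
    have : planeDet (φ.vel b) (-Complex.I * φ.vel b) = -planeDet (φ.vel b) (Complex.I * φ.vel b) := by
      simp [planeDet]; ring
    linarith
  rw [baseIndex, indToward_eq hφ hS (by simpa using h1.ne'), indToward_eq hφ hS (by simpa using h2.ne)]
  simp only [Finset.sum_singleton, sign_pos h1, sign_neg h2]
  rw [max_eq_left]
  · simp
  · simp

end Quasidoodle

/-- To check a property of pairs of points of the circle near a pair, it suffices to check it for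
lifts to the line. -/
theorem eventually_prod_circle {α : Type*} {F : Filter α} {P : α → UnitAddCircle × UnitAddCircle → Prop}
    {s t : ℝ} (h : ∃ r > 0, ∀ᶠ a in F, ∀ s' t' : ℝ, |s' - s| < r → |t' - t| < r → P a (s', t')) :
    ∀ᶠ q in F ×ˢ 𝓝 ((s : UnitAddCircle), (t : UnitAddCircle)), P q.1 q.2 := by
  obtain ⟨r, hr, h⟩ := h
  have hn (u : ℝ) : ((↑) : ℝ → UnitAddCircle) '' Metric.ball u r ∈ 𝓝 (u : UnitAddCircle) := by
    rw [circle_nhds_coe]; exact image_mem_map (Metric.ball_mem_nhds u hr)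
  filter_upwards [h.prod_mk (prod_mem_nhds (hn s) (hn t))]
  rintro ⟨a, x, y⟩ ⟨ha, ⟨s', hs', rfl⟩, ⟨t', ht', rfl⟩⟩
  exact ha s' t' hs' ht'

namespace Quasidoodle

/-! ### Immersions, I-doodles and transverse crossings in the `C¹`-topology -/

theorem tendsto_vel (φ : Quasidoodle) (z : UnitAddCircle) :
    Tendsto (fun q : Quasidoodle × UnitAddCircle => q.1.vel q.2) (φ.nhdsC1 ×ˢ 𝓝 z)
      (𝓝 (φ.vel z)) := by
  obtain ⟨s, -, rfl⟩ := exists_coe_mem_Ico 0 z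
  have : φ.nhdsC1 ×ˢ 𝓝 (s : UnitAddCircle) =
      map (fun q : Quasidoodle × ℝ => (q.1, (q.2 : UnitAddCircle))) (φ.nhdsC1 ×ˢ 𝓝 s) := by
    rw [circle_nhds_coe]
    conv_lhs => rw [← map_id (f := φ.nhdsC1)]
    rw [prod_map_map_eq]
    rfl
  rw [this, tendsto_map'_iff]
  exact φ.tendsto_deriv s

theorem IsImmersion.eventually {φ : Quasidoodle} (hφ : φ.IsImmersion) :
    ∀ᶠ ψ in φ.nhdsC1, ψ.IsImmersion := by
  have := isCompact_univ.eventually_forall_mem (F := φ.nhdsC1)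
    (P := fun (ψ : Quasidoodle) (z : UnitAddCircle) => ψ.vel z ≠ 0)
    fun z _ => (φ.tendsto_vel z).eventually_ne (hφ z)
  exact this.mono fun ψ h z => h z (mem_univ z)

/-- Curves near an immersion are injective on arcs of uniform length. -/
theorem IsImmersion.exists_injOn {φ : Quasidoodle} (hφ : φ.IsImmersion) (z : ℝ) :
    ∃ r > 0, ∀ᶠ ψ in φ.nhdsC1, InjOn ψ.toFun (Icc (z - r) (z + r)) := by
  have hv := hφ.deriv_ne_zero z
  -- near `z` all curves near `φ` advance strictly in the direction of the velocity of `φ` at `z`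
  obtain ⟨r, hr, h⟩ := φ.exists_forall_deriv_mem z
    (U := {w | 0 < planeDet w (Complex.I * deriv φ.toFun z)}) (by
      refine IsOpen.mem_nhds ?_ ((planeDet_I_mul_pos_iff hv).2 (by simp [div_self hv]))
      exact isOpen_lt continuous_const (by unfold planeDet; fun_prop))
  refine ⟨r, hr, h.mono fun ψ hψ s hs t ht hst => ?_⟩
  by_contra hne
  obtain ⟨ξ, hξ, he⟩ := ψ.exists_planeDet_secant (Complex.I * deriv φ.toFun z) hne
  have hξ' : ξ ∈ Icc (z - r) (z + r) :=
    ⟨(le_min hs.1 ht.1).trans hξ.1.le, hξ.2.le.trans (max_le hs.2 ht.2)⟩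
  rw [hst, sub_self] at he
  have h0 : planeDet 0 (Complex.I * deriv φ.toFun z) = 0 := by simp [planeDet]
  rw [h0] at he
  exact (mul_ne_zero (sub_ne_zero.2 (Ne.symm hne)) (hψ ξ hξ').ne') he.symm

theorem IsImmersion.eventually_injective_near {φ : Quasidoodle} (hφ : φ.IsImmersion)
    (x : UnitAddCircle) : ∀ᶠ q in φ.nhdsC1 ×ˢ 𝓝 (x, x), q.1.pt q.2.1 = q.1.pt q.2.2 → q.2.1 = q.2.2 := by
  obtain ⟨s, -, rfl⟩ := exists_coe_mem_Ico 0 x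
  obtain ⟨r, hr, h⟩ := hφ.exists_injOn s
  refine eventually_prod_circle (P := fun (ψ : Quasidoodle) p => ψ.pt p.1 = ψ.pt p.2 → p.1 = p.2)
    ⟨r, hr, h.mono fun ψ hψ s' t' hs' ht' he => ?_⟩
  have hs := abs_lt.1 hs'
  have ht := abs_lt.1 ht'
  rw [hψ (show s' ∈ Icc (s - r) (s + r) from ⟨by linarith [hs.1], by linarith [hs.2]⟩)
    (show t' ∈ Icc (s - r) (s + r) from ⟨by linarith [ht.1], by linarith [ht.2]⟩) he]

theorem eventually_pt_ne {φ : Quasidoodle} {x y : UnitAddCircle} (h : φ.pt x ≠ φ.pt y) :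
    ∀ᶠ q in φ.nhdsC1 ×ˢ 𝓝 (x, y), q.1.pt q.2.1 ≠ q.1.pt q.2.2 := by
  have h1 : Tendsto (fun q : Quasidoodle × (UnitAddCircle × UnitAddCircle) => q.1.pt q.2.1)
      (φ.nhdsC1 ×ˢ 𝓝 (x, y)) (𝓝 (φ.pt x)) := by
    rw [nhds_prod_eq]
    exact (φ.tendsto_pt x).comp (tendsto_fst.prodMk (tendsto_fst.comp tendsto_snd))
  have h2 : Tendsto (fun q : Quasidoodle × (UnitAddCircle × UnitAddCircle) => q.1.pt q.2.2)
      (φ.nhdsC1 ×ˢ 𝓝 (x, y)) (𝓝 (φ.pt y)) := by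
    rw [nhds_prod_eq]
    exact (φ.tendsto_pt y).comp (tendsto_fst.prodMk (tendsto_snd.comp tendsto_snd))
  exact (h1.sub h2).eventually_ne (sub_ne_zero.2 h) |>.mono fun q hq => sub_ne_zero.1 hq

/-- I-doodles form an open set. -/
theorem IsIDoodle.eventually {φ : Quasidoodle} (hφ : φ.IsIDoodle) :
    ∀ᶠ ψ in φ.nhdsC1, ψ.IsIDoodle := by
  have h3 := (isCompact_univ (X := UnitAddCircle × UnitAddCircle × UnitAddCircle)).eventually_forall_mem
    (F := φ.nhdsC1) (P := fun (ψ : Quasidoodle) p => p.1 ≠ p.2.1 → p.2.1 ≠ p.2.2 → p.1 ≠ p.2.2 →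
      ¬(ψ.pt p.1 = ψ.pt p.2.1 ∧ ψ.pt p.2.1 = ψ.pt p.2.2)) (by
    rintro ⟨x, y, z⟩ -
    have t12 : Tendsto (fun q : Quasidoodle × (UnitAddCircle × UnitAddCircle × UnitAddCircle) =>
        (q.1, (q.2.1, q.2.2.1))) (φ.nhdsC1 ×ˢ 𝓝 (x, y, z)) (φ.nhdsC1 ×ˢ 𝓝 (x, y)) :=
      tendsto_fst.prodMk (((continuous_fst.prodMk (continuous_fst.comp continuous_snd)).tendsto
        (x, y, z)).comp tendsto_snd)
    have t23 : Tendsto (fun q : Quasidoodle × (UnitAddCircle × UnitAddCircle × UnitAddCircle) =>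
        (q.1, (q.2.2.1, q.2.2.2))) (φ.nhdsC1 ×ˢ 𝓝 (x, y, z)) (φ.nhdsC1 ×ˢ 𝓝 (y, z)) :=
      tendsto_fst.prodMk (((continuous_snd).tendsto (x, y, z)).comp tendsto_snd)
    have t13 : Tendsto (fun q : Quasidoodle × (UnitAddCircle × UnitAddCircle × UnitAddCircle) =>
        (q.1, (q.2.1, q.2.2.2))) (φ.nhdsC1 ×ˢ 𝓝 (x, y, z)) (φ.nhdsC1 ×ˢ 𝓝 (x, z)) :=
      tendsto_fst.prodMk (((continuous_fst.prodMk (continuous_snd.comp continuous_snd)).tendsto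
        (x, y, z)).comp tendsto_snd)
    by_cases h12 : φ.pt x = φ.pt y
    · by_cases h23 : φ.pt y = φ.pt z
      · by_cases e12 : x = y
        · subst e12
          filter_upwards [t12.eventually (hφ.1.eventually_injective_near x)] with q hq a _ _ h
          exact a (hq h.1)
        by_cases e23 : y = z
        · subst e23
          filter_upwards [t23.eventually (hφ.1.eventually_injective_near y)] with q hq _ a _ h
          exact a (hq h.2)
        by_cases e13 : x = z
        · subst e13
          filter_upwards [t13.eventually (hφ.1.eventually_injective_near x)] with q hq _ _ a h
          exact a (hq (h.1.trans h.2))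
        exact absurd ⟨h12, h23⟩ (hφ.2 x y z e12 e23 e13)
      · filter_upwards [t23.eventually (eventually_pt_ne h23)] with q hq _ _ _ h
        exact hq h.2
    · filter_upwards [t12.eventually (eventually_pt_ne h12)] with q hq _ _ _ h
      exact hq h.1)
  filter_upwards [hφ.1.eventually, h3] with ψ h1 h3
  exact ⟨h1, fun x y z => h3 (x, y, z) (mem_univ _)⟩

/-- Nearby I-doodles are equivalent. -/
theorem eventually_equivalent {φ : Quasidoodle} (hφ : φ.IsIDoodle) :
    ∀ᶠ ψ in φ.nhdsC1, ∃ hψ : ψ.IsIDoodle, IDoodle.Equivalent ⟨φ, hφ⟩ ⟨ψ, hψ⟩ := by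
  obtain ⟨δ, hδ, h⟩ := eventually_nhdsC1_iff.1 hφ.eventually
  refine eventually_nhdsC1_iff.2 ⟨δ, hδ, fun ψ hψ => ⟨h ψ hψ, fun τ => lin τ φ ψ,
    isContinuousFamily_lin φ ψ, lin_zero φ ψ, lin_one φ ψ, fun τ hτ => h _ ?_⟩⟩
  exact Close.lin hτ (Close.refl hδ φ) hψ

/-- Near a pair of transverse velocities the frame keeps its orientation. -/
theorem exists_sign_planeDet_eq {φ : Quasidoodle} {s₀ t₀ : ℝ}
    (h : planeDet (deriv φ.toFun s₀) (deriv φ.toFun t₀) ≠ 0) :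
    ∃ r > 0, ∀ᶠ ψ in φ.nhdsC1, ∀ s ∈ Icc (s₀ - r) (s₀ + r), ∀ t ∈ Icc (t₀ - r) (t₀ + r),
      SignType.sign (planeDet (deriv ψ.toFun s) (deriv ψ.toFun t)) =
        SignType.sign (planeDet (deriv φ.toFun s₀) (deriv φ.toFun t₀)) := by
  have h1 : ContinuousAt (fun p : ℂ × ℂ => SignType.sign (planeDet p.1 p.2))
      (deriv φ.toFun s₀, deriv φ.toFun t₀) :=
    ContinuousAt.comp (f := fun p : ℂ × ℂ => planeDet p.1 p.2) (continuousAt_sign_of_ne_zero h)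
      continuous_planeDet.continuousAt
  have h2 : ∀ᶠ p in 𝓝 (deriv φ.toFun s₀, deriv φ.toFun t₀), SignType.sign (planeDet p.1 p.2) =
      SignType.sign (planeDet (deriv φ.toFun s₀) (deriv φ.toFun t₀)) :=
    h1.tendsto.eventually ((isOpen_discrete {_}).mem_nhds rfl)
  rw [nhds_prod_eq] at h2
  obtain ⟨pa, hpa, pb, hpb, hp⟩ := eventually_prod_iff.1 h2
  obtain ⟨r, hr, h3⟩ := φ.exists_forall_deriv_mem s₀ hpa
  obtain ⟨r', hr', h4⟩ := φ.exists_forall_deriv_mem t₀ hpb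
  refine ⟨min r r', lt_min hr hr', ?_⟩
  filter_upwards [h3, h4] with ψ h3 h4 s hs t ht
  refine hp (h3 s ?_) (h4 t ?_)
  · exact ⟨by linarith [hs.1, min_le_left r r'], by linarith [hs.2, min_le_left r r']⟩
  · exact ⟨by linarith [ht.1, min_le_right r r'], by linarith [ht.2, min_le_right r r']⟩

/-- Two transverse branches meet at most once. -/
theorem injective_sub_of_planeDet_ne_zero {ψ : Quasidoodle} {A B : Set ℝ} (hA : A.OrdConnected)
    (hB : B.OrdConnected)
    (h : ∀ s ∈ A, ∀ t ∈ B, planeDet (deriv ψ.toFun s) (deriv ψ.toFun t) ≠ 0) {s s' t t' : ℝ}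
    (hs : s ∈ A) (hs' : s' ∈ A) (ht : t ∈ B) (ht' : t' ∈ B)
    (he : ψ.toFun t - ψ.toFun s = ψ.toFun t' - ψ.toFun s') : s = s' ∧ t = t' := by
  have hw : ψ.toFun t' - ψ.toFun t = ψ.toFun s' - ψ.toFun s := by linear_combination -he
  have hsubA : Ioo (min s s') (max s s') ⊆ A :=
    Ioo_subset_Icc_self.trans (hA.uIcc_subset hs hs')
  have hsubB : Ioo (min t t') (max t t') ⊆ B :=
    Ioo_subset_Icc_self.trans (hB.uIcc_subset ht ht')
  have hz (u : ℂ) : planeDet 0 u = 0 := by simp [planeDet]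
  by_cases h1 : s = s'
  · subst h1
    refine ⟨rfl, ?_⟩
    by_contra hne
    obtain ⟨ξ, hξ, h2⟩ := ψ.exists_planeDet_secant (deriv ψ.toFun s) hne
    rw [hw, sub_self, hz] at h2
    refine mul_ne_zero (sub_ne_zero.2 (Ne.symm hne)) ?_ h2.symm
    rw [planeDet_swap, neg_ne_zero]
    exact h s hs ξ (hsubB hξ)
  · exfalso
    by_cases h2 : t = t'
    · subst h2
      obtain ⟨ξ, hξ, h2⟩ := ψ.exists_planeDet_secant (deriv ψ.toFun t) h1
      rw [← hw, sub_self, hz] at h2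
      exact mul_ne_zero (sub_ne_zero.2 (Ne.symm h1)) (h ξ (hsubA hξ) t ht) h2.symm
    · obtain ⟨ξ, hξ, h3⟩ := ψ.exists_planeDet_secant (ψ.toFun s' - ψ.toFun s) h2
      obtain ⟨ζ, hζ, h4⟩ := ψ.exists_planeDet_secant (deriv ψ.toFun ξ) h1
      rw [hw, planeDet_self, planeDet_swap, h4] at h3
      have := mul_ne_zero (sub_ne_zero.2 (Ne.symm h2)) (neg_ne_zero.2
        (mul_ne_zero (sub_ne_zero.2 (Ne.symm h1)) (h ζ (hsubA hζ) ξ (hsubB hξ))))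
      exact this h3.symm

/-- The linearization of the difference of two branches with velocities `u`, `v`. -/
noncomputable def diffMap (u v : ℂ) : (ℝ × ℝ) →L[ℝ] ℂ :=
  (ContinuousLinearMap.snd ℝ ℝ ℝ).smulRight v - (ContinuousLinearMap.fst ℝ ℝ ℝ).smulRight u

theorem diffMap_apply (u v : ℂ) (p : ℝ × ℝ) : diffMap u v p = p.2 * v - p.1 * u := by
  simp [diffMap]

theorem diffMap_injective {u v : ℂ} (h : planeDet u v ≠ 0) : Function.Injective (diffMap u v) := by
  rw [injective_iff_map_eq_zero]
  rintro ⟨a, b⟩ hab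
  rw [diffMap_apply] at hab
  have h1 : b * planeDet u v = 0 := by
    have : planeDet u (b * v - a * u) = b * planeDet u v := by simp [planeDet]; ring
    rw [← this, hab]; simp [planeDet]
  have h2 : a * planeDet u v = 0 := by
    have : planeDet v (b * v - a * u) = a * planeDet u v := by simp [planeDet]; ring
    rw [← this, hab]; simp [planeDet]
  simp [(mul_eq_zero.1 h1).resolve_right h, (mul_eq_zero.1 h2).resolve_right h]

/-- `diffMap` as an equivalence. -/
noncomputable def diffEquiv {u v : ℂ} (h : planeDet u v ≠ 0) : (ℝ × ℝ) ≃L[ℝ] ℂ :=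
  (LinearMap.linearEquivOfInjective (diffMap u v).toLinearMap (diffMap_injective h)
    (by simp [Complex.finrank_real_complex])).toContinuousLinearEquiv

theorem coe_diffEquiv {u v : ℂ} (h : planeDet u v ≠ 0) :
    (diffEquiv h : (ℝ × ℝ) →L[ℝ] ℂ) = diffMap u v := by
  ext <;> rfl

theorem norm_sub_sub_le_of_deriv {ψ : Quasidoodle} {v : ℂ} {η : ℝ} {A : Set ℝ} (hA : Convex ℝ A)
    (h : ∀ s ∈ A, ‖deriv ψ.toFun s - v‖ ≤ η) {s t : ℝ} (hs : s ∈ A) (ht : t ∈ A) :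
    ‖ψ.toFun t - ψ.toFun s - ((t - s : ℝ) : ℂ) * v‖ ≤ η * |t - s| := by
  have hd : ∀ r ∈ A, HasDerivWithinAt (fun r : ℝ => ψ.toFun r - (r : ℂ) * v)
      (deriv ψ.toFun r - v) A r := by
    intro r _
    have h1 : HasDerivAt (fun r : ℝ => (r : ℂ) * v) (1 * v) r :=
      (HasDerivAt.ofReal_comp (hasDerivAt_id r)).mul_const v
    rw [one_mul] at h1
    exact ((ψ.hasDerivAt r).sub h1).hasDerivWithinAt
  have := hA.norm_image_sub_le_of_norm_hasDerivWithin_le hd h hs ht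
  have e : ψ.toFun t - ψ.toFun s - ((t - s : ℝ) : ℂ) * v =
      ψ.toFun t - t * v - (ψ.toFun s - s * v) := by push_cast; ring
  rw [e, ← Real.norm_eq_abs]
  exact this

/-- A transverse crossing persists under `C¹`-small perturbations. -/
theorem exists_forall_exists_sub_eq {φ : Quasidoodle} {s₀ t₀ : ℝ}
    (h : planeDet (deriv φ.toFun s₀) (deriv φ.toFun t₀) ≠ 0) (h0 : φ.toFun s₀ = φ.toFun t₀)
    {r' : ℝ} (hr' : 0 < r') : ∃ ρ > 0, ∀ᶠ ψ in φ.nhdsC1, ∀ w : ℂ, ‖w‖ < ρ →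
      ∃ s t, |s - s₀| < r' ∧ |t - t₀| < r' ∧ ψ.toFun t - ψ.toFun s = w := by
  set u := deriv φ.toFun s₀
  set v := deriv φ.toFun t₀
  -- on a ball of radius `r` the difference map of every nearby curve is `c`-close to the linear
  -- isomorphism `diffEquiv h`, so it is onto a ball of a radius independent of the curve
  set N := (diffEquiv h).toNonlinearRightInverse.nnnorm with hN
  have hNpos : 0 < N := (diffEquiv h).nnnorm_symm_pos
  set c : NNReal := N⁻¹ / 2 with hc
  have hcpos : 0 < c := by positivity
  have hη : (0 : ℝ) < c / 2 := by positivity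
  obtain ⟨r₁, hr₁, e1⟩ := φ.exists_forall_deriv_mem s₀ (Metric.ball_mem_nhds u hη)
  obtain ⟨r₂, hr₂, e2⟩ := φ.exists_forall_deriv_mem t₀ (Metric.ball_mem_nhds v hη)
  set r := min (min r₁ r₂) (r' / 2) with hr
  have hr1 : r ≤ r₁ := (min_le_left _ _).trans (min_le_left _ _)
  have hr2 : r ≤ r₂ := (min_le_left _ _).trans (min_le_right _ _)
  have hr3 : r ≤ r' / 2 := min_le_right _ _
  have hrpos : 0 < r := lt_min (lt_min hr₁ hr₂) (half_pos hr')
  have hcR : (0 : ℝ) < c := by exact_mod_cast hcpos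
  refine ⟨c * r / 2, by positivity, ?_⟩
  filter_upwards [e1, e2, φ.eventually_close (show 0 < c * r / 4 by positivity)] with ψ h1 h2 h3 w hw
  have happ : ApproximatesLinearOn (fun p : ℝ × ℝ => ψ.toFun p.2 - ψ.toFun p.1)
      (diffEquiv h : (ℝ × ℝ) →L[ℝ] ℂ) (Metric.closedBall (s₀, t₀) r) c := by
    rw [ApproximatesLinearOn.approximatesLinearOn_iff_lipschitzOnWith]
    refine LipschitzOnWith.of_dist_le_mul fun p hp q hq => ?_
    rw [← closedBall_prod_same, mem_prod, Real.closedBall_eq_Icc, Real.closedBall_eq_Icc] at hp hq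
    have a1 := norm_sub_sub_le_of_deriv (ψ := ψ) (convex_Icc (s₀ - r₁) (s₀ + r₁))
      (fun s hs => (mem_ball_iff_norm.1 (h1 s hs)).le)
      (Icc_subset_Icc (by linarith) (by linarith) hq.1)
      (Icc_subset_Icc (by linarith) (by linarith) hp.1)
    have a2 := norm_sub_sub_le_of_deriv (ψ := ψ) (convex_Icc (t₀ - r₂) (t₀ + r₂))
      (fun s hs => (mem_ball_iff_norm.1 (h2 s hs)).le)
      (Icc_subset_Icc (by linarith) (by linarith) hq.2)
      (Icc_subset_Icc (by linarith) (by linarith) hp.2)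
    have b1 : |p.1 - q.1| ≤ dist p q := by rw [← Real.dist_eq]; exact le_max_left _ _
    have b2 : |p.2 - q.2| ≤ dist p q := by rw [← Real.dist_eq]; exact le_max_right _ _
    rw [dist_eq_norm]
    have e : ((fun p : ℝ × ℝ => ψ.toFun p.2 - ψ.toFun p.1) - ⇑(diffEquiv h : (ℝ × ℝ) →L[ℝ] ℂ)) p -
        ((fun p : ℝ × ℝ => ψ.toFun p.2 - ψ.toFun p.1) - ⇑(diffEquiv h : (ℝ × ℝ) →L[ℝ] ℂ)) q =
        (ψ.toFun p.2 - ψ.toFun q.2 - ((p.2 - q.2 : ℝ) : ℂ) * v) -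
        (ψ.toFun p.1 - ψ.toFun q.1 - ((p.1 - q.1 : ℝ) : ℂ) * u) := by
      simp only [Pi.sub_apply, coe_diffEquiv, diffMap_apply]
      push_cast; ring
    rw [e]
    refine (norm_sub_le _ _).trans ?_
    have c1 := mul_le_mul_of_nonneg_left b1 hη.le
    have c2 := mul_le_mul_of_nonneg_left b2 hη.le
    linarith
  have hsurj := happ.surjOn_closedBall_of_nonlinearRightInverse
    (diffEquiv h).toNonlinearRightInverse hrpos.le subset_rfl
  have hcN : ((N : ℝ)⁻¹ - c) = c := by
    rw [hc]; push_cast; ring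
  rw [← hN, hcN] at hsurj
  have hF : ‖ψ.toFun t₀ - ψ.toFun s₀‖ < c * r / 2 := by
    have e : ψ.toFun t₀ - ψ.toFun s₀ = (ψ.toFun t₀ - φ.toFun t₀) - (ψ.toFun s₀ - φ.toFun s₀) := by
      rw [h0]; ring
    rw [e]
    refine (norm_sub_le _ _).trans_lt ?_
    linarith [(h3 t₀).1, (h3 s₀).1]
  obtain ⟨p, hp, hpw⟩ := hsurj (show w ∈ _ by
    rw [mem_closedBall_iff_norm]
    refine (norm_sub_le _ _).trans ?_
    linarith)
  rw [← closedBall_prod_same, mem_prod, Metric.mem_closedBall, Metric.mem_closedBall,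
    Real.dist_eq, Real.dist_eq] at hp
  exact ⟨p.1, p.2, by linarith [hp.1], by linarith [hp.2], hpw⟩

/-! ### Density of regular I-doodles -/

/-- The standard parametrization of the unit circle. -/
noncomputable def circ (s : ℝ) : ℂ := Complex.exp (2 * Real.pi * Complex.I * s)

theorem contDiff_circ {n : WithTop ℕ∞} : ContDiff ℝ n circ := by
  unfold circ
  have : ContDiff ℝ n (fun s : ℝ => (s : ℂ)) := Complex.ofRealCLM.contDiff
  fun_prop

theorem circ_ne_zero (s : ℝ) : circ s ≠ 0 := Complex.exp_ne_zero _

theorem norm_circ (s : ℝ) : ‖circ s‖ = 1 := by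
  rw [circ, show (2 * Real.pi * Complex.I * s : ℂ) = ((2 * Real.pi * s : ℝ) : ℂ) * Complex.I by
    push_cast; ring]
  exact Complex.norm_exp_ofReal_mul_I _

theorem hasDerivAt_circ (s : ℝ) :
    HasDerivAt circ (2 * Real.pi * Complex.I * circ s) s := by
  have h1 : HasDerivAt (fun s : ℝ => 2 * Real.pi * Complex.I * (s : ℂ)) (2 * Real.pi * Complex.I * 1) s :=
    ((hasDerivAt_id s).ofReal_comp).const_mul _
  have := h1.cexp
  rw [mul_one] at this
  refine this.congr_deriv ?_
  simp only [circ]; ring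

theorem circ_eq_iff {s t : ℝ} : circ s = circ t ↔ (s : UnitAddCircle) = t := by
  rw [circ, circ, Complex.exp_eq_exp_iff_exists_int, circle_coe_eq_iff]
  refine exists_congr fun m => ?_
  have h : (2 * Real.pi * Complex.I : ℂ) ≠ 0 := by simp [Real.pi_ne_zero]
  rw [show (2 * Real.pi * Complex.I * t + m * (2 * Real.pi * Complex.I) : ℂ) =
    2 * Real.pi * Complex.I * (t + m) by ring, mul_right_inj' h]
  exact_mod_cast Iff.rfl

theorem circ_periodic : Function.Periodic circ 1 := fun s =>
  circ_eq_iff.2 (by simp)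

/-- The perturbation of `φ` by a trigonometric polynomial. -/
noncomputable def perturb (φ : Quasidoodle) (a : ℂ × ℂ × ℂ) : Quasidoodle where
  toFun s := φ.toFun s + (a.1 * circ s + a.2.1 * circ s ^ 2 + a.2.2 * circ s ^ 3)
  smooth := φ.smooth.add (((contDiff_const.mul contDiff_circ).add
    (contDiff_const.mul (contDiff_circ.pow 2))).add (contDiff_const.mul (contDiff_circ.pow 3)))
  periodic s := by simp only [φ.periodic s, circ_periodic s]

theorem perturb_toFun (φ : Quasidoodle) (a : ℂ × ℂ × ℂ) (s : ℝ) : (φ.perturb a).toFun s =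
    φ.toFun s + (a.1 * circ s + a.2.1 * circ s ^ 2 + a.2.2 * circ s ^ 3) := rfl

theorem deriv_perturb (φ : Quasidoodle) (a : ℂ × ℂ × ℂ) (s : ℝ) : deriv (φ.perturb a).toFun s =
    deriv φ.toFun s + 2 * Real.pi * Complex.I * circ s *
      (a.1 + 2 * a.2.1 * circ s + 3 * a.2.2 * circ s ^ 2) := by
  have h := hasDerivAt_circ s
  have := (φ.hasDerivAt s).add (((h.const_mul a.1).add ((h.pow 2).const_mul a.2.1)).add
    ((h.pow 3).const_mul a.2.2))
  refine (this.congr_deriv ?_).deriv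
  push_cast; ring

theorem close_perturb (φ : Quasidoodle) {δ : ℝ} {a : ℂ × ℂ × ℂ} (ha : ‖a‖ < δ / 50) :
    Close δ φ (φ.perturb a) := by
  have h1 : ‖a.1‖ < δ / 50 := (norm_fst_le a).trans_lt ha
  have h2 : ‖a.2.1‖ < δ / 50 := ((norm_fst_le a.2).trans (norm_snd_le a)).trans_lt ha
  have h3 : ‖a.2.2‖ < δ / 50 := ((norm_snd_le a.2).trans (norm_snd_le a)).trans_lt ha
  intro s
  have hc := norm_circ s
  rw [perturb_toFun, deriv_perturb, add_sub_cancel_left, add_sub_cancel_left]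
  have hδ : 0 < δ / 50 := (norm_nonneg _).trans_lt ha
  constructor
  · refine (norm_add₃_le).trans_lt ?_
    simp only [norm_mul, norm_pow, hc, one_pow, mul_one]
    linarith
  · have hpi : ‖(2 * Real.pi * Complex.I * circ s : ℂ)‖ = 2 * Real.pi := by
      simp [hc, abs_of_pos Real.pi_pos]
    rw [norm_mul, hpi]
    have h4 : ‖a.1 + 2 * a.2.1 * circ s + 3 * a.2.2 * circ s ^ 2‖ < 6 * (δ / 50) := by
      refine (norm_add₃_le).trans_lt ?_
      simp only [norm_mul, norm_pow, hc, one_pow, mul_one, Complex.norm_ofNat]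
      linarith
    have h5 := Real.pi_lt_four
    have h6 := Real.pi_pos
    calc _ < 2 * Real.pi * (6 * (δ / 50)) := by gcongr
      _ ≤ 2 * 4 * (6 * (δ / 50)) := by gcongr
      _ ≤ δ := by linarith

/-- The perturbation that produces a tangency at the times `s`, `t` with ratio of velocities `l`;
the remaining freedom is the complex parameter `m`. A cubic polynomial is written in the Newton form
`const + m (z - circ s) + (z - circ s)² (q + r (z - circ t))`. -/
noncomputable def tangencyParam (φ : Quasidoodle) (w : (ℝ × ℝ × ℝ) × ℂ) : ℂ × ℂ × ℂ :=
  let s := w.1.1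
  let t := w.1.2.1
  let l : ℂ := w.1.2.2
  let m := w.2
  let d := circ t - circ s
  let q := (φ.toFun s - φ.toFun t - m * d) / d ^ 2
  let r := ((l * (deriv φ.toFun s + 2 * Real.pi * Complex.I * circ s * m) - deriv φ.toFun t) /
    (2 * Real.pi * Complex.I * circ t) - m - 2 * q * d) / d ^ 2
  (m - 2 * circ s * q + (circ s ^ 2 + 2 * circ s * circ t) * r,
    q - (2 * circ s + circ t) * r, r)

theorem contDiffOn_div {E : Type*} [NormedAddCommGroup E] [NormedSpace ℝ E] {U : Set E} {f g : E → ℂ}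
    (hf : ContDiffOn ℝ 1 f U) (hg : ContDiffOn ℝ 1 g U) (h0 : ∀ x ∈ U, g x ≠ 0) :
    ContDiffOn ℝ 1 (fun x => f x / g x) U := by
  simp only [div_eq_mul_inv]
  exact hf.mul (hg.inv h0)

theorem contDiffOn_tangencyParam (φ : Quasidoodle) :
    ContDiffOn ℝ 1 φ.tangencyParam {w | w.1.1 < w.1.2.1 ∧ w.1.2.1 < w.1.1 + 1} := by
  set U : Set ((ℝ × ℝ × ℝ) × ℂ) := {w | w.1.1 < w.1.2.1 ∧ w.1.2.1 < w.1.1 + 1}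
  have hφ : ContDiff ℝ 1 φ.toFun := φ.smooth.of_le (by exact_mod_cast le_top)
  have hφ' : ContDiff ℝ 1 (deriv φ.toFun) := φ.contDiff_deriv.of_le (by exact_mod_cast le_top)
  have hs : ContDiff ℝ 1 fun w : (ℝ × ℝ × ℝ) × ℂ => w.1.1 := by fun_prop
  have ht : ContDiff ℝ 1 fun w : (ℝ × ℝ × ℝ) × ℂ => w.1.2.1 := by fun_prop
  have hl : ContDiff ℝ 1 fun w : (ℝ × ℝ × ℝ) × ℂ => (w.1.2.2 : ℂ) :=
    Complex.ofRealCLM.contDiff.comp (by fun_prop : ContDiff ℝ 1 fun w : (ℝ × ℝ × ℝ) × ℂ => w.1.2.2)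
  have hm : ContDiffOn ℝ 1 (fun w : (ℝ × ℝ × ℝ) × ℂ => w.2) U := by fun_prop
  have cs := ((contDiff_circ (n := 1)).comp hs).contDiffOn (s := U)
  have ct := ((contDiff_circ (n := 1)).comp ht).contDiffOn (s := U)
  have fs := (hφ.comp hs).contDiffOn (s := U)
  have ft := (hφ.comp ht).contDiffOn (s := U)
  have fs' := (hφ'.comp hs).contDiffOn (s := U)
  have ft' := (hφ'.comp ht).contDiffOn (s := U)
  have hd := ct.sub cs
  have hd0 : ∀ w ∈ U, (circ w.1.2.1 - circ w.1.1) ^ 2 ≠ 0 := fun w hw => by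
    refine pow_ne_zero 2 (sub_ne_zero.2 fun h => ?_)
    exact circle_coe_ne_of_lt hw.1 hw.2 (circ_eq_iff.1 h).symm
  have hq := contDiffOn_div ((fs.sub ft).sub (hm.mul hd)) (hd.pow 2) hd0
  have hpi : (2 * Real.pi * Complex.I : ℂ) ≠ 0 := by simp [Real.pi_ne_zero]
  have cpi : ContDiffOn ℝ 1 (fun _ : (ℝ × ℝ × ℝ) × ℂ => (2 * Real.pi * Complex.I : ℂ)) U :=
    contDiffOn_const
  have c2 : ContDiffOn ℝ 1 (fun _ : (ℝ × ℝ × ℝ) × ℂ => (2 : ℂ)) U := contDiffOn_const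
  have hr := contDiffOn_div (((contDiffOn_div (((hl.contDiffOn (s := U)).mul
    (fs'.add ((cpi.mul cs).mul hm))).sub ft') (cpi.mul ct)
    (fun w _ => mul_ne_zero hpi (circ_ne_zero _))).sub hm).sub ((c2.mul hq).mul hd)) (hd.pow 2) hd0
  exact ((hm.sub ((c2.mul cs).mul hq)).add (((cs.pow 2).add ((c2.mul cs).mul ct)).mul hr)).prodMk
    ((hq.sub (((c2.mul cs).add ct).mul hr)).prodMk hr)

/-- Every perturbation with a tangential double point is a value of `tangencyParam`. -/
theorem eq_tangencyParam {φ : Quasidoodle} {a : ℂ × ℂ × ℂ} {s t l : ℝ} (hst : s < t) (hst' : t < s + 1)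
    (h : (φ.perturb a).toFun s = (φ.perturb a).toFun t)
    (h' : deriv (φ.perturb a).toFun t = l * deriv (φ.perturb a).toFun s) :
    a = φ.tangencyParam ((s, t, l), a.1 + 2 * a.2.1 * circ s + 3 * a.2.2 * circ s ^ 2) := by
  obtain ⟨a₁, a₂, a₃⟩ := a
  rw [perturb_toFun, perturb_toFun] at h
  rw [deriv_perturb, deriv_perturb] at h'
  simp only at h h'
  have hd : circ t - circ s ≠ 0 := sub_ne_zero.2 fun h =>
    circle_coe_ne_of_lt hst hst' (circ_eq_iff.1 h).symm
  have hpi : (2 * Real.pi * Complex.I : ℂ) ≠ 0 := by simp [Real.pi_ne_zero]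
  have ht := circ_ne_zero t
  have hq : (φ.toFun s - φ.toFun t - (a₁ + 2 * a₂ * circ s + 3 * a₃ * circ s ^ 2) *
      (circ t - circ s)) / (circ t - circ s) ^ 2 = a₂ + a₃ * (2 * circ s + circ t) := by
    rw [div_eq_iff (pow_ne_zero 2 hd)]
    linear_combination h
  have hr : ((l * (deriv φ.toFun s + 2 * Real.pi * Complex.I * circ s *
      (a₁ + 2 * a₂ * circ s + 3 * a₃ * circ s ^ 2)) - deriv φ.toFun t) /
      (2 * Real.pi * Complex.I * circ t) - (a₁ + 2 * a₂ * circ s + 3 * a₃ * circ s ^ 2) -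
      2 * (a₂ + a₃ * (2 * circ s + circ t)) * (circ t - circ s)) / (circ t - circ s) ^ 2 = a₃ := by
    rw [← h', add_sub_cancel_left, mul_div_cancel_left₀ _ (mul_ne_zero hpi ht),
      div_eq_iff (pow_ne_zero 2 hd)]
    ring
  simp only [tangencyParam, hq, hr]
  refine Prod.ext ?_ (Prod.ext ?_ rfl) <;> simp only <;> ring

/-- Regular I-doodles are dense: perturbations with a tangency form the image of a space of smaller
dimension. -/
theorem IsIDoodle.frequently_isRegularIDoodle {φ : Quasidoodle} (hφ : φ.IsIDoodle) :
    ∃ᶠ ψ in φ.nhdsC1, ψ.IsRegularIDoodle := by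
  rw [φ.hasBasis_nhdsC1.frequently_iff]
  intro δ₀ hδ₀
  obtain ⟨δ₁, hδ₁, hopen⟩ := eventually_nhdsC1_iff.1 hφ.eventually
  set δ := min δ₀ δ₁
  have hδ : 0 < δ := lt_min hδ₀ hδ₁
  -- the parameters of tangencies form a space of dimension `5`, the perturbations one of
  -- dimension `6`
  have hdense : Dense (φ.tangencyParam '' {w | w.1.1 < w.1.2.1 ∧ w.1.2.1 < w.1.1 + 1})ᶜ := by
    refine φ.contDiffOn_tangencyParam.dense_compl_image_of_dimH_lt_finrank ?_ subset_rfl ?_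
    · have e1 : Convex ℝ {w : (ℝ × ℝ × ℝ) × ℂ | w.1.1 - w.1.2.1 < 0} :=
        convex_halfSpace_lt (IsLinearMap.mk (by intro x y; simp; ring) (by intro c x; simp; ring)) 0
      have e2 : Convex ℝ {w : (ℝ × ℝ × ℝ) × ℂ | w.1.2.1 - w.1.1 < 1} :=
        convex_halfSpace_lt (IsLinearMap.mk (by intro x y; simp; ring) (by intro c x; simp; ring)) 1
      have e : {w : (ℝ × ℝ × ℝ) × ℂ | w.1.1 < w.1.2.1 ∧ w.1.2.1 < w.1.1 + 1} =
          {w | w.1.1 - w.1.2.1 < 0} ∩ {w | w.1.2.1 - w.1.1 < 1} := by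
        ext w
        change (w.1.1 < w.1.2.1 ∧ w.1.2.1 < w.1.1 + 1) ↔
          (w.1.1 - w.1.2.1 < 0 ∧ w.1.2.1 - w.1.1 < 1)
        constructor <;> rintro ⟨h1, h2⟩ <;> constructor <;> linarith
      rw [e]
      exact e1.inter e2
    · refine (dimH_mono (subset_univ _)).trans_lt ?_
      rw [Real.dimH_univ_eq_finrank]
      simp [Complex.finrank_real_complex]
      norm_num
  obtain ⟨a, ha, hball⟩ := hdense.exists_mem_open (Metric.isOpen_ball (x := (0 : ℂ × ℂ × ℂ))
    (ε := δ / 50)) ⟨0, Metric.mem_ball_self (by positivity)⟩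
  have hclose := φ.close_perturb (mem_ball_zero_iff.1 hball)
  have hI := hopen _ (hclose.mono (min_le_right _ _))
  refine ⟨φ.perturb a, hclose.mono (min_le_left _ _), hI, fun z w hzw hpt hdet => ?_⟩
  have key : ∀ s t : ℝ, s < t → t < s + 1 → (φ.perturb a).toFun s = (φ.perturb a).toFun t →
      planeDet (deriv (φ.perturb a).toFun s) (deriv (φ.perturb a).toFun t) ≠ 0 := by
    intro s t hst hst' he hdet
    have hs := hI.1.deriv_ne_zero s
    set u := deriv (φ.perturb a).toFun s
    set v := deriv (φ.perturb a).toFun t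
    -- parallel velocities: the second is a real multiple of the first
    have hl : v = ((v / u).re : ℂ) * u := by
      have him : (v / u).im = 0 := by
        rw [Complex.div_im]
        simp only [planeDet] at hdet
        rw [← sub_div]
        rw [div_eq_zero_iff]; left; linarith
      have : ((v / u).re : ℂ) = v / u := Complex.ext (by simp) (by simp [him])
      rw [this, div_mul_cancel₀ _ hs]
    exact ha ⟨_, ⟨hst, hst'⟩, (eq_tangencyParam hst hst' he hl).symm⟩
  obtain ⟨s, hs, rfl⟩ := exists_coe_mem_Ico 0 z
  obtain ⟨t, ht, rfl⟩ := exists_coe_mem_Ico 0 w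
  rcases lt_trichotomy s t with h | h | h
  · exact key s t h (by linarith [hs.1, ht.2]) hpt hdet
  · exact hzw (by rw [h])
  · refine key t s h (by linarith [hs.2, ht.1]) hpt.symm ?_
    rw [planeDet_swap, neg_eq_zero]; exact hdet

end Quasidoodle

/-! ### The radial cutoff of the area form and of the angular form -/

/-- A smooth step: `0` for `q ≤ 1 / 2` and `1` for `q ≥ 1`. -/
noncomputable def stepFun (q : ℝ) : ℝ := Real.smoothTransition (2 * q - 1)

theorem contDiff_stepFun {n : ℕ∞} : ContDiff ℝ n stepFun :=
  Real.smoothTransition.contDiff.comp ((contDiff_const.mul contDiff_id).sub contDiff_const)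

theorem stepFun_of_le {q : ℝ} (h : q ≤ 1 / 2) : stepFun q = 0 :=
  Real.smoothTransition.zero_of_nonpos (by linarith)

theorem stepFun_of_ge {q : ℝ} (h : 1 ≤ q) : stepFun q = 1 :=
  Real.smoothTransition.one_of_one_le (by linarith)

theorem hasDerivAt_stepFun (q : ℝ) : HasDerivAt stepFun (deriv stepFun q) q :=
  ((contDiff_stepFun (n := 1)).differentiable (by simp) q).hasDerivAt

theorem contDiff_deriv_stepFun : ContDiff ℝ 1 (deriv stepFun) :=
  ((contDiff_succ_iff_deriv (n := 1)).1 (contDiff_stepFun (n := 2))).2.2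

theorem deriv_stepFun_of_gt {q : ℝ} (h : 1 < q) : deriv stepFun q = 0 := by
  have : stepFun =ᶠ[𝓝 q] fun _ => 1 := (lt_mem_nhds h).mono fun x hx => stepFun_of_ge (le_of_lt hx)
  rw [this.deriv_eq, deriv_const]

/-- The radial density of total mass one, as a function of the square of the radius. -/
noncomputable def massDensity (q : ℝ) : ℝ := deriv stepFun q / Real.pi

/-- The coefficient of the cut off angular form `(x dy - y dx) / (2 π r²)`, as a function of the
square of the radius. -/
noncomputable def angDensity (q : ℝ) : ℝ := stepFun q / (2 * Real.pi * q)

theorem contDiff_massDensity : ContDiff ℝ 1 massDensity := contDiff_deriv_stepFun.div_const _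

theorem massDensity_of_gt {q : ℝ} (h : 1 < q) : massDensity q = 0 := by
  rw [massDensity, deriv_stepFun_of_gt h, zero_div]

theorem angDensity_of_ge {q : ℝ} (h : 1 ≤ q) : angDensity q = 1 / (2 * Real.pi * q) := by
  rw [angDensity, stepFun_of_ge h]

theorem contDiff_angDensity : ContDiff ℝ 1 angDensity := by
  rw [contDiff_iff_contDiffAt]
  intro q
  rcases lt_or_ge q (1 / 2) with h | h
  · have : angDensity =ᶠ[𝓝 q] fun _ => 0 := (gt_mem_nhds h).mono fun x hx => by
      rw [angDensity, stepFun_of_le (le_of_lt hx), zero_div]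
    exact contDiffAt_const.congr_of_eventuallyEq this
  · refine (contDiff_stepFun (n := 1)).contDiffAt.div ?_ ?_
    · fun_prop
    · have := Real.pi_pos; positivity

/-- The exterior derivative of the cut off angular form is the cut off area form. -/
theorem massDensity_eq (q : ℝ) :
    massDensity q = 2 * angDensity q + 2 * q * deriv angDensity q := by
  have h1 : HasDerivAt angDensity (deriv angDensity q) q :=
    (contDiff_angDensity.differentiable (by simp) q).hasDerivAt
  have h2 : HasDerivAt (fun q => 2 * Real.pi * (q * angDensity q))
      (2 * Real.pi * (1 * angDensity q + q * deriv angDensity q)) q :=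
    ((hasDerivAt_id q).mul h1).const_mul _
  have h3 : (fun q => 2 * Real.pi * (q * angDensity q)) = stepFun := by
    funext q
    by_cases hq : q = 0
    · rw [hq, stepFun_of_le (by norm_num)]; simp
    · rw [angDensity]; field_simp
  rw [h3] at h2
  rw [massDensity, h2.deriv]
  field_simp

/-! ### Pulling back forms along a map to the plane -/

section Pullback

variable {E : Type*} [NormedAddCommGroup E] [NormedSpace ℝ E] {F : E → ℂ}

/-- The coefficient at the vectors `a`, `b` of the pullback under `F` of a radial area form. -/
noncomputable def areaPullback (F : E → ℂ) (a b x : E) : ℝ :=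
  massDensity (Complex.normSq (F x)) * planeDet (fderiv ℝ F x a) (fderiv ℝ F x b)

/-- The coefficient at the vector `a` of the pullback under `F` of the cut off angular form. -/
noncomputable def anglePullback (F : E → ℂ) (a x : E) : ℝ :=
  angDensity (Complex.normSq (F x)) * planeDet (F x) (fderiv ℝ F x a)

theorem hasFDerivAt_planeDet {f g : E → ℂ} {f' g' : E →L[ℝ] ℂ} {x : E} (hf : HasFDerivAt f f' x)
    (hg : HasFDerivAt g g' x) : ∃ L : E →L[ℝ] ℝ, HasFDerivAt (fun x => planeDet (f x) (g x)) L x ∧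
      ∀ c, L c = planeDet (f' c) (g x) + planeDet (f x) (g' c) := by
  have fr := Complex.reCLM.hasFDerivAt.comp x hf
  have fi := Complex.imCLM.hasFDerivAt.comp x hf
  have gr := Complex.reCLM.hasFDerivAt.comp x hg
  have gi := Complex.imCLM.hasFDerivAt.comp x hg
  refine ⟨_, (fr.mul gi).sub (fi.mul gr), fun c => ?_⟩
  simp [planeDet]
  ring

theorem hasFDerivAt_radial {f : E → ℂ} {f' : E →L[ℝ] ℂ} {x : E} (hf : HasFDerivAt f f' x)
    {h : ℝ → ℝ} (hh : ContDiff ℝ 1 h) :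
    ∃ L : E →L[ℝ] ℝ, HasFDerivAt (fun x => h (Complex.normSq (f x))) L x ∧
      ∀ c, L c = deriv h (Complex.normSq (f x)) *
        (2 * ((f x).re * (f' c).re + (f x).im * (f' c).im)) := by
  have fr := Complex.reCLM.hasFDerivAt.comp x hf
  have fi := Complex.imCLM.hasFDerivAt.comp x hf
  have hN : HasFDerivAt (fun x => Complex.normSq (f x)) _ x := (fr.mul fr).add (fi.mul fi)
  have h1 : HasDerivAt h (deriv h (Complex.normSq (f x))) (Complex.normSq (f x)) :=
    (hh.differentiable (by simp) _).hasDerivAt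
  refine ⟨_, h1.comp_hasFDerivAt x hN, fun c => ?_⟩
  simp
  ring

theorem hasFDerivAt_fderiv_apply (hF : ContDiff ℝ 2 F) (a x : E) :
    HasFDerivAt (fun x => fderiv ℝ F x a) ((fderiv ℝ (fderiv ℝ F) x).flip a) x := by
  have h : HasFDerivAt (fderiv ℝ F) (fderiv ℝ (fderiv ℝ F) x) x :=
    ((hF.fderiv_right (m := 1) (by norm_num)).differentiable (by simp) x).hasFDerivAt
  have := h.clm_apply (hasFDerivAt_const a x)
  refine this.congr_fderiv ?_
  ext c; simp

theorem fderiv_fderiv_symm (hF : ContDiff ℝ 2 F) (x a b : E) :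
    fderiv ℝ (fderiv ℝ F) x a b = fderiv ℝ (fderiv ℝ F) x b a :=
  (hF.contDiffAt.isSymmSndFDerivAt (by simp)) a b

theorem differentiable_areaPullback (hF : ContDiff ℝ 2 F) (a b : E) :
    Differentiable ℝ (areaPullback F a b) := by
  intro x
  obtain ⟨L, hL, -⟩ := hasFDerivAt_radial ((hF.differentiable (by simp) x).hasFDerivAt)
    contDiff_massDensity
  obtain ⟨L', hL', -⟩ := hasFDerivAt_planeDet (hasFDerivAt_fderiv_apply hF a x)
    (hasFDerivAt_fderiv_apply hF b x)
  exact (hL.mul hL').differentiableAt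

/-- The pullback of an area form to three dimensions is closed. -/
theorem areaPullback_closed (hF : ContDiff ℝ 2 F) (a b c x : E) :
    fderiv ℝ (areaPullback F b c) x a - fderiv ℝ (areaPullback F a c) x b +
      fderiv ℝ (areaPullback F a b) x c = 0 := by
  obtain ⟨L, hL, hL'⟩ := hasFDerivAt_radial ((hF.differentiable (by simp) x).hasFDerivAt)
    contDiff_massDensity
  have key : ∀ p q v, fderiv ℝ (areaPullback F p q) x v =
      massDensity (Complex.normSq (F x)) *
        (planeDet (fderiv ℝ (fderiv ℝ F) x v p) (fderiv ℝ F x q) +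
          planeDet (fderiv ℝ F x p) (fderiv ℝ (fderiv ℝ F) x v q)) +
      planeDet (fderiv ℝ F x p) (fderiv ℝ F x q) * L v := by
    intro p q v
    obtain ⟨M, hM, hM'⟩ := hasFDerivAt_planeDet (hasFDerivAt_fderiv_apply hF p x)
      (hasFDerivAt_fderiv_apply hF q x)
    have : HasFDerivAt (areaPullback F p q) _ x := hL.mul hM
    rw [this.fderiv]
    simp [hM']
  rw [key, key, key, hL', hL', hL', fderiv_fderiv_symm hF x b a, fderiv_fderiv_symm hF x c a,
    fderiv_fderiv_symm hF x c b]
  simp only [planeDet]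
  ring

theorem differentiable_anglePullback (hF : ContDiff ℝ 2 F) (a : E) :
    Differentiable ℝ (anglePullback F a) := by
  intro x
  have h := (hF.differentiable (by simp) x).hasFDerivAt
  obtain ⟨L, hL, -⟩ := hasFDerivAt_radial h contDiff_angDensity
  obtain ⟨L', hL', -⟩ := hasFDerivAt_planeDet h (hasFDerivAt_fderiv_apply hF a x)
  exact (hL.mul hL').differentiableAt

/-- The exterior derivative of the pulled back cut off angular form is the pullback of the radial area
form. -/
theorem anglePullback_deriv (hF : ContDiff ℝ 2 F) (a b x : E) :
    fderiv ℝ (anglePullback F b) x a - fderiv ℝ (anglePullback F a) x b = areaPullback F a b x := by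
  have h := (hF.differentiable (by simp) x).hasFDerivAt
  obtain ⟨L, hL, hL'⟩ := hasFDerivAt_radial h contDiff_angDensity
  have key : ∀ p v, fderiv ℝ (anglePullback F p) x v =
      angDensity (Complex.normSq (F x)) *
        (planeDet (fderiv ℝ F x v) (fderiv ℝ F x p) +
          planeDet (F x) (fderiv ℝ (fderiv ℝ F) x v p)) +
      planeDet (F x) (fderiv ℝ F x p) * L v := by
    intro p v
    obtain ⟨M, hM, hM'⟩ := hasFDerivAt_planeDet h (hasFDerivAt_fderiv_apply hF p x)
    have : HasFDerivAt (anglePullback F p) _ x := hL.mul hM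
    rw [this.fderiv]
    simp [hM']
  rw [key, key, hL', hL', fderiv_fderiv_symm hF x b a, areaPullback, massDensity_eq,
    Complex.normSq_apply]
  simp only [planeDet]
  ring

theorem continuous_areaPullback (hF : ContDiff ℝ 2 F) (a b : E) : Continuous (areaPullback F a b) :=
  (differentiable_areaPullback hF a b).continuous

end Pullback

theorem integral_Icc_fin_two (g : ℝ → ℝ → ℝ) (a b : Fin 2 → ℝ) :
    ∫ x in Icc a b, g (x 0) (x 1) = ∫ p in Icc (a 0) (b 0) ×ˢ Icc (a 1) (b 1), g p.1 p.2 := by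
  have h := (MeasureTheory.volume_preserving_finTwoArrow ℝ).setIntegral_preimage_emb
    (MeasurableEquiv.finTwoArrow (α := ℝ)).measurableEmbedding (fun p : ℝ × ℝ => g p.1 p.2)
    (Icc (a 0) (b 0) ×ˢ Icc (a 1) (b 1))
  rw [← h]
  congr 2
  ext x
  simp only [mem_Icc, mem_preimage, mem_prod, Pi.le_def, Fin.forall_fin_two,
    MeasurableEquiv.finTwoArrow]
  change _ ↔ (a 0 ≤ x 0 ∧ x 0 ≤ b 0) ∧ (a 1 ≤ x 1 ∧ x 1 ≤ b 1)
  tauto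

/-- The total mass of the area form is one. -/
theorem integral_massDensity : ∫ z : ℂ, massDensity (Complex.normSq z) = 1 := by
  have h1 : ∫ z : ℂ, massDensity (Complex.normSq z) = ∫ z : ℂ, massDensity (‖z‖ ^ 2) := by
    simp only [Complex.normSq_eq_norm_sq]
  rw [h1, MeasureTheory.integral_fun_norm_addHaar MeasureTheory.volume (fun y => massDensity (y ^ 2))]
  have h2 : ∫ y in Ioi (0 : ℝ), y ^ (Module.finrank ℝ ℂ - 1) • massDensity (y ^ 2) = (2 * Real.pi)⁻¹ := by
    have hd : ∀ y ∈ Ioi (0 : ℝ), HasDerivAt (fun y => (2 * Real.pi)⁻¹ * stepFun (y ^ 2))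
        (y ^ (Module.finrank ℝ ℂ - 1) • massDensity (y ^ 2)) y := by
      intro y _
      have := ((hasDerivAt_stepFun (y ^ 2)).comp y (hasDerivAt_pow 2 y)).const_mul (2 * Real.pi)⁻¹
      refine this.congr_deriv ?_
      rw [Complex.finrank_real_complex, massDensity]
      simp
      field_simp
    have hc : Continuous fun y : ℝ => stepFun (y ^ 2) :=
      (contDiff_stepFun (n := 1)).continuous.comp (continuous_pow 2)
    have hlim : Tendsto (fun y : ℝ => (2 * Real.pi)⁻¹ * stepFun (y ^ 2)) atTop (𝓝 (2 * Real.pi)⁻¹) := by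
      refine tendsto_const_nhds.congr' ?_
      filter_upwards [eventually_ge_atTop 1] with y hy
      rw [stepFun_of_ge (by nlinarith), mul_one]
    have hint : MeasureTheory.IntegrableOn
        (fun y : ℝ => y ^ (Module.finrank ℝ ℂ - 1) • massDensity (y ^ 2)) (Ioi 0) := by
      have hcont : Continuous fun y : ℝ => y ^ (Module.finrank ℝ ℂ - 1) • massDensity (y ^ 2) :=
        (continuous_pow _).smul (contDiff_massDensity.continuous.comp (continuous_pow 2))
      refine (hcont.integrableOn_Icc (a := 0) (b := 1)).of_forall_sdiff_eq_zero measurableSet_Ioi ?_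
      rintro y ⟨hy, hy'⟩
      have : 1 < y := by
        by_contra h
        exact hy' ⟨le_of_lt hy, not_lt.1 h⟩
      rw [massDensity_of_gt (by nlinarith), smul_zero]
    have := MeasureTheory.integral_Ioi_of_hasDerivAt_of_tendsto
      (continuous_const.mul hc).continuousWithinAt hd hint hlim
    rw [this]
    simp [stepFun_of_le]
  rw [h2, Complex.finrank_real_complex]
  have hpi := Real.pi_pos
  simp [MeasureTheory.measureReal_def, Complex.volume_ball]

/-! ### Chords of a segment of curves -/

namespace Quasidoodle

/-- The chord from the point at time `s` to the point at time `t`, on the curve with parameter `τ`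
of the segment from `φ` to `ψ`. -/
noncomputable def chord (φ ψ : Quasidoodle) (τ s t : ℝ) : ℂ :=
  (lin τ φ ψ).toFun t - (lin τ φ ψ).toFun s

/-- The derivative of the chord with respect to the parameter of the segment. -/
noncomputable def chordVel (φ ψ : Quasidoodle) (s t : ℝ) : ℂ :=
  (ψ.toFun t - φ.toFun t) - (ψ.toFun s - φ.toFun s)

section

variable {E : Type*} [NormedAddCommGroup E] [NormedSpace ℝ E] (φ ψ : Quasidoodle)

theorem contDiff_chord {τ s t : E → ℝ} (hτ : ContDiff ℝ 2 τ) (hs : ContDiff ℝ 2 s)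
    (ht : ContDiff ℝ 2 t) : ContDiff ℝ 2 fun x => chord φ ψ (τ x) (s x) (t x) := by
  have h : ∀ χ : Quasidoodle, ContDiff ℝ 2 χ.toFun := fun χ =>
    contDiff_infty.1 χ.smooth 2
  have h1 : ContDiff ℝ 2 fun x => ((1 - τ x : ℝ) : ℂ) :=
    Complex.ofRealCLM.contDiff.comp (contDiff_const.sub hτ)
  have h2 : ContDiff ℝ 2 fun x => ((τ x : ℝ) : ℂ) := Complex.ofRealCLM.contDiff.comp hτ
  exact ((h1.mul ((h φ).comp ht)).add (h2.mul ((h ψ).comp ht))).sub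
    ((h1.mul ((h φ).comp hs)).add (h2.mul ((h ψ).comp hs)))

theorem fderiv_chord {τ s t : E → ℝ} {τ' s' t' : E →L[ℝ] ℝ} {x : E} (hτ : HasFDerivAt τ τ' x)
    (hs : HasFDerivAt s s' x) (ht : HasFDerivAt t t' x) (c : E) :
    fderiv ℝ (fun x => chord φ ψ (τ x) (s x) (t x)) x c =
      (τ' c : ℂ) * chordVel φ ψ (s x) (t x) + (t' c : ℂ) * deriv (lin (τ x) φ ψ).toFun (t x) -
        (s' c : ℂ) * deriv (lin (τ x) φ ψ).toFun (s x) := by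
  have h1 : HasFDerivAt (fun x => ((1 - τ x : ℝ) : ℂ)) _ x :=
    Complex.ofRealCLM.hasFDerivAt.comp x (hτ.const_sub 1)
  have h2 : HasFDerivAt (fun x => ((τ x : ℝ) : ℂ)) _ x := Complex.ofRealCLM.hasFDerivAt.comp x hτ
  have k : ∀ (χ : Quasidoodle) {u : E → ℝ} {u' : E →L[ℝ] ℝ}, HasFDerivAt u u' x →
      HasFDerivAt (fun x => χ.toFun (u x)) _ x := fun χ u u' hu =>
    (χ.hasDerivAt (u x)).hasFDerivAt.comp x hu
  have := ((h1.mul (k φ ht)).add (h2.mul (k ψ ht))).sub ((h1.mul (k φ hs)).add (h2.mul (k ψ hs)))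
  have h3 : HasFDerivAt (fun x => chord φ ψ (τ x) (s x) (t x)) _ x := this
  rw [h3.fderiv]
  simp only [deriv_lin, chordVel]
  simp
  ring

end

/-- The double integral, over pairs of times, of the weight `U` against the pullback of the radial
area form of total mass one under the chord map. -/
noncomputable def chordArea (ψ : Quasidoodle) (U : ℝ → ℝ → ℝ) (b : ℝ) : ℝ :=
  ∫ p in Icc b (b + 1) ×ˢ Icc b (b + 1), U p.1 p.2 *
    (massDensity (Complex.normSq (ψ.toFun p.2 - ψ.toFun p.1)) *
      planeDet (-deriv ψ.toFun p.1) (deriv ψ.toFun p.2))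

/-- The pullback of the radial area form to the parameter of the segment and the end of a chord
starting at time `b`. -/
noncomputable def fanDensity (φ ψ : Quasidoodle) (b : ℝ) (p : ℝ × ℝ) : ℝ :=
  massDensity (Complex.normSq (chord φ ψ p.1 b p.2)) *
    planeDet (chordVel φ ψ b p.2) (deriv (lin p.1 φ ψ).toFun p.2)

/-- A weight that is locally constant at the short chords multiplies the closed area form into a
closed form, so the weighted chord area changes only through the two faces of the square of times
on which a chord starts or ends at the time `b`; these faces contribute equally. -/
theorem chordArea_sub_chordArea (φ ψ : Quasidoodle) {U : ℝ → ℝ → ℝ} {b : ℝ}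
    (hloc : ∀ τ ∈ Icc (0 : ℝ) 1, ∀ s ∈ Icc b (b + 1), ∀ t ∈ Icc b (b + 1),
      1 < ‖chord φ ψ τ s t‖ ∨ ∀ᶠ p : ℝ × ℝ in 𝓝 (s, t), U p.1 p.2 = U s t)
    (h0 : ∀ s ∈ Icc b (b + 1), U s b = 0 ∧ U (b + 1) s = 0)
    (hsymm : ∀ t ∈ Icc b (b + 1), U t (b + 1) = U b t) :
    ψ.chordArea U b - φ.chordArea U b =
      -2 * ∫ p in Icc (0 : ℝ) 1 ×ˢ Icc b (b + 1), U b p.2 * fanDensity φ ψ b p := by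
  set F : (Fin 3 → ℝ) → ℂ := fun x => chord φ ψ (x 0) (x 1) (x 2) with hF
  have hp : ∀ i : Fin 3, ContDiff ℝ 2 fun x : Fin 3 → ℝ => x i := fun i => contDiff_apply ℝ ℝ i
  have hFc : ContDiff ℝ 2 F := contDiff_chord φ ψ (hp 0) (hp 1) (hp 2)
  have hd : ∀ x c, fderiv ℝ F x c = (c 0 : ℂ) * chordVel φ ψ (x 1) (x 2) +
      (c 2 : ℂ) * deriv (lin (x 0) φ ψ).toFun (x 2) -
        (c 1 : ℂ) * deriv (lin (x 0) φ ψ).toFun (x 1) := fun x c =>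
    fderiv_chord φ ψ (hasFDerivAt_apply 0 x) (hasFDerivAt_apply 1 x) (hasFDerivAt_apply 2 x) c
  set e : Fin 3 → Fin 3 → ℝ := fun i => Pi.single i 1 with he
  -- the closed two-form as a divergence free vector field on the box `[0, 1] × [b, b + 1]²`
  set A : Fin 3 → (Fin 3 → ℝ) → ℝ := ![areaPullback F (e 1) (e 2),
    fun x => -areaPullback F (e 0) (e 2) x, areaPullback F (e 0) (e 1)] with hA
  have hAd : ∀ i, Differentiable ℝ (A i) := by
    intro i
    fin_cases i
    · exact differentiable_areaPullback hFc _ _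
    · exact (differentiable_areaPullback hFc _ _).neg
    · exact differentiable_areaPullback hFc _ _
  -- the form vanishes near long chords, which is where the weight may jump
  have hA0 : ∀ x, 1 < ‖F x‖ → ∀ i, A i =ᶠ[𝓝 x] fun _ => 0 := by
    intro x hx i
    filter_upwards [(hFc.continuous.norm.tendsto x).eventually (lt_mem_nhds hx)] with y hy
    have h1 : massDensity (Complex.normSq (F y)) = 0 := by
      apply massDensity_of_gt
      rw [Complex.normSq_eq_norm_sq]
      nlinarith
    fin_cases i <;> simp [hA, areaPullback, h1]
  set lo : Fin 3 → ℝ := ![0, b, b] with hlo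
  set hi : Fin 3 → ℝ := ![1, b + 1, b + 1] with hhi
  have hle : lo ≤ hi := by
    intro i; fin_cases i <;> simp [hlo, hhi]
  have hmem : ∀ x ∈ Icc lo hi, x 0 ∈ Icc (0 : ℝ) 1 ∧ x 1 ∈ Icc b (b + 1) ∧ x 2 ∈ Icc b (b + 1) := by
    rintro x ⟨hx, hx'⟩
    exact ⟨⟨hx 0, hx' 0⟩, ⟨hx 1, hx' 1⟩, ⟨hx 2, hx' 2⟩⟩
  have hder : ∀ x ∈ Icc lo hi, ∀ i, HasFDerivAt (fun x => U (x 1) (x 2) * A i x)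
      (U (x 1) (x 2) • fderiv ℝ (A i) x) x := by
    intro x hx i
    obtain ⟨hx0, hx1, hx2⟩ := hmem x hx
    rcases hloc _ hx0 _ hx1 _ hx2 with h | h
    · have h1 := hA0 x h i
      have h2 : fderiv ℝ (A i) x = 0 := by
        rw [h1.fderiv_eq]; exact fderiv_const_apply _
      rw [h2, smul_zero]
      refine (hasFDerivAt_const (0 : ℝ) x).congr_of_eventuallyEq (h1.mono fun y hy => ?_)
      simp only [hy, mul_zero]
    · refine (((hAd i) x).hasFDerivAt.const_mul (U (x 1) (x 2))).congr_of_eventuallyEq ?_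
      have hc : Tendsto (fun y : Fin 3 → ℝ => (y 1, y 2)) (𝓝 x) (𝓝 (x 1, x 2)) :=
        ((continuous_apply 1).prodMk (continuous_apply 2)).tendsto x
      filter_upwards [hc.eventually h] with y hy
      rw [hy]
  have hdiv : ∀ x, ∑ i, (U (x 1) (x 2) • fderiv ℝ (A i) x) (e i) = 0 := by
    intro x
    have h1 := areaPullback_closed hFc (e 0) (e 1) (e 2) x
    have h2 : fderiv ℝ (A 1) x = -fderiv ℝ (areaPullback F (e 0) (e 2)) x := by
      exact fderiv_fun_neg
    rw [Fin.sum_univ_three, h2]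
    change U (x 1) (x 2) * fderiv ℝ (areaPullback F (e 1) (e 2)) x (e 0) +
      U (x 1) (x 2) * -fderiv ℝ (areaPullback F (e 0) (e 2)) x (e 1) +
      U (x 1) (x 2) * fderiv ℝ (areaPullback F (e 0) (e 1)) x (e 2) = 0
    linear_combination U (x 1) (x 2) * h1
  have key := MeasureTheory.integral_divergence_of_hasFDerivAt_off_countable' lo hi hle
    (fun i x => U (x 1) (x 2) * A i x) (fun i x => U (x 1) (x 2) • fderiv ℝ (A i) x) ∅
    countable_empty (fun i x hx => (hder x hx i).continuousAt.continuousWithinAt)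
    (fun x hx i => hder x (by
      rw [sdiff_empty] at hx
      exact ⟨fun j => (hx j trivial).1.le, fun j => (hx j trivial).2.le⟩) i)
    (by
      have : (fun x => ∑ i, (U (x 1) (x 2) • fderiv ℝ (A i) x) (Pi.single i 1)) = fun _ => 0 :=
        funext hdiv
      rw [this]
      exact MeasureTheory.integrableOn_zero)
  have hdiv' : (fun x => ∑ i, (U (x 1) (x 2) • fderiv ℝ (A i) x) (Pi.single i 1)) = fun _ => 0 :=
    funext hdiv
  rw [hdiv', MeasureTheory.integral_zero, Fin.sum_univ_three] at key
  have hd0 : ∀ x, fderiv ℝ F x (e 0) = chordVel φ ψ (x 1) (x 2) := by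
    intro x; rw [hd]; simp [he]
  have hd1 : ∀ x, fderiv ℝ F x (e 1) = -deriv (lin (x 0) φ ψ).toFun (x 1) := by
    intro x; rw [hd]; simp [he]
  have hd2 : ∀ x, fderiv ℝ F x (e 2) = deriv (lin (x 0) φ ψ).toFun (x 2) := by
    intro x; rw [hd]; simp [he]
  -- the faces of the box: two curves, and the fans of chords that start or end at a fixed time
  have f0 : ∀ c : ℝ, (∫ x : Fin 2 → ℝ in Icc (lo ∘ Fin.succAbove 0) (hi ∘ Fin.succAbove 0),
      U (Fin.insertNth (α := fun _ : Fin 3 => ℝ) 0 c x 1)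
        (Fin.insertNth (α := fun _ : Fin 3 => ℝ) 0 c x 2) * A 0 (Fin.insertNth 0 c x)) =
      (lin c φ ψ).chordArea U b := by
    intro c
    refine Eq.trans ?_ (integral_Icc_fin_two (fun s t => U s t *
      (massDensity (Complex.normSq ((lin c φ ψ).toFun t - (lin c φ ψ).toFun s)) *
      planeDet (-deriv (lin c φ ψ).toFun s) (deriv (lin c φ ψ).toFun t)))
      (lo ∘ Fin.succAbove 0) (hi ∘ Fin.succAbove 0))
    refine MeasureTheory.integral_congr_ae (Eventually.of_forall fun x => ?_)
    change U (x 0) (x 1) * areaPullback F (e 1) (e 2) (Fin.insertNth 0 c x) = _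
    rw [areaPullback, hd1, hd2]
    rfl
  have f1 : ∀ c : ℝ, (∫ x : Fin 2 → ℝ in Icc (lo ∘ Fin.succAbove 1) (hi ∘ Fin.succAbove 1),
      U (Fin.insertNth (α := fun _ : Fin 3 => ℝ) 1 c x 1)
        (Fin.insertNth (α := fun _ : Fin 3 => ℝ) 1 c x 2) * A 1 (Fin.insertNth 1 c x)) =
      ∫ p in Icc (0 : ℝ) 1 ×ˢ Icc b (b + 1), -(U c p.2 * fanDensity φ ψ c p) := by
    intro c
    refine Eq.trans ?_ (integral_Icc_fin_two (fun τ t => -(U c t * fanDensity φ ψ c (τ, t)))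
      (lo ∘ Fin.succAbove 1) (hi ∘ Fin.succAbove 1))
    refine MeasureTheory.integral_congr_ae (Eventually.of_forall fun x => ?_)
    change U c (x 1) * -areaPullback F (e 0) (e 2) (Fin.insertNth 1 c x) = _
    rw [areaPullback, hd0, hd2, mul_neg]
    rfl
  have f2 : ∀ c : ℝ, (∫ x : Fin 2 → ℝ in Icc (lo ∘ Fin.succAbove 2) (hi ∘ Fin.succAbove 2),
      U (Fin.insertNth (α := fun _ : Fin 3 => ℝ) 2 c x 1)
        (Fin.insertNth (α := fun _ : Fin 3 => ℝ) 2 c x 2) * A 2 (Fin.insertNth 2 c x)) =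
      ∫ p in Icc (0 : ℝ) 1 ×ˢ Icc b (b + 1), U p.2 c * fanDensity φ ψ c p := by
    intro c
    refine Eq.trans ?_ (integral_Icc_fin_two (fun τ t => U t c * fanDensity φ ψ c (τ, t))
      (lo ∘ Fin.succAbove 2) (hi ∘ Fin.succAbove 2))
    refine MeasureTheory.integral_congr_ae (Eventually.of_forall fun x => ?_)
    change U (x 1) c * areaPullback F (e 0) (e 1) (Fin.insertNth 2 c x) = _
    rw [areaPullback, hd0, hd1]
    change _ * (massDensity (Complex.normSq (chord φ ψ (x 0) (x 1) c)) *
      planeDet (chordVel φ ψ (x 1) c) (-deriv (lin (x 0) φ ψ).toFun (x 1))) = 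
      _ * (massDensity (Complex.normSq (chord φ ψ (x 0) c (x 1))) *
      planeDet (chordVel φ ψ c (x 1)) (deriv (lin (x 0) φ ψ).toFun (x 1)))
    have e1 : chord φ ψ (x 0) (x 1) c = -chord φ ψ (x 0) c (x 1) := by simp [chord]
    have e2 : chordVel φ ψ (x 1) c = -chordVel φ ψ c (x 1) := by simp [chordVel]
    rw [e1, e2, Complex.normSq_neg]
    simp [planeDet]
  have hv1 : hi 1 = b + 1 := rfl
  have hv2 : hi 2 = b + 1 := rfl
  have hv3 : lo 1 = b := rfl
  have hv4 : lo 2 = b := rfl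
  have hv5 : hi 0 = 1 := rfl
  have hv6 : lo 0 = 0 := rfl
  rw [f0, f0, f1, f1, f2, f2, hv1, hv2, hv3, hv4, hv5, hv6, lin_one, lin_zero] at key
  have hmeas : MeasurableSet (Icc (0 : ℝ) 1 ×ˢ Icc b (b + 1)) := measurableSet_Icc.prod measurableSet_Icc
  -- of the four fans two carry weight zero, and the other two agree by periodicity
  have z1 : ∫ p in Icc (0 : ℝ) 1 ×ˢ Icc b (b + 1), -(U (b + 1) p.2 * fanDensity φ ψ (b + 1) p) = 0 := by
    refine MeasureTheory.setIntegral_eq_zero_of_forall_eq_zero fun p hp => ?_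
    rw [(h0 _ hp.2).2, zero_mul, neg_zero]
  have z2 : ∫ p in Icc (0 : ℝ) 1 ×ˢ Icc b (b + 1), U p.2 b * fanDensity φ ψ b p = 0 := by
    refine MeasureTheory.setIntegral_eq_zero_of_forall_eq_zero fun p hp => ?_
    rw [(h0 _ hp.2).1, zero_mul]
  have z3 : ∫ p in Icc (0 : ℝ) 1 ×ˢ Icc b (b + 1), U p.2 (b + 1) * fanDensity φ ψ (b + 1) p =
      ∫ p in Icc (0 : ℝ) 1 ×ˢ Icc b (b + 1), U b p.2 * fanDensity φ ψ b p := by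
    refine MeasureTheory.setIntegral_congr_fun hmeas fun p hp => ?_
    simp only [hsymm _ hp.2, fanDensity, chord, chordVel, Quasidoodle.periodic _ b]
  rw [z1, z2, z3, MeasureTheory.integral_neg] at key
  linarith

theorem angDensity_mul_planeDet {z w : ℂ} (hz : 1 < ‖z‖) :
    angDensity (Complex.normSq z) * planeDet z w = (2 * Real.pi)⁻¹ * (w / z).im := by
  have h : 1 < Complex.normSq z := by
    rw [Complex.normSq_eq_norm_sq]; nlinarith
  rw [angDensity_of_ge h.le, Complex.div_im, planeDet]
  have hpi := Real.pi_pos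
  field_simp

/-- The integral of the angular form over the chords from `b` that avoid a neighbourhood of `b`. -/
theorem integral_angVel_away (ψ : Quasidoodle) {b r : ℝ} {v : ℂ} (hr : 0 < r)
    (hv : ∀ s ∈ Icc (b - r) (b + r), 0 < (deriv ψ.toFun s / v).re)
    (hoff : ∀ t ∈ Icc (b + r) (b + 1 - r), ψ.toFun t ≠ ψ.toFun b) (hr' : r ≤ 1 / 2) :
    ∫ t in (b + r)..(b + 1 - r), ψ.angVel (ψ.toFun b) t = 2 * Real.pi * ψ.ind (ψ.toFun b) -
      (Complex.arg ((ψ.toFun (b + r) - ψ.toFun b) / v) -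
        Complex.arg (-((ψ.toFun (b - r) - ψ.toFun b) / v))) := by
  obtain ⟨h1, h2⟩ := integral_angVel_of_isSide
    (isSide_of_mem (v := v) (show b ∈ Ioo (b - r) (b + r) by constructor <;> linarith)) hv
  have h3 : IntervalIntegrable (ψ.angVel (ψ.toFun b)) MeasureTheory.volume (b + r) (b + 1 - r) := by
    apply ContinuousOn.intervalIntegrable
    rw [uIcc_of_le (by linarith)]
    exact Complex.continuous_im.comp_continuousOn (ψ.continuous_deriv.continuousOn.div
      (ψ.continuous_toFun.sub continuous_const).continuousOn
      fun t ht => sub_ne_zero.2 (hoff t ht))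
  have h4 := intervalIntegral.integral_add_adjacent_intervals h1 h3
  have h5 := ind_eq_integral ψ (ψ.toFun b) (b - r)
  rw [show b - r + 1 = b + 1 - r by ring, ← h4, h2] at h5
  have hpi := Real.pi_pos
  rw [h5]
  field_simp
  ring

/-- If the chords from `b` are long for both ends of the segment, the degree of the fan of chords
from `b` is the change of the index of the point at time `b`. -/
theorem integral_fanDensity (φ ψ : Quasidoodle) {b r : ℝ} {v : ℂ} (hr : 0 < r) (hr' : r ≤ 1 / 2)
    (hv : ∀ τ ∈ Icc (0 : ℝ) 1, ∀ s ∈ Icc (b - r) (b + r), 0 < (deriv (lin τ φ ψ).toFun s / v).re)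
    (hend : ∀ τ ∈ Icc (0 : ℝ) 1, 1 < ‖chord φ ψ τ b (b + r)‖ ∧ 1 < ‖chord φ ψ τ b (b + 1 - r)‖)
    (hface : ∀ t ∈ Icc (b + r) (b + 1 - r), 1 < ‖chord φ ψ 0 b t‖ ∧ 1 < ‖chord φ ψ 1 b t‖) :
    ∫ p in Icc (0 : ℝ) 1 ×ˢ Icc (b + r) (b + 1 - r), fanDensity φ ψ b p =
      ψ.ind (ψ.toFun b) - φ.ind (φ.toFun b) := by
  set G : ℝ × ℝ → ℂ := fun p => chord φ ψ p.1 b p.2 with hG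
  have hGc : ContDiff ℝ 2 G := contDiff_chord φ ψ contDiff_fst contDiff_const contDiff_snd
  have hd : ∀ x c, fderiv ℝ G x c = (c.1 : ℂ) * chordVel φ ψ b x.2 +
      (c.2 : ℂ) * deriv (lin x.1 φ ψ).toFun x.2 := by
    intro x c
    have := fderiv_chord φ ψ (x := x) hasFDerivAt_fst (hasFDerivAt_const b x) hasFDerivAt_snd c
    rw [hG, this]
    simp
  have hfan : ∀ p, fanDensity φ ψ b p = areaPullback G (1, 0) (0, 1) p := by
    intro p
    rw [areaPullback, hd, hd]
    simp [fanDensity, hG]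
  have hJ1 : Differentiable ℝ (anglePullback G (0, 1)) := differentiable_anglePullback hGc _
  have hJ0 : Differentiable ℝ (fun x => -anglePullback G (1, 0) x) :=
    (differentiable_anglePullback hGc _).neg
  have hdiv : ∀ x, fderiv ℝ (anglePullback G (0, 1)) x (1, 0) +
      fderiv ℝ (fun x => -anglePullback G (1, 0) x) x (0, 1) = fanDensity φ ψ b x := by
    intro x
    rw [hfan, ← anglePullback_deriv hGc, fderiv_fun_neg]
    simp [sub_eq_add_neg]
  -- Green's formula turns the integral over the rectangle into one over its boundary
  have key := MeasureTheory.integral_divergence_prod_Icc_of_hasFDerivAt_of_le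
    (anglePullback G (0, 1)) (fun x => -anglePullback G (1, 0) x) _ _ (0, b + r) (1, b + 1 - r)
    (by constructor <;> (simp; try linarith)) hJ1.continuous.continuousOn hJ0.continuous.continuousOn
    (fun x _ => (hJ1 x).hasFDerivAt) (fun x _ => (hJ0 x).hasFDerivAt) (by
      simp only [hdiv]
      refine Continuous.integrableOn_Icc ?_
      rw [funext hfan]
      exact continuous_areaPullback hGc _ _)
  simp only [hdiv] at key
  rw [Icc_prod_Icc, key]
  have hre := fun τ hτ => re_endpoints_pos hr (hv τ hτ)
  -- on the sides where the end of the chord is fixed, the direction of the chord stays in a half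
  -- plane, so the angle is a difference of arguments
  have side : ∀ (u : ℂ) (t : ℝ), (∀ τ ∈ Icc (0 : ℝ) 1, 1 < ‖chord φ ψ τ b t‖ ∧
      0 < (u * chord φ ψ τ b t).re) → ∫ x in (0 : ℝ)..1, -anglePullback G (1, 0) (x, t) =
      -((2 * Real.pi)⁻¹ * (Complex.arg (u * chord φ ψ 1 b t) - Complex.arg (u * chord φ ψ 0 b t))) := by
    intro u t ht
    have h1 : ∀ τ : ℝ, HasDerivAt (fun τ => chord φ ψ τ b t) (chordVel φ ψ b t) τ := by
      intro τ
      have h2 : (fun τ : ℝ => chord φ ψ τ b t) =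
          fun τ : ℝ => chord φ ψ 0 b t + (τ : ℂ) * chordVel φ ψ b t := by
        funext τ
        simp only [chord, chordVel, lin_toFun]
        push_cast; ring
      rw [h2]
      simpa using (((hasDerivAt_id τ).ofReal_comp).mul_const (chordVel φ ψ b t)).const_add
        (chord φ ψ 0 b t)
    have h3 := (integral_im_div_of_mem_slitPlane (u := u) (a := 0) (c := 1) h1 continuous_const
      (by
        rw [uIcc_of_le zero_le_one]
        exact fun τ hτ => Or.inl (ht τ hτ).2)).2
    rw [intervalIntegral.integral_neg, ← h3, ← intervalIntegral.integral_const_mul]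
    congr 1
    refine intervalIntegral.integral_congr fun τ hτ => ?_
    rw [uIcc_of_le zero_le_one] at hτ
    simp only [anglePullback, hd]
    rw [show G (τ, t) = chord φ ψ τ b t from rfl]
    simpa using angDensity_mul_planeDet (w := chordVel φ ψ b t) (ht τ hτ).1
  -- on the other two sides one curve is fixed, and the angle swept is computed by its index
  have face : ∀ c : ℝ, (∀ t ∈ Icc (b + r) (b + 1 - r), 1 < ‖chord φ ψ c b t‖) →
      ∫ y in (b + r)..(b + 1 - r), anglePullback G (0, 1) (c, y) =
      (2 * Real.pi)⁻¹ * ∫ y in (b + r)..(b + 1 - r), (lin c φ ψ).angVel ((lin c φ ψ).toFun b) y := by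
    intro c hc
    rw [← intervalIntegral.integral_const_mul]
    refine intervalIntegral.integral_congr fun t ht => ?_
    rw [uIcc_of_le (by linarith)] at ht
    simp only [anglePullback, hd]
    rw [show G (c, t) = chord φ ψ c b t from rfl]
    simpa [angVel, chord] using angDensity_mul_planeDet (w := deriv (lin c φ ψ).toFun t) (hc t ht)
  have hne : ∀ c t : ℝ, 1 < ‖chord φ ψ c b t‖ → (lin c φ ψ).toFun t ≠ (lin c φ ψ).toFun b := by
    intro c t h he
    rw [chord, he, sub_self, norm_zero] at h
    linarith
  have hper : ∀ τ : ℝ, chord φ ψ τ b (b + 1 - r) = (lin τ φ ψ).toFun (b - r) - (lin τ φ ψ).toFun b := by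
    intro τ
    rw [chord, show b + 1 - r = b - r + 1 by ring, (lin τ φ ψ).periodic]
  rw [side v⁻¹ (b + r) (fun τ hτ => ⟨(hend τ hτ).1, by
      rw [mul_comm, ← div_eq_mul_inv]; exact (hre τ hτ).1⟩),
    side (-v⁻¹) (b + 1 - r) (fun τ hτ => ⟨(hend τ hτ).2, by
      rw [hper, mul_comm, mul_neg, ← div_eq_mul_inv]; exact (hre τ hτ).2⟩),
    face 0 (fun t ht => (hface t ht).1), face 1 (fun t ht => (hface t ht).2),
    integral_angVel_away _ hr (hv 0 (by simp)) (fun t ht => hne 0 t (hface t ht).1) hr',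
    integral_angVel_away _ hr (hv 1 (by simp)) (fun t ht => hne 1 t (hface t ht).2) hr']
  have e1 : ∀ τ : ℝ, v⁻¹ * chord φ ψ τ b (b + r) =
      ((lin τ φ ψ).toFun (b + r) - (lin τ φ ψ).toFun b) / v := fun τ => by
    rw [chord, mul_comm, div_eq_mul_inv]
  have e2 : ∀ τ : ℝ, -v⁻¹ * chord φ ψ τ b (b + 1 - r) =
      -(((lin τ φ ψ).toFun (b - r) - (lin τ φ ψ).toFun b) / v) := fun τ => by
    rw [hper]; ring
  simp only [e1, e2, lin_zero, lin_one]
  have hpi := Real.pi_pos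
  field_simp
  ring

/-- If the weight is the constant `K` at the short chords from `b`, the change of the weighted chord
area is determined by the change of the index of the point at time `b`. -/
theorem chordArea_sub_chordArea_eq_ind (φ ψ : Quasidoodle) {U : ℝ → ℝ → ℝ} {b r K : ℝ} {v : ℂ}
    (hloc : ∀ τ ∈ Icc (0 : ℝ) 1, ∀ s ∈ Icc b (b + 1), ∀ t ∈ Icc b (b + 1),
      1 < ‖chord φ ψ τ s t‖ ∨ ∀ᶠ p : ℝ × ℝ in 𝓝 (s, t), U p.1 p.2 = U s t)
    (h0 : ∀ s ∈ Icc b (b + 1), U s b = 0 ∧ U (b + 1) s = 0)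
    (hsymm : ∀ t ∈ Icc b (b + 1), U t (b + 1) = U b t) (hr : 0 < r) (hr' : r ≤ 1 / 2)
    (hv : ∀ τ ∈ Icc (0 : ℝ) 1, ∀ s ∈ Icc (b - r) (b + r), 0 < (deriv (lin τ φ ψ).toFun s / v).re)
    (hend : ∀ τ ∈ Icc (0 : ℝ) 1, 1 < ‖chord φ ψ τ b (b + r)‖ ∧ 1 < ‖chord φ ψ τ b (b + 1 - r)‖)
    (hface : ∀ t ∈ Icc (b + r) (b + 1 - r), 1 < ‖chord φ ψ 0 b t‖ ∧ 1 < ‖chord φ ψ 1 b t‖)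
    (hK : ∀ τ ∈ Icc (0 : ℝ) 1, ∀ t ∈ Icc (b + r) (b + 1 - r), 1 < ‖chord φ ψ τ b t‖ ∨ U b t = K)
    (hK0 : ∀ τ ∈ Icc (0 : ℝ) 1, ∀ t ∈ Icc b (b + 1), t ∉ Icc (b + r) (b + 1 - r) →
      1 < ‖chord φ ψ τ b t‖ ∨ U b t = 0) :
    ψ.chordArea U b - φ.chordArea U b =
      -2 * (K * (ψ.ind (ψ.toFun b) - φ.ind (φ.toFun b))) := by
  rw [chordArea_sub_chordArea φ ψ hloc h0 hsymm, ← integral_fanDensity φ ψ hr hr' hv hend hface]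
  congr 1
  rw [← MeasureTheory.integral_const_mul]
  have hz : ∀ p : ℝ × ℝ, 1 < ‖chord φ ψ p.1 b p.2‖ → fanDensity φ ψ b p = 0 := by
    intro p hp
    rw [fanDensity, massDensity_of_gt, zero_mul]
    rw [Complex.normSq_eq_norm_sq]; nlinarith
  have hsub : Icc (0 : ℝ) 1 ×ˢ Icc (b + r) (b + 1 - r) ⊆ Icc (0 : ℝ) 1 ×ˢ Icc b (b + 1) :=
    prod_mono_right (Icc_subset_Icc (by linarith) (by linarith))
  refine (MeasureTheory.setIntegral_eq_of_subset_of_forall_sdiff_eq_zero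
    (measurableSet_Icc.prod measurableSet_Icc) hsub ?_).trans
    (MeasureTheory.setIntegral_congr_fun (measurableSet_Icc.prod measurableSet_Icc) ?_)
  · rintro p ⟨hp, hp'⟩
    rcases hK0 p.1 hp.1 p.2 hp.2 fun h => hp' ⟨hp.1, h⟩ with h | h
    · rw [hz p h, mul_zero]
    · rw [h, zero_mul]
  · intro p hp
    rcases hK p.1 hp.1 p.2 hp.2 with h | h
    · simp only [hz p h, mul_zero]
    · simp only [h]

end Quasidoodle

/-! ### The local degree of the chord map -/

theorem integral_massDensity_prod :
    ∫ p : ℝ × ℝ, massDensity (p.1 ^ 2 + p.2 ^ 2) = 1 := by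
  rw [← integral_massDensity, ← Complex.volume_preserving_equiv_real_prod.integral_comp
    Complex.measurableEquivRealProd.measurableEmbedding]
  congr 1
  funext z
  simp [Complex.normSq_apply, sq]

namespace Quasidoodle

/-- Dilation of the plane by the factor `l`. -/
noncomputable def scale (l : ℝ) (ψ : Quasidoodle) : Quasidoodle where
  toFun s := l * ψ.toFun s
  smooth := contDiff_const.mul ψ.smooth
  periodic s := by simp only [ψ.periodic s]

theorem scale_toFun (l : ℝ) (ψ : Quasidoodle) (s : ℝ) : (scale l ψ).toFun s = l * ψ.toFun s := rfl

theorem deriv_scale (l : ℝ) (ψ : Quasidoodle) (s : ℝ) :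
    deriv (scale l ψ).toFun s = l * deriv ψ.toFun s :=
  ((ψ.hasDerivAt s).const_mul _).deriv

theorem ind_scale {l : ℝ} (hl : l ≠ 0) (ψ : Quasidoodle) (p : ℂ) :
    (scale l ψ).ind (l * p) = ψ.ind p := by
  have hl' : (l : ℂ) ≠ 0 := by exact_mod_cast hl
  simp only [ind, deriv_scale, scale_toFun, ← mul_sub, mul_div_mul_left _ _ hl']

theorem lin_scale (l τ : ℝ) (φ ψ : Quasidoodle) :
    lin τ (scale l φ) (scale l ψ) = scale l (lin τ φ ψ) :=
  ext_toFun fun s => by simp only [lin_toFun, scale_toFun]; ring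

/-- The part of a transverse rectangle of chords in which the chords cover the unit disc once. -/
theorem integral_rectangle_chord (ψ : Quasidoodle) {A B : Set ℝ} (hA : A.OrdConnected)
    (hB : B.OrdConnected) {σ : SignType} (hσ0 : σ ≠ 0)
    (hσ : ∀ s ∈ A, ∀ t ∈ B, SignType.sign (planeDet (deriv ψ.toFun s) (deriv ψ.toFun t)) = σ)
    (hsurj : ∀ w : ℂ, ‖w‖ ≤ 1 → ∃ s ∈ A, ∃ t ∈ B, ψ.toFun t - ψ.toFun s = w) :
    ∫ p in A ×ˢ B, massDensity (Complex.normSq (ψ.toFun p.2 - ψ.toFun p.1)) *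
      planeDet (-deriv ψ.toFun p.1) (deriv ψ.toFun p.2) = -(σ : ℝ) := by
  set f : ℝ × ℝ → ℝ × ℝ := fun p =>
    ((ψ.toFun p.2 - ψ.toFun p.1).re, (ψ.toFun p.2 - ψ.toFun p.1).im) with hf
  set f' : ℝ × ℝ → (ℝ × ℝ →L[ℝ] ℝ × ℝ) := fun p =>
    (Matrix.toLin (.finTwoProd ℝ) (.finTwoProd ℝ)
      !![-(deriv ψ.toFun p.1).re, (deriv ψ.toFun p.2).re;
        -(deriv ψ.toFun p.1).im, (deriv ψ.toFun p.2).im]).toContinuousLinearMap with hf'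
  have hmeas : MeasurableSet (A ×ˢ B) := hA.measurableSet.prod hB.measurableSet
  have hdet : ∀ p, (f' p).det = planeDet (-deriv ψ.toFun p.1) (deriv ψ.toFun p.2) := by
    intro p
    simp only [hf', LinearMap.det_toContinuousLinearMap, LinearMap.det_toLin, Matrix.det_fin_two_of,
      planeDet, Complex.neg_re, Complex.neg_im]
    ring
  have hder : ∀ p ∈ A ×ˢ B, HasFDerivWithinAt f (f' p) (A ×ˢ B) p := by
    intro p _
    apply HasFDerivAt.hasFDerivWithinAt
    simp only [hf']
    rw [Matrix.toLin_finTwoProd_toContinuousLinearMap]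
    have k1 : ∀ s, HasDerivAt (fun s => (ψ.toFun s).re) (deriv ψ.toFun s).re s := fun s =>
      Complex.reCLM.hasFDerivAt.comp_hasDerivAt s (ψ.hasDerivAt s)
    have k2 : ∀ s, HasDerivAt (fun s => (ψ.toFun s).im) (deriv ψ.toFun s).im s := fun s =>
      Complex.imCLM.hasFDerivAt.comp_hasDerivAt s (ψ.hasDerivAt s)
    refine HasFDerivAt.prodMk ?_ ?_
    · have := ((k1 p.2).comp_hasFDerivAt p (hasFDerivAt_snd (𝕜 := ℝ) (E := ℝ) (F := ℝ))).sub
        ((k1 p.1).comp_hasFDerivAt p (hasFDerivAt_fst (𝕜 := ℝ) (E := ℝ) (F := ℝ)))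
      refine (this.congr_of_eventuallyEq (Eventually.of_forall fun q => ?_)).congr_fderiv ?_
      · simp
      · ext <;> simp
    · have := ((k2 p.2).comp_hasFDerivAt p (hasFDerivAt_snd (𝕜 := ℝ) (E := ℝ) (F := ℝ))).sub
        ((k2 p.1).comp_hasFDerivAt p (hasFDerivAt_fst (𝕜 := ℝ) (E := ℝ) (F := ℝ)))
      refine (this.congr_of_eventuallyEq (Eventually.of_forall fun q => ?_)).congr_fderiv ?_
      · simp
      · ext <;> simp
  have hne : ∀ s ∈ A, ∀ t ∈ B, planeDet (deriv ψ.toFun s) (deriv ψ.toFun t) ≠ 0 := by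
    intro s hs t ht h
    have := hσ s hs t ht
    rw [h, sign_zero] at this
    exact hσ0 this.symm
  -- the chord map is injective with Jacobian of constant sign, and its image contains the unit
  -- disc, which carries the whole mass
  have hinj : InjOn f (A ×ˢ B) := by
    rintro ⟨s, t⟩ ⟨hs, ht⟩ ⟨s', t'⟩ ⟨hs', ht'⟩ he
    simp only [hf, Prod.mk.injEq] at he
    obtain ⟨h1, h2⟩ := injective_sub_of_planeDet_ne_zero hA hB hne hs hs' ht ht'
      (Complex.ext he.1 he.2)
    exact Prod.ext h1 h2
  have key := MeasureTheory.integral_image_eq_integral_abs_det_fderiv_smul MeasureTheory.volume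
    hmeas hder hinj (fun p => massDensity (p.1 ^ 2 + p.2 ^ 2))
  have hz : ∀ p, p ∉ f '' (A ×ˢ B) → massDensity (p.1 ^ 2 + p.2 ^ 2) = 0 := by
    intro p hp
    apply massDensity_of_gt
    by_contra hle
    obtain ⟨s, hs, t, ht, h⟩ := hsurj ⟨p.1, p.2⟩ (by
      rw [← abs_of_nonneg (norm_nonneg _), ← sq_le_one_iff_abs_le_one, ← Complex.normSq_eq_norm_sq,
        Complex.normSq_mk]
      nlinarith)
    exact hp ⟨(s, t), ⟨hs, ht⟩, by simp only [hf, h]⟩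
  rw [MeasureTheory.setIntegral_eq_integral_of_forall_compl_eq_zero hz, integral_massDensity_prod]
    at key
  have hint : ∫ p in A ×ˢ B, massDensity (Complex.normSq (ψ.toFun p.2 - ψ.toFun p.1)) *
      planeDet (-deriv ψ.toFun p.1) (deriv ψ.toFun p.2) = ∫ p in A ×ˢ B,
        -(σ : ℝ) * |(f' p).det| • massDensity ((f p).1 ^ 2 + (f p).2 ^ 2) := by
    refine MeasureTheory.setIntegral_congr_fun hmeas fun p hp => ?_
    have h1 : planeDet (-deriv ψ.toFun p.1) (deriv ψ.toFun p.2) = -(σ : ℝ) * |(f' p).det| := by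
      rw [hdet]
      have h2 : planeDet (-deriv ψ.toFun p.1) (deriv ψ.toFun p.2) =
        -planeDet (deriv ψ.toFun p.1) (deriv ψ.toFun p.2) := by simp [planeDet]; ring
      rw [h2, abs_neg, neg_mul, ← hσ _ hp.1 _ hp.2, sign_mul_abs]
    have h3 : Complex.normSq (ψ.toFun p.2 - ψ.toFun p.1) = (f p).1 ^ 2 + (f p).2 ^ 2 := by
      simp only [hf, Complex.normSq_apply]; ring
    simp only [h1, h3, smul_eq_mul]
    ring
  rw [hint, MeasureTheory.integral_const_mul, ← key, mul_one]

/-- After a strong dilation the weighted chord area counts the crossings with their signs and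
weights. -/
theorem eventually_chordArea_scale (ψ : Quasidoodle) {U : ℝ → ℝ → ℝ} {b : ℝ}
    (P : Finset (ℝ × ℝ)) (hP : ∀ p ∈ P, p.1 ∈ Ioo b (b + 1) ∧ p.2 ∈ Ioo b (b + 1) ∧
      ψ.toFun p.1 = ψ.toFun p.2 ∧ planeDet (deriv ψ.toFun p.1) (deriv ψ.toFun p.2) ≠ 0 ∧
      ∀ᶠ q : ℝ × ℝ in 𝓝 p, U q.1 q.2 = U p.1 p.2)
    (hU : ∀ p ∈ Icc b (b + 1) ×ˢ Icc b (b + 1), p ∉ P → ψ.toFun p.1 = ψ.toFun p.2 →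
      ∀ᶠ q : ℝ × ℝ in 𝓝 p, U q.1 q.2 = 0) :
    ∀ᶠ l : ℝ in atTop, (scale l ψ).chordArea U b = ∑ p ∈ P, U p.1 p.2 *
      -((SignType.sign (planeDet (deriv ψ.toFun p.1) (deriv ψ.toFun p.2)) : SignType) : ℝ) := by
  set Q : ℝ → ℝ × ℝ → Set (ℝ × ℝ) := fun r p =>
    Icc (p.1 - r) (p.1 + r) ×ˢ Icc (p.2 - r) (p.2 + r) with hQ
  have hQball : ∀ r p, Q r p = Metric.closedBall p r := fun r p => by
    rw [hQ, ← closedBall_prod_same, Real.closedBall_eq_Icc, Real.closedBall_eq_Icc]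
  -- the size of the rectangles around the crossings
  obtain ⟨r, hr, hr1, hr2, hr3, hr4⟩ : ∃ r > 0, (∀ p ∈ P, Q r p ⊆ Icc b (b + 1) ×ˢ Icc b (b + 1)) ∧
      (∀ p ∈ P, ∀ q ∈ Q r p, U q.1 q.2 = U p.1 p.2) ∧
      (∀ p ∈ P, ∀ q ∈ P, p ≠ q → Disjoint (Q r p) (Q r q)) ∧
      ∀ p ∈ P, ∀ s ∈ Icc (p.1 - r) (p.1 + r), ∀ t ∈ Icc (p.2 - r) (p.2 + r),
        SignType.sign (planeDet (deriv ψ.toFun s) (deriv ψ.toFun t)) =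
          SignType.sign (planeDet (deriv ψ.toFun p.1) (deriv ψ.toFun p.2)) := by
    have small : ∀ {p : ℝ × ℝ} {V : Set (ℝ × ℝ)}, V ∈ 𝓝 p → ∀ᶠ r in 𝓝[>] (0 : ℝ), Q r p ⊆ V := by
      intro p V hV
      obtain ⟨ε, hε, h⟩ := Metric.nhds_basis_closedBall.mem_iff.1 hV
      filter_upwards [Ioc_mem_nhdsGT hε] with r hr
      rw [hQball]
      exact (Metric.closedBall_subset_closedBall hr.2).trans h
    have e1 : ∀ᶠ r in 𝓝[>] (0 : ℝ), ∀ p ∈ P, Q r p ⊆ Icc b (b + 1) ×ˢ Icc b (b + 1) := by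
      rw [Filter.eventually_all_finset]
      intro p hp
      exact small (prod_mem_nhds (Icc_mem_nhds (hP p hp).1.1 (hP p hp).1.2)
        (Icc_mem_nhds (hP p hp).2.1.1 (hP p hp).2.1.2))
    have e2 : ∀ᶠ r in 𝓝[>] (0 : ℝ), ∀ p ∈ P, ∀ q ∈ Q r p, U q.1 q.2 = U p.1 p.2 := by
      rw [Filter.eventually_all_finset]
      exact fun p hp => small (hP p hp).2.2.2.2
    have e3 : ∀ᶠ r in 𝓝[>] (0 : ℝ), ∀ p ∈ P, ∀ q ∈ P, p ≠ q → Disjoint (Q r p) (Q r q) := by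
      rw [Filter.eventually_all_finset]
      intro p hp
      rw [Filter.eventually_all_finset]
      intro q hq
      by_cases hpq : p = q
      · exact Eventually.of_forall fun r h => absurd hpq h
      · obtain ⟨V, W, hV, hW, hVW⟩ := t2_separation_nhds hpq
        filter_upwards [small hV, small hW] with r h1 h2 _
        exact hVW.mono h1 h2
    have e4 : ∀ᶠ r in 𝓝[>] (0 : ℝ), ∀ p ∈ P, ∀ s ∈ Icc (p.1 - r) (p.1 + r),
        ∀ t ∈ Icc (p.2 - r) (p.2 + r), SignType.sign (planeDet (deriv ψ.toFun s) (deriv ψ.toFun t)) =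
          SignType.sign (planeDet (deriv ψ.toFun p.1) (deriv ψ.toFun p.2)) := by
      rw [Filter.eventually_all_finset]
      intro p hp
      obtain ⟨ρ, hρ, h⟩ := exists_sign_planeDet_eq (hP p hp).2.2.2.1
      have h' := eventually_self h
      filter_upwards [Ioc_mem_nhdsGT hρ] with r hr s hs t ht
      exact h' s (Icc_subset_Icc (by linarith [hr.2]) (by linarith [hr.2]) hs) t
        (Icc_subset_Icc (by linarith [hr.2]) (by linarith [hr.2]) ht)
    obtain ⟨r, ⟨h1, h2, h3, h4⟩, h5⟩ :=
      ((e1.and (e2.and (e3.and e4))).and self_mem_nhdsWithin).exists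
    exact ⟨r, h5, h1, h2, h3, h4⟩
  -- after dilation, the chords in each rectangle cover the unit disc
  have hsurj : ∀ᶠ l : ℝ in atTop, ∀ p ∈ P, ∀ w : ℂ, ‖w‖ ≤ 1 →
      ∃ s ∈ Icc (p.1 - r) (p.1 + r), ∃ t ∈ Icc (p.2 - r) (p.2 + r),
        (scale l ψ).toFun t - (scale l ψ).toFun s = w := by
    rw [Filter.eventually_all_finset]
    intro p hp
    obtain ⟨ρ, hρ, h⟩ := exists_forall_exists_sub_eq (hP p hp).2.2.2.1 (hP p hp).2.2.1 hr
    have h' := eventually_self h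
    filter_upwards [eventually_gt_atTop (1 / ρ)] with l hl w hw
    have hl0 : 0 < l := lt_trans (by positivity) hl
    obtain ⟨s, t, hs, ht, he⟩ := h' (w / l) (by
      rw [norm_div, Complex.norm_real, Real.norm_of_nonneg hl0.le, div_lt_iff₀ hl0]
      rw [div_lt_iff₀ hρ] at hl
      linarith)
    refine ⟨s, ⟨by linarith [(abs_lt.1 hs).1], by linarith [(abs_lt.1 hs).2]⟩, t,
      ⟨by linarith [(abs_lt.1 ht).1], by linarith [(abs_lt.1 ht).2]⟩, ?_⟩
    have : (l : ℂ) ≠ 0 := by exact_mod_cast hl0.ne'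
    rw [scale_toFun, scale_toFun, ← mul_sub, he]
    field_simp
  -- outside the rectangles, short chords of the dilated curve have weight zero
  have hfar : ∀ᶠ l : ℝ in atTop, ∀ p ∈ (Icc b (b + 1) ×ˢ Icc b (b + 1)) \
      ⋃ p ∈ P, Metric.ball p r, 1 < ‖(scale l ψ).toFun p.2 - (scale l ψ).toFun p.1‖ ∨
        U p.1 p.2 = 0 := by
    refine ((isCompact_Icc.prod isCompact_Icc).diff (isOpen_biUnion fun _ _ =>
      Metric.isOpen_ball)).eventually_forall_mem
      (P := fun (l : ℝ) (p : ℝ × ℝ) => 1 < ‖(scale l ψ).toFun p.2 - (scale l ψ).toFun p.1‖ ∨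
        U p.1 p.2 = 0) ?_
    rintro p ⟨hp, hp'⟩
    by_cases he : ψ.toFun p.1 = ψ.toFun p.2
    · have hpP : p ∉ P := fun h => hp' (mem_biUnion h (Metric.mem_ball_self hr))
      exact (((hU p hp hpP he).prod_inr atTop)).mono fun q hq => Or.inr hq
    · have h1 : 0 < ‖ψ.toFun p.2 - ψ.toFun p.1‖ := norm_pos_iff.2 (sub_ne_zero.2 (Ne.symm he))
      have h2 : ∀ᶠ q : ℝ × ℝ in 𝓝 p, ‖ψ.toFun p.2 - ψ.toFun p.1‖ / 2 <
          ‖ψ.toFun q.2 - ψ.toFun q.1‖ := by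
        have hc : Continuous fun q : ℝ × ℝ => ‖ψ.toFun q.2 - ψ.toFun q.1‖ :=
          ((ψ.continuous_toFun.comp continuous_snd).sub
            (ψ.continuous_toFun.comp continuous_fst)).norm
        exact (hc.tendsto p).eventually (lt_mem_nhds (half_lt_self h1))
      filter_upwards [(eventually_gt_atTop (2 / ‖ψ.toFun p.2 - ψ.toFun p.1‖)).prod_mk h2]
      rintro ⟨l, q⟩ ⟨hl, hq⟩
      left
      have hl0 : 0 < l := lt_trans (by positivity) hl
      simp only at hq ⊢
      rw [scale_toFun, scale_toFun, ← mul_sub, norm_mul, Complex.norm_real,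
        Real.norm_of_nonneg hl0.le]
      rw [div_lt_iff₀ h1] at hl
      nlinarith
  filter_upwards [hsurj, hfar, eventually_gt_atTop 0] with l h1 h2 hl
  have hsub : (⋃ p ∈ P, Q r p) ⊆ Icc b (b + 1) ×ˢ Icc b (b + 1) := iUnion₂_subset hr1
  rw [chordArea, MeasureTheory.setIntegral_eq_of_subset_of_forall_sdiff_eq_zero
    (measurableSet_Icc.prod measurableSet_Icc) hsub,
    MeasureTheory.integral_biUnion_finset]
  · refine Finset.sum_congr rfl fun p hp => ?_
    have h3 : ∫ q in Q r p, U q.1 q.2 *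
        (massDensity (Complex.normSq ((scale l ψ).toFun q.2 - (scale l ψ).toFun q.1)) *
          planeDet (-deriv (scale l ψ).toFun q.1) (deriv (scale l ψ).toFun q.2)) =
        ∫ q in Q r p, U p.1 p.2 *
        (massDensity (Complex.normSq ((scale l ψ).toFun q.2 - (scale l ψ).toFun q.1)) *
          planeDet (-deriv (scale l ψ).toFun q.1) (deriv (scale l ψ).toFun q.2)) :=
      MeasureTheory.setIntegral_congr_fun (measurableSet_Icc.prod measurableSet_Icc)
        fun q hq => by simp only [hr2 p hp q hq]
    rw [h3, MeasureTheory.integral_const_mul]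
    congr 1
    refine integral_rectangle_chord (scale l ψ) ordConnected_Icc ordConnected_Icc
      (sign_ne_zero.2 (hP p hp).2.2.2.1) (fun s hs t ht => ?_) (h1 p hp)
    rw [deriv_scale, deriv_scale, planeDet_smul_left, planeDet_smul_right, ← hr4 p hp s hs t ht,
      sign_mul, sign_mul, sign_pos hl, one_mul, one_mul]
  · exact fun p _ => measurableSet_Icc.prod measurableSet_Icc
  · exact fun p hp q hq hpq => hr3 p hp q hq hpq
  · intro p hp
    refine MeasureTheory.IntegrableOn.congr_fun (f := fun q : ℝ × ℝ => U p.1 p.2 *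
        (massDensity (Complex.normSq ((scale l ψ).toFun q.2 - (scale l ψ).toFun q.1)) *
          planeDet (-deriv (scale l ψ).toFun q.1) (deriv (scale l ψ).toFun q.2))) ?_
      (fun q hq => by simp only [hr2 p hp q hq]) (measurableSet_Icc.prod measurableSet_Icc)
    refine ContinuousOn.integrableOn_compact (isCompact_Icc.prod isCompact_Icc) (Continuous.continuousOn ?_)
    have k := (scale l ψ).continuous_toFun
    have k' := (scale l ψ).continuous_deriv
    refine continuous_const.mul ((contDiff_massDensity.continuous.comp
      (Complex.continuous_normSq.comp ((k.comp continuous_snd).sub (k.comp continuous_fst)))).mul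
      (continuous_planeDet.comp ((k'.comp continuous_fst).neg.prodMk (k'.comp continuous_snd))))
  · rintro p ⟨hp, hp'⟩
    have hp'' : p ∉ ⋃ p ∈ P, Metric.ball p r := fun h => hp' (by
      obtain ⟨q, hq, hpq⟩ := mem_iUnion₂.1 h
      exact mem_biUnion hq (by rw [hQball]; exact Metric.ball_subset_closedBall hpq))
    rcases h2 p ⟨hp, hp''⟩ with h | h
    · rw [massDensity_of_gt (by rw [Complex.normSq_eq_norm_sq]; nlinarith), zero_mul, mul_zero]
    · rw [h, zero_mul]

end Quasidoodle

/-! ### Weighted sums over crossings -/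

/-- A function which is locally constant on a set `Z` extends to a function which is locally constant
near `Z`. -/
theorem exists_locally_constant_extension {X : Type*} [PseudoMetricSpace X] {Z : Set X} {c : X → ℝ}
    (h : ∀ ζ ∈ Z, ∀ᶠ ξ in 𝓝[Z] ζ, c ξ = c ζ) :
    ∃ w : X → ℝ, ∀ ζ ∈ Z, ∀ᶠ ξ in 𝓝 ζ, w ξ = c ζ := by
  classical
  have h' : ∀ ζ : X, ∃ r > 0, ζ ∈ Z → ∀ ξ ∈ Z, dist ξ ζ < 2 * r → c ξ = c ζ := by
    intro ζ
    by_cases hζ : ζ ∈ Z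
    · obtain ⟨r, hr, hb⟩ := Metric.mem_nhdsWithin_iff.1 (h ζ hζ)
      exact ⟨r / 2, half_pos hr, fun _ ξ hξ hd => hb ⟨by
        rw [Metric.mem_ball]; linarith, hξ⟩⟩
    · exact ⟨1, one_pos, fun h => absurd h hζ⟩
  choose r hr hc using h'
  refine ⟨fun ξ => if hξ : ∃ ζ ∈ Z, dist ξ ζ < r ζ then c hξ.choose else 0, fun ζ hζ => ?_⟩
  filter_upwards [Metric.ball_mem_nhds ζ (hr ζ)] with ξ hξ
  have hex : ∃ ζ ∈ Z, dist ξ ζ < r ζ := ⟨ζ, hζ, hξ⟩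
  rw [dif_pos hex]
  obtain ⟨h1, h2⟩ := hex.choose_spec
  set η := hex.choose
  have h3 : dist η ζ < r η + r ζ :=
    (dist_triangle_left η ζ ξ).trans_lt (add_lt_add h2 hξ)
  rcases le_total (r η) (r ζ) with h4 | h4
  · exact hc ζ hζ η h1 (by linarith)
  · exact (hc η h1 ζ hζ (by rw [dist_comm]; linarith)).symm

namespace Quasidoodle

/-- The crossings as pairs of times in `[b, b + 1)`. -/
def timePairs (ψ : Quasidoodle) (b : ℝ) : Set (ℝ × ℝ) :=
  {p | b ≤ p.1 ∧ p.1 < p.2 ∧ p.2 < b + 1 ∧ ψ.toFun p.1 = ψ.toFun p.2}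

/-- The sum of the signs of the crossings, with weights `c`. -/
noncomputable def signedSum (ψ : Quasidoodle) (b : ℝ) (c : UnitAddCircle × UnitAddCircle → ℝ) : ℝ :=
  ∑ᶠ p ∈ ψ.timePairs b,
    -((SignType.sign (planeDet (deriv ψ.toFun p.1) (deriv ψ.toFun p.2)) : SignType) : ℝ) *
      c ((p.1 : UnitAddCircle), (p.2 : UnitAddCircle))

/-- Finitely many crossings, all of them transverse, none of them at time `b`. -/
structure GoodAt (ψ : Quasidoodle) (b : ℝ) : Prop where
  finite : (ψ.timePairs b).Finite
  transverse : ∀ p ∈ ψ.timePairs b, planeDet (deriv ψ.toFun p.1) (deriv ψ.toFun p.2) ≠ 0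
  simple : ∀ t, ψ.toFun t = ψ.toFun b → (t : UnitAddCircle) = b

theorem GoodAt.ne {ψ : Quasidoodle} {b : ℝ} (h : ψ.GoodAt b) {t : ℝ} (ht : t ∈ Ioo b (b + 1)) :
    ψ.toFun t ≠ ψ.toFun b := fun he =>
  circle_coe_ne_of_lt ht.1 ht.2 (h.simple t he).symm

theorem tendsto_sub_pt (φ : Quasidoodle) (ζ : UnitAddCircle × UnitAddCircle) :
    Tendsto (fun q : Quasidoodle × UnitAddCircle × UnitAddCircle => q.1.pt q.2.1 - q.1.pt q.2.2)
      (φ.nhdsC1 ×ˢ 𝓝 ζ) (𝓝 (φ.pt ζ.1 - φ.pt ζ.2)) := by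
  have h1 : Tendsto (fun q : Quasidoodle × UnitAddCircle × UnitAddCircle => (q.1, q.2.1))
      (φ.nhdsC1 ×ˢ 𝓝 ζ) (φ.nhdsC1 ×ˢ 𝓝 ζ.1) :=
    tendsto_fst.prodMk ((continuous_fst.tendsto ζ).comp tendsto_snd)
  have h2 : Tendsto (fun q : Quasidoodle × UnitAddCircle × UnitAddCircle => (q.1, q.2.2))
      (φ.nhdsC1 ×ˢ 𝓝 ζ) (φ.nhdsC1 ×ˢ 𝓝 ζ.2) :=
    tendsto_fst.prodMk ((continuous_snd.tendsto ζ).comp tendsto_snd)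
  exact ((φ.tendsto_pt ζ.1).comp h1).sub ((φ.tendsto_pt ζ.2).comp h2)

/-- Chords near a nondegenerate chord are longer than all small numbers. -/
theorem eventually_lt_norm_sub {φ : Quasidoodle} {ζ : UnitAddCircle × UnitAddCircle}
    (h : φ.pt ζ.1 ≠ φ.pt ζ.2) :
    ∀ᶠ q : (Quasidoodle × ℝ) × UnitAddCircle × UnitAddCircle in (φ.nhdsC1 ×ˢ 𝓝[>] 0) ×ˢ 𝓝 ζ,
      q.1.2 < ‖q.1.1.pt q.2.1 - q.1.1.pt q.2.2‖ := by
  have h1 : Tendsto (fun q : (Quasidoodle × ℝ) × UnitAddCircle × UnitAddCircle => (q.1.1, q.2))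
      ((φ.nhdsC1 ×ˢ 𝓝[>] 0) ×ˢ 𝓝 ζ) (φ.nhdsC1 ×ˢ 𝓝 ζ) :=
    (tendsto_fst.comp tendsto_fst).prodMk tendsto_snd
  have h2 : Tendsto (fun q : (Quasidoodle × ℝ) × UnitAddCircle × UnitAddCircle => q.1.2)
      ((φ.nhdsC1 ×ˢ 𝓝[>] 0) ×ˢ 𝓝 ζ) (𝓝 0) :=
    (tendsto_nhdsWithin_iff.1 (tendsto_snd.comp tendsto_fst)).1
  exact h2.eventually_lt ((φ.tendsto_sub_pt ζ).comp h1).norm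
    (norm_pos_iff.2 (sub_ne_zero.2 h))

/-- The auxiliary data common to all curves near `φ`: a weight `w` on pairs of points of the circle,
locally constant at short chords, that agrees with the weights `c ψ` at the crossings, together with
the size `r` of an arc around the time `b` and a bound `ε` for short chords. -/
theorem exists_common_weight {φ : Quasidoodle} (hφ : φ.IsImmersion)
    {c : Quasidoodle → UnitAddCircle × UnitAddCircle → ℝ}
    (hc : ∀ ζ : UnitAddCircle × UnitAddCircle, φ.pt ζ.1 = φ.pt ζ.2 →
      ∀ᶠ q in φ.nhdsC1 ×ˢ 𝓝 ζ, q.1.pt q.2.1 = q.1.pt q.2.2 → c q.1 q.2 = c φ ζ)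
    (hdiag : ∀ x, c φ (x, x) = 0) (hsymm : ∀ x y, φ.pt x = φ.pt y → c φ (x, y) = c φ (y, x))
    {b K : ℝ} (hK : ∀ y : UnitAddCircle, y ≠ b → φ.pt y = φ.pt b → c φ (b, y) = K) :
    ∃ (w : UnitAddCircle × UnitAddCircle → ℝ) (r ε δ : ℝ), 0 < r ∧ r ≤ 1 / 2 ∧ 0 < ε ∧ 0 < δ ∧
      (∀ x y, w (x, y) = w (y, x)) ∧ (∀ x, ∀ᶠ ξ in 𝓝 (x, x), w ξ = 0) ∧
      ∀ ψ, Close δ φ ψ →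
        (∀ ξ, ε < ‖ψ.pt ξ.1 - ψ.pt ξ.2‖ ∨ ∀ᶠ η in 𝓝 ξ, w η = w ξ) ∧
        (∀ ξ, ψ.pt ξ.1 = ψ.pt ξ.2 → w ξ = c ψ ξ) ∧
        (∀ s ∈ Icc (b - r) (b + r), 0 < (deriv ψ.toFun s / deriv φ.toFun b).re) ∧
        (ε < ‖ψ.toFun (b + r) - ψ.toFun b‖ ∧ ε < ‖ψ.toFun (b - r) - ψ.toFun b‖) ∧
        (∀ t ∈ Icc (b + r) (b + 1 - r), ε < ‖ψ.toFun t - ψ.toFun b‖ ∨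
          w ((b : UnitAddCircle), (t : UnitAddCircle)) = K) ∧
        ∀ t ∈ Icc b (b + 1), t ∉ Icc (b + r) (b + 1 - r) →
          w ((b : UnitAddCircle), (t : UnitAddCircle)) = 0 := by
  set Z : Set (UnitAddCircle × UnitAddCircle) := {ζ | φ.pt ζ.1 = φ.pt ζ.2} with hZ
  -- the weight is locally constant on the closed set of double points of `φ`, so it has an
  -- extension that is constant near each of them; the extension is then made symmetric
  obtain ⟨w₀, hw₀⟩ := exists_locally_constant_extension (Z := Z) (c := c φ) fun ζ hζ => by
    have h2 : Tendsto (fun ξ : UnitAddCircle × UnitAddCircle => (φ, ξ)) (𝓝[Z] ζ)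
        (φ.nhdsC1 ×ˢ 𝓝 ζ) :=
      (tendsto_const_pure.mono_right φ.pure_le_nhdsC1).prodMk
        (tendsto_id.mono_left nhdsWithin_le_nhds)
    filter_upwards [h2.eventually (hc ζ hζ), self_mem_nhdsWithin] with ξ h3 h4
    exact h3 h4
  set w : UnitAddCircle × UnitAddCircle → ℝ := fun ξ => (w₀ ξ + w₀ ξ.swap) / 2 with hwdef
  have hw : ∀ ζ ∈ Z, ∀ᶠ ξ in 𝓝 ζ, w ξ = c φ ζ := by
    intro ζ hζ
    have h1 : ∀ᶠ ξ in 𝓝 ζ, w₀ ξ.swap = c φ ζ.swap :=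
      (continuous_swap.tendsto ζ).eventually (hw₀ ζ.swap hζ.symm)
    filter_upwards [hw₀ ζ hζ, h1] with ξ h2 h3
    rw [hwdef]
    simp only [h2, h3, show c φ ζ.swap = c φ ζ from (hsymm _ _ hζ).symm]
    ring
  have hw0 : ∀ x, ∀ᶠ ξ in 𝓝 (x, x), w ξ = 0 := fun x => by
    simpa only [hdiag] using hw (x, x) rfl
  obtain ⟨r₁, hr₁, hcone⟩ := exists_forall_deriv_mem φ b (U := {u | 0 < (u / deriv φ.toFun b).re})
    ((Complex.continuous_re.comp (continuous_id.div_const _)).continuousAt.preimage_mem_nhds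
      (lt_mem_nhds (by simp [div_self (hφ.deriv_ne_zero b)])))
  obtain ⟨r₂, hr₂, hinj⟩ := hφ.exists_injOn b
  have hpair : ∀ t : ℝ, Tendsto (fun t : ℝ => ((b : UnitAddCircle), (t : UnitAddCircle))) (𝓝 t)
      (𝓝 ((b : UnitAddCircle), (t : UnitAddCircle))) := fun t =>
    (continuous_const.prodMk (AddCircle.continuous_mk' 1)).tendsto t
  obtain ⟨r₃, hr₃, hzero⟩ := Metric.eventually_nhds_iff.1 ((hpair b).eventually (hw0 b))
  obtain ⟨r, hr, hrr₁, hrr₂, hrr₃, hr4⟩ : ∃ r > 0, r ≤ r₁ ∧ r ≤ r₂ ∧ r < r₃ ∧ r ≤ 1 / 4 :=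
    ⟨min (min r₁ r₂) (min (r₃ / 2) (1 / 4)), by positivity,
      (min_le_left _ _).trans (min_le_left _ _), (min_le_left _ _).trans (min_le_right _ _),
      ((min_le_right _ _).trans (min_le_left _ _)).trans_lt (half_lt_self hr₃),
      (min_le_right _ _).trans (min_le_right _ _)⟩
  -- a short chord of a curve near `φ` is near a double point of `φ`, where `w` is locally constant
  have E1 : ∀ᶠ q in φ.nhdsC1 ×ˢ 𝓝[>] (0 : ℝ), ∀ ξ ∈ (univ : Set (UnitAddCircle × UnitAddCircle)),
      q.2 < ‖q.1.pt ξ.1 - q.1.pt ξ.2‖ ∨ ∀ᶠ η in 𝓝 ξ, w η = w ξ := by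
    refine isCompact_univ.eventually_forall_mem
      (P := fun (q : Quasidoodle × ℝ) (ξ : UnitAddCircle × UnitAddCircle) =>
        q.2 < ‖q.1.pt ξ.1 - q.1.pt ξ.2‖ ∨ ∀ᶠ η in 𝓝 ξ, w η = w ξ) fun ζ _ => ?_
    by_cases hζ : φ.pt ζ.1 = φ.pt ζ.2
    · refine (((hw ζ hζ).and (hw ζ hζ).eventually_nhds).prod_inr _).mono fun q hq => Or.inr ?_
      exact hq.2.mono fun η h => h.trans hq.1.symm
    · exact (eventually_lt_norm_sub hζ).mono fun q hq => Or.inl hq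
  -- at the crossings of nearby curves, `w` agrees with the given weights
  have E2 : ∀ᶠ ψ in φ.nhdsC1, ∀ ξ ∈ (univ : Set (UnitAddCircle × UnitAddCircle)),
      ψ.pt ξ.1 = ψ.pt ξ.2 → w ξ = c ψ ξ := by
    refine isCompact_univ.eventually_forall_mem
      (P := fun (ψ : Quasidoodle) (ξ : UnitAddCircle × UnitAddCircle) =>
        ψ.pt ξ.1 = ψ.pt ξ.2 → w ξ = c ψ ξ) fun ζ _ => ?_
    by_cases hζ : φ.pt ζ.1 = φ.pt ζ.2
    · filter_upwards [hc ζ hζ, (hw ζ hζ).prod_inr φ.nhdsC1] with q h1 h2 h3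
      rw [h2, h1 h3]
    · filter_upwards [(φ.tendsto_sub_pt ζ).eventually_ne (sub_ne_zero.2 hζ)] with q h1 h2
      exact absurd (sub_eq_zero.2 h2) h1
  have long : ∀ s : ℝ, φ.toFun s ≠ φ.toFun b → ∀ᶠ q in φ.nhdsC1 ×ˢ 𝓝[>] (0 : ℝ),
      q.2 < ‖q.1.toFun s - q.1.toFun b‖ := fun s hs =>
    (eventually_lt_norm_sub (φ := φ) (ζ := ((s : UnitAddCircle), (b : UnitAddCircle)))
      hs).curry.mono fun _ h => h.self_of_nhds
  have hI := eventually_self hinj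
  -- the chords from `b` to the ends of the arc around `b` stay long
  have E4 := long (b + r) fun h => by
    have := hI ⟨by linarith, by linarith⟩ ⟨by linarith, by linarith⟩ h
    linarith
  have E5 := long (b - r) fun h => by
    have := hI ⟨by linarith, by linarith⟩ ⟨by linarith, by linarith⟩ h
    linarith
  -- a short chord from `b` leads to a crossing of `φ` at `b`, where the weight is `K`
  have E6 : ∀ᶠ q in φ.nhdsC1 ×ˢ 𝓝[>] (0 : ℝ), ∀ t ∈ Icc (b + r) (b + 1 - r),
      q.2 < ‖q.1.toFun t - q.1.toFun b‖ ∨ w ((b : UnitAddCircle), (t : UnitAddCircle)) = K := by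
    refine isCompact_Icc.eventually_forall_mem (P := fun (q : Quasidoodle × ℝ) (t : ℝ) =>
      q.2 < ‖q.1.toFun t - q.1.toFun b‖ ∨ w ((b : UnitAddCircle), (t : UnitAddCircle)) = K)
      fun t ht => ?_
    by_cases he : φ.toFun t = φ.toFun b
    · have h1 := hw ((b : UnitAddCircle), (t : UnitAddCircle)) he.symm
      rw [hK t (circle_coe_ne_of_lt (by linarith [ht.1]) (by linarith [ht.2])).symm he] at h1
      exact (((hpair t).eventually h1).prod_inr _).mono fun q hq => Or.inr hq
    · have h1 : Tendsto (fun q : (Quasidoodle × ℝ) × ℝ =>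
          (q.1, ((q.2 : UnitAddCircle), (b : UnitAddCircle)))) ((φ.nhdsC1 ×ˢ 𝓝[>] (0 : ℝ)) ×ˢ 𝓝 t)
          ((φ.nhdsC1 ×ˢ 𝓝[>] (0 : ℝ)) ×ˢ 𝓝 ((t : UnitAddCircle), (b : UnitAddCircle))) :=
        tendsto_fst.prodMk ((((AddCircle.continuous_mk' 1).prodMk continuous_const).tendsto t).comp
          tendsto_snd)
      exact (h1.eventually (eventually_lt_norm_sub he)).mono fun q hq => Or.inl hq
  have E := E1.and ((tendsto_fst.eventually (E2.and hcone)).and (E4.and (E5.and E6)))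
  obtain ⟨⟨δ, ε⟩, ⟨hδ, hε⟩, H⟩ := (φ.hasBasis_nhdsC1.prod (nhdsGT_basis (0 : ℝ))).eventually_iff.1 E
  refine ⟨w, r, ε / 2, δ, hr, by linarith, half_pos hε, hδ, fun x y => ?_, hw0, fun ψ hψ => ?_⟩
  · simp only [hwdef, Prod.swap_prod_mk, add_comm]
  · obtain ⟨h1, ⟨h2, h3⟩, h4, h5, h6⟩ := H (x := (ψ, ε / 2)) ⟨hψ, half_pos hε, half_lt_self hε⟩
    refine ⟨fun ξ => h1 ξ trivial, fun ξ => h2 ξ trivial, fun s hs => h3 s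
      (Icc_subset_Icc (by linarith) (by linarith) hs), ⟨h4, h5⟩, h6, fun t ht ht' => ?_⟩
    rcases lt_or_ge t (b + r) with h | h
    · exact hzero (by rw [Real.dist_eq, abs_lt]; constructor <;> linarith [ht.1])
    · have h7 : b + 1 - r < t := by
        by_contra h8
        exact ht' ⟨h, not_lt.1 h8⟩
      have h8 : (t : UnitAddCircle) = ((t - 1 : ℝ) : UnitAddCircle) :=
        circle_coe_eq_iff.2 ⟨1, by push_cast; ring⟩
      rw [h8]
      exact hzero (by rw [Real.dist_eq, abs_lt]; constructor <;> linarith [ht.2])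

theorem chord_scale (l : ℝ) (φ ψ : Quasidoodle) (τ s t : ℝ) :
    chord (scale l φ) (scale l ψ) τ s t =
      l * ((lin τ φ ψ).toFun t - (lin τ φ ψ).toFun s) := by
  rw [chord, lin_scale, scale_toFun, scale_toFun, mul_sub]

/-- The weight `w` on pairs of points of the circle, cut off to the pairs of times in increasing
order. -/
noncomputable def orderedWeight (w : UnitAddCircle × UnitAddCircle → ℝ) (s t : ℝ) : ℝ :=
  open Classical in if s < t then w ((s : UnitAddCircle), (t : UnitAddCircle)) else 0

theorem orderedWeight_of_lt (w : UnitAddCircle × UnitAddCircle → ℝ) {s t : ℝ} (h : s < t) :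
    orderedWeight w s t = w ((s : UnitAddCircle), (t : UnitAddCircle)) := if_pos h

theorem orderedWeight_of_le (w : UnitAddCircle × UnitAddCircle → ℝ) {s t : ℝ} (h : t ≤ s) :
    orderedWeight w s t = 0 := if_neg (not_lt.2 h)

section

variable {w : UnitAddCircle × UnitAddCircle → ℝ}

theorem eventually_orderedWeight_of_lt {s t : ℝ} (h : s < t) {k : ℝ}
    (hw : ∀ᶠ η in 𝓝 ((s : UnitAddCircle), (t : UnitAddCircle)), w η = k) :
    ∀ᶠ p : ℝ × ℝ in 𝓝 (s, t), orderedWeight w p.1 p.2 = k := by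
  have h1 : Tendsto (fun p : ℝ × ℝ => ((p.1 : UnitAddCircle), (p.2 : UnitAddCircle))) (𝓝 (s, t))
      (𝓝 ((s : UnitAddCircle), (t : UnitAddCircle))) :=
    (((AddCircle.continuous_mk' 1).comp continuous_fst).prodMk
      ((AddCircle.continuous_mk' 1).comp continuous_snd)).tendsto (s, t)
  filter_upwards [h1.eventually hw, (isOpen_lt continuous_fst continuous_snd).mem_nhds h] with p h2 h3
  rw [orderedWeight_of_lt w h3, h2]

theorem eventually_orderedWeight_of_ge (hw0 : ∀ x, ∀ᶠ ξ in 𝓝 (x, x), w ξ = 0) {s t : ℝ}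
    (h : t ≤ s) : ∀ᶠ p : ℝ × ℝ in 𝓝 (s, t), orderedWeight w p.1 p.2 = 0 := by
  rcases h.lt_or_eq with h | rfl
  · filter_upwards [(isOpen_lt continuous_snd continuous_fst).mem_nhds h] with p h3
    exact orderedWeight_of_le w (le_of_lt h3)
  · have h1 : Tendsto (fun p : ℝ × ℝ => ((p.1 : UnitAddCircle), (p.2 : UnitAddCircle))) (𝓝 (t, t))
        (𝓝 ((t : UnitAddCircle), (t : UnitAddCircle))) :=
      (((AddCircle.continuous_mk' 1).comp continuous_fst).prodMk
        ((AddCircle.continuous_mk' 1).comp continuous_snd)).tendsto (t, t)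
    filter_upwards [h1.eventually (hw0 t)] with p h2
    rw [orderedWeight]
    split_ifs
    · exact h2
    · rfl

end

/-- The weighted chord area of a strongly dilated curve is the weighted sum over the crossings. -/
theorem eventually_chordArea_eq_signedSum {ψ : Quasidoodle} {b : ℝ} (hψ : ψ.GoodAt b)
    {w : UnitAddCircle × UnitAddCircle → ℝ} {c : UnitAddCircle × UnitAddCircle → ℝ}
    (hw0 : ∀ x, ∀ᶠ ξ in 𝓝 (x, x), w ξ = 0)
    (hw : ∀ ξ, ψ.pt ξ.1 = ψ.pt ξ.2 → ∀ᶠ η in 𝓝 ξ, w η = w ξ)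
    (hwc : ∀ ξ, ψ.pt ξ.1 = ψ.pt ξ.2 → w ξ = c ξ) :
    ∀ᶠ l : ℝ in atTop, (scale l ψ).chordArea (orderedWeight w) b = ψ.signedSum b c := by
  have hmem : ∀ p : ℝ × ℝ, p ∈ ψ.timePairs b → p.1 ∈ Ioo b (b + 1) ∧ p.2 ∈ Ioo b (b + 1) := by
    rintro p ⟨h1, h2, h3, h4⟩
    have h5 : b ≠ p.1 := by
      intro h5
      rw [← h5] at h4 h2
      exact hψ.ne ⟨h2, h3⟩ h4.symm
    have h6 := lt_of_le_of_ne h1 h5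
    exact ⟨⟨h6, h2.trans h3⟩, h6.trans h2, h3⟩
  have key := eventually_chordArea_scale ψ (U := orderedWeight w) (b := b) hψ.finite.toFinset ?_ ?_
  · filter_upwards [key] with l hl
    rw [hl, signedSum, finsum_mem_eq_finite_toFinset_sum _ hψ.finite]
    refine Finset.sum_congr rfl fun p hp => ?_
    have hp := hψ.finite.mem_toFinset.1 hp
    rw [orderedWeight_of_lt w hp.2.1, hwc ((p.1 : UnitAddCircle), (p.2 : UnitAddCircle)) hp.2.2.2,
      mul_comm]
  · intro p hp
    have hp := hψ.finite.mem_toFinset.1 hp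
    refine ⟨(hmem p hp).1, (hmem p hp).2, hp.2.2.2, hψ.transverse p hp, ?_⟩
    rw [orderedWeight_of_lt w hp.2.1]
    exact eventually_orderedWeight_of_lt hp.2.1 (hw ((p.1 : UnitAddCircle), (p.2 : UnitAddCircle))
      hp.2.2.2)
  · rintro p ⟨⟨h1, h1'⟩, ⟨h2, h2'⟩⟩ hp he
    rcases lt_or_ge p.1 p.2 with h | h
    · have hp' : ¬ (b ≤ p.1 ∧ p.1 < p.2 ∧ p.2 < b + 1 ∧ ψ.toFun p.1 = ψ.toFun p.2) := fun h =>
        hp (hψ.finite.mem_toFinset.2 h)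
      have h3 : p.2 = b + 1 := by
        by_contra h3
        exact hp' ⟨h1, h, lt_of_le_of_ne h2' h3, he⟩
      have h4 : ψ.toFun p.1 = ψ.toFun b := by rw [he, h3, ψ.periodic]
      have h5 : p.1 = b := by
        by_contra h5
        exact hψ.ne ⟨lt_of_le_of_ne h1 (Ne.symm h5), h3 ▸ h⟩ h4
      refine eventually_orderedWeight_of_lt h ?_
      have h6 : (p.2 : UnitAddCircle) = (p.1 : UnitAddCircle) :=
        circle_coe_eq_iff.2 ⟨1, by rw [h3, h5]; simp⟩
      rw [h6]
      exact hw0 _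
    · exact eventually_orderedWeight_of_ge hw0 h

/-- For curves near `φ` in general position, the weighted sum over the crossings changes only when
the point at time `b` crosses another branch. -/
theorem exists_signedSum_sub {φ : Quasidoodle} (hφ : φ.IsImmersion)
    {c : Quasidoodle → UnitAddCircle × UnitAddCircle → ℝ}
    (hc : ∀ ζ : UnitAddCircle × UnitAddCircle, φ.pt ζ.1 = φ.pt ζ.2 →
      ∀ᶠ q in φ.nhdsC1 ×ˢ 𝓝 ζ, q.1.pt q.2.1 = q.1.pt q.2.2 → c q.1 q.2 = c φ ζ)
    (hdiag : ∀ x, c φ (x, x) = 0) (hsymm : ∀ x y, φ.pt x = φ.pt y → c φ (x, y) = c φ (y, x))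
    {b K : ℝ} (hK : ∀ y : UnitAddCircle, y ≠ b → φ.pt y = φ.pt b → c φ (b, y) = K) :
    ∃ δ > 0, ∀ ψ₀ ψ₁, Close δ φ ψ₀ → Close δ φ ψ₁ → ψ₀.GoodAt b → ψ₁.GoodAt b →
      ψ₁.signedSum b (c ψ₁) - ψ₀.signedSum b (c ψ₀) =
        -2 * (K * (ψ₁.ind (ψ₁.toFun b) - ψ₀.ind (ψ₀.toFun b))) := by
  obtain ⟨w, r, ε, δ, hr, hr', hε, hδ, hws, hw0, H⟩ := exists_common_weight hφ hc hdiag hsymm hK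
  refine ⟨δ, hδ, fun ψ₀ ψ₁ h₀ h₁ g₀ g₁ => ?_⟩
  have hL : ∀ τ ∈ Icc (0 : ℝ) 1, Close δ φ (lin τ ψ₀ ψ₁) := fun τ hτ => h₀.lin hτ h₁
  have loc : ∀ ψ, Close δ φ ψ → ∀ ξ, ψ.pt ξ.1 = ψ.pt ξ.2 → ∀ᶠ η in 𝓝 ξ, w η = w ξ := by
    intro ψ hψ ξ hξ
    refine ((H ψ hψ).1 ξ).resolve_left fun h => ?_
    rw [hξ, sub_self, norm_zero] at h
    linarith
  have sum : ∀ ψ, Close δ φ ψ → ψ.GoodAt b → ∀ᶠ l : ℝ in atTop,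
      (scale l ψ).chordArea (orderedWeight w) b = ψ.signedSum b (c ψ) := fun ψ hψ g =>
    eventually_chordArea_eq_signedSum g hw0 (loc ψ hψ) (H ψ hψ).2.1
  have face : ∀ ψ : Quasidoodle, ψ.GoodAt b → ∀ᶠ l : ℝ in atTop, ∀ t ∈ Icc (b + r) (b + 1 - r),
      1 < l * ‖ψ.toFun t - ψ.toFun b‖ := by
    intro ψ g
    obtain ⟨m, hm, hm'⟩ : ∃ m > 0, ∀ t ∈ Icc (b + r) (b + 1 - r), m ≤ ‖ψ.toFun t - ψ.toFun b‖ := by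
      obtain ⟨t₀, ht₀, hmin⟩ := isCompact_Icc.exists_isMinOn
        (nonempty_Icc.2 (by linarith : b + r ≤ b + 1 - r))
        ((ψ.continuous_toFun.sub continuous_const).norm.continuousOn (f := fun t =>
          ‖ψ.toFun t - ψ.toFun b‖))
      exact ⟨_, norm_pos_iff.2 (sub_ne_zero.2 (g.ne ⟨by linarith [ht₀.1], by linarith [ht₀.2]⟩)),
        fun t ht => hmin ht⟩
    filter_upwards [eventually_gt_atTop (1 / m)] with l hl t ht
    rw [div_lt_iff₀ hm] at hl
    have hl0 : 0 < l := by
      by_contra h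
      nlinarith
    nlinarith [hm' t ht]
  -- a dilation that is strong enough for both curves: their weighted chord areas count crossings,
  -- the chords from `b` are long, and chords of norm greater than `ε` become long
  obtain ⟨l, hs0, hs1, hf0, hf1, hlε⟩ := ((sum ψ₀ h₀ g₀).and ((sum ψ₁ h₁ g₁).and
    ((face ψ₀ g₀).and ((face ψ₁ g₁).and (eventually_gt_atTop (1 / ε)))))).exists
  have hl0 : 0 < l := lt_trans (by positivity) hlε
  have hlC : (l : ℂ) ≠ 0 := by exact_mod_cast hl0.ne'
  have norm_chord : ∀ τ s t, ‖chord (scale l ψ₀) (scale l ψ₁) τ s t‖ =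
      l * ‖(lin τ ψ₀ ψ₁).toFun t - (lin τ ψ₀ ψ₁).toFun s‖ := by
    intro τ s t
    rw [chord_scale, norm_mul, Complex.norm_real, Real.norm_of_nonneg hl0.le]
  have long : ∀ x : ℝ, ε < x → 1 < l * x := by
    intro x hx
    rw [div_lt_iff₀ hε] at hlε
    nlinarith
  rw [← hs0, ← hs1, chordArea_sub_chordArea_eq_ind (scale l ψ₀) (scale l ψ₁) (r := r) (K := K)
    (v := deriv φ.toFun b) ?_ ?_ ?_ hr hr' ?_ ?_ ?_ ?_ ?_, scale_toFun, scale_toFun,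
    ind_scale hl0.ne', ind_scale hl0.ne']
  · intro τ hτ s _ t _
    rcases lt_or_ge s t with h | h
    · rcases (H _ (hL τ hτ)).1 ((t : UnitAddCircle), (s : UnitAddCircle)) with h1 | h1
      · left
        rw [norm_chord]
        exact long _ h1
      · right
        rw [orderedWeight_of_lt w h]
        refine eventually_orderedWeight_of_lt h ?_
        have h2 := (continuous_swap.tendsto
          ((s : UnitAddCircle), (t : UnitAddCircle))).eventually h1
        filter_upwards [h2] with η h3
        rw [← Prod.mk.eta (p := η), hws, hws (s : UnitAddCircle)]
        exact h3
    · right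
      rw [orderedWeight_of_le w h]
      exact eventually_orderedWeight_of_ge hw0 h
  · intro s hs
    exact ⟨orderedWeight_of_le w hs.1, orderedWeight_of_le w hs.2⟩
  · intro t ht
    have hb : ((b + 1 : ℝ) : UnitAddCircle) = (b : UnitAddCircle) :=
      circle_coe_eq_iff.2 ⟨1, by simp⟩
    have hbb : w ((b : UnitAddCircle), (b : UnitAddCircle)) = 0 := (hw0 _).self_of_nhds
    rcases ht.1.eq_or_lt with rfl | h1
    · rw [orderedWeight_of_lt w (lt_add_one b), orderedWeight_of_le w le_rfl, hb, hbb]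
    · rcases ht.2.eq_or_lt with rfl | h2
      · rw [orderedWeight_of_lt w (lt_add_one b), orderedWeight_of_le w le_rfl, hb, hbb]
      · rw [orderedWeight_of_lt w h1, orderedWeight_of_lt w h2, hb, hws]
  · intro τ hτ s hs
    rw [lin_scale, deriv_scale, mul_div_assoc, Complex.re_ofReal_mul]
    exact mul_pos hl0 ((H _ (hL τ hτ)).2.2.1 s hs)
  · intro τ hτ
    obtain ⟨h1, h2⟩ := (H _ (hL τ hτ)).2.2.2.1
    rw [norm_chord, norm_chord, show b + 1 - r = b - r + 1 by ring, (lin τ ψ₀ ψ₁).periodic]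
    exact ⟨long _ h1, long _ h2⟩
  · intro t ht
    rw [norm_chord, norm_chord, lin_zero, lin_one]
    exact ⟨hf0 t ht, hf1 t ht⟩
  · intro τ hτ t ht
    rw [norm_chord, orderedWeight_of_lt w (by linarith [ht.1])]
    exact ((H _ (hL τ hτ)).2.2.2.2.1 t ht).imp_left (long _)
  · intro τ hτ t ht ht'
    right
    rcases ht.1.eq_or_lt with rfl | h1
    · exact orderedWeight_of_le w le_rfl
    · rw [orderedWeight_of_lt w h1]
      exact (H _ (hL τ hτ)).2.2.2.2.2 t ht ht'

end Quasidoodle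

theorem exists_pos_le_forall_le {α : Type*} (S : Finset α) {ρ : α → ℝ} (hρ : ∀ z, 0 < ρ z) {r₁ : ℝ}
    (hr₁ : 0 < r₁) : ∃ r > 0, r ≤ r₁ ∧ ∀ z ∈ S, r ≤ ρ z := by
  have h1 : ∀ᶠ r in 𝓝[>] (0 : ℝ), ∀ z ∈ S, r ∈ Ioc 0 (ρ z) := by
    rw [Filter.eventually_all_finset]
    exact fun z _ => Ioc_mem_nhdsGT (hρ z)
  obtain ⟨r, h2, h3⟩ := (h1.and (Ioc_mem_nhdsGT hr₁)).exists
  exact ⟨r, h3.1, h3.2, fun z hz => (h2 z hz).2⟩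

namespace Quasidoodle

/-! ### Indices of nearby points of nearby curves -/

theorem IsSide.eq_zero {ψ : Quasidoodle} {z r s : ℝ} {v p : ℂ} {e : ℝ} (h : IsSide ψ z r v p e)
    (hv : ∀ s ∈ Icc (z - r) (z + r), 0 < (deriv ψ.toFun s / v).re) (hs : s ∈ Icc (z - r) (z + r))
    (hp : ψ.toFun s = p) : e = 0 := by
  simpa using h.eq_sign hv hs (u := 0) (σ := 0) (by rw [hp, add_zero])
    fun s _ => by simp [planeDet]

/-- Near a point `x` of multiplicity `m`, the index of a point with respect to a nearby curve is
determined, up to a small error, by the sides of the `m` branches on which it lies. -/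
theorem exists_sides {ι : Type*} {φ : Quasidoodle} (hφ : φ.IsImmersion) {x : ℂ} {S : Finset ι}
    {z : ι → ℝ} (hinj : ∀ i ∈ S, ∀ j ∈ S, (z i : UnitAddCircle) = z j → i = j)
    (hS : ∀ s : ℝ, φ.toFun s = x ↔ ∃ i ∈ S, (s : UnitAddCircle) = z i) {r₁ ε : ℝ} (hr₁ : 0 < r₁)
    (hε : 0 < ε) :
    ∃ r ∈ Ioo 0 r₁, ∀ᶠ q in φ.nhdsC1 ×ˢ 𝓝 x, ∃ e : ι → ℝ,
      (∀ i ∈ S, IsSide q.1 (z i) r (deriv φ.toFun (z i)) q.2 (e i)) ∧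
      (∀ i ∈ S, ∀ s ∈ Icc (z i - r) (z i + r),
        0 < (deriv q.1.toFun s / deriv φ.toFun (z i)).re) ∧
      |q.1.ind q.2 - φ.ind x - 2⁻¹ * ∑ i ∈ S, e i| < ε := by
  have hcone : ∀ i : ι, ∃ r > 0, ∀ᶠ ψ in φ.nhdsC1,
      ∀ s ∈ Icc (z i - r) (z i + r), 0 < (deriv ψ.toFun s / deriv φ.toFun (z i)).re := by
    intro i
    refine exists_forall_deriv_mem φ (z i) (U := {u | 0 < (u / deriv φ.toFun (z i)).re})
      ((Complex.continuous_re.comp (continuous_id.div_const _)).continuousAt.preimage_mem_nhds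
        (lt_mem_nhds ?_))
    simp [div_self (hφ.deriv_ne_zero (z i))]
  choose ρ hρ hcone using hcone
  obtain ⟨r₂, hr₂, hr₂', hr₂''⟩ := exists_pos_le_forall_le S hρ hr₁
  obtain ⟨r, hr, h1, h2⟩ := ind_sub_ind hφ hinj hS hr₂
  have h3 : ∀ᶠ ψ in φ.nhdsC1, ∀ i ∈ S, ∀ s ∈ Icc (z i - r) (z i + r),
      0 < (deriv ψ.toFun s / deriv φ.toFun (z i)).re := by
    rw [Filter.eventually_all_finset]
    intro i hi
    have h := hr₂'' i hi
    exact (hcone i).mono fun ψ hψ s hs =>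
      hψ s (Icc_subset_Icc (by linarith [hr.2]) (by linarith [hr.2]) hs)
  refine ⟨r, ⟨hr.1, hr.2.trans_le hr₂'⟩, ?_⟩
  filter_upwards [h1, h2 ε hε, tendsto_fst.eventually h3] with q k1 k2 k3
  choose! e he using k1
  exact ⟨e, he, k3, k2 e he⟩

/-- The times near a representative of `z` fill a neighbourhood of `z`. -/
theorem eventually_exists_rep (z : UnitAddCircle) {r : ℝ} (hr : 0 < r) :
    ∀ᶠ y in 𝓝 z, ∃ s ∈ Ioo (rep z - r) (rep z + r), (s : UnitAddCircle) = y := by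
  have h : Ioo (rep z - r) (rep z + r) ∈ 𝓝 (rep z) := Ioo_mem_nhds (by linarith) (by linarith)
  have h2 := image_mem_map (m := ((↑) : ℝ → UnitAddCircle)) h
  rw [← circle_nhds_coe, coe_rep] at h2
  exact h2

/-- For curves near `φ`, the preimages of points near `x` lie near the preimages of `x`. -/
theorem eventually_fiber_near {φ : Quasidoodle} {x : ℂ} {S : Finset UnitAddCircle}
    (hS : φ.fiber x = S) {V : UnitAddCircle → Set UnitAddCircle} (hV : ∀ z ∈ S, V z ∈ 𝓝 z) :
    ∀ᶠ q in φ.nhdsC1 ×ˢ 𝓝 x, ∀ y, q.1.pt y = q.2 → ∃ z ∈ S, y ∈ V z := by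
  have h := isCompact_univ.eventually_forall_mem (X := UnitAddCircle) (F := φ.nhdsC1 ×ˢ 𝓝 x)
    (P := fun (q : Quasidoodle × ℂ) (y : UnitAddCircle) => q.1.pt y = q.2 → ∃ z ∈ S, y ∈ V z) ?_
  · exact h.mono fun q hq y => hq y trivial
  · intro y _
    by_cases hy : y ∈ S
    · have h1 : ∀ᶠ y' in 𝓝 y, y' ∈ V y := hV y hy
      exact (h1.prod_inr _).mono fun q hq _ => ⟨y, hy, hq⟩
    · have hne : φ.pt y ≠ x := fun he => hy (by rw [← Finset.mem_coe, ← hS]; exact he)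
      have h1 : Tendsto (fun q : (Quasidoodle × ℂ) × UnitAddCircle => q.1.1.pt q.2)
          ((φ.nhdsC1 ×ˢ 𝓝 x) ×ˢ 𝓝 y) (𝓝 (φ.pt y)) :=
        (φ.tendsto_pt y).comp ((tendsto_fst.comp tendsto_fst).prodMk tendsto_snd)
      have h2 : Tendsto (fun q : (Quasidoodle × ℂ) × UnitAddCircle => q.1.2)
          ((φ.nhdsC1 ×ˢ 𝓝 x) ×ˢ 𝓝 y) (𝓝 x) := tendsto_snd.comp tendsto_fst
      have h3 := (h1.sub h2).eventually_ne (sub_ne_zero.2 hne)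
      exact h3.mono fun q hq he => absurd (sub_eq_zero.2 he) hq

/-- A common radius for disjoint arcs around finitely many points on which all curves near `φ` are
injective. -/
theorem exists_radius_injOn {φ : Quasidoodle} (hφ : φ.IsImmersion) (S : Finset UnitAddCircle) :
    ∃ ρ > 0, (∀ z ∈ S, ∀ z' ∈ S, z ≠ z' → Disjoint (Metric.ball z ρ) (Metric.ball z' ρ)) ∧
      ∀ᶠ ψ in φ.nhdsC1, ∀ z ∈ S, InjOn ψ.pt (Metric.ball z ρ) := by
  have h1 : ∀ z : UnitAddCircle, ∃ ρ > 0, ∀ᶠ ψ in φ.nhdsC1, InjOn ψ.pt (Metric.ball z ρ) := by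
    intro z
    obtain ⟨pa, ha, pb, hb, h⟩ := eventually_prod_iff.1 (hφ.eventually_injective_near z)
    obtain ⟨ρ, hρ, hb'⟩ := Metric.nhds_basis_ball.eventually_iff.1 hb
    refine ⟨ρ, hρ, ha.mono fun ψ hψ y hy y' hy' he => h hψ (y := (y, y')) (hb' ?_) he⟩
    rw [← ball_prod_same]
    exact ⟨hy, hy'⟩
  choose ρ hρ h1 using h1
  have e1 : ∀ᶠ r in 𝓝[>] (0 : ℝ), ∀ z ∈ S, r ∈ Ioc 0 (ρ z) := by
    rw [Filter.eventually_all_finset]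
    exact fun z _ => Ioc_mem_nhdsGT (hρ z)
  have e2 : ∀ᶠ r in 𝓝[>] (0 : ℝ), ∀ z ∈ S, ∀ z' ∈ S, z ≠ z' →
      Disjoint (Metric.ball z r) (Metric.ball z' r) := by
    rw [Filter.eventually_all_finset]
    intro z _
    rw [Filter.eventually_all_finset]
    intro z' _
    by_cases hz : z = z'
    · exact Eventually.of_forall fun r h => absurd hz h
    · filter_upwards [Ioc_mem_nhdsGT (half_pos (dist_pos.2 hz))] with r hr _
      exact Metric.ball_disjoint_ball (by linarith [hr.2])
  obtain ⟨r, ⟨h2, h3⟩, h4⟩ := ((e1.and e2).and self_mem_nhdsWithin).exists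
  refine ⟨r, h4, h3, ?_⟩
  rw [Filter.eventually_all_finset]
  exact fun z hz => (h1 z).mono fun ψ hψ => hψ.mono (Metric.ball_subset_ball (h2 z hz).2)

/-- If all branches of a multiple point of `φ` still meet in one point for a nearby curve, then no
other branch meets this point, and its index is the same. -/
theorem eventually_ind_eq {φ : Quasidoodle} (hφ : φ.IsImmersion) {x : ℂ}
    {S : Finset UnitAddCircle} (hS : φ.fiber x = S) :
    ∃ ρ > 0, ∀ᶠ q in φ.nhdsC1 ×ˢ 𝓝 x, ∀ ξ : UnitAddCircle → UnitAddCircle,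
      (∀ z ∈ S, dist (ξ z) z < ρ ∧ q.1.pt (ξ z) = q.2) →
        InjOn ξ S ∧ q.1.fiber q.2 = ξ '' S ∧ q.1.ind q.2 = φ.ind x := by
  obtain ⟨ρ₁, hρ₁, hdisj, hinj⟩ := exists_radius_injOn hφ S
  obtain ⟨r, hr, hside⟩ := exists_sides hφ (rep_inj S) (toFun_eq_iff_exists_rep hS)
    one_pos (half_pos one_pos)
  have hrep : ∀ z, ∃ ρ > 0, ∀ y, dist y z < ρ →
      ∃ s ∈ Ioo (rep z - r) (rep z + r), (s : UnitAddCircle) = y := fun z =>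
    Metric.eventually_nhds_iff.1 (eventually_exists_rep z hr.1)
  choose ρ₂ hρ₂ hrep using hrep
  obtain ⟨ρ, hρ, hle, hle'⟩ := exists_pos_le_forall_le S hρ₂ hρ₁
  refine ⟨ρ, hρ, ?_⟩
  filter_upwards [hside, eventually_fiber_near hS (V := fun z => Metric.ball z ρ₁)
    fun z _ => Metric.ball_mem_nhds z hρ₁, tendsto_fst.eventually hinj,
    tendsto_fst.eventually hφ.eventually] with q h1 h2 h3 himm ξ hξ
  have hball : ∀ z ∈ S, ξ z ∈ Metric.ball z ρ₁ := fun z hz => (hξ z hz).1.trans_le hle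
  have hξinj : InjOn ξ S := by
    intro z hz z' hz' he
    by_contra hne
    exact disjoint_left.1 (hdisj z hz z' hz' hne) (hball z hz) (he ▸ hball z' hz')
  have hfib : q.1.fiber q.2 = ξ '' S := by
    ext y
    constructor
    · intro hy
      obtain ⟨z, hz, hyz⟩ := h2 y hy
      exact ⟨z, hz, h3 z hz (hball z hz) hyz ((hξ z hz).2.trans (Eq.symm hy))⟩
    · rintro ⟨z, hz, rfl⟩
      exact (hξ z hz).2
  refine ⟨hξinj, hfib, ?_⟩
  obtain ⟨e, he, hcone, hind⟩ := h1
  -- the point lies on each of the branches, so there is no contribution of sides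
  have he0 : ∀ z ∈ S, e z = 0 := by
    intro z hz
    obtain ⟨s, hs, hsy⟩ := hrep z (ξ z) ((hξ z hz).1.trans_le (hle' z hz))
    refine (he z hz).eq_zero (hcone z hz) (Ioo_subset_Icc_self hs) ?_
    rw [← pt_coe, hsy]
    exact (hξ z hz).2
  rw [Finset.sum_eq_zero he0, mul_zero, sub_zero] at hind
  -- both indices are in the same class modulo `1` and differ by less than `1`
  obtain ⟨m, hm⟩ := exists_int_ind_eq_add hφ (rep_inj S) (toFun_eq_iff_exists_rep hS)
  obtain ⟨n, hn⟩ := exists_int_ind_eq_add (x := q.2) himm (S := S) (z := fun z => rep (ξ z))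
    (fun i hi j hj h => hξinj hi hj (by rwa [coe_rep, coe_rep] at h)) (fun s => by
      have : q.1.toFun s = q.2 ↔ (s : UnitAddCircle) ∈ q.1.fiber q.2 := Iff.rfl
      rw [this, hfib]
      simp only [coe_rep]
      constructor
      · rintro ⟨z, hz, h⟩
        exact ⟨z, hz, h.symm⟩
      · rintro ⟨z, hz, h⟩
        exact ⟨z, hz, h.symm⟩)
  rw [hm, hn] at hind ⊢
  have h5 : |((n - m : ℤ) : ℝ)| < 1 := by
    push_cast
    calc |(n : ℝ) - m| = |(n : ℝ) + S.card / 2 - (m + S.card / 2)| := by congr 1; ring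
      _ < 1 := by linarith
  have h6 : n - m = 0 := by
    rw [← Int.abs_lt_one_iff]
    exact_mod_cast h5
  have h7 : n = m := by omega
  rw [h7]

end Quasidoodle

/-! ### Partial moments of nearby curves -/

theorem binom_add_one (i : ℝ) (β : ℕ) : binom (i + 1) (β + 1) = binom i (β + 1) + binom i β := by
  have h1 : ∏ k ∈ Finset.range (β + 1), (i + 1 - k) = (i + 1) * ∏ k ∈ Finset.range β, (i - k) := by
    rw [Finset.prod_range_succ', mul_comm]
    congr 1
    · simp
    · refine Finset.prod_congr rfl fun k _ => ?_
      push_cast; ring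
  have h2 : (β.factorial : ℝ) ≠ 0 := by exact_mod_cast β.factorial_ne_zero
  rw [binom, binom, binom, h1, Finset.prod_range_succ, Nat.factorial_succ]
  push_cast
  field_simp
  ring

namespace Quasidoodle

/-- A finite union of fibers, transverse ones, that contains all points of multiplicity at least
three. -/
structure IsCore (φ : Quasidoodle) (T : Set UnitAddCircle) : Prop where
  finite : T.Finite
  saturated : ∀ x ∈ T, ∀ y, φ.pt y = φ.pt x → y ∈ T
  transverse : ∀ x ∈ T, ∀ y ∈ T, x ≠ y → φ.pt x = φ.pt y → planeDet (φ.vel x) (φ.vel y) ≠ 0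
  double : ∀ x ∉ T, ∀ y z, φ.pt y = φ.pt x → φ.pt z = φ.pt x → y ≠ x → z ≠ x → y = z

theorem IsIDoodle.isCore_empty {φ : Quasidoodle} (hφ : φ.IsIDoodle) : φ.IsCore ∅ where
  finite := finite_empty
  saturated := by simp
  transverse := by simp
  double := by
    intro x _ y z hy hz hyx hzx
    by_contra hyz
    exact hφ.2 x y z hyx.symm hyz hzx.symm ⟨hy.symm, hy.trans hz.symm⟩

/-- A transverse double point persists as at most one double point of nearby curves. -/
theorem exists_nhds_unique_crossing {φ : Quasidoodle} {x y : UnitAddCircle}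
    (h : planeDet (φ.vel x) (φ.vel y) ≠ 0) :
    ∃ V ∈ 𝓝 x, ∃ W ∈ 𝓝 y, ∀ᶠ ψ in φ.nhdsC1, ∀ x₁ ∈ V, ∀ x₂ ∈ V, ∀ y₁ ∈ W, ∀ y₂ ∈ W,
      ψ.pt x₁ = ψ.pt y₁ → ψ.pt x₂ = ψ.pt y₂ → x₁ = x₂ ∧ y₁ = y₂ := by
  obtain ⟨r, hr, hs⟩ := exists_sign_planeDet_eq (φ := φ) (s₀ := rep x) (t₀ := rep y)
    (by rwa [deriv_rep, deriv_rep])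
  refine ⟨_, eventually_exists_rep x hr, _, eventually_exists_rep y hr, ?_⟩
  filter_upwards [hs] with ψ hψ
  rintro _ ⟨s₁, hs₁, rfl⟩ _ ⟨s₂, hs₂, rfl⟩ _ ⟨t₁, ht₁, rfl⟩ _ ⟨t₂, ht₂, rfl⟩ h1 h2
  rw [deriv_rep, deriv_rep] at hψ
  obtain ⟨h3, h4⟩ := injective_sub_of_planeDet_ne_zero (ψ := ψ) ordConnected_Icc ordConnected_Icc
    (fun s hs t ht h0 => by
      have := hψ s hs t ht
      rw [h0, sign_zero] at this
      exact h (sign_eq_zero_iff.1 this.symm))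
    (Ioo_subset_Icc_self hs₁) (Ioo_subset_Icc_self hs₂) (Ioo_subset_Icc_self ht₁)
    (Ioo_subset_Icc_self ht₂) (by
      rw [pt_coe, pt_coe] at h1 h2
      rw [h1, h2, sub_self, sub_self])
  rw [h3, h4]
  exact ⟨rfl, rfl⟩

/-- Near the core there are no double points besides those of the core. -/
theorem IsCore.exists_radius {φ : Quasidoodle} (hφ : φ.IsImmersion) {T : Set UnitAddCircle}
    (hT : φ.IsCore T) : ∃ r₀ > 0, ∀ r < r₀, ∀ x ∈ Metric.cthickening r T,
      ∀ y ∈ Metric.cthickening r T, φ.pt x = φ.pt y → x = y ∨ (x ∈ T ∧ y ∈ T) := by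
  have h1 : ∀ x₀ : UnitAddCircle, ∀ y₀ : UnitAddCircle, ∃ ρ > 0, x₀ ∈ T → y₀ ∈ T →
      ∀ x, dist x x₀ < ρ → ∀ y, dist y y₀ < ρ → φ.pt x = φ.pt y → x = y ∨ (x ∈ T ∧ y ∈ T) := by
    intro x₀ y₀
    by_cases hmem : x₀ ∈ T ∧ y₀ ∈ T
    swap
    · exact ⟨1, one_pos, fun hx hy => absurd ⟨hx, hy⟩ hmem⟩
    have h2 : ∀ᶠ ξ : UnitAddCircle × UnitAddCircle in 𝓝 (x₀, y₀), φ.pt ξ.1 = φ.pt ξ.2 →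
        ξ.1 = ξ.2 ∨ (ξ.1 ∈ T ∧ ξ.2 ∈ T) := by
      by_cases he : φ.pt x₀ = φ.pt y₀
      · by_cases hxy : x₀ = y₀
        · subst hxy
          have h3 := (hφ.eventually_injective_near x₀).filter_mono
            (prod_mono_left (𝓝 (x₀, x₀)) φ.pure_le_nhdsC1)
          rw [pure_prod, eventually_map] at h3
          exact h3.mono fun ξ h h' => Or.inl (h h')
        · obtain ⟨V, hV, W, hW, h3⟩ :=
            exists_nhds_unique_crossing (hT.transverse x₀ hmem.1 y₀ hmem.2 hxy he)
          filter_upwards [prod_mem_nhds hV hW] with ξ hξ h'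
          obtain ⟨h4, h5⟩ := eventually_self h3 ξ.1 hξ.1 x₀ (mem_of_mem_nhds hV) ξ.2 hξ.2 y₀
            (mem_of_mem_nhds hW) h' he
          rw [h4, h5]
          exact Or.inr hmem
      · have hc : Continuous fun ξ : UnitAddCircle × UnitAddCircle => φ.pt ξ.1 - φ.pt ξ.2 :=
          (φ.continuous_pt.comp continuous_fst).sub (φ.continuous_pt.comp continuous_snd)
        exact ((hc.tendsto (x₀, y₀)).eventually_ne (sub_ne_zero.2 he)).mono fun ξ h h' =>
          absurd (sub_eq_zero.2 h') h
    obtain ⟨ρ, hρ, h3⟩ := Metric.eventually_nhds_iff.1 h2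
    exact ⟨ρ, hρ, fun _ _ x hx y hy => h3 (y := (x, y)) (max_lt hx hy)⟩
  choose ρ hρ h1 using h1
  obtain ⟨r₀, hr₀, -, h2⟩ := exists_pos_le_forall_le (hT.finite.toFinset ×ˢ hT.finite.toFinset)
    (ρ := fun p => ρ p.1 p.2) (fun p => hρ p.1 p.2) one_pos
  refine ⟨r₀, hr₀, fun r hr x hx y hy he => ?_⟩
  obtain ⟨x₀, hx₀, hx'⟩ := Metric.mem_thickening_iff.1 (Metric.cthickening_subset_thickening'
    hr₀ hr T hx)
  obtain ⟨y₀, hy₀, hy'⟩ := Metric.mem_thickening_iff.1 (Metric.cthickening_subset_thickening'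
    hr₀ hr T hy)
  have h3 := h2 (x₀, y₀) (by
    rw [Finset.mem_product]
    exact ⟨hT.finite.mem_toFinset.2 hx₀, hT.finite.mem_toFinset.2 hy₀⟩)
  exact h1 x₀ y₀ hx₀ hy₀ x (hx'.trans_le h3) y (hy'.trans_le h3) he

open Classical in
/-- The weight of a crossing in the moment; crossings with both preimages in `N` are left out. -/
noncomputable def regularWeight (β : ℕ) (N : Set UnitAddCircle) (ψ : Quasidoodle)
    (p : UnitAddCircle × UnitAddCircle) : ℝ :=
  if p.1 = p.2 ∨ (p.1 ∈ N ∧ p.2 ∈ N) then 0 else binom (ψ.ind (ψ.pt p.1)) β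

/-- The moment without the contribution of the crossings with both preimages in `N`. -/
noncomputable def partialMoment (ψ : Quasidoodle) (b : ℝ) (β : ℕ) (N : Set UnitAddCircle) : ℝ :=
  ψ.signedSum b (regularWeight β N ψ) + 2 * binom (ψ.ind (ψ.toFun b) + 2⁻¹) (β + 1)

theorem IsCore.fiber_eq {φ : Quasidoodle} {T : Set UnitAddCircle} (hT : φ.IsCore T)
    {x y : UnitAddCircle} (hx : x ∉ T) (hxy : x ≠ y) (he : φ.pt x = φ.pt y) :
    φ.fiber (φ.pt x) = (({x, y} : Finset UnitAddCircle) : Set UnitAddCircle) := by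
  ext z
  simp only [mem_fiber, Finset.coe_insert, Finset.coe_singleton, mem_insert_iff, mem_singleton_iff]
  constructor
  · intro h
    by_contra! h'
    exact h'.2 (hT.double x hx z y h he.symm h'.1 hxy.symm)
  · rintro (rfl | rfl)
    · rfl
    · exact he.symm

theorem tendsto_pt_fst (φ : Quasidoodle) (ζ : UnitAddCircle × UnitAddCircle) :
    Tendsto (fun q : Quasidoodle × UnitAddCircle × UnitAddCircle => (q.1, q.1.pt q.2.1))
      (φ.nhdsC1 ×ˢ 𝓝 ζ) (φ.nhdsC1 ×ˢ 𝓝 (φ.pt ζ.1)) :=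
  tendsto_fst.prodMk ((φ.tendsto_pt ζ.1).comp
    (tendsto_fst.prodMk ((continuous_fst.tendsto ζ).comp tendsto_snd)))

/-- Double points of curves near `φ` which are near a double point of `φ` have the same index. -/
theorem eventually_ind_double_eq {φ : Quasidoodle} (hφ : φ.IsImmersion) {x y : UnitAddCircle}
    (hxy : x ≠ y)
    (hfib : φ.fiber (φ.pt x) = (({x, y} : Finset UnitAddCircle) : Set UnitAddCircle)) :
    ∀ᶠ q in φ.nhdsC1 ×ˢ 𝓝 (x, y), q.1.pt q.2.1 = q.1.pt q.2.2 →
      q.1.ind (q.1.pt q.2.1) = φ.ind (φ.pt x) := by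
  obtain ⟨ρ, hρ, h⟩ := eventually_ind_eq hφ hfib
  have hball : ∀ᶠ ξ in 𝓝 (x, y), ξ ∈ Metric.ball (x, y) ρ := Metric.ball_mem_nhds (x, y) hρ
  filter_upwards [(φ.tendsto_pt_fst (x, y)).eventually h, hball.prod_inr _] with q h1 h2 h3
  classical
  refine (h1 (fun z => if z = x then q.2.1 else q.2.2) fun z hz => ?_).2.2
  obtain ⟨h4, h5⟩ := max_lt_iff.1 (show max _ _ < ρ from h2)
  rw [Finset.mem_insert, Finset.mem_singleton] at hz
  rcases hz with rfl | rfl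
  · rw [if_pos rfl]
    exact ⟨h4, rfl⟩
  · rw [if_neg hxy.symm]
    exact ⟨h5, h3.symm⟩

/-- The weight in the partial moment is locally constant along the double points of all nearby curves,
as `exists_signedSum_sub` requires. -/
theorem IsCore.eventually_regularWeight_eq {φ : Quasidoodle} (hφ : φ.IsImmersion)
    {T : Set UnitAddCircle} (hT : φ.IsCore T) {r : ℝ} (hr : 0 < r)
    (hiso : ∀ x ∈ Metric.cthickening r T, ∀ y ∈ Metric.cthickening r T, φ.pt x = φ.pt y →
      x = y ∨ (x ∈ T ∧ y ∈ T)) (β : ℕ) (ζ : UnitAddCircle × UnitAddCircle)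
    (hζ : φ.pt ζ.1 = φ.pt ζ.2) :
    ∀ᶠ q in φ.nhdsC1 ×ˢ 𝓝 ζ, q.1.pt q.2.1 = q.1.pt q.2.2 →
      regularWeight β (Metric.thickening r T) q.1 q.2 =
        regularWeight β (Metric.thickening r T) φ ζ := by
  obtain ⟨x, y⟩ := ζ
  simp only at hζ
  by_cases hxy : x = y
  · subst hxy
    filter_upwards [hφ.eventually_injective_near x] with q h1 h2
    rw [regularWeight, regularWeight, if_pos (Or.inl (h1 h2)), if_pos (Or.inl rfl)]
  by_cases hx : x ∈ T
  · have hy : y ∈ T := hT.saturated x hx y hζ.symm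
    have hx' : x ∈ Metric.thickening r T := Metric.self_subset_thickening hr T hx
    have hy' : y ∈ Metric.thickening r T := Metric.self_subset_thickening hr T hy
    have h1 : ∀ᶠ ξ : UnitAddCircle × UnitAddCircle in 𝓝 (x, y),
        ξ ∈ Metric.thickening r T ×ˢ Metric.thickening r T :=
      prod_mem_nhds (Metric.isOpen_thickening.mem_nhds hx') (Metric.isOpen_thickening.mem_nhds hy')
    filter_upwards [h1.prod_inr φ.nhdsC1] with q h2 _
    rw [regularWeight, regularWeight, if_pos (Or.inr ⟨h2.1, h2.2⟩), if_pos (Or.inr ⟨hx', hy'⟩)]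
  · have h1 : (x, y) ∉ Metric.cthickening r T ×ˢ Metric.cthickening r T := by
      rintro ⟨h2, h3⟩
      rcases hiso x h2 y h3 hζ with h | h
      · exact hxy h
      · exact hx h.1
    have h2 : ∀ᶠ ξ : UnitAddCircle × UnitAddCircle in 𝓝 (x, y),
        ξ ∉ Metric.cthickening r T ×ˢ Metric.cthickening r T :=
      (Metric.isClosed_cthickening.prod Metric.isClosed_cthickening).isOpen_compl.mem_nhds h1
    have h3 : ∀ᶠ ξ : UnitAddCircle × UnitAddCircle in 𝓝 (x, y), ξ.1 ≠ ξ.2 :=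
      (isOpen_ne_fun continuous_fst continuous_snd).mem_nhds hxy
    have h4 : ∀ p : UnitAddCircle × UnitAddCircle, p.1 ≠ p.2 →
        p ∉ Metric.cthickening r T ×ˢ Metric.cthickening r T →
        ¬ (p.1 = p.2 ∨ (p.1 ∈ Metric.thickening r T ∧ p.2 ∈ Metric.thickening r T)) := by
      rintro p hp hp' (h | h)
      · exact hp h
      · exact hp' ⟨Metric.thickening_subset_cthickening r T h.1,
          Metric.thickening_subset_cthickening r T h.2⟩
    filter_upwards [h2.prod_inr φ.nhdsC1, h3.prod_inr φ.nhdsC1,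
      eventually_ind_double_eq hφ hxy (hT.fiber_eq hx hxy hζ)] with q h5 h6 h7 h8
    rw [regularWeight, regularWeight, if_neg (h4 _ h6 h5), if_neg (h4 (x, y) hxy h1), h7 h8]

theorem GoodAt.fiber_eq {ψ : Quasidoodle} {b : ℝ} (h : ψ.GoodAt b) :
    ψ.fiber (ψ.toFun b) = (({(b : UnitAddCircle)} : Finset UnitAddCircle) : Set UnitAddCircle) := by
  ext z
  obtain ⟨s, -, rfl⟩ := exists_coe_mem_Ico 0 z
  simp only [Finset.coe_singleton, mem_singleton_iff]
  constructor
  · exact h.simple s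
  · intro hs
    rw [mem_fiber, hs, pt_coe]

/-- The point at time `b` on a curve near `φ` keeps its index if it is simple for `φ`, and changes
it by one half in one or the other direction if it was a double point. -/
theorem IsCore.eventually_ind_base {φ : Quasidoodle} (hφ : φ.IsImmersion) {T : Set UnitAddCircle}
    (hT : φ.IsCore T) {b : ℝ} (hb : (b : UnitAddCircle) ∉ T) :
    (∀ᶠ ψ in φ.nhdsC1, ψ.GoodAt b → ψ.ind (ψ.toFun b) = φ.ind (φ.toFun b)) ∨
      ∀ᶠ ψ in φ.nhdsC1, ψ.GoodAt b → ψ.ind (ψ.toFun b) = φ.ind (φ.toFun b) + 2⁻¹ ∨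
        ψ.ind (ψ.toFun b) = φ.ind (φ.toFun b) - 2⁻¹ := by
  have hlim : Tendsto (fun ψ : Quasidoodle => (ψ, ψ.toFun b)) φ.nhdsC1
      (φ.nhdsC1 ×ˢ 𝓝 (φ.toFun b)) :=
    tendsto_id.prodMk ((φ.tendsto_toFun b).comp (tendsto_id.prodMk tendsto_const_nhds))
  by_cases hd : ∃ y : UnitAddCircle, (b : UnitAddCircle) ≠ y ∧ φ.pt b = φ.pt y
  · right
    obtain ⟨y, hby, he⟩ := hd
    have hfib : φ.fiber (φ.toFun b) = _ := hT.fiber_eq hb hby he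
    have h1 : ∀ᶠ s : ℝ in 𝓝 (rep y), (s : UnitAddCircle) ≠ b := by
      refine ((AddCircle.continuous_mk' (1 : ℝ)).tendsto (rep y)).eventually_ne ?_
      rw [QuotientAddGroup.mk'_apply]
      rw [coe_rep]
      exact hby.symm
    obtain ⟨r₁, hr₁, h1⟩ := Metric.eventually_nhds_iff.1 h1
    obtain ⟨r, hr, h2⟩ := exists_sides hφ (rep_inj _) (toFun_eq_iff_exists_rep hfib) hr₁ one_pos
    obtain ⟨m, hm⟩ := exists_int_ind_eq_add hφ (rep_inj _) (toFun_eq_iff_exists_rep hfib)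
    filter_upwards [hlim.eventually h2, hφ.eventually] with ψ h3 himm hψ
    obtain ⟨e, he, hcone, hind⟩ := h3
    obtain ⟨n, hn⟩ := exists_int_ind_eq_add himm (rep_inj _) (toFun_eq_iff_exists_rep hψ.fiber_eq)
    rw [Finset.sum_pair hby] at hind
    rw [Finset.card_pair hby] at hm
    rw [Finset.card_singleton] at hn
    -- the point lies on its own branch and off the other one
    have he0 : e b = 0 := (he b (by simp)).eq_zero (hcone b (by simp)) (s := rep b)
      ⟨by linarith [hr.1], by linarith [hr.1]⟩ (by rw [toFun_rep, pt_coe])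
    have hey : e y = 1 ∨ e y = -1 := (he y (by simp)).cases fun s hs hs' => by
      refine h1 (y := s) ?_ (hψ.simple s hs')
      rw [Real.dist_eq, abs_lt]
      constructor <;> linarith [hs.1, hs.2, hr.2]
    rw [he0, zero_add, hn, hm] at hind
    rw [hn, hm]
    push_cast at hind
    rcases hey with h | h
    · left
      rw [h] at hind
      have h5 : |((n - m - 1 : ℤ) : ℝ)| < 1 := by
        push_cast
        convert hind using 2
        ring
      have h6 : n - m - 1 = 0 := by
        rw [← Int.abs_lt_one_iff]
        exact_mod_cast h5
      have h7 : n = m + 1 := by omega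
      rw [h7]; push_cast; ring
    · right
      rw [h] at hind
      have h5 : |((n - m : ℤ) : ℝ)| < 1 := by
        push_cast
        convert hind using 2
        ring
      have h6 : n - m = 0 := by
        rw [← Int.abs_lt_one_iff]
        exact_mod_cast h5
      have h7 : n = m := by omega
      rw [h7]; push_cast; ring
  · left
    push Not at hd
    have hfib : φ.fiber (φ.toFun b) =
        (({(b : UnitAddCircle)} : Finset UnitAddCircle) : Set UnitAddCircle) := by
      ext z
      simp only [Finset.coe_singleton, mem_singleton_iff]
      constructor
      · intro hz
        by_contra hne
        exact hd z (Ne.symm hne) (Eq.symm hz)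
      · rintro rfl
        rfl
    obtain ⟨ρ, hρ, h⟩ := eventually_ind_eq hφ hfib
    filter_upwards [hlim.eventually h] with ψ h1 _
    exact (h1 id fun z hz => by
      rw [Finset.mem_singleton] at hz
      subst hz
      exact ⟨by simpa using hρ, rfl⟩).2.2

/-- The moment without the crossings near the core is the same for all nearby curves in general
position: when the point at time `b` crosses another branch, the last term compensates for the
change of the sign and of the weight of that crossing. -/
theorem IsCore.exists_partialMoment_eq {φ : Quasidoodle} (hφ : φ.IsImmersion)
    {T : Set UnitAddCircle} (hT : φ.IsCore T) {b : ℝ} (hb : (b : UnitAddCircle) ∉ T) (β : ℕ) :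
    ∃ r₀ > 0, ∀ r ∈ Ioo 0 r₀, ∃ δ > 0, ∀ ψ₀ ψ₁, Close δ φ ψ₀ → Close δ φ ψ₁ → ψ₀.GoodAt b →
      ψ₁.GoodAt b → ψ₀.partialMoment b β (Metric.thickening r T) =
        ψ₁.partialMoment b β (Metric.thickening r T) := by
  obtain ⟨r₀, hr₀, hiso⟩ := hT.exists_radius hφ
  have hbT : ∃ r₁ > 0, (b : UnitAddCircle) ∉ Metric.thickening r₁ T := by
    obtain ⟨r₁, hr₁, h⟩ := Metric.nhds_basis_ball.mem_iff.1
      (hT.finite.isClosed.isOpen_compl.mem_nhds hb)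
    refine ⟨r₁, hr₁, fun h' => ?_⟩
    obtain ⟨z, hz, hd⟩ := Metric.mem_thickening_iff.1 h'
    exact h (Metric.mem_ball.2 (by rwa [dist_comm])) hz
  obtain ⟨r₁, hr₁, hbT⟩ := hbT
  refine ⟨min r₀ r₁, lt_min hr₀ hr₁, fun r hr => ?_⟩
  have hbN : (b : UnitAddCircle) ∉ Metric.thickening r T := fun h =>
    hbT (Metric.thickening_mono (hr.2.le.trans (min_le_right _ _)) T h)
  -- a branch that crosses the point at time `b` does so with the weight `binom · β` of the double
  -- point of `φ` at `b`
  obtain ⟨δ₁, hδ₁, h1⟩ := exists_signedSum_sub hφ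
    (c := regularWeight β (Metric.thickening r T)) (b := b) (K := binom (φ.ind (φ.toFun b)) β)
    (hT.eventually_regularWeight_eq hφ hr.1 (hiso r (hr.2.trans_le (min_le_left _ _))) β)
    (fun x => by rw [regularWeight, if_pos (Or.inl rfl)])
    (fun x y he => by
      have : (x = y ∨ (x ∈ Metric.thickening r T ∧ y ∈ Metric.thickening r T)) ↔
          (y = x ∨ (y ∈ Metric.thickening r T ∧ x ∈ Metric.thickening r T)) := by
        rw [eq_comm, and_comm]
      simp only [regularWeight, he]
      split_ifs with h1 h2 h2
      · rfl
      · exact absurd (this.1 h1) h2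
      · exact absurd (this.2 h2) h1
      · rfl)
    (fun y hy _ => by
      rw [regularWeight, if_neg, pt_coe]
      rintro (h | h)
      · exact hy h.symm
      · exact hbN h.1)
  have fin : ∀ {p : Quasidoodle → Prop}, (∀ᶠ ψ in φ.nhdsC1, ψ.GoodAt b → p ψ) →
      (∀ ψ₀ ψ₁, ψ₁.signedSum b (regularWeight β (Metric.thickening r T) ψ₁) -
        ψ₀.signedSum b (regularWeight β (Metric.thickening r T) ψ₀) =
        -2 * (binom (φ.ind (φ.toFun b)) β * (ψ₁.ind (ψ₁.toFun b) - ψ₀.ind (ψ₀.toFun b))) →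
        p ψ₀ → p ψ₁ → ψ₀.partialMoment b β (Metric.thickening r T) =
          ψ₁.partialMoment b β (Metric.thickening r T)) →
      ∃ δ > 0, ∀ ψ₀ ψ₁, Close δ φ ψ₀ → Close δ φ ψ₁ → ψ₀.GoodAt b →
        ψ₁.GoodAt b → ψ₀.partialMoment b β (Metric.thickening r T) =
        ψ₁.partialMoment b β (Metric.thickening r T) := by
    intro p hp h
    obtain ⟨δ₂, hδ₂, h2⟩ := eventually_nhdsC1_iff.1 hp
    refine ⟨min δ₁ δ₂, lt_min hδ₁ hδ₂, fun ψ₀ ψ₁ c₀ c₁ g₀ g₁ => ?_⟩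
    exact h _ _ (h1 ψ₀ ψ₁ (c₀.mono (min_le_left _ _)) (c₁.mono (min_le_left _ _)) g₀ g₁)
      (h2 _ (c₀.mono (min_le_right _ _)) g₀) (h2 _ (c₁.mono (min_le_right _ _)) g₁)
  rcases hT.eventually_ind_base hφ hb with h2 | h2
  · refine fin h2 fun ψ₀ ψ₁ hs e₀ e₁ => ?_
    rw [e₀, e₁, sub_self, mul_zero, mul_zero] at hs
    rw [partialMoment, partialMoment, e₀, e₁, sub_eq_zero.1 hs]
  · refine fin h2 fun ψ₀ ψ₁ hs e₀ e₁ => ?_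
    -- by Pascal's rule, the last term of the moment changes by the opposite amount
    have hb := binom_add_one (φ.ind (φ.toFun b)) β
    have k1 : φ.ind (φ.toFun b) + 2⁻¹ + 2⁻¹ = φ.ind (φ.toFun b) + 1 := by ring
    have k2 : φ.ind (φ.toFun b) - 2⁻¹ + 2⁻¹ = φ.ind (φ.toFun b) := by ring
    rw [partialMoment, partialMoment]
    rcases e₀ with e₀ | e₀ <;> rcases e₁ with e₁ | e₁ <;> rw [e₀, e₁] at hs ⊢ <;>
      simp only [k1, k2, hb] <;> linarith

/-! ### Moments as weighted sums -/

theorem IsImmersion.finite_fiber {φ : Quasidoodle} (hφ : φ.IsImmersion) (x : ℂ) :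
    (φ.fiber x).Finite := by
  by_contra hinf
  have hcl : IsClosed (φ.fiber x) := isClosed_singleton.preimage φ.continuous_pt
  obtain ⟨z, hz, hacc⟩ := Set.Infinite.exists_accPt_of_subset_isCompact hinf hcl.isCompact le_rfl
  have h := (hφ.eventually_injective_near z).filter_mono
    (prod_mono_left (𝓝 (z, z)) φ.pure_le_nhdsC1)
  rw [pure_prod, eventually_map, nhds_prod_eq] at h
  have h2 : ∀ᶠ y in 𝓝 z, φ.pt z = φ.pt y → z = y := h.curry.self_of_nhds
  obtain ⟨y, ⟨hy, hyf⟩, hy2⟩ := ((accPt_iff_frequently.1 hacc).and_eventually h2).exists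
  exact hy (hy2 (hz.trans hyf.symm)).symm

/-- An accumulation point of double points would be a point where the curve is not immersed or a
crossing that is not transverse. -/
theorem IsRegularIDoodle.finite_doublePairs {φ : Quasidoodle} (hφ : φ.IsRegularIDoodle) :
    {ξ : UnitAddCircle × UnitAddCircle | ξ.1 ≠ ξ.2 ∧ φ.pt ξ.1 = φ.pt ξ.2}.Finite := by
  by_contra hinf
  obtain ⟨ζ, -, hacc⟩ := Set.Infinite.exists_accPt_of_subset_isCompact hinf isCompact_univ
    (subset_univ _)
  have hfreq := accPt_iff_frequently.1 hacc
  have hζ : φ.pt ζ.1 = φ.pt ζ.2 := by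
    by_contra hne
    have hc : Continuous fun ξ : UnitAddCircle × UnitAddCircle => φ.pt ξ.1 - φ.pt ξ.2 :=
      (φ.continuous_pt.comp continuous_fst).sub (φ.continuous_pt.comp continuous_snd)
    obtain ⟨ξ, ⟨-, -, h1⟩, h2⟩ := (hfreq.and_eventually
      ((hc.tendsto ζ).eventually_ne (sub_ne_zero.2 hne))).exists
    exact h2 (sub_eq_zero.2 h1)
  by_cases he : ζ.1 = ζ.2
  · have h := (hφ.1.1.eventually_injective_near ζ.1).filter_mono
      (prod_mono_left (𝓝 (ζ.1, ζ.1)) φ.pure_le_nhdsC1)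
    rw [pure_prod, eventually_map] at h
    have h' : ∀ᶠ ξ in 𝓝 ζ, φ.pt ξ.1 = φ.pt ξ.2 → ξ.1 = ξ.2 := by
      nth_rewrite 2 [he] at h
      exact h
    obtain ⟨ξ, ⟨-, h1, h2⟩, h3⟩ := (hfreq.and_eventually h').exists
    exact h1 (h3 h2)
  · obtain ⟨V, hV, W, hW, h⟩ := exists_nhds_unique_crossing (hφ.2 ζ.1 ζ.2 he hζ)
    have hVW : ∀ᶠ ξ in 𝓝 ζ, ξ ∈ V ×ˢ W := prod_mem_nhds hV hW
    obtain ⟨ξ, ⟨h0, h1, h2⟩, h3⟩ := (hfreq.and_eventually hVW).exists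
    obtain ⟨h4, h5⟩ := eventually_self h ξ.1 h3.1 ζ.1 (mem_of_mem_nhds hV) ξ.2 h3.2 ζ.2
      (mem_of_mem_nhds hW) h2 hζ
    exact h0 (Prod.ext h4 h5)

/-- The pair of points of the circle visited at two times. -/
def coePair (p : ℝ × ℝ) : UnitAddCircle × UnitAddCircle :=
  ((p.1 : UnitAddCircle), (p.2 : UnitAddCircle))

theorem injOn_coePair (b : ℝ) : InjOn coePair (Ico b (b + 1) ×ˢ Ico b (b + 1)) := by
  rintro p ⟨h1, h2⟩ q ⟨h3, h4⟩ h
  exact Prod.ext (circle_coe_inj_Ico h1 h3 (congrArg Prod.fst h))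
    (circle_coe_inj_Ico h2 h4 (congrArg Prod.snd h))

theorem timePairs_subset (ψ : Quasidoodle) (b : ℝ) :
    ψ.timePairs b ⊆ Ico b (b + 1) ×ˢ Ico b (b + 1) := fun _ ⟨h1, h2, h3, _⟩ =>
  ⟨⟨h1, h2.trans h3⟩, h1.trans h2.le, h3⟩

theorem coe_ne_of_mem_timePairs {ψ : Quasidoodle} {b : ℝ} {p : ℝ × ℝ} (hp : p ∈ ψ.timePairs b) :
    (p.1 : UnitAddCircle) ≠ (p.2 : UnitAddCircle) :=
  circle_coe_ne_of_lt hp.2.1 (by linarith [hp.1, hp.2.2.1])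

theorem IsRegularIDoodle.goodAt {φ : Quasidoodle} (hφ : φ.IsRegularIDoodle) {b : ℝ}
    (hb : φ.fiber (φ.pt b) = {(b : UnitAddCircle)}) : φ.GoodAt b where
  finite := by
    refine Set.Finite.of_finite_image (f := coePair) (hφ.finite_doublePairs.subset ?_)
      ((injOn_coePair b).mono (φ.timePairs_subset b))
    rintro _ ⟨p, hp, rfl⟩
    exact ⟨coe_ne_of_mem_timePairs hp, hp.2.2.2⟩
  transverse p hp := hφ.2 _ _ (coe_ne_of_mem_timePairs hp) hp.2.2.2
  simple t ht := by
    have : (t : UnitAddCircle) ∈ φ.fiber (φ.pt b) := ht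
    rwa [hb] at this

theorem visitTime_coe {b s : ℝ} (hs : s ∈ Ico b (b + 1)) :
    visitTime (b : UnitAddCircle) (s : UnitAddCircle) = s - b := by
  rw [visitTime, ← AddCircle.coe_sub, AddCircle.equivIco_coe_of_mem]
  constructor <;> linarith [hs.1, hs.2]

open Classical in
/-- The crossing sum of the definition as a sum over pairs of times. -/
theorem crossingSum_eq {φ : Quasidoodle} (hφ : φ.IsImmersion) (b : ℝ) (β : ℕ)
    (U : Set UnitAddCircle) : φ.crossingSum b β U = φ.signedSum b fun p =>
      if p.1 ∈ U ∧ p.2 ∈ U then binom (φ.ind (φ.pt p.1)) β else 0 := by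
  rw [crossingSum, signedSum]
  have hbij : BijOn coePair {p ∈ φ.timePairs b | (p.1 : UnitAddCircle) ∈ U ∧
      (p.2 : UnitAddCircle) ∈ U} (φ.crossings b U) := by
    refine ⟨?_, (injOn_coePair b).mono fun p hp => φ.timePairs_subset b hp.1, ?_⟩
    · rintro p ⟨hp, hU⟩
      obtain ⟨h1, h2⟩ := φ.timePairs_subset b hp
      refine ⟨hU.1, hU.2, ?_, hp.2.2.2⟩
      change visitTime b (p.1 : UnitAddCircle) < visitTime b (p.2 : UnitAddCircle)
      rw [visitTime_coe h1, visitTime_coe h2]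
      linarith [hp.2.1]
    · rintro ⟨x, y⟩ ⟨hx, hy, hlt, he⟩
      obtain ⟨s, hs, rfl⟩ := exists_coe_mem_Ico b x
      obtain ⟨t, ht, rfl⟩ := exists_coe_mem_Ico b y
      simp only [visitTime_coe hs, visitTime_coe ht] at hlt
      exact ⟨(s, t), ⟨⟨hs.1, by linarith, ht.2, he⟩, hx, hy⟩, rfl⟩
  rw [← finsum_mem_eq_of_bijOn coePair hbij (f := fun p : ℝ × ℝ =>
    -((SignType.sign (planeDet (deriv φ.toFun p.1) (deriv φ.toFun p.2)) : SignType) : ℝ) *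
      if (p.1 : UnitAddCircle) ∈ U ∧ (p.2 : UnitAddCircle) ∈ U then
        binom (φ.ind (φ.pt p.1)) β else 0)]
  · refine finsum_mem_inter_support_eq' _ _ _ ?_
    intro p hp
    constructor
    · exact fun h => h.1
    · refine fun h => ⟨h, ?_⟩
      by_contra h'
      simp only [Function.mem_support, if_neg h', mul_zero, ne_eq, not_true_eq_false] at hp
  · rintro p ⟨hp, hU⟩
    rw [if_pos hU, pointIndex_eq hφ (hφ.finite_fiber _)]
    rfl

theorem signedSum_congr {ψ : Quasidoodle} {b : ℝ} {c c' : UnitAddCircle × UnitAddCircle → ℝ}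
    (h : ∀ p ∈ ψ.timePairs b, c (coePair p) = c' (coePair p)) :
    ψ.signedSum b c = ψ.signedSum b c' :=
  finsum_mem_congr rfl fun p hp => by
    have := h p hp
    rw [coePair] at this
    rw [this]

theorem GoodAt.signedSum_add {ψ : Quasidoodle} {b : ℝ} (h : ψ.GoodAt b)
    (c c' : UnitAddCircle × UnitAddCircle → ℝ) :
    ψ.signedSum b (fun p => c p + c' p) = ψ.signedSum b c + ψ.signedSum b c' := by
  simp only [signedSum, mul_add]
  exact finsum_mem_add_distrib h.finite

/-- The moment is the sum of the contribution of the crossings near a given set and of the rest. -/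
theorem GoodAt.moment_eq {ψ : Quasidoodle} {b : ℝ} (h : ψ.GoodAt b) (hψ : ψ.IsImmersion) (β : ℕ)
    (N : Set UnitAddCircle) :
    ψ.moment b β = ψ.crossingSum b β N + ψ.partialMoment b β N := by
  have hb : ψ.fiber (ψ.pt b) = {(b : UnitAddCircle)} := by
    have := h.fiber_eq
    rwa [Finset.coe_singleton] at this
  rw [moment, partialMoment, baseIndex_eq hψ hb, crossingSum_eq hψ, crossingSum_eq hψ, pt_coe,
    ← add_assoc, ← h.signedSum_add]
  congr 1
  refine signedSum_congr fun p hp => ?_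
  have hne : (coePair p).1 ≠ (coePair p).2 := coe_ne_of_mem_timePairs hp
  simp only [regularWeight, mem_univ, and_self, if_true]
  by_cases hN : (coePair p).1 ∈ N ∧ (coePair p).2 ∈ N
  · rw [if_pos hN, if_pos (Or.inr hN), add_zero]
  · rw [if_neg hN, if_neg (not_or.2 ⟨hne, hN⟩), zero_add]

theorem GoodAt.moment_eq_partialMoment {ψ : Quasidoodle} {b : ℝ} (h : ψ.GoodAt b)
    (hψ : ψ.IsImmersion) (β : ℕ) : ψ.moment b β = ψ.partialMoment b β ∅ := by
  rw [h.moment_eq hψ β ∅, crossingSum_eq hψ]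
  simp [signedSum]

/-! ### Change of the initial point -/

/-- Reparametrization by a shift. -/
def shift (σ : ℝ) (ψ : Quasidoodle) : Quasidoodle where
  toFun s := ψ.toFun (s + σ)
  smooth := ψ.smooth.comp (contDiff_id.add contDiff_const)
  periodic s := by
    change ψ.toFun (s + 1 + σ) = _
    rw [add_right_comm, ψ.periodic]

theorem shift_toFun (σ : ℝ) (ψ : Quasidoodle) (s : ℝ) : (shift σ ψ).toFun s = ψ.toFun (s + σ) := rfl

theorem deriv_shift (σ : ℝ) (ψ : Quasidoodle) (s : ℝ) :
    deriv (shift σ ψ).toFun s = deriv ψ.toFun (s + σ) := deriv_comp_add_const _ _ _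

theorem shift_zero (ψ : Quasidoodle) : shift 0 ψ = ψ := ext_toFun fun s => by
  rw [shift_toFun, add_zero]

theorem ind_shift (σ : ℝ) (ψ : Quasidoodle) (p : ℂ) : (shift σ ψ).ind p = ψ.ind p := by
  rw [ind_eq_integral ψ p σ, ind]
  congr 1
  simp only [deriv_shift, shift_toFun]
  rw [intervalIntegral.integral_comp_add_right (fun s => (deriv ψ.toFun s / (ψ.toFun s - p)).im),
    zero_add, add_comm]
  rfl

theorem pt_shift (σ : ℝ) (ψ : Quasidoodle) (z : UnitAddCircle) :
    (shift σ ψ).pt z = ψ.pt (z + σ) := by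
  obtain ⟨s, -, rfl⟩ := exists_coe_mem_Ico 0 z
  rw [← AddCircle.coe_add, pt_coe, pt_coe, shift_toFun]

theorem vel_shift (σ : ℝ) (ψ : Quasidoodle) (z : UnitAddCircle) :
    (shift σ ψ).vel z = ψ.vel (z + σ) := by
  obtain ⟨s, -, rfl⟩ := exists_coe_mem_Ico 0 z
  rw [← AddCircle.coe_add, vel_coe, vel_coe, deriv_shift]

theorem IsRegularIDoodle.shift {ψ : Quasidoodle} (h : ψ.IsRegularIDoodle) (σ : ℝ) :
    (ψ.shift σ).IsRegularIDoodle := by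
  refine ⟨⟨fun z => ?_, fun x y z hxy hyz hxz => ?_⟩, fun x y hxy he => ?_⟩
  · rw [vel_shift]
    exact h.1.1 _
  · simp only [pt_shift]
    exact h.1.2 _ _ _ (fun h => hxy (add_right_cancel h)) (fun h => hyz (add_right_cancel h))
      (fun h => hxz (add_right_cancel h))
  · simp only [pt_shift, vel_shift] at he ⊢
    exact h.2 _ _ (fun h => hxy (add_right_cancel h)) he

theorem GoodAt.shift {ψ : Quasidoodle} {b σ : ℝ} (h : ψ.GoodAt (b + σ)) (hψ : ψ.IsRegularIDoodle) :
    (ψ.shift σ).GoodAt b := by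
  refine (hψ.shift σ).goodAt ?_
  ext z
  rw [mem_fiber, pt_shift, pt_shift, ← AddCircle.coe_add, mem_singleton_iff, pt_coe]
  have h1 : z + σ ∈ ψ.fiber (ψ.toFun (b + σ)) ↔ z = b := by
    rw [h.fiber_eq, Finset.coe_singleton, mem_singleton_iff, AddCircle.coe_add]
    exact add_left_inj _
  exact h1

theorem partialMoment_shift (ψ : Quasidoodle) (b σ : ℝ) (β : ℕ) :
    (ψ.shift σ).partialMoment b β ∅ = ψ.partialMoment (b + σ) β ∅ := by
  rw [partialMoment, partialMoment, ind_shift, shift_toFun]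
  congr 1
  refine finsum_mem_eq_of_bijOn (fun p : ℝ × ℝ => (p.1 + σ, p.2 + σ)) ⟨?_, ?_, ?_⟩ ?_
  · rintro p ⟨h1, h2, h3, h4⟩
    exact ⟨by simpa using h1, by simpa using h2, by simp only; linarith, h4⟩
  · rintro p - q - h
    simp only [Prod.mk.injEq, add_left_inj] at h
    exact Prod.ext h.1 h.2
  · rintro p ⟨h1, h2, h3, h4⟩
    refine ⟨(p.1 - σ, p.2 - σ), ⟨by simp only; linarith, by simpa using h2, by simp only; linarith,
      ?_⟩, by simp⟩
    simpa [shift_toFun] using h4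
  · intro p _
    simp only [deriv_shift, regularWeight, ind_shift, pt_shift, AddCircle.coe_add, add_left_inj,
      mem_empty_iff_false, and_self, or_false]

theorem tendsto_shift (ψ : Quasidoodle) (σ₀ : ℝ) :
    Tendsto (fun σ => ψ.shift σ) (𝓝 σ₀) (ψ.shift σ₀).nhdsC1 := by
  rw [(ψ.shift σ₀).hasBasis_nhdsC1.tendsto_right_iff]
  intro δ hδ
  have key : ∀ f : ℝ → ℂ, Continuous f → ∀ᶠ σ in 𝓝 σ₀, ∀ s ∈ Icc (0 : ℝ) 1,
      ‖f (s + σ) - f (s + σ₀)‖ < δ := by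
    intro f hf
    refine isCompact_Icc.eventually_forall_mem
      (P := fun (σ s : ℝ) => ‖f (s + σ) - f (s + σ₀)‖ < δ) fun s _ => ?_
    rw [← nhds_prod_eq]
    have hc : Continuous fun q : ℝ × ℝ => ‖f (q.2 + q.1) - f (q.2 + σ₀)‖ :=
      ((hf.comp (continuous_snd.add continuous_fst)).sub
        (hf.comp (continuous_snd.add continuous_const))).norm
    exact (hc.tendsto (σ₀, s)).eventually (gt_mem_nhds (by simpa using hδ))
  filter_upwards [key _ ψ.continuous_toFun, key _ ψ.continuous_deriv] with σ h1 h2 s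
  simp only [shift_toFun, deriv_shift]
  have hfr : Int.fract s ∈ Icc (0 : ℝ) 1 := ⟨Int.fract_nonneg s, (Int.fract_lt_one s).le⟩
  have e : ∀ τ : ℝ, s + τ = Int.fract s + τ + (⌊s⌋ : ℤ) := fun τ => by
    rw [Int.fract]; ring
  rw [e, e, toFun_add_int, toFun_add_int, deriv_add_int, deriv_add_int]
  exact ⟨h1 _ hfr, h2 _ hfr⟩

/-! ### The moment invariant -/

/-- All but finitely many times in a period can serve as initial time. -/
theorem IsRegularIDoodle.eventually_goodAt {ψ : Quasidoodle} (hψ : ψ.IsRegularIDoodle) (σ₀ : ℝ) :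
    ∀ᶠ σ in 𝓝[≠] σ₀, ψ.GoodAt σ := by
  set D : Set UnitAddCircle := Prod.fst '' {ξ : UnitAddCircle × UnitAddCircle |
    ξ.1 ≠ ξ.2 ∧ ψ.pt ξ.1 = ψ.pt ξ.2} with hD
  have hfin : (D \ {(σ₀ : UnitAddCircle)}).Finite := (hψ.finite_doublePairs.image _).sdiff
  have h1 : ∀ᶠ σ : ℝ in 𝓝 σ₀, (σ : UnitAddCircle) ∉ D \ {(σ₀ : UnitAddCircle)} :=
    ((AddCircle.continuous_mk' (1 : ℝ)).tendsto σ₀).eventually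
      (hfin.isClosed.isOpen_compl.mem_nhds (by simp))
  have h2 : ∀ᶠ σ : ℝ in 𝓝 σ₀, σ ∈ Ioo (σ₀ - 1) (σ₀ + 1) :=
    Ioo_mem_nhds (by linarith) (by linarith)
  filter_upwards [nhdsWithin_le_nhds h1, nhdsWithin_le_nhds h2, self_mem_nhdsWithin]
    with σ h3 h4 h5
  have h6 : (σ : UnitAddCircle) ≠ σ₀ := by
    rcases lt_or_gt_of_ne (show σ ≠ σ₀ from h5) with h | h
    · exact circle_coe_ne_of_lt h (by linarith [h4.1])
    · exact (circle_coe_ne_of_lt h (by linarith [h4.2])).symm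
  refine hψ.goodAt ?_
  ext z
  rw [mem_fiber, mem_singleton_iff]
  constructor
  · intro hz
    by_contra hne
    exact h3 ⟨⟨(σ, z), ⟨Ne.symm hne, hz.symm⟩, rfl⟩, h6⟩
  · rintro rfl
    rfl

theorem exists_close_partialMoment_eq {φ : Quasidoodle} (hφ : φ.IsIDoodle) (b : ℝ) (β : ℕ) :
    ∃ δ > 0, ∀ ψ₀ ψ₁, Close δ φ ψ₀ → Close δ φ ψ₁ → ψ₀.GoodAt b → ψ₁.GoodAt b →
      ψ₀.partialMoment b β ∅ = ψ₁.partialMoment b β ∅ := by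
  obtain ⟨r₀, hr₀, h⟩ := hφ.isCore_empty.exists_partialMoment_eq hφ.1 (b := b) (by simp) β
  simpa using h (r₀ / 2) ⟨half_pos hr₀, half_lt_self hr₀⟩

/-- A function that is constant, near each point, on a dense set is constant on this set. -/
theorem eq_of_locally_eq_on_dense {B : Set ℝ} {f : ℝ → ℝ}
    (hB : ∀ σ, ∃ᶠ b in 𝓝 σ, b ∈ B)
    (h : ∀ σ, ∃ U ∈ 𝓝 σ, ∀ b ∈ U, ∀ b' ∈ U, b ∈ B → b' ∈ B → f b = f b') {b b' : ℝ}
    (hb : b ∈ B) (hb' : b' ∈ B) : f b = f b' := by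
  set A : Set ℝ := {σ | ∀ᶠ c in 𝓝 σ, c ∈ B → f c = f b} with hA
  have hopen : IsOpen A := isOpen_iff_eventually.2 fun σ hσ => hσ.eventually_nhds
  have hclosed : IsClosed A := by
    rw [← isOpen_compl_iff, isOpen_iff_eventually]
    intro σ hσ
    obtain ⟨U, hU, hU'⟩ := h σ
    filter_upwards [eventually_mem_nhds_iff.2 hU] with τ hτ hτA
    have hτ' : ∀ᶠ c in 𝓝 τ, c ∈ U := hτ
    obtain ⟨c, hcB, hcU, hcA⟩ := ((hB τ).and_eventually (hτ'.and hτA)).exists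
    refine hσ ?_
    filter_upwards [hU] with d hd hdB
    rw [hU' d hd c hcU hdB hcB, hcA hcB]
  have hbA : b ∈ A := by
    obtain ⟨U, hU, hU'⟩ := h b
    filter_upwards [hU] with c hc hcB
    exact hU' c hc b (mem_of_mem_nhds hU) hcB hb
  have := IsClopen.eq_univ ⟨hclosed, hopen⟩ ⟨b, hbA⟩
  have hb'A : b' ∈ A := by rw [this]; trivial
  exact (hb'A.self_of_nhds hb').symm

/-- The moment does not depend on the distinguished point. -/
theorem IsRegularIDoodle.partialMoment_eq {ψ : Quasidoodle} (hψ : ψ.IsRegularIDoodle) (β : ℕ)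
    {b b' : ℝ} (hb : ψ.GoodAt b) (hb' : ψ.GoodAt b') :
    ψ.partialMoment b β ∅ = ψ.partialMoment b' β ∅ := by
  refine eq_of_locally_eq_on_dense (B := {b | ψ.GoodAt b}) (f := fun b => ψ.partialMoment b β ∅)
    (fun σ => ?_) (fun σ => ?_) hb hb'
  · exact ((hψ.eventually_goodAt σ).frequently).filter_mono nhdsWithin_le_nhds
  · obtain ⟨δ, hδ, h⟩ := exists_close_partialMoment_eq (hψ.shift σ).1 0 β
    refine ⟨_, (ψ.tendsto_shift σ).eventually (eventually_close _ hδ), fun c hc c' hc' g g' => ?_⟩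
    have k : ∀ d, ψ.GoodAt d → (ψ.shift d).GoodAt 0 := fun d gd =>
      GoodAt.shift (by rwa [zero_add]) hψ
    have := h _ _ hc hc' (k c g) (k c' g')
    rwa [partialMoment_shift, partialMoment_shift, zero_add, zero_add] at this

/-- All regular I-doodles near an I-doodle have the same moment. -/
theorem IsIDoodle.exists_moment_eq {φ : Quasidoodle} (hφ : φ.IsIDoodle) (β : ℕ) :
    ∃ v : ℝ, ∀ᶠ ψ in φ.nhdsC1, ψ.IsRegularIDoodle → ∀ b : UnitAddCircle,
      ψ.fiber (ψ.pt b) = {b} → ψ.moment b β = v := by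
  obtain ⟨δ, hδ, h⟩ := exists_close_partialMoment_eq hφ 0 β
  -- a regular curve is moved into general position at time `0` by a small shift
  have key : ∀ ψ, Close (δ / 2) φ ψ → ψ.IsRegularIDoodle → ∃ χ, Close δ φ χ ∧ χ.GoodAt 0 ∧
      ∀ b : UnitAddCircle, ψ.fiber (ψ.pt b) = {b} → ψ.moment b β = χ.partialMoment 0 β ∅ := by
    intro ψ hψ hreg
    have h1 : ∀ᶠ σ in 𝓝 (0 : ℝ), Close (δ / 2) ψ (ψ.shift σ) := by
      have := (ψ.tendsto_shift 0).eventually (eventually_close _ (half_pos hδ))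
      rwa [shift_zero] at this
    obtain ⟨σ, h2, h3⟩ := ((hreg.eventually_goodAt 0).and (nhdsWithin_le_nhds h1)).exists
    refine ⟨ψ.shift σ, by simpa using hψ.trans h3, GoodAt.shift (by rwa [zero_add]) hreg, ?_⟩
    intro b hb
    obtain ⟨s, -, rfl⟩ := exists_coe_mem_Ico 0 b
    have hg := hreg.goodAt hb
    rw [hg.moment_eq_partialMoment hreg.1.1, partialMoment_shift, zero_add]
    exact hreg.partialMoment_eq β hg h2
  obtain ⟨ψ₀, hreg₀, hψ₀⟩ := (hφ.frequently_isRegularIDoodle.and_eventually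
    (eventually_close φ (half_pos hδ))).exists
  obtain ⟨χ₀, hχ₀, hg₀, -⟩ := key ψ₀ hψ₀ hreg₀
  refine ⟨χ₀.partialMoment 0 β ∅, ?_⟩
  filter_upwards [eventually_close φ (half_pos hδ)] with ψ hψ hreg b hb
  obtain ⟨χ, hχ, hg, h1⟩ := key ψ hψ hreg
  rw [h1 b hb]
  exact h _ _ hχ hχ₀ hg hg₀

theorem IsRegularIDoodle.exists_simple {ψ : Quasidoodle} (hψ : ψ.IsRegularIDoodle) :
    ∃ b : ℝ, ψ.GoodAt b := (hψ.eventually_goodAt 0).exists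

theorem GoodAt.fiber_eq_singleton {ψ : Quasidoodle} {b : ℝ} (h : ψ.GoodAt b) :
    ψ.fiber (ψ.pt b) = {(b : UnitAddCircle)} := by
  rw [pt_coe, h.fiber_eq, Finset.coe_singleton]

end Quasidoodle

open Quasidoodle

/-- The common moment of the regular I-doodles near an I-doodle. -/
noncomputable def momentInvariant (β : ℕ) (φ : IDoodle) : ℝ := (φ.2.exists_moment_eq β).choose

theorem momentInvariant_spec (β : ℕ) (φ : IDoodle) : ∀ᶠ ψ in φ.1.nhdsC1, ψ.IsRegularIDoodle →
    ∀ b : UnitAddCircle, ψ.fiber (ψ.pt b) = {b} → ψ.moment b β = momentInvariant β φ :=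
  (φ.2.exists_moment_eq β).choose_spec

theorem momentInvariant_eventually_eq (β : ℕ) (φ : IDoodle) :
    ∀ᶠ ψ in φ.1.nhdsC1, ∀ hψ : ψ.IsIDoodle, momentInvariant β ⟨ψ, hψ⟩ = momentInvariant β φ := by
  filter_upwards [eventually_eventually_nhdsC1 (momentInvariant_spec β φ)] with ψ h hψ
  obtain ⟨χ, h1, h2, h3⟩ := (hψ.frequently_isRegularIDoodle.and_eventually
    (h.and (momentInvariant_spec β ⟨ψ, hψ⟩))).exists
  obtain ⟨b, hb⟩ := h1.exists_simple
  rw [← h2 h1 b hb.fiber_eq_singleton, ← h3 h1 b hb.fiber_eq_singleton]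

/-- Along a path of I-doodles the function `momentInvariant` is locally constant, hence constant. -/
theorem isMomentInvariant_momentInvariant (β : ℕ) : IsMomentInvariant β (momentInvariant β) := by
  refine ⟨?_, fun φ hφ b hb => ?_⟩
  · rintro φ ψ ⟨γ, hγ, h0, h1, hI⟩
    set f : Icc (0 : ℝ) 1 → ℝ := fun t => momentInvariant β ⟨γ t, hI t t.2⟩ with hf
    have hloc : IsLocallyConstant f := by
      rw [IsLocallyConstant.iff_eventually_eq]
      intro t
      have h2 : Tendsto (fun s : Icc (0 : ℝ) 1 => γ s) (𝓝 t) (γ t).nhdsC1 := by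
        refine (hγ.tendsto t.2).comp ?_
        rw [nhdsWithin_eq_map_subtype_coe t.2]
        exact tendsto_map
      exact (h2.eventually (momentInvariant_eventually_eq β ⟨γ t, hI t t.2⟩)).mono fun s hs =>
        hs (hI s s.2)
    have h3 := hloc.apply_eq_of_preconnectedSpace ⟨0, by simp⟩ ⟨1, by simp⟩
    have e0 : (⟨γ 0, hI 0 (by simp)⟩ : IDoodle) = φ := Subtype.ext h0
    have e1 : (⟨γ 1, hI 1 (by simp)⟩ : IDoodle) = ψ := Subtype.ext h1
    simp only [hf] at h3
    rwa [e0, e1] at h3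
  · exact (eventually_self (momentInvariant_spec β φ) hφ b hb).symm

/-- An invariant with the prescribed values on regular I-doodles has at an arbitrary I-doodle the
common value of the moments of the regular I-doodles in a neighbourhood. -/
theorem IsMomentInvariant.eventually_eq {β : ℕ} {V : IDoodle → ℝ} (hV : IsMomentInvariant β V)
    (φ : IDoodle) : ∀ᶠ ψ in φ.1.nhdsC1, ψ.IsRegularIDoodle → ∀ b : UnitAddCircle,
      ψ.fiber (ψ.pt b) = {b} → V φ = ψ.moment b β := by
  filter_upwards [eventually_equivalent φ.2] with ψ h hreg b hb
  obtain ⟨hψ, he⟩ := h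
  rw [hV.1 _ _ he]
  exact hV.2 ⟨ψ, hψ⟩ hreg b hb

namespace Quasidoodle

/-! ### Resolution of a triple point -/

theorem dist_coe_lt_iff {s t r : ℝ} :
    dist (s : UnitAddCircle) (t : UnitAddCircle) < r ↔ ∃ m : ℤ, |s + m - t| < r := by
  rw [dist_eq_norm, ← AddCircle.coe_sub, UnitAddCircle.norm_eq]
  constructor
  · intro h
    refine ⟨-round (s - t), ?_⟩
    rw [Int.cast_neg, show s + -(round (s - t) : ℝ) - t = s - t - round (s - t) by ring]
    exact h
  · rintro ⟨m, hm⟩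
    refine (round_le (s - t) (-m)).trans_lt ?_
    rw [Int.cast_neg, show s - t - -(m : ℝ) = s + m - t by ring]
    exact hm

theorem signType_cast_inj {σ τ : SignType} (h : (σ : ℝ) = τ) : σ = τ := by
  cases σ <;> cases τ <;> first | rfl | norm_num at h

/-- The relations among signs from which the indices of the three crossings of a resolved triple point
are found; here `x`, `y`, `z` are the orientations of the pairs of branches and `A`, `B` tell the
order of the crossings on two of the branches. -/
theorem signType_identities : ∀ A B x y z : SignType, A ≠ 0 → B ≠ 0 → x ≠ 0 → y ≠ 0 → z ≠ 0 →
    A * -y = B * -z → -(A * x * y) ≠ 0 ∧ A * -y = -(A * x * y) * x ∧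
      -A * -x = - -(A * x * y) * y ∧ -B * x = -(A * x * y) * z := by
  intro A B x y z
  cases A <;> cases B <;> cases x <;> cases y <;> cases z <;> decide

/-- A curve near the triple point with branches at the times `s 0 < s 1 < s 2`: the three branches,
on windows of radius `R` around these times, are embedded and pairwise transverse with frames of
the orientations `d`, and each two of them cross near the triple point. The number `c` is the index
of the triple point, and `r` bounds the distance to the times `s i` at the crossings. -/
structure IsNearTriple (ψ : Quasidoodle) (b : ℝ) (s : Fin 3 → ℝ) (r R : ℝ)
    (d : Fin 3 → Fin 3 → SignType) (c : ℝ) : Prop where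
  doodle : ψ.IsIDoodle
  radius_pos : 0 < r
  radius_le : r ≤ R
  window : ∀ i, b < s i - R ∧ s i + R < b + 1
  ordered : s 0 + R < s 1 - R ∧ s 1 + R < s 2 - R
  injOn : ∀ i, InjOn ψ.toFun (Icc (s i - R) (s i + R))
  sign : ∀ i j, i ≠ j → ∀ u ∈ Icc (s i - R) (s i + R), ∀ v ∈ Icc (s j - R) (s j + R),
    SignType.sign (planeDet (deriv ψ.toFun u) (deriv ψ.toFun v)) = d i j
  cross : ∀ i j, i ≠ j → ∃ u v, |u - s i| < r ∧ |v - s j| < r ∧ ψ.toFun u = ψ.toFun v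
  side : ∃ v : Fin 3 → ℂ, ∀ i, ∀ u, |u - s i| < r → ∃ e : Fin 3 → ℝ,
    (∀ k, IsSide ψ (s k) R (v k) (ψ.toFun u) (e k)) ∧
    (∀ k, ∀ w ∈ Icc (s k - R) (s k + R), 0 < (deriv ψ.toFun w / v k).re) ∧
    |ψ.ind (ψ.toFun u) - c - 2⁻¹ * ∑ k, e k| < 1 / 2
  orient : ∀ i j, i ≠ j → d i j ≠ 0 ∧ d j i = -d i j
  half_int : ∃ m : ℤ, c = m + 3 / 2

namespace IsNearTriple

variable {ψ : Quasidoodle} {b : ℝ} {s : Fin 3 → ℝ} {r R : ℝ} {d : Fin 3 → Fin 3 → SignType} {c : ℝ}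

theorem mem_window (h : IsNearTriple ψ b s r R d c) {i : Fin 3} {u : ℝ} (hu : |u - s i| < r) :
    u ∈ Ioo (s i - R) (s i + R) := by
  have := abs_lt.1 hu
  constructor <;> linarith [h.radius_le]

theorem coe_ne (h : IsNearTriple ψ b s r R d c) {i j : Fin 3} (hij : i ≠ j) {u v : ℝ}
    (hu : u ∈ Ioo (s i - R) (s i + R)) (hv : v ∈ Ioo (s j - R) (s j + R)) :
    (u : UnitAddCircle) ≠ v := by
  intro he
  have h1 := circle_coe_inj_Ico (a := b) ⟨by linarith [(h.window i).1, hu.1],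
    by linarith [(h.window i).2, hu.2]⟩ ⟨by linarith [(h.window j).1, hv.1],
    by linarith [(h.window j).2, hv.2]⟩ he
  have h2 := h.ordered
  have h3 := h.radius_pos
  have h4 := h.radius_le
  obtain ⟨hu1, hu2⟩ := hu
  obtain ⟨hv1, hv2⟩ := hv
  fin_cases i <;> fin_cases j <;> simp at hij hu1 hu2 hv1 hv2 <;> linarith

/-- The index of the crossing of the branches `i` and `j`, in terms of the order of the two
crossings on the branch `i`. -/
theorem ind_eq (h : IsNearTriple ψ b s r R d c) {i j k : Fin 3} (hij : i ≠ j) (hjk : j ≠ k)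
    (hik : i ≠ k) {u u' w y : ℝ} (hu : |u - s i| < r) (hu' : |u' - s j| < r) (hw : |w - s i| < r)
    (hy : |y - s k| < r) (he : ψ.toFun u = ψ.toFun u') (he' : ψ.toFun w = ψ.toFun y) :
    u ≠ w ∧ ψ.ind (ψ.toFun u) =
      c + 2⁻¹ * ((SignType.sign (u - w) * d k i : SignType) : ℝ) := by
  have hne : u ≠ w := by
    rintro rfl
    exact h.doodle.2 u u' y (h.coe_ne hij (h.mem_window hu) (h.mem_window hu'))
      (h.coe_ne hjk (h.mem_window hu') (h.mem_window hy))
      (h.coe_ne hik (h.mem_window hu) (h.mem_window hy)) ⟨he, he.symm.trans he'⟩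
  refine ⟨hne, ?_⟩
  obtain ⟨v, hv⟩ := h.side
  obtain ⟨e, hside, hcone, hind⟩ := hv i u hu
  have hei : e i = 0 := (hside i).eq_zero (hcone i) (Ioo_subset_Icc_self (h.mem_window hu)) rfl
  have hej : e j = 0 := (hside j).eq_zero (hcone j) (Ioo_subset_Icc_self (h.mem_window hu')) he.symm
  have hek : e k = ((SignType.sign (u - w) * d k i : SignType) : ℝ) := by
    refine (hside k).eq_sign (hcone k) (Ioo_subset_Icc_self (h.mem_window hy))
      (u := ψ.toFun u - ψ.toFun w) (by rw [he']; ring) fun t ht => ?_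
    obtain ⟨q, hq, hq'⟩ := exists_planeDet_secant ψ (deriv ψ.toFun t) hne.symm
    have hqi : q ∈ Icc (s i - R) (s i + R) := by
      have h1 := h.mem_window hu
      have h2 := h.mem_window hw
      exact ⟨(le_min h2.1.le h1.1.le).trans hq.1.le, hq.2.le.trans (max_le h2.2.le h1.2.le)⟩
    rw [planeDet_swap, hq', ← mul_neg, ← planeDet_swap, sign_mul, h.sign k i hik.symm t ht q hqi]
  have hsum : ∑ l, e l = e k := by
    refine Finset.sum_eq_single k (fun l _ hl => ?_) (by simp)
    have : l = i ∨ l = j := by omega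
    rcases this with rfl | rfl <;> assumption
  rw [hsum, hek] at hind
  -- both sides are integers
  have hfib : ψ.fiber (ψ.toFun u) =
      (({(u : UnitAddCircle), (u' : UnitAddCircle)} : Finset UnitAddCircle) : Set UnitAddCircle) :=
    h.doodle.isCore_empty.fiber_eq (x := (u : UnitAddCircle)) (by simp)
      (h.coe_ne hij (h.mem_window hu) (h.mem_window hu')) he
  obtain ⟨n, hn⟩ := exists_int_ind_eq_add h.doodle.1 (rep_inj _) (toFun_eq_iff_exists_rep hfib)
  rw [Finset.card_pair (h.coe_ne hij (h.mem_window hu) (h.mem_window hu'))] at hn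
  obtain ⟨m, hm⟩ := h.half_int
  have hσ : SignType.sign (u - w) * d k i ≠ 0 :=
    mul_ne_zero (sign_ne_zero.2 (sub_ne_zero.2 hne)) (h.orient k i hik.symm).1
  rw [hn, hm] at hind ⊢
  generalize SignType.sign (u - w) * d k i = σ at hind hσ ⊢
  have key : ∀ p : ℤ, |(n : ℝ) + ((2 : ℕ) : ℝ) / 2 - p| < 1 / 2 → n + 1 = p := by
    intro p hp
    have h1 : |((n + 1 - p : ℤ) : ℝ)| < 1 := by
      push_cast at hp ⊢
      rw [show (n : ℝ) + 1 - p = n + 2 / 2 - p by ring]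
      linarith
    have h2 : n + 1 - p = 0 := by
      rw [← Int.abs_lt_one_iff]
      exact_mod_cast h1
    omega
  cases σ with
  | zero => exact absurd rfl hσ
  | pos =>
    have := key (m + 2) (by
      push_cast
      convert hind using 2
      simp
      ring)
    have h1 : (n : ℝ) + 1 = m + 2 := by exact_mod_cast this
    simp
    linarith
  | neg =>
    have := key (m + 1) (by
      push_cast
      convert hind using 2
      simp
      ring)
    have h1 : (n : ℝ) + 1 = m + 1 := by exact_mod_cast this
    simp
    linarith

theorem lt (h : IsNearTriple ψ b s r R d c) {i j : Fin 3} (hij : i < j) {u v : ℝ}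
    (hu : |u - s i| < r) (hv : |v - s j| < r) : u < v := by
  have hu := h.mem_window hu
  have hv := h.mem_window hv
  have h2 := h.ordered
  have h3 := h.radius_pos
  have h4 := h.radius_le
  obtain ⟨hu1, hu2⟩ := hu
  obtain ⟨hv1, hv2⟩ := hv
  fin_cases i <;> fin_cases j <;> simp at hij hu1 hu2 hv1 hv2 <;> linarith

/-- Transversality on the windows makes the crossing of two branches unique. -/
theorem crossing_unique (h : IsNearTriple ψ b s r R d c) {i j : Fin 3} (hij : i ≠ j)
    {u u' v v' : ℝ} (hu : |u - s i| < r) (hv : |v - s j| < r) (hu' : |u' - s i| < r)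
    (hv' : |v' - s j| < r) (he : ψ.toFun u = ψ.toFun v) (he' : ψ.toFun u' = ψ.toFun v') :
    u = u' ∧ v = v' := by
  refine injective_sub_of_planeDet_ne_zero (ψ := ψ) (A := Icc (s i - R) (s i + R))
    (B := Icc (s j - R) (s j + R)) ordConnected_Icc ordConnected_Icc (fun p hp q hq h0 => ?_)
    (Ioo_subset_Icc_self (h.mem_window hu)) (Ioo_subset_Icc_self (h.mem_window hu'))
    (Ioo_subset_Icc_self (h.mem_window hv)) (Ioo_subset_Icc_self (h.mem_window hv'))
    (by rw [he, he', sub_self, sub_self])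
  have := h.sign i j hij p hp q hq
  rw [h0, sign_zero] at this
  exact (h.orient i j hij).1 this.symm

theorem mem_thickening_iff (h : IsNearTriple ψ b s r R d c) {t : ℝ} (ht : t ∈ Ico b (b + 1)) :
    (t : UnitAddCircle) ∈ Metric.thickening r (range fun i => (s i : UnitAddCircle)) ↔
      ∃ i, |t - s i| < r := by
  rw [Metric.mem_thickening_iff]
  constructor
  · rintro ⟨_, ⟨i, rfl⟩, hi⟩
    obtain ⟨m, hm⟩ := dist_coe_lt_iff.1 hi
    have h1 := h.window i
    have h2 := h.radius_le
    have h3 := abs_lt.1 hm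
    have h4 : (m : ℝ) < 1 := by linarith [ht.1]
    have h5 : (-1 : ℝ) < m := by linarith [ht.2]
    have h6 : m = 0 := by
      have h4 : m < 1 := by exact_mod_cast h4
      have h5 : -1 < m := by exact_mod_cast h5
      omega
    exact ⟨i, by simpa [h6] using hm⟩
  · rintro ⟨i, hi⟩
    exact ⟨_, ⟨i, rfl⟩, dist_coe_lt_iff.2 ⟨0, by simpa using hi⟩⟩

theorem mem_Ico (h : IsNearTriple ψ b s r R d c) {i : Fin 3} {u : ℝ} (hu : |u - s i| < r) :
    u ∈ Ico b (b + 1) := by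
  have h1 := h.window i
  have h2 := h.mem_window hu
  exact ⟨by linarith [h2.1], by linarith [h2.2]⟩

/-- The three crossings near the triple point all have one of the two indices `c ± 1 / 2`; which
one depends on the sign of the crossing and on the side `E` of the resolution. -/
theorem exists_side (h : IsNearTriple ψ b s r R d c) : ∃ E : SignType, E ≠ 0 ∧
    (∀ u v, |u - s 0| < r → |v - s 1| < r → ψ.toFun u = ψ.toFun v →
      ψ.ind (ψ.toFun u) = c + 2⁻¹ * ((E * d 0 1 : SignType) : ℝ)) ∧
    (∀ u v, |u - s 0| < r → |v - s 2| < r → ψ.toFun u = ψ.toFun v →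
      ψ.ind (ψ.toFun u) = c + 2⁻¹ * ((-E * d 0 2 : SignType) : ℝ)) ∧
    ∀ u v, |u - s 1| < r → |v - s 2| < r → ψ.toFun u = ψ.toFun v →
      ψ.ind (ψ.toFun u) = c + 2⁻¹ * ((E * d 1 2 : SignType) : ℝ) := by
  obtain ⟨a, a', ha, ha', hA⟩ := h.cross 0 1 (by decide)
  obtain ⟨p, p', hp, hp', hP⟩ := h.cross 0 2 (by decide)
  obtain ⟨q, q', hq, hq', hQ⟩ := h.cross 1 2 (by decide)
  -- the index of each crossing is expressed by the order of the crossings on a branch through it;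
  -- the two expressions for the crossing of the first two branches must agree
  obtain ⟨hn1, h1⟩ := h.ind_eq (i := 0) (j := 1) (k := 2) (by decide) (by decide) (by decide)
    ha ha' hp hp' hA hP
  obtain ⟨-, h2⟩ := h.ind_eq (i := 0) (j := 2) (k := 1) (by decide) (by decide) (by decide)
    hp hp' ha ha' hP hA
  obtain ⟨hn2, h3⟩ := h.ind_eq (i := 1) (j := 0) (k := 2) (by decide) (by decide) (by decide)
    ha' ha hq hq' hA.symm hQ
  obtain ⟨-, h4⟩ := h.ind_eq (i := 1) (j := 2) (k := 0) (by decide) (by decide) (by decide)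
    hq hq' ha' ha hQ hA.symm
  rw [← neg_sub a p, Left.sign_neg, (h.orient 0 1 (by decide)).2] at h2
  rw [← hA, (h.orient 1 2 (by decide)).2, h1] at h3
  rw [← neg_sub a' q, Left.sign_neg] at h4
  rw [(h.orient 0 2 (by decide)).2] at h1 h3
  have hd := (h.orient 0 1 (by decide)).1
  have hd' := (h.orient 0 2 (by decide)).1
  have hd'' := (h.orient 1 2 (by decide)).1
  have hs : SignType.sign (a - p) ≠ 0 := sign_ne_zero.2 (sub_ne_zero.2 hn1)
  have hs' : SignType.sign (a' - q) ≠ 0 := sign_ne_zero.2 (sub_ne_zero.2 hn2)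
  have h5 := signType_cast_inj (by linarith : ((SignType.sign (a - p) * -d 0 2 : SignType) : ℝ) =
    ((SignType.sign (a' - q) * -d 1 2 : SignType) : ℝ))
  -- the side is fixed by the index of the crossing of the branches `0` and `1`
  obtain ⟨k0, k1, k2, k3⟩ := signType_identities _ _ _ _ _ hs hs' hd hd' hd'' h5
  refine ⟨-(SignType.sign (a - p) * d 0 1 * d 0 2), k0, fun u v hu hv he => ?_,
    fun u v hu hv he => ?_, fun u v hu hv he => ?_⟩
  · obtain ⟨rfl, rfl⟩ := h.crossing_unique (by decide) hu hv ha ha' he hA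
    rw [h1, k1]
  · obtain ⟨rfl, rfl⟩ := h.crossing_unique (by decide) hu hv hp hp' he hP
    rw [h2, k2]
  · obtain ⟨rfl, rfl⟩ := h.crossing_unique (by decide) hu hv hq hq' he hQ
    rw [h4, k3]

open Classical in
/-- The crossing sum near the triple point has exactly three terms, one for each pair of branches. -/
theorem crossingSum_eq_sum (h : IsNearTriple ψ b s r R d c) (β : ℕ) :
    ∃ a a' p p' q q' : ℝ, (|a - s 0| < r ∧ |a' - s 1| < r ∧ ψ.toFun a = ψ.toFun a') ∧
      (|p - s 0| < r ∧ |p' - s 2| < r ∧ ψ.toFun p = ψ.toFun p') ∧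
      (|q - s 1| < r ∧ |q' - s 2| < r ∧ ψ.toFun q = ψ.toFun q') ∧
      ψ.crossingSum b β (Metric.thickening r (range fun i => (s i : UnitAddCircle))) =
        -(d 0 1 : ℝ) * binom (ψ.ind (ψ.toFun a)) β + (-(d 0 2 : ℝ) * binom (ψ.ind (ψ.toFun p)) β +
          -(d 1 2 : ℝ) * binom (ψ.ind (ψ.toFun q)) β) := by
  obtain ⟨a, a', ha, ha', hA⟩ := h.cross 0 1 (by decide)
  obtain ⟨p, p', hp, hp', hP⟩ := h.cross 0 2 (by decide)
  obtain ⟨q, q', hq, hq', hQ⟩ := h.cross 1 2 (by decide)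
  refine ⟨a, a', p, p', q, q', ⟨ha, ha', hA⟩, ⟨hp, hp', hP⟩, ⟨hq, hq', hQ⟩, ?_⟩
  rw [crossingSum_eq h.doodle.1, signedSum]
  have hF : ∀ x ∈ ({(a, a'), (p, p'), (q, q')} : Finset (ℝ × ℝ)), x ∈ ψ.timePairs b := by
    have key : ∀ i j : Fin 3, i < j → ∀ u v, |u - s i| < r → |v - s j| < r →
        ψ.toFun u = ψ.toFun v → (u, v) ∈ ψ.timePairs b := fun i j hij u v hu hv he =>
      ⟨(h.mem_Ico hu).1, h.lt hij hu hv, (h.mem_Ico hv).2, he⟩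
    intro x hx
    simp only [Finset.mem_insert, Finset.mem_singleton] at hx
    rcases hx with rfl | rfl | rfl
    exacts [key 0 1 (by decide) _ _ ha ha' hA, key 0 2 (by decide) _ _ hp hp' hP,
      key 1 2 (by decide) _ _ hq hq' hQ]
  rw [finsum_mem_eq_sum_of_inter_support_eq (t := {(a, a'), (p, p'), (q, q')})]
  · have h1 : (a, a') ∉ ({(p, p'), (q, q')} : Finset (ℝ × ℝ)) := by
      simp only [Finset.mem_insert, Finset.mem_singleton, Prod.mk.injEq, not_or, not_and]
      exact ⟨fun _ => (h.lt (by decide) ha' hp').ne, fun e => ((h.lt (by decide) ha hq).ne e).elim⟩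
    have h2 : (p, p') ∉ ({(q, q')} : Finset (ℝ × ℝ)) := by
      simp only [Finset.mem_singleton, Prod.mk.injEq, not_and]
      exact fun e => ((h.lt (by decide) hp hq).ne e).elim
    rw [Finset.sum_insert h1, Finset.sum_insert h2, Finset.sum_singleton]
    have key : ∀ i j : Fin 3, i ≠ j → ∀ u v, |u - s i| < r → |v - s j| < r →
        -((SignType.sign (planeDet (deriv ψ.toFun (u, v).1) (deriv ψ.toFun (u, v).2)) : SignType) : ℝ) *
        (if ((((u, v).1 : ℝ) : UnitAddCircle), (((u, v).2 : ℝ) : UnitAddCircle)).1 ∈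
            Metric.thickening r (range fun i => (s i : UnitAddCircle)) ∧
          ((((u, v).1 : ℝ) : UnitAddCircle), (((u, v).2 : ℝ) : UnitAddCircle)).2 ∈
            Metric.thickening r (range fun i => (s i : UnitAddCircle)) then
          binom (ψ.ind (ψ.pt ((((u, v).1 : ℝ) : UnitAddCircle),
            (((u, v).2 : ℝ) : UnitAddCircle)).1)) β else 0) =
        -(d i j : ℝ) * binom (ψ.ind (ψ.toFun u)) β := by
      intro i j hij u v hu hv
      rw [if_pos ⟨(h.mem_thickening_iff (h.mem_Ico hu)).2 ⟨i, hu⟩,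
        (h.mem_thickening_iff (h.mem_Ico hv)).2 ⟨j, hv⟩⟩, pt_coe,
        h.sign i j hij _ (Ioo_subset_Icc_self (h.mem_window hu)) _
          (Ioo_subset_Icc_self (h.mem_window hv))]
    rw [key 0 1 (by decide) a a' ha ha', key 0 2 (by decide) p p' hp hp',
      key 1 2 (by decide) q q' hq hq']
  · ext x
    refine ⟨fun ⟨hx, hx'⟩ => ⟨?_, hx'⟩, fun ⟨hx, hx'⟩ => ⟨hF x hx, hx'⟩⟩
    have h0 : ((x.1 : UnitAddCircle), (x.2 : UnitAddCircle)).1 ∈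
        Metric.thickening r (range fun i => (s i : UnitAddCircle)) ∧
        ((x.1 : UnitAddCircle), (x.2 : UnitAddCircle)).2 ∈
          Metric.thickening r (range fun i => (s i : UnitAddCircle)) := by
      by_contra hn
      refine hx' ?_
      simp only [if_neg hn, mul_zero]
    obtain ⟨u, v⟩ := x
    have hI := timePairs_subset ψ b hx
    obtain ⟨i, hi⟩ := (h.mem_thickening_iff hI.1).1 h0.1
    obtain ⟨j, hj⟩ := (h.mem_thickening_iff hI.2).1 h0.2
    have hlt : u < v := hx.2.1
    have he : ψ.toFun u = ψ.toFun v := hx.2.2.2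
    simp only [Finset.coe_insert, Finset.coe_singleton, mem_insert_iff, mem_singleton_iff,
      Prod.mk.injEq]
    -- two different branches cross once, and a branch does not cross itself
    rcases lt_trichotomy i j with hij | rfl | hij
    · have : (i = 0 ∧ j = 1) ∨ (i = 0 ∧ j = 2) ∨ (i = 1 ∧ j = 2) := by
        clear * - hij
        revert i j; decide
      rcases this with ⟨rfl, rfl⟩ | ⟨rfl, rfl⟩ | ⟨rfl, rfl⟩
      · exact Or.inl (h.crossing_unique hij.ne hi hj ha ha' he hA)
      · exact Or.inr (Or.inl (h.crossing_unique hij.ne hi hj hp hp' he hP))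
      · exact Or.inr (Or.inr (h.crossing_unique hij.ne hi hj hq hq' he hQ))
    · exact (hlt.ne (h.injOn i (Ioo_subset_Icc_self (h.mem_window hi))
        (Ioo_subset_Icc_self (h.mem_window hj)) he)).elim
    · exact (hlt.not_gt (h.lt hij hj hi)).elim

/-- The contribution of a resolved triple point to a moment. -/
theorem crossingSum_eq_of_side (h : IsNearTriple ψ b s r R d c) : ∃ E : SignType, E ≠ 0 ∧
    (∀ u v, |u - s 0| < r → |v - s 1| < r → ψ.toFun u = ψ.toFun v →
      ψ.ind (ψ.toFun u) = c + 2⁻¹ * ((E * d 0 1 : SignType) : ℝ)) ∧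
    ∀ β, ψ.crossingSum b β (Metric.thickening r (range fun i => (s i : UnitAddCircle))) =
      -(2⁻¹ * (binom (c + 2⁻¹) β + binom (c - 2⁻¹) β) * ((d 0 1 : ℝ) + d 0 2 + d 1 2)) -
        2⁻¹ * E * (binom (c + 2⁻¹) β - binom (c - 2⁻¹) β) := by
  obtain ⟨E, hE, h1, h2, h3⟩ := h.exists_side
  refine ⟨E, hE, h1, fun β => ?_⟩
  obtain ⟨a, a', p, p', q, q', ⟨ha, ha', hA⟩, ⟨hp, hp', hP⟩, ⟨hq, hq', hQ⟩, hsum⟩ :=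
    h.crossingSum_eq_sum β
  rw [hsum, h1 a a' ha ha' hA, h2 p p' hp hp' hP, h3 q q' hq hq' hQ]
  have key : ∀ σ τ : SignType, σ ≠ 0 → τ ≠ 0 → -(τ : ℝ) * binom (c + 2⁻¹ * ((σ * τ : SignType) : ℝ)) β =
      -(2⁻¹ * (binom (c + 2⁻¹) β + binom (c - 2⁻¹) β) * τ) -
        2⁻¹ * σ * (binom (c + 2⁻¹) β - binom (c - 2⁻¹) β) := by
    intro σ τ hσ hτ
    cases σ <;> cases τ <;> simp [sub_eq_add_neg] at hσ hτ ⊢ <;> ring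
  have hE' : -E ≠ 0 := fun h0 => hE (by cases E <;> first | rfl | cases h0)
  rw [key _ _ hE (h.orient 0 1 (by decide)).1, key _ _ hE'
    (h.orient 0 2 (by decide)).1, key _ _ hE (h.orient 1 2 (by decide)).1, SignType.coe_neg]
  ring

end IsNearTriple

theorem exists_radius_sign {φ : Quasidoodle} {s : Fin 3 → ℝ}
    (ht : ∀ i j, i ≠ j → planeDet (deriv φ.toFun (s i)) (deriv φ.toFun (s j)) ≠ 0) :
    ∃ ρ > 0, ∀ R ≤ ρ, ∀ᶠ ψ in φ.nhdsC1, ∀ i j, i ≠ j → ∀ u ∈ Icc (s i - R) (s i + R),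
      ∀ v ∈ Icc (s j - R) (s j + R), SignType.sign (planeDet (deriv ψ.toFun u) (deriv ψ.toFun v)) =
        SignType.sign (planeDet (deriv φ.toFun (s i)) (deriv φ.toFun (s j))) := by
  have h : ∀ p : Fin 3 × Fin 3, ∃ ρ > 0, p.1 ≠ p.2 → ∀ᶠ ψ in φ.nhdsC1,
      ∀ u ∈ Icc (s p.1 - ρ) (s p.1 + ρ), ∀ v ∈ Icc (s p.2 - ρ) (s p.2 + ρ),
        SignType.sign (planeDet (deriv ψ.toFun u) (deriv ψ.toFun v)) =
          SignType.sign (planeDet (deriv φ.toFun (s p.1)) (deriv φ.toFun (s p.2))) := by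
    intro p
    by_cases hp : p.1 = p.2
    · exact ⟨1, one_pos, fun h => (h hp).elim⟩
    · obtain ⟨r, hr, h⟩ := exists_sign_planeDet_eq (ht p.1 p.2 hp)
      exact ⟨r, hr, fun _ => h⟩
  choose ρ hρ h using h
  obtain ⟨r, hr, -, hle⟩ := exists_pos_le_forall_le Finset.univ hρ one_pos
  refine ⟨r, hr, fun R hR => eventually_all.2 fun i => eventually_all.2 fun j => ?_⟩
  by_cases hij : i = j
  · exact Eventually.of_forall fun ψ h => (h hij).elim
  filter_upwards [h (i, j) hij] with ψ hψ _ u hu v hv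
  have := hle (i, j) (Finset.mem_univ _)
  exact hψ u ⟨by linarith [hu.1], by linarith [hu.2]⟩ v ⟨by linarith [hv.1], by linarith [hv.2]⟩

theorem exists_radius_injOn_toFun {φ : Quasidoodle} (hφ : φ.IsImmersion) (s : Fin 3 → ℝ) :
    ∃ ρ > 0, ∀ R ≤ ρ, ∀ᶠ ψ in φ.nhdsC1, ∀ i, InjOn ψ.toFun (Icc (s i - R) (s i + R)) := by
  choose ρ hρ h using fun i => hφ.exists_injOn (s i)
  obtain ⟨r, hr, -, hle⟩ := exists_pos_le_forall_le Finset.univ hρ one_pos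
  refine ⟨r, hr, fun R hR => eventually_all.2 fun i => ?_⟩
  filter_upwards [h i] with ψ hψ
  have := hle i (Finset.mem_univ _)
  exact hψ.mono (Icc_subset_Icc (by linarith) (by linarith))

/-- Every I-doodle near a curve with a transverse triple point is near that triple point in the
sense of `IsNearTriple`. -/
theorem exists_isNearTriple {φ : Quasidoodle} (hφ : φ.IsImmersion) {b : ℝ} {s : Fin 3 → ℝ}
    (hs : ∀ i, s i ∈ Ioo b (b + 1)) (h01 : s 0 < s 1) (h12 : s 1 < s 2) {x : ℂ}
    (hx : ∀ t : ℝ, φ.toFun t = x ↔ ∃ i ∈ Finset.univ, (t : UnitAddCircle) = s i)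
    (ht : ∀ i j, i ≠ j → planeDet (deriv φ.toFun (s i)) (deriv φ.toFun (s j)) ≠ 0) :
    ∃ R > 0, ∃ r₀ > 0, ∀ r ∈ Ioo 0 r₀, ∀ᶠ ψ in φ.nhdsC1, ψ.IsIDoodle →
      IsNearTriple ψ b s r R
        (fun i j => SignType.sign (planeDet (deriv φ.toFun (s i)) (deriv φ.toFun (s j))))
        (φ.ind x) := by
  have hinj : ∀ i ∈ Finset.univ, ∀ j ∈ Finset.univ, (s i : UnitAddCircle) = s j → i = j := by
    intro i _ j _ h
    have := circle_coe_inj_Ico (Ioo_subset_Ico_self (hs i)) (Ioo_subset_Ico_self (hs j)) h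
    fin_cases i <;> fin_cases j <;> first | rfl | (simp at this; linarith)
  obtain ⟨ρ₁, hρ₁, h1⟩ := exists_radius_sign ht
  obtain ⟨ρ₂, hρ₂, h2⟩ := exists_radius_injOn_toFun hφ s
  obtain ⟨ρ₃, hρ₃, -, h3⟩ := exists_pos_le_forall_le Finset.univ
    (fun i => lt_min (sub_pos.2 (hs i).1) (sub_pos.2 (hs i).2)) one_pos
  have hpos : 0 < min (min ρ₁ ρ₂) (min ρ₃ (min ((s 1 - s 0) / 2) ((s 2 - s 1) / 2))) :=
    lt_min (lt_min hρ₁ hρ₂) (lt_min hρ₃ (lt_min (by linarith) (by linarith)))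
  -- the windows of radius `R` are fixed first: the estimate of the index in terms of the sides on
  -- these windows holds for all times within some `r₀` of the triple point
  obtain ⟨R, ⟨hR, hR'⟩, hside⟩ := exists_sides hφ hinj hx hpos (ε := 1 / 2) (by norm_num)
  simp only [lt_min_iff] at hR'
  obtain ⟨⟨hR1, hR2⟩, hR3, hR4, hR5⟩ := hR'
  have hxs : ∀ i, φ.toFun (s i) = x := fun i => (hx _).2 ⟨i, Finset.mem_univ _, rfl⟩
  have hev : ∀ i, ∃ ρ > 0, ∀ᶠ ψ in φ.nhdsC1, ∀ u, |u - s i| < ρ → ∃ e : Fin 3 → ℝ,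
      (∀ k ∈ Finset.univ, IsSide ψ (s k) R (deriv φ.toFun (s k)) (ψ.toFun u) (e k)) ∧
      (∀ k ∈ Finset.univ, ∀ w ∈ Icc (s k - R) (s k + R),
        0 < (deriv ψ.toFun w / deriv φ.toFun (s k)).re) ∧
      |ψ.ind (ψ.toFun u) - φ.ind x - 2⁻¹ * ∑ k, e k| < 1 / 2 := by
    intro i
    have ht : Tendsto (fun q : Quasidoodle × ℝ => (q.1, q.1.toFun q.2)) (φ.nhdsC1 ×ˢ 𝓝 (s i))
        (φ.nhdsC1 ×ˢ 𝓝 x) := by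
      have := tendsto_toFun φ (s i)
      rw [hxs i] at this
      exact tendsto_fst.prodMk this
    obtain ⟨pa, hpa, pb, hpb, hp⟩ := eventually_prod_iff.1 (ht.eventually hside)
    obtain ⟨ρ, hρ, hb⟩ := Metric.eventually_nhds_iff.1 hpb
    exact ⟨ρ, hρ, hpa.mono fun ψ hψ u hu => hp hψ (hb (by rwa [Real.dist_eq]))⟩
  choose ρ hρ hev using hev
  obtain ⟨r₀, hr₀, hr₀R, hr₀ρ⟩ := exists_pos_le_forall_le Finset.univ hρ hR
  refine ⟨R, hR, r₀, hr₀, fun r hr => ?_⟩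
  have hcross : ∀ᶠ ψ in φ.nhdsC1, ∀ i j, i ≠ j → ∃ u v, |u - s i| < r ∧ |v - s j| < r ∧
      ψ.toFun u = ψ.toFun v := by
    refine eventually_all.2 fun i => eventually_all.2 fun j => ?_
    by_cases hij : i = j
    · exact Eventually.of_forall fun ψ h => (h hij).elim
    obtain ⟨ρ', hρ', h⟩ := exists_forall_exists_sub_eq (ht i j hij) ((hxs i).trans (hxs j).symm) hr.1
    filter_upwards [h] with ψ hψ _
    obtain ⟨u, v, hu, hv, he⟩ := hψ 0 (by simpa using hρ')
    exact ⟨u, v, hu, hv, (sub_eq_zero.1 he).symm⟩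
  filter_upwards [h1 R hR1.le, h2 R hR2.le, eventually_all.2 hev, hcross] with ψ g1 g2 g3 g4 hd
  exact {
    doodle := hd
    radius_pos := hr.1
    radius_le := hr.2.le.trans hr₀R
    window := fun i => by
      have := (h3 i (Finset.mem_univ _))
      have h5 := this.trans (min_le_left _ _)
      have h6 := this.trans (min_le_right _ _)
      constructor <;> linarith
    ordered := by constructor <;> linarith
    injOn := g2
    sign := g1
    cross := g4
    side := ⟨fun k => deriv φ.toFun (s k), fun i u hu => by
      obtain ⟨e, e1, e2, e3⟩ := g3 i u (hu.trans (hr.2.trans_le (hr₀ρ i (Finset.mem_univ _))))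
      exact ⟨e, fun k => e1 k (Finset.mem_univ _), fun k => e2 k (Finset.mem_univ _), e3⟩⟩
    orient := fun i j hij => ⟨sign_ne_zero.2 (ht i j hij), by
      rw [planeDet_swap, Left.sign_neg]⟩
    half_int := by
      obtain ⟨n, hn⟩ := exists_int_ind_eq_add hφ hinj hx
      exact ⟨n, by rw [hn]; simp⟩ }

/-- The side of a resolution is locally constant, because the index of the crossing of the first
two branches is. -/
theorem IsNearTriple.eventually_side_eq {ψ : Quasidoodle} {b : ℝ} {s : Fin 3 → ℝ} {r R : ℝ}
    {d : Fin 3 → Fin 3 → SignType} {c : ℝ} (h : IsNearTriple ψ b s r R d c) {E : SignType}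
    (hE : ∀ u v, |u - s 0| < r → |v - s 1| < r → ψ.toFun u = ψ.toFun v →
      ψ.ind (ψ.toFun u) = c + 2⁻¹ * ((E * d 0 1 : SignType) : ℝ)) :
    ∀ᶠ χ in ψ.nhdsC1, ∀ E' : SignType,
      (∀ u v, |u - s 0| < r → |v - s 1| < r → χ.toFun u = χ.toFun v →
        χ.ind (χ.toFun u) = c + 2⁻¹ * ((E' * d 0 1 : SignType) : ℝ)) → E' = E := by
  obtain ⟨a, a', ha, ha', hA⟩ := h.cross 0 1 (by decide)
  have hdet : planeDet (deriv ψ.toFun a) (deriv ψ.toFun a') ≠ 0 := by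
    intro h0
    have := h.sign 0 1 (by decide) a (Ioo_subset_Icc_self (h.mem_window ha)) a'
      (Ioo_subset_Icc_self (h.mem_window ha'))
    rw [h0, sign_zero] at this
    exact (h.orient 0 1 (by decide)).1 this.symm
  have hne := h.coe_ne (by decide) (h.mem_window ha) (h.mem_window ha')
  have hfib : ψ.fiber (ψ.pt a) =
      (({(a : UnitAddCircle), (a' : UnitAddCircle)} : Finset UnitAddCircle) : Set UnitAddCircle) :=
    h.doodle.isCore_empty.fiber_eq (by simp) hne hA
  have hev := eventually_ind_double_eq h.doodle.1 hne hfib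
  obtain ⟨pa, hpa, pb, hpb, hp⟩ := eventually_prod_iff.1 hev
  have hc : Tendsto (fun q : ℝ × ℝ => ((q.1 : UnitAddCircle), (q.2 : UnitAddCircle))) (𝓝 (a, a'))
      (𝓝 ((a : UnitAddCircle), (a' : UnitAddCircle))) :=
    (Continuous.prodMk ((AddCircle.continuous_mk' 1).comp continuous_fst)
      ((AddCircle.continuous_mk' 1).comp continuous_snd)).tendsto (a, a')
  obtain ⟨ρ, hρ, hb⟩ := Metric.eventually_nhds_iff.1 (hc.eventually hpb)
  have hr' : 0 < min ρ (min (r - |a - s 0|) (r - |a' - s 1|)) :=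
    lt_min hρ (lt_min (sub_pos.2 ha) (sub_pos.2 ha'))
  obtain ⟨ρ', hρ', hcr⟩ := exists_forall_exists_sub_eq hdet hA hr'
  filter_upwards [hcr, hpa] with χ hχ hpχ E' hE'
  obtain ⟨u, v, hu, hv, he⟩ := hχ 0 (by simpa using hρ')
  simp only [lt_min_iff] at hu hv
  have he := (sub_eq_zero.1 he).symm
  have hind := hp hpχ (hb (y := (u, v)) (by
    rw [Prod.dist_eq, Real.dist_eq, Real.dist_eq]; exact max_lt hu.1 hv.1)) he
  have h1 : |u - s 0| < r := by
    have := abs_sub_le u a (s 0); linarith [hu.2.1]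
  have h2 : |v - s 1| < r := by
    have := abs_sub_le v a' (s 1); linarith [hv.2.2]
  have h3 := hE' u v h1 h2 he
  have h4 := hE a a' ha ha' hA
  change χ.ind (χ.toFun u) = ψ.ind (ψ.toFun a) at hind
  rw [h3, h4] at hind
  have h5 := signType_cast_inj (by linarith : ((E' * d 0 1 : SignType) : ℝ) =
    ((E * d 0 1 : SignType) : ℝ))
  exact mul_right_cancel₀ (h.orient 0 1 (by decide)).1 h5

end Quasidoodle

theorem Quasidoodle.IsContinuousFamily.restrict {γ : ℝ → Quasidoodle}
    (h : Quasidoodle.IsContinuousFamily γ) {t : ℝ} (ht : t ∈ Icc (0 : ℝ) 1) :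
    Quasidoodle.IsContinuousFamily fun u => γ (t + u * (1 - t)) := by
  intro k
  refine (h k).comp (f := fun p : ℝ × ℝ => (t + p.1 * (1 - t), p.2)) (by fun_prop) fun p hp => ?_
  have h1 := ht.1
  have h2 := sub_nonneg.2 ht.2
  have h3 := hp.1.1
  have h4 := hp.1.2
  exact ⟨⟨by positivity, by nlinarith⟩, mem_univ _⟩

namespace Quasidoodle

theorem IsRegular.isIDoodle {φ : Quasidoodle} (h : φ.IsRegular) (h0 : φ.groups = ∅) :
    φ.IsIDoodle := by
  refine ⟨h.1, fun x y z hxy hyz hxz he => ?_⟩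
  have h1 : φ.fiber (φ.pt y) ∈ φ.groups := by
    refine ⟨_, rfl, ?_⟩
    rw [← encard_eq_three.2 ⟨x, y, z, hxy, hxz, hyz, rfl⟩]
    refine encard_le_encard ?_
    rintro w (rfl | rfl | rfl)
    exacts [he.1, rfl, he.2.symm]
  simp [h0] at h1

theorem exists_fiber_eq_of_mem_groups {φ : Quasidoodle} {G : Set UnitAddCircle}
    (hG : G ∈ φ.groups) {g : UnitAddCircle} (hg : g ∈ G) : φ.fiber (φ.pt g) = G := by
  obtain ⟨x, rfl, -⟩ := hG
  rw [(mem_fiber φ).1 hg]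

theorem IsRegular.isCore {φ : Quasidoodle} (h : φ.IsRegular) {T : Set UnitAddCircle}
    (hT : φ.groups = {T}) : φ.IsCore T where
  finite := (h.2.2 T (by simp [hT])).1
  saturated x hx y hy := by
    rw [← exists_fiber_eq_of_mem_groups (φ := φ) (by simp [hT]) hx]
    exact hy
  transverse x hx y hy hxy _ := (h.2.2 T (by simp [hT])).2 x hx y hy hxy
  double x hx y z hy hz hyx hzx := by
    by_contra hyz
    have h1 : φ.fiber (φ.pt x) ∈ φ.groups := by
      refine ⟨_, rfl, ?_⟩
      rw [← encard_eq_three.2 ⟨x, y, z, hyx.symm, hzx.symm, hyz, rfl⟩]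
      refine encard_le_encard ?_
      rintro w (rfl | rfl | rfl)
      exacts [rfl, hy, hz]
    rw [hT, mem_singleton_iff] at h1
    exact hx (h1 ▸ (mem_fiber φ).2 rfl)

theorem exists_coe_notMem {T : Set UnitAddCircle} (hT : T.Finite) : ∃ b : ℝ, (b : UnitAddCircle) ∉ T := by
  by_contra! h
  have h1 : InjOn ((↑) : ℝ → UnitAddCircle) (Ico 0 (0 + 1)) := fun s hs t ht he =>
    circle_coe_inj_Ico hs ht he
  have h2 := (hT.subset (fun z (hz : z ∈ ((↑) : ℝ → UnitAddCircle) '' Ico 0 (0 + 1)) => by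
    obtain ⟨s, -, rfl⟩ := hz
    exact h s)).of_finite_image h1
  exact (Ico_infinite (by norm_num : (0 : ℝ) < 0 + 1)) h2

/-- The three points of a group in the order in which they are visited after the time `b`. -/
theorem exists_ordered_times {T : Set UnitAddCircle} (hT : T.encard = 3) {b : ℝ}
    (hb : (b : UnitAddCircle) ∉ T) : ∃ s : Fin 3 → ℝ, (∀ i, s i ∈ Ioo b (b + 1)) ∧ s 0 < s 1 ∧
      s 1 < s 2 ∧ T = range fun i => (s i : UnitAddCircle) := by
  classical
  have hfin : T.Finite := finite_of_encard_eq_coe hT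
  choose l hl hl' using fun z => exists_coe_mem_Ico b z
  have hinj : Function.Injective l := fun z w h => by rw [← hl' z, ← hl' w, h]
  have hcard : (hfin.toFinset.image l).card = 3 := by
    rw [Finset.card_image_of_injective _ hinj]
    have := hfin.encard_eq_coe_toFinset_card
    rw [hT] at this
    exact_mod_cast this.symm
  set e := (hfin.toFinset.image l).orderEmbOfFin hcard with he
  have hmem : ∀ i, ∃ z ∈ T, l z = e i := fun i => by
    have := (hfin.toFinset.image l).orderEmbOfFin_mem hcard i
    obtain ⟨z, hz, hzi⟩ := Finset.mem_image.1 this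
    exact ⟨z, hfin.mem_toFinset.1 hz, hzi⟩
  refine ⟨e, fun i => ?_, e.strictMono (by decide), e.strictMono (by decide), ?_⟩
  · obtain ⟨z, hz, hzi⟩ := hmem i
    rw [← hzi]
    refine ⟨lt_of_le_of_ne (hl z).1 fun h => hb ?_, (hl z).2⟩
    rw [h, hl' z]
    exact hz
  · ext z
    constructor
    · intro hz
      have h1 : l z ∈ range e := by
        rw [he, Finset.range_orderEmbOfFin]
        simpa using ⟨z, hz, rfl⟩
      obtain ⟨i, hi⟩ := h1
      exact ⟨i, by simp only [hi, hl']⟩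
    · rintro ⟨i, rfl⟩
      obtain ⟨z, hz, hzi⟩ := hmem i
      simp only [← hzi, hl' z]
      exact hz

/-- Regular I-doodles in general position at the time `b` are dense: after an approximation by a
regular I-doodle, a small shift of time moves `b` off the double points. -/
theorem IsIDoodle.frequently_goodAt {ψ : Quasidoodle} (hψ : ψ.IsIDoodle) (b : ℝ) :
    ∃ᶠ χ in ψ.nhdsC1, χ.IsRegularIDoodle ∧ χ.GoodAt b := by
  intro hev
  refine hψ.frequently_isRegularIDoodle ?_
  filter_upwards [eventually_eventually_nhdsC1 hev] with χ hχ hreg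
  have h1 : ∀ᶠ σ in 𝓝[≠] (0 : ℝ), χ.GoodAt (b + σ) := by
    have h2 := hreg.eventually_goodAt b
    rw [eventually_nhdsWithin_iff] at h2 ⊢
    have h3 : Tendsto (fun σ : ℝ => b + σ) (𝓝 0) (𝓝 b) := by
      have : Continuous fun σ : ℝ => b + σ := by fun_prop
      simpa using this.tendsto 0
    exact (h3.eventually h2).mono fun σ hσ h0 => hσ (by simpa using h0)
  have h4 : ∀ᶠ σ in 𝓝[≠] (0 : ℝ), ¬ ((χ.shift σ).IsRegularIDoodle ∧ (χ.shift σ).GoodAt b) := by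
    have := tendsto_shift χ 0
    rw [shift_zero] at this
    exact (this.eventually hχ).filter_mono nhdsWithin_le_nhds
  obtain ⟨σ, hσ, hσ'⟩ := (h1.and h4).exists
  exact hσ' ⟨hreg.shift σ, hσ.shift hreg⟩

/-- Near a curve with a single transverse triple point, a moment invariant and the crossing sums
around the triple point are determined by the side `E` on which a doodle lies. -/
theorem IsRegular.exists_value_eq {φ : Quasidoodle} (hφ : φ.IsRegular) {T : Set UnitAddCircle}
    (hT : φ.groups = {T}) (hT3 : T.encard = 3) {x : ℂ} (hx : φ.fiber x = T) {b : ℝ}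
    (hb : (b : UnitAddCircle) ∉ T) {β : ℕ} {V : IDoodle → ℝ} (hV : IsMomentInvariant β V) :
    ∃ D : ℝ, ∃ r₀ > 0, ∀ r ∈ Ioo 0 r₀, ∃ K : ℝ, ∀ᶠ ψ in φ.nhdsC1, ∀ hψ : ψ.IsIDoodle,
      ∃ E : SignType, E ≠ 0 ∧
        (∀ β', ψ.crossingSum b β' (Metric.thickening r T) =
          -(2⁻¹ * (binom (φ.ind x + 2⁻¹) β' + binom (φ.ind x - 2⁻¹) β') * D) -
            2⁻¹ * E * (binom (φ.ind x + 2⁻¹) β' - binom (φ.ind x - 2⁻¹) β')) ∧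
        V ⟨ψ, hψ⟩ = K - 2⁻¹ * E * (binom (φ.ind x + 2⁻¹) β - binom (φ.ind x - 2⁻¹) β) := by
  obtain ⟨s, hs, h01, h12, hTs⟩ := exists_ordered_times hT3 hb
  have hcore := hφ.isCore hT
  have hsT : ∀ i, (s i : UnitAddCircle) ∈ T := fun i => hTs ▸ mem_range_self i
  have hxt : ∀ t : ℝ, φ.toFun t = x ↔ ∃ i ∈ Finset.univ, (t : UnitAddCircle) = s i := by
    intro t
    rw [← pt_coe, ← mem_fiber, hx, hTs]
    simp [eq_comm]
  have ht : ∀ i j, i ≠ j → planeDet (deriv φ.toFun (s i)) (deriv φ.toFun (s j)) ≠ 0 := by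
    intro i j hij
    rw [← vel_coe, ← vel_coe]
    refine hcore.transverse _ (hsT i) _ (hsT j) (fun h => hij ?_) ?_
    · have := circle_coe_inj_Ico (Ioo_subset_Ico_self (hs i)) (Ioo_subset_Ico_self (hs j)) h
      fin_cases i <;> fin_cases j <;> first | rfl | (simp at this; linarith)
    · rw [pt_coe, pt_coe, (hxt _).2 ⟨i, by simp, rfl⟩, (hxt _).2 ⟨j, by simp, rfl⟩]
  obtain ⟨R, hR, r₁, hr₁, hnear⟩ := exists_isNearTriple hφ.1 hs h01 h12 hxt ht
  obtain ⟨r₂, hr₂, hpm⟩ := hcore.exists_partialMoment_eq hφ.1 hb β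
  set d : Fin 3 → Fin 3 → SignType :=
    fun i j => SignType.sign (planeDet (deriv φ.toFun (s i)) (deriv φ.toFun (s j)))
  refine ⟨(d 0 1 : ℝ) + d 0 2 + d 1 2, min r₁ r₂, lt_min hr₁ hr₂, fun r hr => ?_⟩
  obtain ⟨δ, hδ, hpm⟩ := hpm r ⟨hr.1, hr.2.trans_le (min_le_right _ _)⟩
  -- the common value of the partial moments, which leave out the crossings near the triple point
  obtain ⟨K, hK⟩ : ∃ K, ∀ χ, Close δ φ χ → χ.GoodAt b →
      χ.partialMoment b β (Metric.thickening r T) = K := by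
    by_cases h : ∃ χ, Close δ φ χ ∧ χ.GoodAt b
    · obtain ⟨χ, h1, h2⟩ := h
      exact ⟨_, fun χ' h1' h2' => hpm χ' χ h1' h1 h2' h2⟩
    · exact ⟨0, fun χ h1 h2 => (h ⟨χ, h1, h2⟩).elim⟩
  have hev := (hnear r ⟨hr.1, hr.2.trans_le (min_le_left _ _)⟩).and (eventually_close φ hδ)
  refine ⟨K - 2⁻¹ * (binom (φ.ind x + 2⁻¹) β + binom (φ.ind x - 2⁻¹) β) *
    ((d 0 1 : ℝ) + d 0 2 + d 1 2), ?_⟩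
  filter_upwards [eventually_eventually_nhdsC1 hev] with ψ hψev hψ
  have hN := (eventually_self hψev).1 hψ
  obtain ⟨E, hE, hE1, hE2⟩ := hN.crossingSum_eq_of_side
  rw [← hTs] at hE2
  refine ⟨E, hE, hE2, ?_⟩
  -- a regular I-doodle `χ` near `ψ` lies on the same side and has the value of the invariant as
  -- its moment
  obtain ⟨χ, ⟨hreg, hgood⟩, ⟨hχN, hχδ⟩, hχE, hχV⟩ := ((hψ.frequently_goodAt b).and_eventually
    (hψev.and ((hN.eventually_side_eq hE1).and (hV.eventually_eq ⟨ψ, hψ⟩)))).exists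
  obtain ⟨E', hE', hE1', hE2'⟩ := (hχN hreg.1).crossingSum_eq_of_side
  rw [← hTs] at hE2'
  rw [hχV hreg b hgood.fiber_eq_singleton, hgood.moment_eq hreg.1.1 β (Metric.thickening r T),
    hK χ hχδ hgood, hE2' β, hχE E' hE1']
  ring

end Quasidoodle

open Quasidoodle

theorem binom_one (i : ℝ) : binom i 1 = i := by simp [binom]

/-- On a path that resolves all groups, the invariant is constant for positive times. -/
theorem IsMomentInvariant.value_eq_of_path {β : ℕ} {V : IDoodle → ℝ} (hV : IsMomentInvariant β V)
    {φ ψ : Quasidoodle} {γ : ℝ → Quasidoodle} (hγ : IsResolutionPath ∅ φ ψ γ) (hψ : ψ.IsIDoodle)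
    {t : ℝ} (ht : t ∈ Ioc (0 : ℝ) 1) (hγt : (γ t).IsIDoodle) : V ⟨γ t, hγt⟩ = V ⟨ψ, hψ⟩ := by
  refine hV.1 _ _ ⟨_, hγ.1.restrict (Ioc_subset_Icc_self ht), by simp, by simp [hγ.2.2.1],
    fun u hu => ?_⟩
  have h1 := hγ.2.2.2 (t + u * (1 - t)) ?_
  · exact h1.1.isIDoodle h1.2
  · have h2 := ht.1
    have h3 := sub_nonneg.2 ht.2
    have h4 := hu.1
    have h5 := hu.2
    exact ⟨by positivity, by nlinarith⟩

theorem IsResolutionPath.tendsto {J : Set (Set UnitAddCircle)} {φ ψ : Quasidoodle}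
    {γ : ℝ → Quasidoodle} (hγ : IsResolutionPath J φ ψ γ) :
    Tendsto γ (𝓝[>] 0) φ.nhdsC1 := by
  have h := hγ.1.tendsto (t₀ := 0) (by simp)
  rw [hγ.2.1] at h
  exact h.mono_left (nhdsWithin_le_of_mem (mem_of_superset (Ioc_mem_nhdsGT one_pos)
    Ioc_subset_Icc_self))

/-- The jump of a moment invariant at a curve with a single triple point. -/
theorem IsMomentInvariant.sub_eq {β : ℕ} {V : IDoodle → ℝ} (hV : IsMomentInvariant β V)
    {φ φp φm : Quasidoodle} (hφ : φ.IsRegular) {T : Set UnitAddCircle}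
    (hT : φ.groups = {T}) (hT3 : T.encard = 3) {x : ℂ} (hx : φ.fiber x = T)
    (hres : AreResolutions (.triple T) ∅ φ φp φm) (hp : φp.IsIDoodle) (hm : φm.IsIDoodle) :
    V ⟨φp, hp⟩ - V ⟨φm, hm⟩ = binom (φ.ind x + 2⁻¹) β - binom (φ.ind x - 2⁻¹) β := by
  obtain ⟨γp, γm, hγp, hγm, hsep⟩ := hres
  obtain ⟨b, hb⟩ := exists_coe_notMem (hφ.isCore hT).finite
  obtain ⟨D, r₀, hr₀, hval⟩ := hφ.exists_value_eq hT hT3 hx hb hV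
  obtain ⟨r, hr, hrr⟩ := ((hsep b hb).and (eventually_mem_set.2 (Ioo_mem_nhdsGT hr₀))).exists
  obtain ⟨K, hK⟩ := hval r hrr
  obtain ⟨t, hlt, ht, h1, h2⟩ := (hr.and ((eventually_mem_set.2 (Ioc_mem_nhdsGT (one_pos : (0 : ℝ) < 1))).and
    ((hγp.tendsto.eventually hK).and (hγm.tendsto.eventually hK)))).exists
  have hdp := (hγp.2.2.2 t ht).1.isIDoodle (hγp.2.2.2 t ht).2
  have hdm := (hγm.2.2.2 t ht).1.isIDoodle (hγm.2.2.2 t ht).2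
  obtain ⟨E, hE, hc, hv⟩ := h1 hdp
  obtain ⟨E', hE', hc', hv'⟩ := h2 hdm
  rw [← hV.value_eq_of_path hγp hp ht hdp, ← hV.value_eq_of_path hγm hm ht hdm, hv, hv']
  rw [hc, hc'] at hlt
  simp only [binom_one] at hlt
  -- for `β = 1` the inequality defining the sides forces `E = -1` and `E' = 1`
  cases E <;> cases E' <;> simp at hE hE' hlt ⊢ <;> linarith

/-! ### The order of the moments -/

/-- The central difference of a function, with step `1`. -/
noncomputable def centralDiff (f : ℝ → ℝ) : ℝ → ℝ := fun x => f (x + 2⁻¹) - f (x - 2⁻¹)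

/-- Each central difference lowers the degree by one: by Pascal's rule it turns a shift of
`binom · (β + 1)` into a shift of `binom · β`. -/
theorem iterate_centralDiff_binom {β L : ℕ} (h : β < L) (a : ℝ) :
    centralDiff^[L] (fun x => binom (x + a) β) = 0 := by
  have h0 : ∀ L, centralDiff^[L] (0 : ℝ → ℝ) = 0 := fun L =>
    Function.iterate_fixed (by ext; simp [centralDiff]) L
  induction β generalizing L a with
  | zero =>
    obtain ⟨L, rfl⟩ := Nat.exists_eq_succ_of_ne_zero h.ne'
    rw [Function.iterate_succ_apply]
    convert h0 L using 2
    ext x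
    simp [centralDiff, binom]
  | succ β ih =>
    obtain ⟨L, rfl⟩ := Nat.exists_eq_succ_of_ne_zero (Nat.ne_zero_of_lt h)
    rw [Function.iterate_succ_apply, ← ih (Nat.lt_of_succ_lt_succ h) (a - 2⁻¹)]
    congr 1
    ext x
    have h1 := binom_add_one (x - 2⁻¹ + a) β
    rw [show x - 2⁻¹ + a + 1 = x + 2⁻¹ + a by ring] at h1
    rw [centralDiff, h1, show x + (a - 2⁻¹) = x - 2⁻¹ + a by ring]
    ring

namespace Quasidoodle

/-- The index of a multiple point is constant as long as its preimages do not change. -/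
theorem IsContinuousFamily.ind_eq {γ : ℝ → Quasidoodle} (hγ : IsContinuousFamily γ) {I : Set ℝ}
    (hI : IsPreconnected I) (hI' : I ⊆ Icc 0 1) {g : UnitAddCircle} {S : Finset UnitAddCircle}
    (hS : ∀ t ∈ I, (γ t).IsImmersion ∧ (γ t).fiber ((γ t).pt g) = S) {t t' : ℝ} (ht : t ∈ I)
    (ht' : t' ∈ I) : (γ t).ind ((γ t).pt g) = (γ t').ind ((γ t').pt g) := by
  have : PreconnectedSpace I := Subtype.preconnectedSpace hI
  have hloc : IsLocallyConstant fun t : I => (γ t).ind ((γ t).pt g) := by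
    rw [IsLocallyConstant.iff_eventually_eq]
    intro t
    obtain ⟨ρ, hρ, hev⟩ := eventually_ind_eq (hS t t.2).1 (hS t t.2).2
    have h1 : Tendsto (fun u : I => γ u) (𝓝 t) (γ t).nhdsC1 := by
      refine (hγ.tendsto (hI' t.2)).comp ?_
      refine Tendsto.mono_right ?_ (nhdsWithin_mono _ hI')
      rw [nhdsWithin_eq_map_subtype_coe t.2]
      exact tendsto_map
    have h2 : Tendsto (fun u : I => (γ u, (γ u).pt g)) (𝓝 t)
        ((γ t).nhdsC1 ×ˢ 𝓝 ((γ t).pt g)) :=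
      h1.prodMk ((tendsto_pt (γ t) g).comp (h1.prodMk tendsto_const_nhds))
    filter_upwards [h2.eventually hev] with u hu
    refine (hu id fun z hz => ⟨by simpa using hρ, ?_⟩).2.2
    have : z ∈ (γ u).fiber ((γ u).pt g) := by
      rw [(hS u u.2).2]
      exact hz
    exact this
  exact hloc.apply_eq_of_preconnectedSpace ⟨t, ht⟩ ⟨t', ht'⟩

/-- Moving one branch off a multiple point changes the index of the latter by `± 1 / 2`. -/
theorem eventually_ind_eq_add_or_sub {φ : Quasidoodle} (hφ : φ.IsImmersion) {x : ℂ}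
    {G : Finset UnitAddCircle} {z g : UnitAddCircle} (hz : z ∉ G) (hg : g ∈ G)
    (hx : φ.fiber x = insert z (G : Set UnitAddCircle)) :
    ∀ᶠ ψ in φ.nhdsC1, ψ.IsImmersion → ψ.fiber (ψ.pt g) = (G : Set UnitAddCircle) →
      ψ.ind (ψ.pt g) = φ.ind x + 2⁻¹ ∨ ψ.ind (ψ.pt g) = φ.ind x - 2⁻¹ := by
  classical
  have hS : φ.fiber x = ((insert z G : Finset UnitAddCircle) : Set UnitAddCircle) := by
    rw [hx, Finset.coe_insert]
  obtain ⟨r₁, hr₁, -, hle⟩ := exists_pos_le_forall_le G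
    (ρ := fun w => if w = z then 1 else dist w z) (fun w => by
      split_ifs with h
      exacts [one_pos, dist_pos.2 h]) one_pos
  obtain ⟨r, ⟨hr, hr'⟩, hev⟩ := exists_sides hφ (rep_inj _) (toFun_eq_iff_exists_rep hS) hr₁
    (ε := 1 / 2) (by norm_num)
  have hgx : φ.pt g = x := by
    have : g ∈ φ.fiber x := hx ▸ mem_insert_of_mem _ hg
    exact this
  have ht : Tendsto (fun ψ : Quasidoodle => (ψ, ψ.pt g)) φ.nhdsC1 (φ.nhdsC1 ×ˢ 𝓝 x) := by
    have := tendsto_pt φ g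
    rw [hgx] at this
    exact tendsto_id.prodMk (this.comp (tendsto_id.prodMk tendsto_const_nhds))
  filter_upwards [ht.eventually hev] with ψ hψ himm hfib
  obtain ⟨e, he, hcone, hind⟩ := hψ
  have heG : ∀ w ∈ G, e w = 0 := fun w hw => by
    refine (he w (Finset.mem_insert_of_mem hw)).eq_zero (hcone w (Finset.mem_insert_of_mem hw))
      (s := rep w) ⟨by linarith, by linarith⟩ ?_
    have : w ∈ ψ.fiber (ψ.pt g) := hfib ▸ hw
    rw [toFun_rep]
    exact this
  have hez : e z = 1 ∨ e z = -1 := by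
    refine (he z (Finset.mem_insert_self _ _)).cases fun s hs hs' => ?_
    have h1 : (s : UnitAddCircle) ∈ G := by
      rw [← Finset.mem_coe, ← hfib]
      exact (pt_coe ψ s).trans hs'
    have h2 := hle _ h1
    rw [if_neg fun h : (s : UnitAddCircle) = z => hz (h ▸ h1)] at h2
    have h3 : dist (s : UnitAddCircle) z < r := by
      rw [← coe_rep z]
      exact dist_coe_lt_iff.2 ⟨0, by
        rw [Int.cast_zero, add_zero, abs_lt]
        constructor <;> linarith [hs.1, hs.2]⟩
    linarith
  rw [Finset.sum_insert hz, Finset.sum_eq_zero heG, add_zero] at hind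
  obtain ⟨n, hn⟩ := exists_int_ind_eq_add hφ (rep_inj _) (toFun_eq_iff_exists_rep hS)
  obtain ⟨m, hm⟩ := exists_int_ind_eq_add himm (rep_inj _) (toFun_eq_iff_exists_rep hfib)
  rw [Finset.card_insert_of_notMem hz] at hn
  push_cast at hn
  -- the two indices differ by a half-integer
  have key : ∀ k : ℤ, |(k : ℝ)| < 1 / 2 → k = 0 := fun k hk => by
    have : |k| < 1 := by
      have h : |(k : ℝ)| < 1 := by linarith
      exact_mod_cast h
    exact Int.abs_lt_one_iff.1 this
  rcases hez with h | h
  · left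
    have := key (m - n - 1) (by
      push_cast
      convert hind using 2
      rw [hm, hn, h]
      ring)
    have h1 : (m : ℝ) = n + 1 := by exact_mod_cast (by omega : m = n + 1)
    rw [hm, hn, h1]
    ring
  · right
    have := key (m - n) (by
      push_cast
      convert hind using 2
      rw [hm, hn, h]
      ring)
    have h1 : (m : ℝ) = n := by exact_mod_cast (by omega : m = n)
    rw [hm, hn, h1]
    ring

end Quasidoodle

open Quasidoodle

theorem IsResolutionPath.isRegular {J : Set (Set UnitAddCircle)} {φ ψ : Quasidoodle}
    {γ : ℝ → Quasidoodle} (hγ : IsResolutionPath J φ ψ γ) : ψ.IsRegular ∧ ψ.groups = J := by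
  have := hγ.2.2.2 1 (by simp)
  rwa [hγ.2.2.1] at this

/-- The index of a group that is not involved in the resolution does not change. -/
theorem IsResolutionPath.ind_eq {J : Set (Set UnitAddCircle)} {φ ψ : Quasidoodle}
    {γ : ℝ → Quasidoodle} (hγ : IsResolutionPath J φ ψ γ) (hφ : φ.IsRegular)
    {G : Set UnitAddCircle} (hG : G ∈ J) (hG' : G ∈ φ.groups) {g : UnitAddCircle} (hg : g ∈ G) :
    ψ.ind (ψ.pt g) = φ.ind (φ.pt g) := by
  have hfin := (hφ.2.2 G hG').1
  have h := hγ.1.ind_eq isPreconnected_Icc subset_rfl (g := g) (S := hfin.toFinset) ?_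
    (right_mem_Icc.2 zero_le_one) (left_mem_Icc.2 zero_le_one)
  · rwa [hγ.2.1, hγ.2.2.1] at h
  · intro t ht
    rw [hfin.coe_toFinset]
    rcases ht.1.eq_or_lt with rfl | h0
    · rw [hγ.2.1]
      exact ⟨hφ.1, exists_fiber_eq_of_mem_groups hG' hg⟩
    · obtain ⟨h1, h2⟩ := hγ.2.2.2 t ⟨h0, ht.2⟩
      exact ⟨h1.1, exists_fiber_eq_of_mem_groups (h2 ▸ hG) hg⟩

/-- When the branch `z` is moved off the multiple point of the group `G`, the index of this point
increases by `1 / 2` on the positive side and decreases by `1 / 2` on the negative side. -/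
theorem AreResolutions.ind_eq {J : Set (Set UnitAddCircle)} {φ φp φm : Quasidoodle}
    {G : Set UnitAddCircle} {z : UnitAddCircle} (h : AreResolutions (.join G z) J φ φp φm)
    (hφ : φ.IsRegular) (hG : G ∈ J) (hz : z ∉ G) (hzG : insert z G ∈ φ.groups)
    {g : UnitAddCircle} (hg : g ∈ G) :
    φp.ind (φp.pt g) = φ.ind (φ.pt g) + 2⁻¹ ∧ φm.ind (φm.pt g) = φ.ind (φ.pt g) - 2⁻¹ := by
  obtain ⟨γp, γm, hγp, hγm, hsep⟩ := h
  have hfin : G.Finite := (hφ.2.2 _ hzG).1.subset (subset_insert z G)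
  have hev := eventually_ind_eq_add_or_sub hφ.1 (x := φ.pt g) (G := hfin.toFinset) (z := z) (g := g)
    (by simpa using hz) (by simpa using hg)
    (by rw [hfin.coe_toFinset]; exact exists_fiber_eq_of_mem_groups hzG (mem_insert_of_mem _ hg))
  obtain ⟨t, hlt, ht, h1, h2⟩ := ((hsep g hg).and ((eventually_mem_set.2
    (Ioc_mem_nhdsGT (one_pos : (0 : ℝ) < 1))).and
    ((hγp.tendsto.eventually hev).and (hγm.tendsto.eventually hev)))).exists
  have hS : ∀ {ψ : Quasidoodle} {γ : ℝ → Quasidoodle}, IsResolutionPath J φ ψ γ →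
      ∀ t ∈ Ioc (0 : ℝ) 1, (γ t).IsImmersion ∧ (γ t).fiber ((γ t).pt g) = hfin.toFinset := by
    intro ψ γ hγ t ht
    rw [hfin.coe_toFinset]
    obtain ⟨h1, h2⟩ := hγ.2.2.2 t ht
    exact ⟨h1.1, exists_fiber_eq_of_mem_groups (h2 ▸ hG) hg⟩
  have hcp := hγp.1.ind_eq isPreconnected_Ioc Ioc_subset_Icc_self (hS hγp) ht
    (right_mem_Ioc.2 one_pos)
  have hcm := hγm.1.ind_eq isPreconnected_Ioc Ioc_subset_Icc_self (hS hγm) ht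
    (right_mem_Ioc.2 one_pos)
  rw [hγp.2.2.1] at hcp
  rw [hγm.2.2.1] at hcm
  obtain ⟨ip, fp⟩ := hS hγp t ht
  obtain ⟨im, fm⟩ := hS hγm t ht
  rw [pointIndex_eq ip (fp ▸ hfin.toFinset.finite_toSet),
    pointIndex_eq im (fm ▸ hfin.toFinset.finite_toSet)] at hlt
  rw [← hcp, ← hcm]
  rcases h1 ip fp with h1 | h1 <;> rcases h2 im fm with h2 | h2
  · linarith
  · exact ⟨h1, h2⟩
  · linarith
  · linarith

/-- The characteristic numbers of a moment invariant. If there is one group `G`, then after `L`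
steps the number is the `L`-th central difference of `binom · β` at the index of the multiple
point; if there are several groups, it vanishes. -/
theorem IsMomentInvariant.characteristicNumber_eq {β : ℕ} {V : IDoodle → ℝ}
    (hV : IsMomentInvariant β V) {P : List DegenerationStep} (hP : IsProcess P) (hP0 : P ≠ [])
    {φ : Quasidoodle} (hφ : φ.IsRegular) (hPφ : processGroups P = φ.groups) {n : ℝ}
    (hn : IsCharacteristicNumber V P φ n) :
    (∃ G, φ.groups = {G} ∧ G.ncard = P.length + 2 ∧
      ∀ g ∈ G, n = centralDiff^[P.length] (fun i => binom i β) (φ.ind (φ.pt g))) ∨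
      (φ.groups.Nontrivial ∧ n = 0) := by
  induction P generalizing φ n with
  | nil => exact (hP0 rfl).elim
  | cons s P ih =>
    obtain ⟨φp, φm, a, b, hres, hp, hm, rfl⟩ := hn
    obtain ⟨hadm, hP'⟩ := hP
    have hres' := hres
    obtain ⟨γp, γm, hγp, hγm, -⟩ := hres'
    obtain ⟨hrp, hgp⟩ := hγp.isRegular
    obtain ⟨hrm, hgm⟩ := hγm.isRegular
    rcases P.eq_nil_or_concat with rfl | hne
    -- a single step: the jump at a triple point is the first central difference
    · cases s with
      | join G z => exact absurd hadm.1 (notMem_empty G)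
      | triple T =>
        left
        have hT : φ.groups = {T} := by
          rw [← hPφ]
          exact insert_empty_eq T
        obtain ⟨h1, rfl⟩ := hp
        obtain ⟨h2, rfl⟩ := hm
        refine ⟨T, hT, ?_, fun g hg => ?_⟩
        · rw [ncard_def, hadm.1]
          rfl
        · exact hV.sub_eq hφ hT hadm.1 (exists_fiber_eq_of_mem_groups (by simp [hT]) hg) hres h1 h2
    · have hne : P ≠ [] := by
        obtain ⟨Q, q, rfl⟩ := hne
        simp
      have ihp := ih hP' hne hrp hgp.symm hp
      have ihm := ih hP' hne hrm hgm.symm hm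
      rw [hgp] at ihp
      rw [hgm] at ihm
      cases s with
      | triple T =>
        right
        have hG : φ.groups = insert T (processGroups P) := hPφ.symm
        have hTne : T.Nonempty := by
          rw [← encard_ne_zero, hadm.1]
          norm_num
        have hT : ∀ G ∈ processGroups P, T ≠ G := fun G hG h =>
          hTne.ne_empty (disjoint_self.1 (h ▸ hadm.2 G hG))
        -- the new triple point does not change the index of a group that is already there, so the
        -- two resolutions have the same number
        rcases ihp with ⟨G, hJ, hcard, hv⟩ | ⟨hJ, rfl⟩
        · rcases ihm with ⟨G', hJ', hcard', hv'⟩ | ⟨hJ', -⟩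
          · obtain rfl : G = G' := singleton_injective (hJ.symm.trans hJ')
            have hGJ : G ∈ processGroups P := hJ ▸ mem_singleton G
            have hGφ : G ∈ φ.groups := hG ▸ mem_insert_of_mem _ hGJ
            refine ⟨⟨T, hG ▸ mem_insert _ _, G, hGφ, hT G hGJ⟩, ?_⟩
            obtain ⟨g, hg⟩ : G.Nonempty := nonempty_of_ncard_ne_zero (by omega)
            rw [hv g hg, hv' g hg, hγp.ind_eq hφ hGJ hGφ hg, hγm.ind_eq hφ hGJ hGφ hg, sub_self]
          · rw [hJ] at hJ'
            exact (not_nontrivial_singleton hJ').elim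
        · rcases ihm with ⟨G', hJ', -⟩ | ⟨-, rfl⟩
          · rw [hJ'] at hJ
            exact (not_nontrivial_singleton hJ).elim
          · exact ⟨hJ.mono (hG ▸ subset_insert _ _), sub_zero 0⟩
      | join G z =>
        obtain ⟨hGJ, hz⟩ := hadm
        have hG : φ.groups = insert (insert z G) (processGroups P \ {G}) := hPφ.symm
        rcases ihp with ⟨G₁, hJ, hcard, hv⟩ | ⟨hJ, rfl⟩
        · rcases ihm with ⟨G₂, hJ', -, hv'⟩ | ⟨hJ', -⟩
          · left
            obtain rfl : G₁ = G₂ := singleton_injective (hJ.symm.trans hJ')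
            obtain rfl : G = G₁ := by rwa [hJ] at hGJ
            rw [hJ, sdiff_self, insert_empty_eq] at hG
            have hzG : insert z G ∈ φ.groups := hG ▸ mem_singleton _
            have hfin : G.Finite := finite_of_ncard_ne_zero (by omega)
            refine ⟨_, hG, by rw [ncard_insert_of_notMem (hz G hGJ) hfin, hcard]; rfl, ?_⟩
            obtain ⟨g₀, hg₀⟩ : G.Nonempty := nonempty_of_ncard_ne_zero (by omega)
            intro g hg
            -- the resolutions shift the index by `± 1 / 2`, which adds one central difference
            obtain ⟨h1, h2⟩ := hres.ind_eq hφ hGJ (hz G hGJ) hzG hg₀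
            have h3 : φ.pt g = φ.pt g₀ := by
              rw [← mem_fiber, exists_fiber_eq_of_mem_groups hzG (mem_insert_of_mem _ hg₀)]
              exact hg
            rw [hv g₀ hg₀, hv' g₀ hg₀, h1, h2, h3, List.length_cons, Function.iterate_succ_apply']
            rfl
          · rw [hJ] at hJ'
            exact (not_nontrivial_singleton hJ').elim
        · rcases ihm with ⟨G', hJ', -⟩ | ⟨-, rfl⟩
          · rw [hJ'] at hJ
            exact (not_nontrivial_singleton hJ).elim
          · right
            -- joining a point to a group leaves the number of groups unchanged
            obtain ⟨H, hH, hHG⟩ := hJ.exists_ne G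
            refine ⟨⟨insert z G, hG ▸ mem_insert _ _, H, hG ▸ mem_insert_of_mem _ ⟨hH, hHG⟩, ?_⟩,
              sub_zero 0⟩
            rintro rfl
            exact hz _ hH (mem_insert z G)

/-- Complexity greater than `β + 1` means several groups or a single group reached in more than `β`
steps; a central difference of that order annihilates `binom · β`. -/
theorem IsMomentInvariant.isOfOrder {β : ℕ} {V : IDoodle → ℝ} (hV : IsMomentInvariant β V) :
    IsOfOrder V (β + 1) := by
  intro φ hφ hlt P hP hPφ n hn
  have hP0 : P ≠ [] := by
    rintro rfl
    have h0 : φ.groups = ∅ := hPφ.symm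
    simp [complexity, h0] at hlt
  rcases hV.characteristicNumber_eq hP hP0 hφ hPφ hn with ⟨G, hG, hcard, hv⟩ | ⟨-, h⟩
  · rw [complexity, hG, finsum_mem_singleton] at hlt
    obtain ⟨g, hg⟩ : G.Nonempty := nonempty_of_ncard_ne_zero (by omega)
    have h1 := iterate_centralDiff_binom (β := β) (L := P.length) (by omega) 0
    simp only [add_zero] at h1
    rw [hv g hg, h1, Pi.zero_apply]
  · exact h

theorem mainTheorem5 (β : ℕ) (hβ : 1 ≤ β) :
    (∃ M : IDoodle → ℝ, IsMomentInvariant β M) ∧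
      ∀ M : IDoodle → ℝ, IsMomentInvariant β M → IsOfOrder M (β + 1) :=
  ⟨⟨_, isMomentInvariant_momentInvariant β⟩, fun _ hM => hM.isOfOrder⟩
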